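/- Let $p$ be an odd prime and let $\mathcal{G}$ be a profinite group with a finite normal subgroup $H$ such that $\mathcal{G}/H\simeq\mathbb{Z}_p$ as topological groups. Fix a closed subgroup $\Gamma\le\mathcal{G}$ with $\mathcal{G}=H\rtimes\Gamma$ (so $\Gamma\simeq\mathbb{Z}_p$), a topological generator $\gamma$ of $\Gamma$, and $n\ge 0$ such that $\gamma^{p^n}$ is central in $\mathcal{G}$; put $\Gamma_0=\Gamma^{p^n}$. Let $\Lambda(\mathcal{G})=\mathbb{Z}_p[[\mathcal{G}]]=\varprojlim_{\mathcal{N}}\mathbb{Z}_p[\mathcal{G}/\mathcal{N}]$ (over the open normal subgroups $\mathcal{N}$ of $\mathcal{G}$), let $\mathcal{Q}(\mathcal{G})$ be the ring obtained from $\Lambda(\mathcal{G})$ by inverting all central regular elements, and let $\mathcal{Q}^c(\mathcal{G})=\mathbb{Q}_p^c\otimes_{\mathbb{Q}_p}\mathcal{Q}(\mathcal{G})$, where $\mathbb{Q}_p^c$ is an algebraic closure of $\mathbb{Q}_p$. Both $\Lambda(\mathcal{G})$ and $\mathcal{Q}(\mathcal{G})$ are viewed inside $\mathcal{Q}^c(\mathcal{G})$,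 and $\mathbb{Z}_p[[\Gamma_0]]$ inside $\Lambda(\mathcal{G})$. Let $\chi$ be an irreducible $\mathbb{Q}_p^c$-valued character of $\mathcal{G}$ with open kernel and let $\eta$ be an irreducible constituent of $\mathrm{res}^{\mathcal{G}}_H\chi$. For an irreducible character $\eta'$ of $H$ put $e(\eta')=\frac{\eta'(1)}{|H|}\sum_{h\in H}\eta'(h^{-1})h$. Let $e_\chi=\sum_{\eta'}e(\eta')\in\mathcal{Q}^c(\mathcal{G})$, where $\eta'$ runs over the irreducible constituents of $\mathrm{res}^{\mathcal{G}}_H\chi$, let $K_\chi=\mathbb{Q}_p(\chi(h)\mid h\in H)$, and let $\varepsilon_\chi=\sum_{\sigma\in\mathrm{Gal}(K_\chi/\mathbb{Q}_p)}\sigma(e_\chi)$, with $\sigma$ acting on the coefficients of $e_\chi$. Then the following are equivalent, where $v_p$ is the $p$-adic valuation: 1. $v_p(\eta(1))=v_p(|H|)$; 2. $\varepsilon_\chi\in\Lambda(\mathcal{G})$; 3. $\varepsilon_\chi\in\Lambda(\mathcal{G})$ and $\varepsilon_\chi\Lambda(\mathcal{G})$ is a maximal $\mathbb{Z}_p[[\Gamma_0]]$-order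 in $\varepsilon_\chi\mathcal{Q}(\mathcal{G})$. Moreover, if these equivalent conditions hold, then there is a ring isomorphism $\varepsilon_\chi\Lambda(\mathcal{G})\simeq M_{\chi(1)\times\chi(1)}(S_\chi)$ for some local integrally closed domain $S_\chi$. Here, for an integral domain $R$ with field of fractions $E$, an $R$-order in a finite-dimensional $E$-algebra $A$ is a subring of $A$ with the same identity element that is finitely generated as an $R$-module and spans $A$ over $E$; it is maximal if no $R$-order in $A$ properly contains it. -/

import Mathlib

universe u

open scoped TensorProduct

noncomputable section

/-! ## Iwasawa algebras -/

section Iwasawa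

variable (p : ℕ) [Fact p.Prime]

/-- The transition map `ℤ_p[G/N] → ℤ_p[G/M]` for open normal subgroups `N ≤ M` of `G`. -/
def iwasawaTransition {G : Type u} [Group G] [TopologicalSpace G]
    {N M : OpenNormalSubgroup G} (h : N ≤ M) :
    MonoidAlgebra ℤ_[p] (G ⧸ N.toSubgroup) →ₐ[ℤ_[p]] MonoidAlgebra ℤ_[p] (G ⧸ M.toSubgroup) :=
  MonoidAlgebra.mapDomainAlgHom ℤ_[p] ℤ_[p]
    (QuotientGroup.map N.toSubgroup M.toSubgroup (MonoidHom.id G) h)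

/-- The Iwasawa algebra `Λ(G) = ℤ_p[[G]] = lim ℤ_p[G/N]`, the inverse limit running over all open
normal subgroups `N` of `G`, realised as the algebra of compatible families. -/
def IwasawaAlgebra (G : Type u) [Group G] [TopologicalSpace G] :
    Subalgebra ℤ_[p] (∀ N : OpenNormalSubgroup G, MonoidAlgebra ℤ_[p] (G ⧸ N.toSubgroup)) where
  carrier := {x | ∀ (N M : OpenNormalSubgroup G) (h : N ≤ M), iwasawaTransition p h (x N) = x M}
  mul_mem' hx hy N M h := by simp only [Pi.mul_apply, map_mul, hx N M h, hy N M h]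
  add_mem' hx hy N M h := by simp only [Pi.add_apply, map_add, hx N M h, hy N M h]
  algebraMap_mem' r N M h := by simp only [Pi.algebraMap_apply, AlgHom.commutes]

namespace IwasawaAlgebra

variable {G : Type u} [Group G] [TopologicalSpace G]

/-- The canonical map from `G` to `Λ(G)`. -/
def of : G →* IwasawaAlgebra p G where
  toFun g := ⟨fun N ↦ MonoidAlgebra.of ℤ_[p] (G ⧸ N.toSubgroup) (QuotientGroup.mk g),
    fun N M h ↦ by
      simp only [iwasawaTransition, MonoidAlgebra.of_apply, MonoidAlgebra.mapDomainAlgHom_apply,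
        MonoidAlgebra.mapDomain_single]
      rfl⟩
  map_one' := Subtype.ext <| funext fun N ↦ map_one (MonoidAlgebra.of ℤ_[p] (G ⧸ N.toSubgroup))
  map_mul' a b := Subtype.ext <| funext fun N ↦ by
    exact map_mul (MonoidAlgebra.of ℤ_[p] (G ⧸ N.toSubgroup)) (a : G ⧸ N.toSubgroup) b

/-- The open normal subgroup `N ∩ K` of a subgroup `K` of `G`. -/
def restrictOpenNormal (K : Subgroup G) (N : OpenNormalSubgroup G) : OpenNormalSubgroup K where
  toOpenSubgroup := N.toOpenSubgroup.comap K.subtype continuous_subtype_val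
  isNormal' := N.isNormal'.comap K.subtype

/-- The canonical ring homomorphism `Λ(K) → Λ(G)` for a subgroup `K` of `G`: its component at `N` is
`Λ(K) → ℤ_p[K/(N ∩ K)] → ℤ_p[G/N]`. -/
def ofSubgroup (K : Subgroup G) : IwasawaAlgebra p K →ₐ[ℤ_[p]] IwasawaAlgebra p G where
  toFun x := ⟨fun N ↦ MonoidAlgebra.mapDomainAlgHom ℤ_[p] ℤ_[p]
      (QuotientGroup.map (restrictOpenNormal K N).toSubgroup N.toSubgroup K.subtype (fun _ hy ↦ hy))
      (x.1 (restrictOpenNormal K N)), fun N M h ↦ by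
    have hle : restrictOpenNormal K N ≤ restrictOpenNormal K M := fun y hy ↦ h hy
    dsimp only
    rw [← x.2 _ _ hle]
    unfold iwasawaTransition
    rw [← AlgHom.comp_apply, ← AlgHom.comp_apply, ← MonoidAlgebra.mapDomainAlgHom_comp,
      ← MonoidAlgebra.mapDomainAlgHom_comp]
    congr 2
    ext y
    rfl⟩
  map_one' := Subtype.ext <| funext fun N ↦ map_one _
  map_mul' x y := Subtype.ext <| funext fun N ↦ map_mul _ _ _
  map_zero' := Subtype.ext <| funext fun N ↦ map_zero _
  map_add' x y := Subtype.ext <| funext fun N ↦ map_add _ _ _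
  commutes' r := Subtype.ext <| funext fun N ↦ AlgHom.commutes _ r

end IwasawaAlgebra

/-! ## Total rings of fractions -/

/-- The central regular elements of a ring. -/
def centralRegular (A : Type u) [Ring A] : Submonoid A :=
  Submonoid.center A ⊓ nonZeroDivisors A

instance centralRegularOreSet (A : Type u) [Ring A] :
    OreLocalization.OreSet (centralRegular A) where
  ore_right_cancel a b s h := ⟨s, by
    rw [(Submonoid.mem_center_iff.mp s.2.1 a).symm, (Submonoid.mem_center_iff.mp s.2.1 b).symm, h]⟩
  oreNum a _ := a
  oreDenom _ s := s
  ore_eq a s := (Submonoid.mem_center_iff.mp s.2.1 a).symm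

/-- The ring `𝒬(G)`, obtained from `Λ(G)` by adjoining inverses of all central regular elements. -/
def FractionIwasawa (G : Type u) [Group G] [TopologicalSpace G] : Type u :=
  OreLocalization (centralRegular (IwasawaAlgebra p G)) (IwasawaAlgebra p G)

instance (G : Type u) [Group G] [TopologicalSpace G] : Ring (FractionIwasawa p G) :=
  inferInstanceAs (Ring (OreLocalization (centralRegular (IwasawaAlgebra p G)) (IwasawaAlgebra p G)))

variable {G : Type u} [Group G] [TopologicalSpace G]

/-- The canonical map `Λ(G) → 𝒬(G)`. -/
def toFraction : IwasawaAlgebra p G →+* FractionIwasawa p G :=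
  OreLocalization.numeratorRingHom (S := centralRegular (IwasawaAlgebra p G))

theorem isUnit_toFraction {x : IwasawaAlgebra p G} (hx : x ∈ centralRegular (IwasawaAlgebra p G)) :
    IsUnit (toFraction p x) :=
  OreLocalization.numerator_isUnit (⟨x, hx⟩ : centralRegular (IwasawaAlgebra p G))

theorem algebraMap_mem_centralRegular {r : ℤ_[p]} (hr : r ≠ 0) :
    algebraMap ℤ_[p] (IwasawaAlgebra p G) r ∈ centralRegular (IwasawaAlgebra p G) := by
  have key : ∀ y : IwasawaAlgebra p G, algebraMap ℤ_[p] (IwasawaAlgebra p G) r * y = 0 → y = 0 := by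
    intro y hy
    rw [← Algebra.smul_def] at hy
    ext N g
    have h1 := congrArg (fun z : IwasawaAlgebra p G ↦ (z.1 N).coeff g) hy
    have h2 : r * (y.1 N).coeff g = 0 := h1
    exact (mul_eq_zero.mp h2).resolve_left hr
  refine ⟨Submonoid.mem_center_iff.mpr fun y ↦ (Algebra.commutes r y).symm, ?_, ?_⟩
  · exact key
  · intro y hy
    exact key y ((Algebra.commutes r y).trans hy)

theorem exists_toFraction_mul (y : FractionIwasawa p G) :
    ∃ s ∈ centralRegular (IwasawaAlgebra p G), ∃ a, toFraction p s * y = toFraction p a := by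
  induction y using OreLocalization.ind with
  | c a s => exact ⟨s, s.2, a, OreLocalization.mul_cancel⟩

theorem toFraction_mem_center {x : IwasawaAlgebra p G} (hx : ∀ y, y * x = x * y) :
    toFraction p x ∈ Subring.center (FractionIwasawa p G) := by
  refine Subring.mem_center_iff.mpr fun y ↦ ?_
  obtain ⟨s, hs, a, h1⟩ := exists_toFraction_mul p y
  refine (isUnit_toFraction p hs).mul_left_cancel ?_
  rw [← mul_assoc, h1, ← mul_assoc, ← map_mul, ← map_mul, hx a, hx s, map_mul, map_mul, mul_assoc, h1]

/-- The structure map `ℤ_p → 𝒬(G)`, with values in the centre. -/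
def padicIntToCenter : ℤ_[p] →+* Subring.center (FractionIwasawa p G) :=
  ((toFraction p).comp (algebraMap ℤ_[p] (IwasawaAlgebra p G))).codRestrict _
    fun r ↦ toFraction_mem_center p fun y ↦ (Algebra.commutes r y).symm

theorem isUnit_padicIntToCenter (r : nonZeroDivisors ℤ_[p]) :
    IsUnit (padicIntToCenter p (G := G) (r : ℤ_[p])) := by
  have hr : (r : ℤ_[p]) ≠ 0 := nonZeroDivisors.ne_zero r.2
  obtain ⟨v, hv⟩ := isUnit_toFraction p (algebraMap_mem_centralRegular p (G := G) hr)
  have hv' : (v : FractionIwasawa p G) = (padicIntToCenter p (G := G) (r : ℤ_[p])).1 := hv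
  have hc : (↑v⁻¹ : FractionIwasawa p G) ∈ Subring.center (FractionIwasawa p G) := by
    refine Subring.mem_center_iff.mpr fun y ↦ ?_
    have hy : Commute y (v : FractionIwasawa p G) := by
      rw [hv']; exact Subring.mem_center_iff.mp (padicIntToCenter p (G := G) (r : ℤ_[p])).2 y
    exact hy.units_inv_right
  refine isUnit_iff_exists_inv.mpr ⟨⟨_, hc⟩, Subtype.ext ?_⟩
  change (padicIntToCenter p (G := G) (r : ℤ_[p])).1 * ↑v⁻¹ = 1
  rw [← hv', Units.mul_inv]

/-- The structure map `ℚ_p → 𝒬(G)`, extending `ℤ_p → Λ(G) → 𝒬(G)`, with values in the centre. -/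
def padicToCenter : ℚ_[p] →+* Subring.center (FractionIwasawa p G) :=
  IsLocalization.lift (M := nonZeroDivisors ℤ_[p]) (isUnit_padicIntToCenter p (G := G))

instance fractionIwasawaAlgebra : Algebra ℚ_[p] (FractionIwasawa p G) :=
  ((Subring.center (FractionIwasawa p G)).subtype.comp (padicToCenter p)).toAlgebra'
    fun r y ↦ (Subring.mem_center_iff.mp (padicToCenter p (G := G) r).2 y).symm

variable (G) in
/-- `𝒬ᶜ(G) = ℚ_pᶜ ⊗ 𝒬(G)`, the tensor product being taken over `ℚ_p`. -/
abbrev FractionIwasawaAlgCl : Type u :=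
  PadicAlgCl p ⊗[ℚ_[p]] FractionIwasawa p G

/-- The canonical map `Λ(G) → 𝒬(G) → 𝒬ᶜ(G)`. -/
def toFractionAlgCl : IwasawaAlgebra p G →+* FractionIwasawaAlgCl p G :=
  (Algebra.TensorProduct.includeRight (R := ℚ_[p]) (A := PadicAlgCl p)
    (B := FractionIwasawa p G)).toRingHom.comp (toFraction p)

/-- The action of `σ ∈ Gal(ℚ_pᶜ/ℚ_p)` on `𝒬ᶜ(G)`, through the left tensor factor. -/
def galoisAct (σ : PadicAlgCl p ≃ₐ[ℚ_[p]] PadicAlgCl p) :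
    FractionIwasawaAlgCl p G →ₐ[ℚ_[p]] FractionIwasawaAlgCl p G :=
  Algebra.TensorProduct.map σ.toAlgHom (AlgHom.id ℚ_[p] (FractionIwasawa p G))

end Iwasawa

/-! ## Characters and idempotents -/

section Characters

variable (p : ℕ) [Fact p.Prime]

/-- `χ : G → ℚ_pᶜ` is the character of the irreducible representation `ρ` of `G`, which has open
kernel. -/
structure IsIrrCharOf {G : Type u} [Group G] [TopologicalSpace G] (χ : G → PadicAlgCl p) {d : ℕ}
    (ρ : Representation (PadicAlgCl p) G (Fin d → PadicAlgCl p)) : Prop where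
  irreducible : ρ.IsIrreducible
  open_kernel : IsOpen {g : G | ρ g = 1}
  char_eq : ∀ g, χ g = LinearMap.trace (PadicAlgCl p) (Fin d → PadicAlgCl p) (ρ g)

/-- `Irr(G)`: the irreducible `ℚ_pᶜ`-valued characters of `G` with open kernel. -/
def IrrChar (G : Type u) [Group G] [TopologicalSpace G] : Type u :=
  {χ : G → PadicAlgCl p // ∃ (d : ℕ)
    (ρ : Representation (PadicAlgCl p) G (Fin d → PadicAlgCl p)), IsIrrCharOf p χ ρ}

variable {p} {G : Type u} [Group G] [TopologicalSpace G]

instance : CoeFun (IrrChar p G) fun _ ↦ G → PadicAlgCl p := ⟨Subtype.val⟩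

/-- The degree `χ(1)` of an irreducible character, as a natural number. -/
def IrrChar.degree (χ : IrrChar p G) : ℕ := χ.2.choose

theorem IrrChar.degree_eq (χ : IrrChar p G) : (χ.degree : PadicAlgCl p) = χ 1 := by
  obtain ⟨ρ, h⟩ := χ.2.choose_spec
  rw [h.char_eq 1, map_one, LinearMap.trace_one, Module.finrank_fin_fun]
  rfl

variable (H : Subgroup G) [Fintype H]

/-- `η` is an irreducible constituent of `res χ`, the restriction of `χ` to the finite group `H`: the
multiplicity `⟨res χ, η⟩ = |H|⁻¹ ∑ χ(h) η(h⁻¹)` is nonzero. -/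
def IsConstituent (χ : IrrChar p G) (η : IrrChar p H) : Prop :=
  (Fintype.card H : PadicAlgCl p)⁻¹ * ∑ h : H, χ (h : G) * η h⁻¹ ≠ 0

/-- `e(η) = η(1)/|H| ∑ η(h⁻¹) h`, as an element of `𝒬ᶜ(G)`. -/
def idemOfChar (η : IrrChar p H) : FractionIwasawaAlgCl p G :=
  ∑ h : H, (η 1 / (Fintype.card H : PadicAlgCl p) * η h⁻¹) ⊗ₜ[ℚ_[p]]
    toFraction p (IwasawaAlgebra.of p (h : G))

/-- `e_χ = ∑ e(η)`, the sum running over the (finitely many) irreducible constituents `η` of the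
restriction of `χ` to `H`. -/
def eChi (χ : IrrChar p G) : FractionIwasawaAlgCl p G :=
  ∑ᶠ (η : IrrChar p H) (_ : IsConstituent H χ η), idemOfChar H η

/-- `K_χ = ℚ_p(χ(h) | h ∈ H)`. -/
def charField (χ : IrrChar p G) : IntermediateField ℚ_[p] (PadicAlgCl p) :=
  IntermediateField.adjoin ℚ_[p] (Set.range fun h : H ↦ χ (h : G))

instance (χ : IrrChar p G) : FiniteDimensional ℚ_[p] (charField H χ) :=
  IntermediateField.finiteDimensional_adjoin fun x _ ↦ (Algebra.IsAlgebraic.isAlgebraic x).isIntegral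

/-- `ε_χ = ∑ σ(e_χ)`, the sum running over the finite group `Gal(K_χ/ℚ_p)`. The group acts on `e_χ`
through arbitrary lifts to `Gal(ℚ_pᶜ/ℚ_p)`; the coefficients of `e_χ` lie in `K_χ`. -/
def epsilonChi (χ : IrrChar p G) : FractionIwasawaAlgCl p G :=
  ∑ σ : charField H χ ≃ₐ[ℚ_[p]] charField H χ,
    galoisAct p (G := G) (σ.liftNormal (PadicAlgCl p)) (eChi H χ)

end Characters

/-! ## Orders -/

section Orders

variable {A : Type u} [Ring A]

/-- For a central idempotent `e` of `A` and a subring `R` of the centre of `A` that is an integral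
domain, `O` is an `R`-order in the ring `eA` (whose identity element is `e`): a subring with the same
identity element `e`, finitely generated as an `R`-module, and such that every element of `eA` is of
the form `r⁻¹ x` with `0 ≠ r ∈ R` and `x ∈ O`. The ring `eA` is written as the corner `eAe`. -/
structure IsOrderIn (R : Subring A) (e : A) (O : NonUnitalSubring A) : Prop where
  one_mem : e ∈ O
  le_corner : O ≤ NonUnitalRing.corner e
  fg : ∃ s : Finset A, (Submodule.span R (s : Set A) : Set A) = O
  full : ∀ a ∈ NonUnitalRing.corner e, ∃ r ∈ R, r ≠ 0 ∧ r * a ∈ O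

/-- `O` is a maximal `R`-order in `eA`: no `R`-order in `eA` properly contains it. -/
def IsMaximalOrderIn (R : Subring A) (e : A) (O : NonUnitalSubring A) : Prop :=
  Maximal (IsOrderIn R e) O

end Orders

section Components

variable (p : ℕ) [Fact p.Prime] {G : Type u} [Group G] [TopologicalSpace G]

/-- For a central idempotent `e` of `Λ(G)`, the ring `eΛ(G)` with identity element `e`, written as
the corner `eΛ(G)e`. -/
def component (e : IwasawaAlgebra p G) : NonUnitalSubring (IwasawaAlgebra p G) :=
  NonUnitalRing.corner e

/-- The ring `ℤ_p[[K]]`, for a subgroup `K` of `G`, viewed inside `𝒬(G)`. -/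
def iwasawaSubring (K : Subgroup G) : Subring (FractionIwasawa p G) :=
  ((toFraction p).comp (IwasawaAlgebra.ofSubgroup p K).toRingHom).range

end Components

end

/-!
The idempotent `ε_χ` is the sum of the idempotents `e(x)` of the characters `x` in the orbit `X` of
`η` under the Galois group of `ℚ_p` and conjugation by `γ`. On characters of `H` the Galois group
acts through power maps of `H`, so `X` is an orbit of a finite commutative group `Δ` of permutations
of `H` (`exists_isCharOrbit_epsilonChi`, by Clifford's theorem). The coefficients
`(η(1) / |H|) ∑ x(h⁻¹)` of `ε_χ` lie in `ℚ_p`, and `ε_χ` lies in `Λ(G)` if and only if they are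
integral, which is clear if `η(1)` and `|H|` have the same valuation.

*Integrality implies full valuation* (`IsCharOrbit.norm_degree_eq`). An integral central idempotent
of the group algebra vanishes on the elements of order divisible by `p`
(`eq_zero_of_dvd_orderOf`): it equals all its powers, and the coefficients of a `p ^ m`-th power,
summed over a conjugacy class, are sums over words of length `p ^ m` on which rotation acts with
large orbits. Averaging over a Sylow subgroup of a centraliser then shows that its coefficients,
multiplied with the class sizes, are divisible by `n = η(1)` (`IsCharOrbit.norm_card_mul_idemFn_le`),
and therefore `n` divides the value at `1` of every integral function in the span of `X`
(`IsCharOrbit.norm_apply_one_le`). Such a function whose value at `1` is a unit times `n ^ 2 / |H|`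
is found as follows. Let `U` be the subgroup of `Δ` with `U / Stab(η)` of order prime to `p` and
`Δ / U` a `p`-group. The `U`-invariant functions in the span of `X` have dimension `|Δ / U|`, and a
`p`-group acting on a nonzero space in characteristic `p` has a nonzero invariant vector, which
here is a multiple of the reduction of the idempotent. So such a function attains its maximal norm on the `Δ`-orbit of
any point where the idempotent is a unit (`IsCharOrbit.norm_lt_one_of_orbit`), and the values on that
orbit can be prescribed; prescribing the value `1` at one point gives the function. Thus `|H|` divides
`n` locally.

*Full valuation implies the matrix ring isomorphism.* The reduction `A` of `ε_χ Λ(G)` modulo `p` is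
generated by the image `R` of `ℤ_p[H]`, a finite ring, and the unit `g` given by `γ`, and is complete
along `g ^ (p ^ n) - 1`. Because the central characters of the members of `X` are integral, `R` has
no ideals stable under `g` (`eq_bot_or_eq_top_of_forall_map_mem`); in particular `R` is semisimple.
By the Skolem–Noether theorem some power of `g` is a unit of `R` times an element centralising `R`,
and this yields a central element `t` of `A` such that `A` is complete along `t` and `A / t` is finite
and simple (`exists_isAdicAlong_isSimpleRing`), hence a matrix ring over a finite field. Lifting
matrix units along `t` and then along `p` makes `ε_χ Λ(G)` a matrix ring over a ring `S` that is
complete in two steps with a finite field as the last quotient; such a ring is a commutative, local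
and completely integrally closed domain (`exists_ringEquiv_matrix_of_isSimpleRing`). The size of the
matrices is `χ(1)` because the representation of `χ` factors through this matrix ring
(`Representation.IsIrreducible.eq_of_matrix`).

*Maximality.* An order containing `M_N(S)` has a common central denominator. It is therefore a matrix
ring over an extension of `S` inside a fractional ideal, and such an extension is trivial because `S`
is completely integrally closed (`IsComplIntClosed.mem_range_of_smul_mem`).
-/

noncomputable section

/-! ### Corner rings -/

namespace IsIdempotentElem

variable {A : Type*} [Ring A] {e : A} (he : IsIdempotentElem e)

/-- The inclusion of the corner ring `eAe` into `A`. -/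
def cornerVal : he.Corner →ₙ+* A where
  toFun c := Subtype.val (p := fun a ↦ a ∈ Subsemigroup.corner e) c
  map_mul' _ _ := rfl
  map_zero' := rfl
  map_add' _ _ := rfl

/-- The element `eae` of the corner ring `eAe`. -/
def toCorner (a : A) : he.Corner := ⟨e * a * e, ⟨a, rfl⟩⟩

@[simp] theorem cornerVal_toCorner (a : A) : he.cornerVal (he.toCorner a) = e * a * e := rfl

@[simp] theorem cornerVal_one : he.cornerVal 1 = e := rfl

theorem cornerVal_injective : Function.Injective he.cornerVal := fun _ _ h ↦ Subtype.ext h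

theorem mul_cornerVal (c : he.Corner) : e * he.cornerVal c = he.cornerVal c :=
  ((Subsemigroup.mem_corner_iff he).mp c.2).1

theorem cornerVal_mul (c : he.Corner) : he.cornerVal c * e = he.cornerVal c :=
  ((Subsemigroup.mem_corner_iff he).mp c.2).2

theorem toCorner_cornerVal (c : he.Corner) : he.toCorner (he.cornerVal c) = c :=
  he.cornerVal_injective (by rw [cornerVal_toCorner, mul_cornerVal, cornerVal_mul])

end IsIdempotentElem

/-! ### Rings complete along a central regular element -/

/-- `A` is separated and complete along the central regular element `π`. Completeness is stated as
the existence of a sum for every power series `∑ π ^ i * a i`. -/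
structure IsAdicAlong {A : Type*} [Ring A] (π : A) : Prop where
  comm : ∀ a, π * a = a * π
  regular : ∀ a, π * a = 0 → a = 0
  sep : ∀ a, (∀ k : ℕ, π ^ k ∣ a) → a = 0
  complete : ∀ a : ℕ → A, ∃ s, ∀ k, π ^ k ∣ s - ∑ i ∈ Finset.range k, π ^ i * a i

namespace IsAdicAlong

section Basic

variable {A : Type*} [Ring A] {π : A} (h : IsAdicAlong π)
include h

theorem pow_comm (k : ℕ) (a : A) : π ^ k * a = a * π ^ k :=
  (Commute.pow_left (h.comm a) k).eq

theorem dvd_mul_left_of {k : ℕ} {a : A} (ha : π ^ k ∣ a) (b : A) : π ^ k ∣ b * a := by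
  obtain ⟨c, rfl⟩ := ha
  exact ⟨b * c, by rw [← mul_assoc, ← h.pow_comm, mul_assoc]⟩

theorem dvd_mul_left_of' {a : A} (ha : π ∣ a) (b : A) : π ∣ b * a := by
  obtain ⟨c, rfl⟩ := ha
  exact ⟨b * c, by rw [← mul_assoc, ← h.comm, mul_assoc]⟩

theorem pow_regular (k : ℕ) (a : A) (ha : π ^ k * a = 0) : a = 0 := by
  induction k with
  | zero => simpa using ha
  | succ k ih =>
    rw [pow_succ', mul_assoc] at ha
    exact ih (h.regular _ ha)

theorem mul_left_cancel (k : ℕ) {a b : A} (hab : π ^ k * a = π ^ k * b) : a = b := by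
  refine sub_eq_zero.mp (h.pow_regular k _ ?_)
  rw [mul_sub, hab, sub_self]

theorem dvd_mul_of_dvd {i j : ℕ} {a b : A} (ha : π ^ i ∣ a) (hb : π ^ j ∣ b) :
    π ^ (i + j) ∣ a * b := by
  obtain ⟨c, rfl⟩ := ha
  obtain ⟨d, rfl⟩ := hb
  refine ⟨c * d, ?_⟩
  rw [pow_add, mul_assoc, mul_assoc, ← mul_assoc c, ← h.pow_comm j c]
  simp only [mul_assoc]

/-- A sequence with `π ^ k ∣ e (k + 1) - e k` converges. -/
theorem exists_limit (e : ℕ → A) (he : ∀ k, π ^ k ∣ e (k + 1) - e k) :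
    ∃ s, ∀ k, π ^ k ∣ s - e k := by
  choose a ha using he
  obtain ⟨s, hs⟩ := h.complete a
  refine ⟨s + e 0, fun k ↦ ?_⟩
  have h1 : ∑ i ∈ Finset.range k, π ^ i * a i = e k - e 0 := by
    rw [← Finset.sum_range_sub e k]
    exact Finset.sum_congr rfl fun i _ ↦ (ha i).symm
  have h2 := hs k
  rw [h1] at h2
  convert h2 using 1
  abel

theorem exists_mul_eq_one {a : A} (ha : π ∣ a - 1) : ∃ s, a * s = 1 := by
  obtain ⟨d, hd⟩ := ha
  have hd' : a = 1 + π * d := by rw [← hd]; abel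
  -- the geometric series
  obtain ⟨s, hs⟩ := h.complete fun i ↦ (-d) ^ i
  refine ⟨s, sub_eq_zero.mp (h.sep _ fun k ↦ ?_)⟩
  have h1 : a * ∑ i ∈ Finset.range k, π ^ i * (-d) ^ i = 1 - (π * -d) ^ k := by
    have h2 : ∀ i, π ^ i * (-d) ^ i = (π * -d) ^ i := fun i ↦
      (Commute.mul_pow (h.comm (-d)) i).symm
    simp only [h2]
    rw [hd', ← mul_neg_geom_sum (π * -d) k]
    noncomm_ring
  have h3 : a * s - 1 = a * (s - ∑ i ∈ Finset.range k, π ^ i * (-d) ^ i) - (π * -d) ^ k := by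
    rw [mul_sub, h1]; abel
  rw [h3]
  refine dvd_sub (h.dvd_mul_left_of (hs k) a) ?_
  rw [Commute.mul_pow (h.comm (-d)) k]
  exact dvd_mul_right _ _

theorem isUnit_of_dvd_sub_one {a : A} (ha : π ∣ a - 1) : IsUnit a := by
  obtain ⟨s, hs⟩ := h.exists_mul_eq_one ha
  have h1 : π ∣ s - 1 := by
    have h2 : s - 1 = -((a - 1) * s) := by rw [sub_mul, hs]; noncomm_ring
    rw [h2]
    exact (dvd_neg).mpr (dvd_mul_of_dvd_left ha s)
  obtain ⟨r, hr⟩ := h.exists_mul_eq_one h1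
  -- the right inverse `s` has a right inverse itself
  have h3 : a = r := left_inv_eq_right_inv hs hr
  subst h3
  exact ⟨⟨a, s, hs, hr⟩, rfl⟩

/-- Newton's iteration `x ↦ 3 x ^ 2 - 2 x ^ 3` lifts idempotents modulo `π`. -/
theorem exists_idempotent {x : A} (hx : π ∣ x * x - x) :
    ∃ e, IsIdempotentElem e ∧ π ∣ e - x := by
  let f : A → A := fun x ↦ 3 * (x * x) - 2 * (x * x * x)
  have f1 : ∀ x, f x - x = (x * x - x) * (1 - 2 * x) := by intro x; simp only [f]; noncomm_ring
  have f2 : ∀ x, f x * f x - f x = (x * x - x) * (x * x - x) * (4 * (x * x) - 4 * x - 3) := by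
    intro x; simp only [f]; noncomm_ring
  let e : ℕ → A := fun k ↦ f^[k] x
  have es : ∀ k, e (k + 1) = f (e k) := fun k ↦ Function.iterate_succ_apply' f k x
  have hk : ∀ k, π ^ (k + 1) ∣ e k * e k - e k := by
    intro k
    induction k with
    | zero => simpa [e] using hx
    | succ k ih =>
      rw [es, f2]
      refine dvd_mul_of_dvd_left ?_ _
      exact (pow_dvd_pow π (by omega)).trans (h.dvd_mul_of_dvd ih ih)
  have hd : ∀ k, π ^ (k + 1) ∣ e (k + 1) - e k := by
    intro k
    rw [es, f1]
    exact dvd_mul_of_dvd_left (hk k) _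
  obtain ⟨s, hs⟩ := h.exists_limit (fun k ↦ e k) fun k ↦ (pow_dvd_pow π (by omega)).trans (hd k)
  refine ⟨s, sub_eq_zero.mp (h.sep _ fun k ↦ ?_), ?_⟩
  · have h1 : s * s - s = s * (s - e k) + (s - e k) * e k + (e k * e k - e k) - (s - e k) := by
      noncomm_ring
    rw [h1]
    exact dvd_sub (dvd_add (dvd_add (h.dvd_mul_left_of (hs k) s) (dvd_mul_of_dvd_left (hs k) _))
      ((pow_dvd_pow π (by omega)).trans (hk k))) (hs k)
  · have h1 : s - x = (s - e 1) + (e 1 - e 0) := by simp [e]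
    rw [h1]
    have h2 := hs 1
    have h3 := hd 0
    simp only [zero_add, pow_one] at h2 h3
    exact dvd_add h2 h3

end Basic

section Quotient

variable {A : Type*} [Ring A] {π : A} (h : IsAdicAlong π) {B : Type*} [Ring B] {φ : A →+* B}
  (hφ : Function.Surjective φ) (hk : ∀ a, φ a = 0 ↔ π ∣ a)
include h hφ hk

theorem isUnit_of_map {a : A} (ha : IsUnit (φ a)) : IsUnit a := by
  obtain ⟨u, hu⟩ := ha
  obtain ⟨b, hb⟩ := hφ (↑u⁻¹ : B)
  have h1 : IsUnit (a * b) := h.isUnit_of_dvd_sub_one ((hk _).mp (by simp [hb, ← hu]))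
  have h2 : IsUnit (b * a) := h.isUnit_of_dvd_sub_one ((hk _).mp (by simp [hb, ← hu]))
  obtain ⟨c, hc⟩ := h1.exists_right_inv
  obtain ⟨d, hd⟩ := h2.exists_left_inv
  have h3 : d * b = b * c := left_inv_eq_right_inv (a := a) (by rw [mul_assoc, hd]) (by
    rw [← mul_assoc, hc])
  exact ⟨⟨a, b * c, by rw [← mul_assoc, hc], by rw [← h3, mul_assoc, hd]⟩, rfl⟩

theorem exists_idempotent_lift {y : B} (hy : IsIdempotentElem y) :
    ∃ e, IsIdempotentElem e ∧ φ e = y := by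
  obtain ⟨x, rfl⟩ := hφ y
  obtain ⟨e, he, hex⟩ := h.exists_idempotent (x := x) ((hk _).mp (by simp [hy.eq]))
  exact ⟨e, he, sub_eq_zero.mp (by rw [← map_sub]; exact (hk _).mpr hex)⟩

end Quotient

section Constructions

variable {A : Type*} [Ring A] {π : A} (h : IsAdicAlong π)
include h

theorem matrix (N : ℕ) : IsAdicAlong (Matrix.scalar (Fin N) π) := by
  have hp : ∀ k, Matrix.scalar (Fin N) π ^ k = Matrix.scalar (Fin N) (π ^ k) := fun k ↦
    (map_pow _ _ _).symm
  have hd : ∀ (k : ℕ) (M : Matrix (Fin N) (Fin N) A),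
      Matrix.scalar (Fin N) π ^ k ∣ M ↔ ∀ i j, π ^ k ∣ M i j := by
    intro k M
    rw [hp]
    constructor
    · rintro ⟨L, rfl⟩ i j
      simp [Matrix.scalar_apply, Matrix.diagonal_mul]
    · intro H
      choose L hL using H
      refine ⟨Matrix.of L, ?_⟩
      ext i j
      simp [Matrix.scalar_apply, Matrix.diagonal_mul, hL]
  refine ⟨fun M ↦ ?_, fun M hM ↦ ?_, fun M hM ↦ ?_, fun M ↦ ?_⟩
  · ext i j
    simp [Matrix.scalar_apply, Matrix.diagonal_mul, Matrix.mul_diagonal, h.comm]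
  · ext i j
    have := congrFun (congrFun hM i) j
    simp only [Matrix.scalar_apply, Matrix.diagonal_mul, Matrix.zero_apply] at this
    exact h.regular _ this
  · ext i j
    exact h.sep _ fun k ↦ (hd k M).mp (hM k) i j
  · choose s hs using fun i j ↦ h.complete fun k ↦ M k i j
    refine ⟨Matrix.of s, fun k ↦ (hd k _).mpr fun i j ↦ ?_⟩
    convert hs i j k using 1
    rw [Matrix.sub_apply, Matrix.sum_apply]
    congr 1
    refine Finset.sum_congr rfl fun c _ ↦ ?_
    rw [hp, Matrix.scalar_apply, Matrix.diagonal_mul]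

theorem corner {e : A} (he : IsIdempotentElem e) : IsAdicAlong (he.toCorner π) := by
  set ϖ : he.Corner := he.toCorner π with hϖ
  have hmul : ∀ c : he.Corner, he.cornerVal (ϖ * c) = π * he.cornerVal c := by
    intro c
    rw [map_mul, hϖ, he.cornerVal_toCorner, mul_assoc, he.mul_cornerVal, ← h.comm, mul_assoc,
      he.mul_cornerVal]
  have hpmul : ∀ (k : ℕ) (c : he.Corner), he.cornerVal (ϖ ^ k * c) = π ^ k * he.cornerVal c := by
    intro k
    induction k with
    | zero => intro c; simp
    | succ k ih => intro c; rw [pow_succ', mul_assoc, hmul, ih, pow_succ', mul_assoc]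
  have hcomm : ∀ (k : ℕ) (d : A), e * (π ^ k * d) * e = π ^ k * (e * d * e) := by
    intro k d
    rw [← mul_assoc e, ← h.pow_comm k e]
    simp only [mul_assoc]
  have hd : ∀ (k : ℕ) (c : he.Corner), ϖ ^ k ∣ c ↔ π ^ k ∣ he.cornerVal c := by
    intro k c
    constructor
    · rintro ⟨d, rfl⟩
      exact ⟨he.cornerVal d, hpmul k d⟩
    · rintro ⟨d, hd⟩
      refine ⟨he.toCorner d, he.cornerVal_injective ?_⟩
      rw [hpmul, he.cornerVal_toCorner, ← hcomm, ← hd, he.mul_cornerVal, he.cornerVal_mul]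
  refine ⟨fun c ↦ he.cornerVal_injective ?_, fun c hc ↦ he.cornerVal_injective ?_,
    fun c hc ↦ he.cornerVal_injective ?_, fun c ↦ ?_⟩
  · rw [hmul, map_mul, hϖ, he.cornerVal_toCorner, ← h.comm e, mul_assoc π, he.eq, h.comm e, ← mul_assoc,
      he.cornerVal_mul, h.comm]
  · have := congrArg he.cornerVal hc
    rw [hmul, map_zero] at this
    rw [h.regular _ this, map_zero]
  · rw [map_zero]
    exact h.sep _ fun k ↦ (hd k c).mp (hc k)
  · obtain ⟨s, hs⟩ := h.complete fun i ↦ he.cornerVal (c i)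
    refine ⟨he.toCorner s, fun k ↦ (hd k _).mpr ?_⟩
    obtain ⟨d, hd⟩ := hs k
    refine ⟨e * d * e, ?_⟩
    rw [map_sub, map_sum, he.cornerVal_toCorner, ← hcomm, ← hd, mul_sub, sub_mul]
    congr 1
    rw [Finset.mul_sum, Finset.sum_mul]
    refine Finset.sum_congr rfl fun i _ ↦ ?_
    rw [hpmul, hcomm, he.mul_cornerVal, he.cornerVal_mul]

end Constructions

end IsAdicAlong

namespace IsAdicAlong

/-- An isomorphism of `A / π` with a matrix ring lifts to an isomorphism of `A` with a matrix ring,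
over a ring which is again complete. The matrix units of `A / π` are lifted to elements `xᵢ`, `yⱼ`
with `yⱼ xᵢ = δᵢⱼ e` for an idempotent `e`, and the matrix ring has entries in `eAe`. -/
theorem exists_ringEquiv_matrix {A : Type u} [Ring A] {π : A} (h : IsAdicAlong π)
    {B : Type*} [Ring B] {φ : A →+* B} (hφ : Function.Surjective φ) (hk : ∀ a, φ a = 0 ↔ π ∣ a)
    {D : Type*} [Ring D] {N : ℕ} [NeZero N] (f : B ≃+* Matrix (Fin N) (Fin N) D) :
    ∃ (C : Type u) (_ : Ring C) (ϖ : C) (ψ : C →+* D) (g : A ≃+* Matrix (Fin N) (Fin N) C),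
      IsAdicAlong ϖ ∧ Function.Surjective ψ ∧ (∀ c, ψ c = 0 ↔ ϖ ∣ c) ∧
      g π = Matrix.scalar (Fin N) ϖ ∧ ∀ a i j, ψ (g a i j) = f (φ a) i j := by
  have hsingle : IsIdempotentElem (f.symm (Matrix.single 0 0 1)) := by
    rw [IsIdempotentElem, ← map_mul, Matrix.single_mul_single_same, mul_one]
  obtain ⟨e, he, hφe⟩ := h.exists_idempotent_lift hφ hk hsingle
  have hfe : f (φ e) = Matrix.single 0 0 1 := by rw [hφe, f.apply_symm_apply]
  choose x hx using fun i ↦ hφ (f.symm (Matrix.single i 0 1))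
  choose y hy using fun j ↦ hφ (f.symm (Matrix.single 0 j 1))
  let C := he.Corner
  let ϖ : C := he.toCorner π
  have hϖ : IsAdicAlong ϖ := h.corner he
  have hϖmul : ∀ c : C, he.cornerVal (ϖ * c) = π * he.cornerVal c := by
    intro c
    rw [map_mul, he.cornerVal_toCorner, mul_assoc, he.mul_cornerVal, ← h.comm, mul_assoc,
      he.mul_cornerVal]
  let ψ : C →+* D :=
    { toFun := fun c ↦ f (φ (he.cornerVal c)) 0 0
      map_one' := by simp [hfe]
      map_zero' := by simp
      map_add' := fun a b ↦ by simp
      map_mul' := fun a b ↦ by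
        have h1 : f (φ (he.cornerVal a)) = f (φ (he.cornerVal a)) * Matrix.single 0 0 1 := by
          rw [← hfe, ← map_mul, ← map_mul, he.cornerVal_mul]
        rw [map_mul, map_mul, map_mul, Matrix.mul_apply, Finset.sum_eq_single 0]
        · intro j _ hj
          have h2 : f (φ (he.cornerVal a)) 0 j = 0 := by
            rw [h1]
            exact Matrix.mul_single_apply_of_ne (hbj := hj) ..
          rw [h2, zero_mul]
        · simp }
  have hψ' : ∀ a, ψ (he.toCorner a) = f (φ a) 0 0 := by
    intro a
    change f (φ (e * a * e)) 0 0 = _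
    simp [hfe]
  have hψs : Function.Surjective ψ := by
    intro d
    obtain ⟨a, ha⟩ := hφ (f.symm (Matrix.single 0 0 d))
    exact ⟨he.toCorner a, by rw [hψ', ha]; simp⟩
  have hψk : ∀ c, ψ c = 0 ↔ ϖ ∣ c := by
    intro c
    constructor
    · intro hc
      have h1 : f (φ (he.cornerVal c)) = 0 := by
        have h2 : f (φ (he.cornerVal c))
            = Matrix.single 0 0 1 * f (φ (he.cornerVal c)) * Matrix.single 0 0 1 := by
          rw [← hfe, ← map_mul, ← map_mul, ← map_mul, ← map_mul, he.mul_cornerVal, he.cornerVal_mul]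
        have h3 : f (φ (he.cornerVal c)) 0 0 = 0 := hc
        rw [h2, Matrix.single_mul_mul_single]
        simp [h3]
      obtain ⟨d, hd⟩ := (hk _).mp ((map_eq_zero_iff f f.injective).mp h1)
      refine ⟨he.toCorner d, he.cornerVal_injective ?_⟩
      rw [hϖmul, he.cornerVal_toCorner, ← mul_assoc, ← mul_assoc, h.comm e, mul_assoc e, ← hd,
        he.mul_cornerVal, he.cornerVal_mul]
    · rintro ⟨d, rfl⟩
      change f (φ (he.cornerVal (ϖ * d))) 0 0 = 0
      rw [hϖmul, map_mul, (hk π).mpr dvd_rfl]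
      simp
  -- the Gram matrix of the lifted matrix units is invertible
  let Γ : Matrix (Fin N) (Fin N) C := Matrix.of fun j i ↦ he.toCorner (y j * x i)
  have hΓ : (Matrix.scalar (Fin N) ϖ) ∣ Γ - 1 := by
    have h1 : ∀ j i, ∃ c, (Γ - 1) j i = ϖ * c := by
      intro j i
      refine (hψk _).mp ?_
      rw [Matrix.sub_apply, map_sub]
      change ψ (he.toCorner (y j * x i)) - _ = 0
      rw [hψ', map_mul, hx, hy, map_mul, f.apply_symm_apply, f.apply_symm_apply]
      rcases eq_or_ne j i with rfl | hij
      · simp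
      · simp [hij]
    choose c hc using h1
    refine ⟨Matrix.of c, ?_⟩
    ext j i
    rw [hc]
    simp [Matrix.scalar_apply, Matrix.diagonal_mul]
  obtain ⟨U, hU⟩ := (hϖ.matrix N).isUnit_of_dvd_sub_one hΓ
  let Γ' : Matrix (Fin N) (Fin N) C := ↑U⁻¹
  have hΓΓ' : Γ * Γ' = 1 := by rw [← hU]; exact U.mul_inv
  have hψΓ : Γ.map ψ = 1 := by
    ext j i
    obtain ⟨c, hc⟩ := hΓ
    have h2 : Γ = 1 + Matrix.scalar (Fin N) ϖ * c := by rw [← hc]; abel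
    rw [h2, Matrix.map_apply, Matrix.add_apply, map_add, Matrix.scalar_apply,
      Matrix.diagonal_mul, map_mul, (hψk ϖ).mpr dvd_rfl, zero_mul, add_zero]
    rcases eq_or_ne j i with rfl | hij
    · simp
    · simp [hij]
  have hψΓ' : Γ'.map ψ = 1 := by
    have h1 := congrArg (fun M : Matrix (Fin N) (Fin N) C ↦ M.map ψ) hΓΓ'
    simp only [Matrix.map_mul, hψΓ, one_mul] at h1
    rw [h1]
    ext j i
    rcases eq_or_ne j i with rfl | hij
    · simp
    · simp [hij]
  -- correct the lifts of the first column by the inverse of the Gram matrix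
  let y' : Fin N → A := fun j ↦ e * y j
  let x' : Fin N → A := fun i ↦ ∑ k, x k * he.cornerVal (Γ' k i)
  have hx'e : ∀ i, x' i * e = x' i := by
    intro i
    simp only [x', Finset.sum_mul, mul_assoc, he.cornerVal_mul]
  have hey' : ∀ i, e * y' i = y' i := by
    intro i
    simp only [y', ← mul_assoc, he.eq]
  have hyx : ∀ j i, y' j * x' i = if j = i then e else 0 := by
    intro j i
    have h1 : y' j * x' i = he.cornerVal ((Γ * Γ') j i) := by
      rw [Matrix.mul_apply, map_sum, Finset.mul_sum]
      refine Finset.sum_congr rfl fun k _ ↦ ?_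
      rw [map_mul]
      change e * y j * (x k * he.cornerVal (Γ' k i)) = e * (y j * x k) * e * he.cornerVal (Γ' k i)
      conv_lhs => rw [← he.mul_cornerVal]
      simp only [mul_assoc]
    rw [h1, hΓΓ', Matrix.one_apply]
    split_ifs <;> simp
  have hfx : ∀ i, f (φ (x' i)) = Matrix.single i 0 1 := by
    intro i
    have h1 : ∀ c : C, f (φ (he.cornerVal c)) = Matrix.single 0 0 (ψ c) := by
      intro c
      have h2 : f (φ (he.cornerVal c))
          = Matrix.single 0 0 1 * f (φ (he.cornerVal c)) * Matrix.single 0 0 1 := by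
        rw [← hfe, ← map_mul, ← map_mul, ← map_mul, ← map_mul, he.mul_cornerVal, he.cornerVal_mul]
      rw [h2, Matrix.single_mul_mul_single]
      simp [ψ]
    simp only [x', map_sum, map_mul, hx, f.apply_symm_apply, h1, Matrix.single_mul_single_same,
      one_mul]
    have h3 : ∀ k, ψ (Γ' k i) = (1 : Matrix (Fin N) (Fin N) D) k i := fun k ↦
      congrFun (congrFun hψΓ' k) i
    rw [Finset.sum_eq_single i]
    · simp [h3]
    · intro k _ hk
      simp [h3, hk]
    · simp
  have hfy : ∀ j, f (φ (y' j)) = Matrix.single 0 j 1 := by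
    intro j
    simp [y', hfe, hy]
  clear_value x' y'
  -- the sum of the lifted diagonal idempotents is an idempotent congruent to `1`, hence equal to it
  let E : A := ∑ i, x' i * y' i
  have hEy : ∀ i, y' i * E = y' i := by
    intro i
    simp only [E, Finset.mul_sum, ← mul_assoc, hyx]
    simp [hey']
  have hE2 : E * E = E := by
    have h1 : E * E = ∑ i, x' i * y' i * E := Finset.sum_mul ..
    rw [h1]
    simp only [mul_assoc, hEy]
    rfl
  have hE : E = 1 := by
    have h1 : IsUnit E := by
      refine h.isUnit_of_dvd_sub_one ((hk _).mp (f.injective ?_))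
      simp only [E, map_sub, map_sum, map_mul, map_one, map_zero, hfx, hfy,
        Matrix.single_mul_single_same, mul_one, Matrix.sum_single_one, sub_self]
    exact h1.mul_left_cancel (by rw [hE2, mul_one])
  let g0 : A → Matrix (Fin N) (Fin N) C := fun a ↦ Matrix.of fun i j ↦ he.toCorner (y' i * a * x' j)
  have hg0 : ∀ a i j, he.cornerVal (g0 a i j) = y' i * a * x' j := by
    intro a i j
    change e * (y' i * a * x' j) * e = _
    conv_rhs => rw [← hey', ← hx'e]
    simp only [mul_assoc]
  let g : A →+* Matrix (Fin N) (Fin N) C :=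
    { toFun := g0
      map_one' := by
        ext i j
        refine he.cornerVal_injective ?_
        rw [hg0, mul_one, hyx, Matrix.one_apply]
        split_ifs <;> simp
      map_zero' := by
        ext i j
        refine he.cornerVal_injective ?_
        rw [hg0]
        simp
      map_add' := fun a b ↦ by
        ext i j
        refine he.cornerVal_injective ?_
        rw [Matrix.add_apply, map_add, hg0, hg0, hg0, mul_add, add_mul]
      map_mul' := fun a b ↦ by
        ext i j
        refine he.cornerVal_injective ?_
        rw [Matrix.mul_apply, map_sum, hg0]
        have h1 : y' i * (a * b) * x' j = y' i * a * E * (b * x' j) := by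
          rw [hE]; simp only [mul_assoc, mul_one]
        rw [h1, Finset.mul_sum, Finset.sum_mul]
        refine Finset.sum_congr rfl fun k _ ↦ ?_
        rw [map_mul, hg0, hg0]
        simp only [mul_assoc] }
  have hginj : Function.Injective g := by
    refine (injective_iff_map_eq_zero g).mpr fun a ha ↦ ?_
    have h1 : ∀ i j, y' i * a * x' j = 0 := by
      intro i j
      rw [← hg0]
      have : g0 a i j = 0 := congrFun (congrFun ha i) j
      rw [this, map_zero]
    have h2 : a = E * a * E := by rw [hE]; simp
    rw [h2]
    simp only [E, Finset.sum_mul, Finset.mul_sum]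
    refine Finset.sum_eq_zero fun i _ ↦ Finset.sum_eq_zero fun j _ ↦ ?_
    have h3 : x' j * y' j * a * (x' i * y' i) = x' j * (y' j * a * x' i) * y' i := by
      simp only [mul_assoc]
    rw [h3, h1]
    simp
  have hgsurj : Function.Surjective g := by
    intro M
    refine ⟨∑ i, ∑ j, x' i * he.cornerVal (M i j) * y' j, ?_⟩
    ext k l
    refine he.cornerVal_injective ?_
    change he.cornerVal (g0 _ k l) = _
    rw [hg0, Finset.mul_sum, Finset.sum_mul, Finset.sum_eq_single k, Finset.mul_sum, Finset.sum_mul,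
      Finset.sum_eq_single l]
    · have h1 : y' k * (x' k * he.cornerVal (M k l) * y' l) * x' l
          = (y' k * x' k) * he.cornerVal (M k l) * (y' l * x' l) := by simp only [mul_assoc]
      rw [h1, hyx, hyx, if_pos rfl, if_pos rfl, he.mul_cornerVal, he.cornerVal_mul]
    · intro j _ hj
      have h1 : y' k * (x' k * he.cornerVal (M k j) * y' j) * x' l
          = (y' k * x' k) * he.cornerVal (M k j) * (y' j * x' l) := by simp only [mul_assoc]
      rw [h1, hyx j, if_neg hj, mul_zero]
    · simp
    · intro i _ hi
      rw [Finset.mul_sum, Finset.sum_mul]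
      refine Finset.sum_eq_zero fun j _ ↦ ?_
      have h1 : y' k * (x' i * he.cornerVal (M i j) * y' j) * x' l
          = (y' k * x' i) * he.cornerVal (M i j) * (y' j * x' l) := by simp only [mul_assoc]
      rw [h1, hyx k, if_neg (Ne.symm hi), zero_mul, zero_mul]
    · simp
  refine ⟨C, inferInstance, ϖ, ψ, RingEquiv.ofBijective g ⟨hginj, hgsurj⟩, hϖ, hψs, hψk, ?_, ?_⟩
  · ext i j
    refine he.cornerVal_injective ?_
    change he.cornerVal (g0 π i j) = _
    rw [hg0, ← h.comm, mul_assoc, hyx, Matrix.scalar_apply, Matrix.diagonal_apply]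
    split_ifs
    · change _ = e * π * e
      rw [mul_assoc, h.comm, ← mul_assoc, he.eq]
    · simp
  · intro a i j
    change f (φ (he.cornerVal (g0 a i j))) 0 0 = _
    rw [hg0]
    simp only [map_mul, hfx, hfy, Matrix.single_mul_mul_single, Matrix.single_apply_same, one_mul,
      mul_one]

end IsAdicAlong

/-! ### Commutativity and integral closedness along a complete filtration -/

namespace IsAdicAlong

/-- A ring complete along `t` whose quotient by `t` is a finite field is commutative: the
multiplicative group of the field is cyclic, so representatives of the residue classes can be chosen
to commute with each other. -/
theorem mul_comm_of_finite_field {C : Type*} [Ring C] {t : C} (h : IsAdicAlong t) {k : Type*}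
    [Field k] [Finite k] {ψ : C →+* k} (hψ : Function.Surjective ψ) (hk : ∀ c, ψ c = 0 ↔ t ∣ c)
    (x y : C) : x * y = y * x := by
  obtain ⟨g, hg⟩ := IsCyclic.exists_generator (α := kˣ)
  obtain ⟨a, ha⟩ := hψ (g : k)
  have key : ∀ x : C, ∃ r x', x = r + t * x' ∧ (r = 0 ∨ ∃ i : ℕ, r = a ^ i) := by
    intro x
    by_cases hx : ψ x = 0
    · obtain ⟨x', hx'⟩ := (hk x).mp hx
      exact ⟨0, x', by rw [hx', zero_add], Or.inl rfl⟩
    · obtain ⟨i, hi⟩ := (Submonoid.mem_powers_iff _ _).mp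
        (mem_powers_iff_mem_zpowers.mpr (hg (Units.mk0 (ψ x) hx)))
      have h1 : ψ (x - a ^ i) = 0 := by
        have := congrArg Units.val hi
        simp only [Units.val_pow_eq_pow_val, Units.val_mk0] at this
        rw [map_sub, map_pow, ha, this, sub_self]
      obtain ⟨x', hx'⟩ := (hk _).mp h1
      exact ⟨a ^ i, x', by rw [← hx']; abel, Or.inr ⟨i, rfl⟩⟩
  have main : ∀ (j : ℕ) (x y : C), t ^ j ∣ x * y - y * x := by
    intro j
    induction j with
    | zero => intro x y; simp
    | succ j ih =>
      intro x y
      obtain ⟨r, x', rfl, hr⟩ := key x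
      obtain ⟨s, y', rfl, hs⟩ := key y
      -- representatives of residue classes are `0` or powers of one element `a`
      have hrs : r * s = s * r := by
        rcases hr with rfl | ⟨i, rfl⟩
        · simp
        rcases hs with rfl | ⟨l, rfl⟩
        · simp
        rw [← pow_add, ← pow_add, add_comm]
      have h1 : (r + t * x') * (s + t * y') - (s + t * y') * (r + t * x')
          = t * ((r * y' - y' * r) + (x' * s - s * x') + t * (x' * y' - y' * x')) := by
        have e1 : r * (t * y') = t * (r * y') := by rw [← mul_assoc, ← h.comm, mul_assoc]
        have e2 : s * (t * x') = t * (s * x') := by rw [← mul_assoc, ← h.comm, mul_assoc]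
        have e3 : x' * (t * y') = t * (x' * y') := by rw [← mul_assoc, ← h.comm, mul_assoc]
        have e4 : y' * (t * x') = t * (y' * x') := by rw [← mul_assoc, ← h.comm, mul_assoc]
        simp only [mul_add, add_mul, mul_sub, mul_assoc, e1, e2, e3, e4, hrs]
        abel
      rw [h1, pow_succ']
      exact mul_dvd_mul_left t (dvd_add (dvd_add (ih _ _) (ih _ _)) (h.dvd_mul_left_of (ih _ _) t))
  exact sub_eq_zero.mp (h.sep _ fun j ↦ main j x y)

/-- A ring `C` complete along `π` is commutative if `C / π` is a commutative ring of characteristic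
`p` that is complete along some `t` with finite residue field. Otherwise the commutators, divided by
the largest possible power of `π`, induce a nonzero alternating biderivation of `C / π`; but it kills
`p`-th powers, which together with `t` topologically generate `C / π`. -/
theorem mul_comm_of_quotient {C : Type*} [Ring C] {π : C} (h : IsAdicAlong π) {p : ℕ}
    [Fact p.Prime] {D : Type*} [CommRing D] [CharP D p] {ψ : C →+* D}
    (hψ : Function.Surjective ψ) (hk : ∀ c, ψ c = 0 ↔ π ∣ c) {t : D} (ht : IsAdicAlong t)
    {k : Type*} [Field k] [Finite k] {θ : D →+* k} (hθ : Function.Surjective θ)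
    (hθk : ∀ c, θ c = 0 ↔ t ∣ c) (x y : C) : x * y = y * x := by
  have : CharP k p := (CharP.charP_iff_prime_eq_zero Fact.out).mpr
    (by rw [← map_natCast θ, CharP.cast_eq_zero, map_zero])
  obtain ⟨t', ht'⟩ := hψ t
  have key : ∀ x : C, ∃ u x' x'', x = u ^ p + t' * x' + π * x'' := by
    intro x
    have : PerfectRing k p := inferInstance
    obtain ⟨δ, hδ⟩ := surjective_frobenius k p (θ (ψ x))
    obtain ⟨v, hv⟩ := hθ δ
    obtain ⟨u, hu⟩ := hψ v
    have h1 : θ (ψ (x - u ^ p)) = 0 := by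
      rw [map_sub, map_sub, map_pow, map_pow, hu, hv, ← hδ, frobenius_def, sub_self]
    obtain ⟨d, hd⟩ := (hθk _).mp h1
    obtain ⟨x', hx'⟩ := hψ d
    have h2 : ψ (x - u ^ p - t' * x') = 0 := by
      rw [map_sub, hd, map_mul, ht', hx', sub_self]
    obtain ⟨x'', hx''⟩ := (hk _).mp h2
    exact ⟨u, x', x'', by rw [← hx'']; abel⟩
  have main : ∀ (j : ℕ) (x y : C), π ^ j ∣ x * y - y * x := by
    intro j
    induction j with
    | zero => intro x y; simp
    | succ j ih =>
      choose c hc using ih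
      let d : C → C → D := fun x y ↦ ψ (c x y)
      have hd : ∀ x y z, π ^ j * z = x * y - y * x → d x y = ψ z := by
        intro x y z hz
        exact congrArg ψ (h.mul_left_cancel j (by rw [hz, ← hc]))
      have hadd : ∀ x x' y, d (x + x') y = d x y + d x' y := by
        intro x x' y
        rw [hd (x + x') y (c x y + c x' y) (by rw [mul_add, ← hc, ← hc]; noncomm_ring), map_add]
      have hself : ∀ x, d x x = 0 := by
        intro x
        rw [hd x x 0 (by simp), map_zero]
      have hneg : ∀ x y, d x y = - d y x := by
        intro x y
        rw [hd x y (-c y x) (by rw [mul_neg, ← hc]; noncomm_ring), map_neg]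
      have hmul : ∀ x x' y, d (x * x') y = ψ x * d x' y + d x y * ψ x' := by
        intro x x' y
        rw [hd (x * x') y (x * c x' y + c x y * x') ?_, map_add, map_mul, map_mul]
        rw [mul_add, ← mul_assoc, h.pow_comm, mul_assoc, ← hc, ← mul_assoc, ← hc]
        noncomm_ring
      have hπ : ∀ x y, d (π * x) y = 0 := by
        intro x y
        rw [hd (π * x) y (π * c x y) ?_, map_mul, (hk π).mpr dvd_rfl, zero_mul]
        have e1 : y * (π * x) = π * (y * x) := by rw [← mul_assoc, ← h.comm, mul_assoc]
        rw [← mul_assoc, ← pow_succ, pow_succ', mul_assoc, ← hc, mul_sub, e1, mul_assoc]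
      have hpow : ∀ x y (m : ℕ), d (x ^ m) y = m * ψ x ^ (m - 1) * d x y := by
        intro x y m
        induction m with
        | zero =>
          rw [hd (x ^ 0) y 0 (by simp)]
          simp
        | succ m ihm =>
          rw [pow_succ, hmul, ihm, map_pow]
          rcases m with - | m
          · simp
          · simp only [Nat.add_sub_cancel, pow_succ]
            push_cast
            ring
      -- `p`-th powers and multiples of `π` do not contribute to the derivation `d`
      have hstep : ∀ x y, ∃ x', d x y = t * d x' y + ψ x' * d t' y := by
        intro x y
        obtain ⟨u, x', x'', hx⟩ := key x
        refine ⟨x', ?_⟩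
        conv_lhs => rw [hx]
        rw [hadd, hadd, hπ, hpow, hmul, ht', CharP.cast_eq_zero]
        ring
      -- iterating `hstep` shows that `d` is divisible by all powers of `t`: first for `y = t`, where
      -- `d t t = 0`, and then for all `y`
      have ht0 : ∀ x, d x t' = 0 := by
        intro x
        refine ht.sep _ fun m ↦ ?_
        induction m generalizing x with
        | zero => simp
        | succ m ihm =>
          obtain ⟨x', hx'⟩ := hstep x t'
          rw [hx', hself, mul_zero, add_zero, pow_succ']
          exact mul_dvd_mul_left t (ihm x')
      have hd0 : ∀ x y, d x y = 0 := by
        intro x y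
        refine ht.sep _ fun m ↦ ?_
        induction m generalizing x with
        | zero => simp
        | succ m ihm =>
          obtain ⟨x', hx'⟩ := hstep x y
          rw [hx', hneg t', ht0, neg_zero, mul_zero, add_zero, pow_succ']
          exact mul_dvd_mul_left t (ihm x')
      intro x y
      rw [hc x y, pow_succ]
      exact mul_dvd_mul_left _ ((hk _).mp (hd0 x y))
  exact sub_eq_zero.mp (h.sep _ fun j ↦ main j x y)

end IsAdicAlong

/-- A commutative ring is completely integrally closed (in its total ring of fractions) if every
fraction `a / b` with `d * (a / b) ^ k` integral for all `k` and some fixed `d ≠ 0` is integral. -/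
def IsComplIntClosed (C : Type*) [CommRing C] : Prop :=
  ∀ a b d : C, b ≠ 0 → d ≠ 0 → (∀ k : ℕ, b ^ k ∣ d * a ^ k) → b ∣ a

theorem IsComplIntClosed.of_field (k : Type*) [Field k] : IsComplIntClosed k :=
  fun _ _ _ hb _ _ ↦ (isUnit_iff_ne_zero.mpr hb).dvd

theorem IsComplIntClosed.isIntegrallyClosed {C : Type*} [CommRing C] [IsDomain C]
    (hC : IsComplIntClosed C) : IsIntegrallyClosed C := by
  refine (isIntegrallyClosed_iff (FractionRing C)).mpr fun {x} hx ↦ ?_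
  obtain ⟨d, hd, hdx⟩ := hx.isAlmostIntegral
  obtain ⟨a, b, hb, rfl⟩ := IsFractionRing.div_surjective (A := C) x
  have hb0 : algebraMap C (FractionRing C) b ≠ 0 :=
    IsFractionRing.to_map_ne_zero_of_mem_nonZeroDivisors hb
  obtain ⟨c, hc⟩ := hC a b d (nonZeroDivisors.ne_zero hb) (nonZeroDivisors.ne_zero hd) fun k ↦ by
    obtain ⟨e, he⟩ := hdx k
    refine ⟨e, IsFractionRing.injective C (FractionRing C) ?_⟩
    rw [map_mul _ (b ^ k), he, Algebra.smul_def, map_mul, map_pow, map_pow, div_pow]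
    field_simp
  exact ⟨c, by rw [hc, map_mul, mul_div_cancel_left₀ _ hb0]⟩

namespace IsAdicAlong

variable {C : Type*} [CommRing C] {π : C} (h : IsAdicAlong π) {D : Type*} [CommRing D] [IsDomain D]
  {ψ : C →+* D} (hψ : Function.Surjective ψ) (hk : ∀ c, ψ c = 0 ↔ π ∣ c)
include h hψ hk

omit hψ [IsDomain D] in
theorem exists_eq_pow_mul {a : C} (ha : a ≠ 0) : ∃ (i : ℕ) (b : C), a = π ^ i * b ∧ ψ b ≠ 0 := by
  classical
  have h1 : ∃ k, ¬ π ^ k ∣ a := by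
    by_contra! H
    exact ha (h.sep a H)
  obtain ⟨i, hi⟩ : ∃ i, Nat.find h1 = i + 1 :=
    Nat.exists_eq_succ_of_ne_zero fun h0 ↦ (Nat.find_spec h1) (by rw [h0, pow_zero]; exact one_dvd a)
  obtain ⟨b, hb⟩ := not_not.mp (Nat.find_min h1 (m := i) (by omega))
  refine ⟨i, b, hb, fun hb0 ↦ ?_⟩
  obtain ⟨c, rfl⟩ := (hk b).mp hb0
  have h2 := Nat.find_spec h1
  rw [hi] at h2
  exact h2 ⟨c, by rw [hb, pow_succ, mul_assoc]⟩

omit hψ in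
theorem isDomain : IsDomain C := by
  have : Nontrivial C := ψ.domain_nontrivial
  have : NoZeroDivisors C := ⟨fun {a b} hab ↦ by
    by_contra! H
    obtain ⟨i, a', rfl, ha'⟩ := h.exists_eq_pow_mul hk H.1
    obtain ⟨j, b', rfl, hb'⟩ := h.exists_eq_pow_mul hk H.2
    have h1 : a' * b' = 0 := h.pow_regular (i + j) _ (by rw [← hab]; ring)
    have h2 : ψ a' * ψ b' = 0 := by rw [← map_mul, h1, map_zero]
    exact (mul_ne_zero ha' hb') h2⟩
  exact NoZeroDivisors.to_isDomain C

theorem isComplIntClosed (hD : IsComplIntClosed D) : IsComplIntClosed C := by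
  have := h.isDomain hk
  have hπ0 : π ≠ 0 := fun h0 ↦ one_ne_zero (α := C) (h.regular 1 (by rw [h0, zero_mul]))
  have hπ : Prime π := by
    refine ⟨hπ0, fun hu ↦ ?_, fun a b hab ↦ ?_⟩
    · exact (hu.map ψ).ne_zero ((hk π).mpr dvd_rfl)
    · rw [← hk, map_mul] at hab
      rw [← hk, ← hk]
      exact mul_eq_zero.mp hab
  -- the case of denominators and numerators prime to `π`
  have main : ∀ a b d : C, ψ b ≠ 0 → ψ d ≠ 0 → (∀ k : ℕ, b ^ k ∣ d * a ^ k) → b ∣ a := by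
    intro a b d hb hd hab
    have hcop : ∀ i k m, π ^ i ∣ b ^ k * m → π ^ i ∣ m := by
      intro i k m hm
      refine hπ.pow_dvd_of_dvd_mul_left i (fun H ↦ ?_) hm
      exact pow_ne_zero k hb (by rw [← map_pow]; exact (hk _).mpr H)
    have step : ∀ a : C, (∀ k : ℕ, b ^ k ∣ d * a ^ k) →
        ∃ c a', a = b * c + π * a' ∧ ∀ k : ℕ, b ^ k ∣ d * a' ^ k := by
      intro a ha
      -- divide `a` by `b` modulo `π`; the error term inherits the hypothesis, so that the process
      -- can be repeated
      have h1 : ψ b ∣ ψ a := hD _ _ (ψ d) hb hd fun k ↦ by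
        rw [← map_pow, ← map_pow, ← map_mul]
        exact map_dvd ψ (ha k)
      obtain ⟨c', hc'⟩ := h1
      obtain ⟨c, rfl⟩ := hψ c'
      obtain ⟨a', ha'⟩ := (hk (a - b * c)).mp (by rw [map_sub, hc', map_mul, sub_self])
      refine ⟨c, a', by rw [← ha']; ring, fun k ↦ ?_⟩
      have h2 : b ^ k ∣ d * (a - b * c) ^ k := by
        rw [sub_eq_add_neg, add_pow, Finset.mul_sum]
        refine Finset.dvd_sum fun i hi ↦ ?_
        have hik : k = i + (k - i) := by
          have := Finset.mem_range.mp hi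
          omega
        have h3 : d * (a ^ i * (-(b * c)) ^ (k - i) * (k.choose i : C))
            = d * a ^ i * (b ^ (k - i) * ((-c) ^ (k - i) * (k.choose i : C))) := by
          rw [neg_mul_eq_mul_neg, mul_pow]; ring
        rw [h3]
        conv_lhs => rw [hik, pow_add]
        exact mul_dvd_mul (ha i) (dvd_mul_right _ _)
      obtain ⟨e, he⟩ := h2
      rw [ha', mul_pow] at he
      obtain ⟨f, hf⟩ := hcop k k e ⟨d * a' ^ k, by rw [← he]; ring⟩
      refine ⟨f, mul_left_cancel₀ (pow_ne_zero k hπ0) ?_⟩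
      rw [hf] at he
      linear_combination he
    choose! c a' hca ha' using step
    let s : ℕ → C := fun j ↦ a'^[j] a
    have hs1 : ∀ j, s (j + 1) = a' (s j) := fun j ↦ Function.iterate_succ_apply' a' j a
    have hs : ∀ j, ∀ k : ℕ, b ^ k ∣ d * s j ^ k := by
      intro j
      induction j with
      | zero => exact hab
      | succ j ih => rw [hs1]; exact ha' _ ih
    have hsum : ∀ j, a = b * (∑ i ∈ Finset.range j, π ^ i * c (s i)) + π ^ j * s j := by
      intro j
      induction j with
      | zero => simp [s]
      | succ j ih =>
        rw [Finset.sum_range_succ, hs1, mul_add, pow_succ]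
        conv_lhs => rw [ih, hca (s j) (hs j)]
        ring
    obtain ⟨σ, hσ⟩ := h.complete fun i ↦ c (s i)
    refine ⟨σ, sub_eq_zero.mp (h.sep _ fun j ↦ ?_)⟩
    have h1 : a - b * σ = π ^ j * s j - b * (σ - ∑ i ∈ Finset.range j, π ^ i * c (s i)) := by
      conv_lhs => rw [hsum j]
      ring
    rw [h1]
    exact dvd_sub (dvd_mul_right _ _) (dvd_mul_of_dvd_right (hσ j) b)
  have main2 : ∀ a b d : C, ψ b ≠ 0 → d ≠ 0 → (∀ k : ℕ, b ^ k ∣ d * a ^ k) → b ∣ a := by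
    intro a b d hb hd hab
    obtain ⟨j, d', rfl, hd'⟩ := h.exists_eq_pow_mul hk hd
    refine main a b d' hb hd' fun k ↦ ?_
    obtain ⟨m, hm⟩ := hab k
    have h1 : π ^ j ∣ m := by
      refine hπ.pow_dvd_of_dvd_mul_left j (fun H ↦ ?_) (b := m) (a := b ^ k)
        ⟨d' * a ^ k, by rw [← hm]; ring⟩
      exact pow_ne_zero k hb (by rw [← map_pow]; exact (hk _).mpr H)
    obtain ⟨f, rfl⟩ := h1
    exact ⟨f, mul_left_cancel₀ (pow_ne_zero j hπ0) (by linear_combination hm)⟩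
  intro a b d hb hd hab
  obtain ⟨i, b', rfl, hb'⟩ := h.exists_eq_pow_mul hk hb
  clear hb
  induction i generalizing a with
  | zero => rw [pow_zero, one_mul] at *; exact main2 a b' d hb' hd (by simpa using hab)
  | succ i ih =>
    -- otherwise `hab (j + 1)` would give `j + 1` factors `π` in `d`, whose order at `π` is `j`
    have h1 : π ∣ a := by
      by_contra ha
      obtain ⟨j, d', rfl, hd'⟩ := h.exists_eq_pow_mul hk hd
      have h2 := hab (j + 1)
      have h3 : π ^ (j + 1) ∣ (d' * a ^ (j + 1)) * π ^ j := by
        refine Dvd.dvd.trans ?_ (h2.trans (dvd_of_eq (by ring)))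
        rw [mul_pow, ← pow_mul]
        exact dvd_mul_of_dvd_left (pow_dvd_pow π (by nlinarith)) _
      rw [pow_succ', mul_dvd_mul_iff_right (pow_ne_zero j hπ0)] at h3
      rcases hπ.dvd_or_dvd h3 with h4 | h4
      · exact hd' ((hk _).mpr h4)
      · exact ha (hπ.dvd_of_dvd_pow h4)
    obtain ⟨a', rfl⟩ := h1
    rw [pow_succ', mul_assoc]
    refine mul_dvd_mul_left π (ih a' fun k ↦ ?_)
    have h2 := hab k
    have h3 : d * (π * a') ^ k = π ^ k * (d * a' ^ k) := by ring
    rw [h3, pow_succ', mul_assoc, mul_pow] at h2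
    exact (mul_dvd_mul_iff_left (pow_ne_zero k hπ0)).mp h2

end IsAdicAlong

/-- The structure theorem behind the matrix ring isomorphism: if `B` is complete along `p`, if `B / p`
is complete along `t`, and if the quotient by `t` is a finite simple ring, then `B` is a matrix ring
over a local completely integrally closed domain (a regular local ring of dimension two). -/
theorem exists_ringEquiv_matrix_of_isSimpleRing {p : ℕ} [Fact p.Prime] {B : Type u} [Ring B]
    (hB : IsAdicAlong (p : B)) {A : Type u} [Ring A] {φ : B →+* A} (hφ : Function.Surjective φ)
    (hφk : ∀ b, φ b = 0 ↔ (p : B) ∣ b) {t : A} (ht : IsAdicAlong t) {Q : Type*} [Ring Q] [Finite Q]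
    [IsSimpleRing Q] {θ : A →+* Q} (hθ : Function.Surjective θ) (hθk : ∀ a, θ a = 0 ↔ t ∣ a) :
    ∃ (N : ℕ) (S : Type u) (_ : CommRing S), 0 < N ∧ IsDomain S ∧ IsLocalRing S ∧
      IsComplIntClosed S ∧ Nonempty (B ≃+* Matrix (Fin N) (Fin N) S) := by
  have : IsArtinianRing Q := inferInstance
  obtain ⟨N, hN, k, _, ⟨f⟩⟩ := IsSimpleRing.exists_ringEquiv_matrix_divisionRing Q
  have : Finite (Matrix (Fin N) (Fin N) k) := Finite.of_equiv Q f.toEquiv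
  have hfin : Finite k := Finite.of_injective (fun x : k ↦ Matrix.single (0 : Fin N) (0 : Fin N) x)
    fun x y hxy ↦ by simpa using congrFun (congrFun hxy 0) 0
  let : Field k := littleWedderburn k
  -- lift the matrix units from `Q` to `A`, and from `A` to `B`
  obtain ⟨C₁, _, t₁, ψ₁, g₁, ht₁, hψ₁, hψ₁k, -, -⟩ := ht.exists_ringEquiv_matrix hθ hθk f
  have hcomm₁ := ht₁.mul_comm_of_finite_field hψ₁ hψ₁k
  let : CommRing C₁ := { (inferInstance : Ring C₁) with mul_comm := hcomm₁ }
  obtain ⟨C, _, ϖ, ψ, g, hϖ, hψ, hψk, -, -⟩ := hB.exists_ringEquiv_matrix hφ hφk g₁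
  have hdom₁ : IsDomain C₁ := ht₁.isDomain hψ₁k
  have hp : (p : C₁) = 0 := by
    have h1 : (p : A) = 0 := by rw [← map_natCast φ]; exact (hφk _).mpr dvd_rfl
    have h2 : (p : Matrix (Fin N) (Fin N) C₁) = 0 := by rw [← map_natCast g₁, h1, map_zero]
    have h3 := congrFun (congrFun h2 0) 0
    rwa [← Matrix.diagonal_natCast, Matrix.diagonal_apply_eq] at h3
  have hchar : CharP C₁ p := (CharP.charP_iff_prime_eq_zero Fact.out).mpr hp
  have hcomm := hϖ.mul_comm_of_quotient hψ hψk ht₁ hψ₁ hψ₁k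
  let : CommRing C := { (inferInstance : Ring C) with mul_comm := hcomm }
  have hdom : IsDomain C := hϖ.isDomain hψk
  have hloc : IsLocalHom (ψ₁.comp ψ) := ⟨fun a ha ↦
    hϖ.isUnit_of_map hψ hψk (ht₁.isUnit_of_map hψ₁ hψ₁k ha)⟩
  exact ⟨N, C, inferInstance, Nat.pos_of_ne_zero hN.ne, hdom, RingHom.domain_isLocalRing (ψ₁.comp ψ),
    hϖ.isComplIntClosed hψ hψk (ht₁.isComplIntClosed hψ₁ hψ₁k (.of_field k)), ⟨g⟩⟩

/-! ### Automorphisms of finite semisimple rings -/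

/-- The Skolem–Noether theorem for a matrix ring over a finite field. -/
theorem exists_unit_conj_matrix {k : Type*} [Field k] [Finite k] {m : ℕ} [NeZero m]
    (f : Matrix (Fin m) (Fin m) k →ₐ[k] Matrix (Fin m) (Fin m) k) :
    ∃ u : (Matrix (Fin m) (Fin m) k)ˣ, ∀ x, f x = u.1 * x * u⁻¹.1 := by
  have hf : Function.Bijective f := Finite.injective_iff_bijective.mp (RingHom.injective f.toRingHom)
  let E := (Matrix.toLinAlgEquiv' (R := k) (n := Fin m))
  obtain ⟨T, hT⟩ := ((E.symm.trans (AlgEquiv.ofBijective f hf)).trans E).eq_linearEquivConjAlgEquiv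
  have h1 : T.toLinearMap * T.symm.toLinearMap = 1 := by ext; simp
  have h2 : T.symm.toLinearMap * T.toLinearMap = 1 := by ext; simp
  refine ⟨⟨E.symm T.toLinearMap, E.symm T.symm.toLinearMap, by rw [← map_mul, h1, map_one],
    by rw [← map_mul, h2, map_one]⟩, fun x ↦ E.injective ?_⟩
  have h3 := DFunLike.congr_fun hT (E x)
  simp only [AlgEquiv.trans_apply, AlgEquiv.symm_apply_apply] at h3
  change E (f x) = _ at h3
  rw [h3]
  change _ = E (E.symm T.toLinearMap * x * E.symm T.symm.toLinearMap)
  rw [map_mul, map_mul, E.apply_symm_apply, E.apply_symm_apply]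
  rfl

/-- The Skolem–Noether theorem for a finite semisimple ring: an automorphism which is trivial on the
centre is inner. -/
theorem IsSemisimpleRing.exists_unit_conj {R : Type u} [Ring R] [Finite R] [IsSemisimpleRing R]
    (σ : R ≃+* R) (hσ : ∀ z ∈ Subring.center R, σ z = z) :
    ∃ c : Rˣ, ∀ r, σ r = c * r * ↑c⁻¹ := by
  -- the Wedderburn decomposition, with finite division rings, which are fields
  obtain ⟨N, D, d, _, hd, ⟨f⟩⟩ := IsSemisimpleRing.exists_ringEquiv_pi_matrix_divisionRing R
  classical
  have hfin : ∀ i, Finite (D i) := fun i ↦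
    have : Finite (∀ i, Matrix (Fin (d i)) (Fin (d i)) (D i)) := Finite.of_equiv R f.toEquiv
    Finite.of_injective (fun x : D i ↦ f.symm (Pi.single i (Matrix.single 0 0 x))) fun x y hxy ↦ by
      have := Pi.single_injective i (f.symm.injective hxy)
      simpa using congrFun (congrFun this 0) 0
  let _ : ∀ i, Field (D i) := fun i ↦ littleWedderburn (D i)
  let τ : (∀ i, Matrix (Fin (d i)) (Fin (d i)) (D i)) ≃+* _ := (f.symm.trans σ).trans f
  have hτ : ∀ z, (∀ y, y * z = z * y) → τ z = z := by
    intro z hz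
    have h1 : f.symm z ∈ Subring.center R := Subring.mem_center_iff.mpr fun g ↦ f.injective (by
      rw [map_mul, map_mul, f.apply_symm_apply, hz])
    change f (σ (f.symm z)) = z
    rw [hσ _ h1, f.apply_symm_apply]
  have hscal : ∀ i (a : D i), τ (Pi.single i (algebraMap (D i) _ a)) =
      Pi.single i (algebraMap (D i) _ a) := by
    intro i a
    refine hτ _ fun y ↦ ?_
    ext j : 1
    rcases eq_or_ne j i with rfl | hj
    · simp only [Pi.mul_apply, Pi.single_eq_same]
      exact (Algebra.commutes _ _).symm
    · simp [Pi.single_eq_of_ne hj]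
  -- fixing the central idempotents, the automorphism acts on each matrix factor separately
  have hloc : ∀ x i, τ x i = τ (Pi.single i (x i)) i := by
    intro x i
    have h1 : (Pi.single i (x i) : ∀ i, Matrix (Fin (d i)) (Fin (d i)) (D i))
        = x * Pi.single i (algebraMap (D i) _ 1) := by
      rw [← Pi.single_mul_right, map_one, mul_one]
    rw [h1, map_mul, hscal, map_one, Pi.mul_apply, Pi.single_eq_same, mul_one]
  let τ' : ∀ i, Matrix (Fin (d i)) (Fin (d i)) (D i) →ₐ[D i] Matrix (Fin (d i)) (Fin (d i)) (D i) :=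
    fun i ↦
    { toFun := fun x ↦ τ (Pi.single i x) i
      map_one' := by
        have := hscal i 1
        rw [map_one] at this
        rw [this, Pi.single_eq_same]
      map_zero' := by rw [Pi.single_zero, map_zero]; rfl
      map_add' := fun x y ↦ by rw [Pi.single_add, map_add]; rfl
      map_mul' := fun x y ↦ by rw [Pi.single_mul, map_mul]; rfl
      commutes' := fun a ↦ by rw [hscal, Pi.single_eq_same] }
  choose u hu using fun i ↦ exists_unit_conj_matrix (τ' i)
  refine ⟨⟨f.symm fun i ↦ u i, f.symm fun i ↦ ↑(u i)⁻¹, ?_, ?_⟩, fun r ↦ f.injective ?_⟩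
  · rw [← map_mul, ← map_one f.symm]
    congr 1
    ext i : 1
    exact (u i).mul_inv
  · rw [← map_mul, ← map_one f.symm]
    congr 1
    ext i : 1
    exact (u i).inv_mul
  · rw [Units.inv_mk, map_mul, map_mul, f.apply_symm_apply, f.apply_symm_apply]
    have h1 : f (σ r) = τ (f r) := by
      change _ = f (σ (f.symm (f r)))
      rw [f.symm_apply_apply]
    rw [h1]
    ext i : 1
    rw [hloc]
    exact hu i (f r i)

namespace IsAdicAlong

/-- Completeness along `π` carries over to any central element a power of which is a unit times
`π`. -/
theorem of_pow_eq_mul {A : Type*} [Ring A] {π : A} (h : IsAdicAlong π) {t : A}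
    (ht : ∀ a, t * a = a * t) {m : ℕ} (hm : 0 < m) {v : Aˣ} (htv : t ^ m = π * v) :
    IsAdicAlong t := by
  have hpow : ∀ k, ∀ a, t ^ k * a = a * t ^ k := fun k a ↦ (Commute.pow_left (ht a) k).eq
  have hv : Commute π (v : A) := h.comm _
  have hpow' : ∀ k, t ^ (m * k) = π ^ k * ↑(v ^ k) := fun k ↦ by
    rw [pow_mul, htv, hv.mul_pow, Units.val_pow_eq_pow_val]
  -- the filtrations by powers of `t` and of `π` are cofinal
  have hdvd : ∀ k a, t ^ (m * k) ∣ a ↔ π ^ k ∣ a := by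
    intro k a
    rw [hpow']
    constructor
    · exact fun H ↦ (dvd_mul_right _ _).trans H
    · rintro ⟨c, rfl⟩
      exact ⟨↑(v ^ k)⁻¹ * c, by rw [mul_assoc, Units.mul_inv_cancel_left]⟩
  refine ⟨ht, fun a ha ↦ ?_, fun a ha ↦ h.sep a fun k ↦ (hdvd k a).mp (ha _), fun a ↦ ?_⟩
  · have h1 : t ^ m * a = 0 := by
      rw [← Nat.succ_pred_eq_of_pos hm, pow_succ, mul_assoc, ha, mul_zero]
    rw [htv, mul_assoc] at h1
    exact (Units.mul_right_eq_zero v).mp (h.regular _ h1)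
  · obtain ⟨s, hs⟩ := h.exists_limit (fun k ↦ ∑ i ∈ Finset.range (m * k), t ^ i * a i) fun k ↦ by
      rw [← hdvd, Nat.mul_succ, Finset.sum_range_add, add_sub_cancel_left]
      refine Finset.dvd_sum fun i _ ↦ ?_
      rw [pow_add, mul_assoc]
      exact dvd_mul_right _ _
    refine ⟨s, fun k ↦ ?_⟩
    have h1 : t ^ k ∣ s - ∑ i ∈ Finset.range (m * k), t ^ i * a i :=
      (pow_dvd_pow t (Nat.le_mul_of_pos_left k hm)).trans ((hdvd k _).mpr (hs k))
    obtain ⟨j, hj⟩ := Nat.exists_eq_add_of_le (Nat.le_mul_of_pos_left k hm)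
    have h2 : s - ∑ i ∈ Finset.range k, t ^ i * a i
        = (s - ∑ i ∈ Finset.range (m * k), t ^ i * a i)
          + ∑ i ∈ Finset.range j, t ^ (k + i) * a (k + i) := by
      rw [hj, Finset.sum_range_add]; abel
    rw [h2]
    refine dvd_add h1 (Finset.dvd_sum fun i _ ↦ ?_)
    rw [pow_add, mul_assoc]
    exact dvd_mul_right _ _

end IsAdicAlong

/-! ### Twisted extensions of a ring without stable ideals -/

/-- The quotient of a ring by the two-sided ideal generated by a central element. -/
theorem exists_quotient_of_central {A : Type u} [Ring A] {t : A} (ht : ∀ a, t * a = a * t) :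
    ∃ (Q : Type u) (_ : Ring Q) (θ : A →+* Q), Function.Surjective θ ∧ ∀ a, θ a = 0 ↔ t ∣ a := by
  have : (Ideal.span {t}).IsTwoSided := ⟨fun {a} b ha ↦ by
    obtain ⟨c, rfl⟩ := Ideal.mem_span_singleton'.mp ha
    exact Ideal.mem_span_singleton'.mpr ⟨c * b, by rw [mul_assoc, mul_assoc, ht]⟩⟩
  refine ⟨A ⧸ Ideal.span {t}, inferInstance, Ideal.Quotient.mk _, Ideal.Quotient.mk_surjective,
    fun a ↦ ?_⟩
  rw [Ideal.Quotient.eq_zero_iff_mem, Ideal.mem_span_singleton']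
  exact exists_congr fun b ↦ by rw [ht, eq_comm]

section Twisted

variable {R : Type*} [Ring R] {Q : Type*} [Ring Q] {ι : R →+* Q} {g : Q} {τ : RingAut R}

theorem pow_mul_map_of_twist (hτ : ∀ r, g * ι r = ι (τ r) * g) (l : ℕ) (r : R) :
    g ^ l * ι r = ι ((τ ^ l) r) * g ^ l := by
  induction l generalizing r with
  | zero => simp
  | succ l ih => rw [pow_succ, mul_assoc, hτ, ← mul_assoc, ih, mul_assoc, pow_succ]; rfl

/-- Let `Q` be generated by the image of `R` and a unit `g` normalising it. If `R` has no
`g`-stable ideals and the powers of `g` occurring in `Q` act differently on the centre of `R`, then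
`Q` is simple: every element of an ideal can be reduced to one with a single nonzero coefficient by
applying suitable combinations of the operators `q ↦ qz - τʲ(z)q`, for central `z`. -/
theorem isSimpleRing_of_twist [Nontrivial Q] (hτ : ∀ r, g * ι r = ι (τ r) * g) (hg : IsUnit g)
    (hR : ∀ I : TwoSidedIdeal R, (∀ r ∈ I, τ r ∈ I) → I = ⊥ ∨ I = ⊤) {w : ℕ}
    (hw : ∀ i < w, ∀ j < w, i ≠ j → ∃ z ∈ Subring.center R, (τ ^ i) z ≠ (τ ^ j) z)
    (hspan : ∀ b : Q, ∃ r : ℕ → R, b = ∑ i ∈ Finset.range w, ι (r i) * g ^ i) :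
    IsSimpleRing Q := by
  classical
  refine .of_eq_bot_or_eq_top fun I ↦ or_iff_not_imp_left.mpr fun hI ↦ ?_
  have hpow := pow_mul_map_of_twist hτ
  have hcen : ∀ (l : ℕ) {z : R}, z ∈ Subring.center R → ∀ r, r * (τ ^ l) z = (τ ^ l) z * r := by
    intro l z hz r
    obtain ⟨s, rfl⟩ := (τ ^ l).surjective r
    rw [← map_mul, ← map_mul, Subring.mem_center_iff.mp hz]
  -- an operator preserving `I`, killing the coefficient at `j` and keeping the one at `i`
  have hkill : ∀ i < w, ∀ j < w, i ≠ j → ∃ (F : Q →+ Q) (φ : ℕ → R → R), (∀ a ∈ I, F a ∈ I) ∧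
      (∀ l r, F (ι r * g ^ l) = ι (φ l r) * g ^ l) ∧ (∀ l, φ l 0 = 0) ∧ (∀ r, φ j r = 0) ∧
      ∀ r, φ i r = r := by
    intro i hi j hj hij
    -- the ideal of the differences `τⁱ(z) - τʲ(z)` for central `z` is stable, hence contains `1`
    let J : TwoSidedIdeal R := TwoSidedIdeal.span {x | ∃ z ∈ Subring.center R,
      x = (τ ^ i) z - (τ ^ j) z}
    have hJ : J = ⊤ := by
      refine (hR J fun r hr ↦ ?_).resolve_left fun hbot ↦ ?_
      · have h1 : J ≤ J.comap (τ : R →+* R) := by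
          refine TwoSidedIdeal.span_le.mpr ?_
          rintro _ ⟨z, hz, rfl⟩
          refine (TwoSidedIdeal.mem_comap _).mpr (TwoSidedIdeal.subset_span ⟨τ z, ?_, ?_⟩)
          · refine Subring.mem_center_iff.mpr fun r ↦ ?_
            simpa using hcen 1 hz r
          · change τ ((τ ^ i) z - (τ ^ j) z) = _
            rw [map_sub]
            simp only [← RingAut.mul_apply, ← pow_succ, ← pow_succ']
        exact (TwoSidedIdeal.mem_comap _).mp (h1 hr)
      · obtain ⟨z, hz, hne⟩ := hw i hi j hj hij
        have h1 : (τ ^ i) z - (τ ^ j) z ∈ J := TwoSidedIdeal.subset_span ⟨z, hz, rfl⟩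
        rw [hbot, TwoSidedIdeal.mem_bot] at h1
        exact hne (sub_eq_zero.mp h1)
    have h1 : (1 : R) ∈ J := by rw [hJ]; trivial
    suffices H : ∀ u ∈ J, ∃ (F : Q →+ Q) (φ : ℕ → R → R), (∀ a ∈ I, F a ∈ I) ∧
        (∀ l r, F (ι r * g ^ l) = ι (φ l r) * g ^ l) ∧ (∀ l, φ l 0 = 0) ∧ (∀ r, φ j r = 0) ∧
        ∀ r, φ i r = u * r by
      obtain ⟨F, φ, h2, h3, h4, h5, h6⟩ := H 1 h1
      exact ⟨F, φ, h2, h3, h4, h5, fun r ↦ by rw [h6, one_mul]⟩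
    intro u hu
    rw [TwoSidedIdeal.mem_span_iff_mem_addSubgroup_closure] at hu
    induction hu using AddSubgroup.closure_induction with
    | mem u hu =>
      obtain ⟨_, ⟨a, -, _, ⟨z, hz, rfl⟩, rfl⟩, b, -, rfl⟩ := hu
      refine ⟨(AddMonoidHom.mulLeft (ι (a * b))).comp
        (AddMonoidHom.mulRight (ι z) - AddMonoidHom.mulLeft (ι ((τ ^ j) z))),
        fun l r ↦ a * b * (r * (τ ^ l) z - (τ ^ j) z * r), fun q hq ↦ ?_, fun l r ↦ ?_, fun l ↦ ?_,
        fun r ↦ ?_, fun r ↦ ?_⟩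
      · exact I.mul_mem_left _ _ (sub_mem (I.mul_mem_right _ _ hq) (I.mul_mem_left _ _ hq))
      · change ι (a * b) * (ι r * g ^ l * ι z - ι ((τ ^ j) z) * (ι r * g ^ l)) = _
        rw [mul_assoc (ι r), hpow]
        simp only [map_mul, map_sub, mul_sub, sub_mul, mul_assoc]
      · simp
      · simp only [hcen j hz, sub_self, mul_zero]
      · have e1 : a * ((τ ^ i) z - (τ ^ j) z) * b * r = a * (((τ ^ i) z - (τ ^ j) z) * (b * r)) := by
          simp only [mul_assoc]
        have e2 : ((τ ^ i) z - (τ ^ j) z) * (b * r) = (b * r) * ((τ ^ i) z - (τ ^ j) z) := by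
          rw [sub_mul, mul_sub, hcen i hz, hcen j hz]
        change a * b * (r * (τ ^ i) z - (τ ^ j) z * r) = a * ((τ ^ i) z - (τ ^ j) z) * b * r
        rw [e1, e2, ← hcen j hz]
        simp only [mul_sub, mul_assoc]
    | zero => exact ⟨0, fun _ _ ↦ 0, by simp, by simp, by simp, by simp, by simp⟩
    | add x y _ _ hx hy =>
      obtain ⟨F, φ, h2, h3, h4, h5, h6⟩ := hx
      obtain ⟨F', φ', h2', h3', h4', h5', h6'⟩ := hy
      refine ⟨F + F', fun l r ↦ φ l r + φ' l r, fun a ha ↦ add_mem (h2 a ha) (h2' a ha),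
        fun l r ↦ ?_, fun l ↦ ?_, fun r ↦ ?_, fun r ↦ ?_⟩
      · rw [AddMonoidHom.add_apply, h3, h3', map_add, add_mul]
      · simp only [h4, h4', add_zero]
      · simp only [h5, h5', add_zero]
      · simp only [h6, h6', add_mul]
    | neg x _ hx =>
      obtain ⟨F, φ, h2, h3, h4, h5, h6⟩ := hx
      refine ⟨-F, fun l r ↦ - φ l r, fun a ha ↦ neg_mem (h2 a ha), fun l r ↦ ?_, fun l ↦ ?_,
        fun r ↦ ?_, fun r ↦ ?_⟩
      · rw [AddMonoidHom.neg_apply, h3, map_neg, neg_mul]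
      · simp only [h4, neg_zero]
      · simp only [h5, neg_zero]
      · simp only [h6, neg_mul]
  obtain ⟨a, haI, ha0⟩ : ∃ a ∈ I, a ≠ 0 := by
    by_contra! H
    exact hI (le_bot_iff.mp fun a ha ↦ (TwoSidedIdeal.mem_bot _).mpr (H a ha))
  obtain ⟨r, hr⟩ := hspan a
  obtain ⟨i, hi, hri⟩ : ∃ i ∈ Finset.range w, ι (r i) ≠ 0 := by
    by_contra! H
    exact ha0 (hr.trans (Finset.sum_eq_zero fun i hi ↦ by rw [H i hi, zero_mul]))
  -- remove all coefficients of an element of `I` but the one at `i`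
  have hred : ∀ s ⊆ (Finset.range w).erase i, ∃ r' : ℕ → R,
      ∑ l ∈ Finset.range w, ι (r' l) * g ^ l ∈ I ∧ r' i = r i ∧ ∀ l ∈ s, r' l = 0 := by
    intro s
    induction s using Finset.induction_on with
    | empty => exact fun _ ↦ ⟨r, hr ▸ haI, rfl, by simp⟩
    | insert j s _ ih =>
      intro hs
      obtain ⟨r', h1, h2, h3⟩ := ih ((Finset.subset_insert j s).trans hs)
      obtain ⟨hji, hjw⟩ := Finset.mem_erase.mp (hs (Finset.mem_insert_self j s))
      obtain ⟨F, φ, h4, h5, h6, h7, h8⟩ := hkill i (Finset.mem_range.mp hi) j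
        (Finset.mem_range.mp hjw) hji.symm
      refine ⟨fun l ↦ φ l (r' l), ?_, ?_, fun l hl ↦ ?_⟩
      · have := h4 _ h1
        simpa only [map_sum, h5] using this
      · simp only [h8, h2]
      · rcases Finset.mem_insert.mp hl with rfl | hl
        · exact h7 _
        · simp only [h3 l hl, h6]
  obtain ⟨r', h1, h2, h3⟩ := hred _ subset_rfl
  rw [Finset.sum_eq_single_of_mem i hi fun l hl hli ↦ by
    rw [h3 l (Finset.mem_erase.mpr ⟨hli, hl⟩), map_zero, zero_mul], h2] at h1
  obtain ⟨v, rfl⟩ := hg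
  have h4 : ι (r i) ∈ I := by
    have := I.mul_mem_right _ (↑(v ^ i)⁻¹) h1
    rwa [mul_assoc, ← Units.val_pow_eq_pow_val, Units.mul_inv, mul_one] at this
  -- the contraction of `I` to `R` is stable and nonzero
  have h5 : I.comap ι = ⊤ := by
    refine (hR _ fun r hr ↦ ?_).resolve_left fun hbot ↦ ?_
    · rw [TwoSidedIdeal.mem_comap] at hr ⊢
      have h6 : ι (τ r) = v * ι r * ↑v⁻¹ := by
        rw [hτ, mul_assoc, Units.mul_inv, mul_one]
      rw [h6]
      exact I.mul_mem_right _ _ (I.mul_mem_left _ _ hr)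
    · have h6 : r i ∈ I.comap ι := (TwoSidedIdeal.mem_comap _).mpr h4
      rw [hbot, TwoSidedIdeal.mem_bot] at h6
      exact hri (by rw [h6, map_zero])
  have h6 : (1 : R) ∈ I.comap ι := by rw [h5]; trivial
  rw [TwoSidedIdeal.mem_comap, map_one] at h6
  exact I.one_mem_iff.mp h6

end Twisted

/-- In a finite commutative reduced ring of characteristic `p` the number of units is prime to `p`. -/
theorem not_dvd_card_units_of_isReduced {p : ℕ} [Fact p.Prime] {Z : Type*} [CommRing Z] [Finite Z]
    [IsReduced Z] [CharP Z p] : ¬ p ∣ Nat.card Zˣ := by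
  intro hp
  obtain ⟨x, hx⟩ := exists_prime_orderOf_dvd_card' p hp
  have h1 : ((x : Z) - 1) ^ p = 0 := by
    rw [sub_pow_char, one_pow, ← Units.val_pow_eq_pow_val, ← hx, pow_orderOf_eq_one, Units.val_one,
      sub_self]
  have h2 : x = 1 := Units.ext (sub_eq_zero.mp (eq_zero_of_pow_eq_zero h1))
  rw [h2, orderOf_one] at hx
  exact (Fact.out : p.Prime).one_lt.ne hx

/-- A central nilpotent element of a semisimple ring vanishes. -/
theorem IsSemisimpleRing.isReduced_center {R : Type*} [Ring R] [IsSemisimpleRing R] :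
    IsReduced (Subring.center R) := by
  refine ⟨fun z ⟨k, hk⟩ ↦ Subtype.ext ?_⟩
  have hz : ∀ a, a * (z : R) = z * a := Subring.mem_center_iff.mp z.2
  have hzk : (z : R) ^ k = 0 := by rw [← Subring.coe_pow, hk]; rfl
  obtain ⟨e, he, hze⟩ := IsSemisimpleRing.ideal_eq_span_idempotent (Ideal.span {(z : R)})
  obtain ⟨r, hr⟩ := Ideal.mem_span_singleton'.mp (hze ▸ Ideal.mem_span_singleton_self e)
  obtain ⟨a, ha⟩ := Ideal.mem_span_singleton'.mp (hze.symm ▸ Ideal.mem_span_singleton_self (z : R))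
  have he0 : e = 0 := by
    rcases Nat.eq_zero_or_pos k with rfl | hk0
    · rw [pow_zero] at hzk
      rw [← mul_one e, hzk, mul_zero]
    · rw [← he.pow_eq hk0.ne', ← hr, (show Commute r z from hz r).mul_pow, hzk, mul_zero]
  rw [← ha, he0, mul_zero]
  rfl

/-- Let `A` be complete along `T = g ^ (p ^ n) - 1`, and generated by `g` and a finite ring `R`
without `g`-stable ideals. By the Skolem–Noether theorem a power `g ^ w` acts on `R` as an element of
`R` does; comparing the two produces a central element `y` of `A` with
`y ^ (p ^ s) = g ^ (p ^ n * M)` for some `M` prime to `p`. Thus `y - 1` is a `p ^ s`-th root of `T`, up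
to a unit, and `A / (y - 1)` is finite and simple. -/
theorem exists_isAdicAlong_isSimpleRing {p : ℕ} [Fact p.Prime] {A : Type u} [Ring A] [CharP A p]
    {R : Type u} [Ring R] [Finite R] (ι : R →+* A) (g : Aˣ) (τ : RingAut R)
    (hτ : ∀ r, g * ι r = ι (τ r) * g)
    (hR : ∀ I : TwoSidedIdeal R, (∀ r ∈ I, τ r ∈ I) → I = ⊥ ∨ I = ⊤) {n : ℕ}
    (hT : IsAdicAlong ((g : A) ^ p ^ n - 1))
    (hspan : ∀ b : A, ∃ (r : ℕ → R) (b' : A),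
      b = ∑ i ∈ Finset.range (p ^ n), ι (r i) * (g : A) ^ i + ((g : A) ^ p ^ n - 1) * b') :
    ∃ (t : A) (Q : Type u) (_ : Ring Q) (θ : A →+* Q), IsAdicAlong t ∧ Finite Q ∧ IsSimpleRing Q ∧
      Function.Surjective θ ∧ ∀ a, θ a = 0 ↔ t ∣ a := by
  have hpp : p.Prime := Fact.out
  have : Nontrivial A := CharP.nontrivial_of_char_ne_one hpp.ne_one
  have hp0 : (p : A) = 0 := CharP.cast_eq_zero A p
  set T : A := (g : A) ^ p ^ n - 1 with hTdef
  have hpow := pow_mul_map_of_twist hτ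
  have hgq : ∀ a : A, (g : A) ^ p ^ n * a = a * (g : A) ^ p ^ n := fun a ↦ by
    have := hT.comm a
    rw [hTdef, sub_mul, mul_sub, one_mul, mul_one] at this
    exact sub_left_injective this
  have hι : Function.Injective ι := by
    rw [injective_iff_map_eq_zero]
    intro r hr
    have h1 : TwoSidedIdeal.ker ι = ⊥ := by
      refine (hR _ fun r hr ↦ ?_).resolve_right fun htop ↦ ?_
      · rw [TwoSidedIdeal.mem_ker] at hr ⊢
        have := hτ r
        rw [hr, mul_zero] at this
        exact (Units.mul_left_eq_zero g).mp this.symm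
      · have h2 : (1 : R) ∈ TwoSidedIdeal.ker ι := by rw [htop]; trivial
        rw [TwoSidedIdeal.mem_ker, map_one] at h2
        exact one_ne_zero h2
    have h2 : r ∈ TwoSidedIdeal.ker ι := (TwoSidedIdeal.mem_ker _).mpr hr
    rwa [h1, TwoSidedIdeal.mem_bot] at h2
  have : Nontrivial R := ι.domain_nontrivial
  have hRp : (p : R) = 0 := hι (by rw [map_natCast, hp0, map_zero])
  have hss : IsSemisimpleRing R := by
    rw [IsArtinianRing.isSemisimpleRing_iff_jacobson]
    have h1 := hR (Ring.jacobson R).toTwoSided fun r hr ↦ by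
      rw [Ideal.mem_toTwoSided] at hr ⊢
      have : RingHomSurjective (τ : R →+* R) := ⟨τ.surjective⟩
      exact Ring.le_comap_jacobson (τ : R →+* R) hr
    rcases h1 with h1 | h1
    · rw [← Ideal.asIdeal_toTwoSided (Ring.jacobson R), h1, TwoSidedIdeal.bot_asIdeal]
    · have h2 : Ring.jacobson R = ⊤ := by
        rw [← Ideal.asIdeal_toTwoSided (Ring.jacobson R), h1, TwoSidedIdeal.top_asIdeal]
      exact absurd h2 (Ring.jacobson_lt_top R).ne
  let Z := Subring.center R
  have hcharZ : CharP Z p := (CharP.charP_iff_prime_eq_zero hpp).mpr (Subtype.ext (by simpa using hRp))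
  have : IsReduced Z := IsSemisimpleRing.isReduced_center
  let M := Nat.card Zˣ
  have hpM : ¬ p ∣ M := not_dvd_card_units_of_isReduced
  -- the centre is a finite reduced ring of characteristic `p`; raising to the power `M` kills its units
  have hM : ∀ u : Rˣ, (∀ r : R, r * u = u * r) → u ^ M = 1 := by
    intro u hu
    have hu' : ∀ r : R, r * ↑u⁻¹ = ↑u⁻¹ * r := fun r ↦
      (Commute.units_inv_right (show Commute r u from hu r)).eq
    let v : Zˣ := ⟨⟨u, Subring.mem_center_iff.mpr hu⟩, ⟨↑u⁻¹, Subring.mem_center_iff.mpr hu'⟩,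
      Subtype.ext u.mul_inv, Subtype.ext u.inv_mul⟩
    have h1 : v ^ M = 1 := pow_card_eq_one'
    exact Units.ext (congrArg (fun x : Zˣ ↦ ((x : Z) : R)) h1)
  -- the order `w` of the action of `g` on the centre of `R`
  let σ : RingAut Z := Subring.centerCongr τ
  have hσ : ∀ (i : ℕ) (z : Z), (((σ ^ i) z : Z) : R) = (τ ^ i) (z : R) := by
    intro i
    induction i with
    | zero => intro z; rfl
    | succ i ih => intro z; rw [pow_succ, pow_succ]; exact ih (σ z)
  have hσq : σ ^ p ^ n = 1 := by
    ext z
    rw [hσ]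
    refine hι ?_
    have h1 := hpow (p ^ n) (z : R)
    rw [hgq] at h1
    exact ((g ^ p ^ n).mul_left_inj.mp (by simpa using h1)).symm
  obtain ⟨a, ha, hwa⟩ := (Nat.dvd_prime_pow hpp).mp (orderOf_dvd_of_pow_eq_one hσq)
  let w := orderOf σ
  let s := n - a
  have hws : p ^ n = w * p ^ s := by
    change p ^ n = orderOf σ * p ^ (n - a)
    rw [hwa, ← pow_add, Nat.add_sub_cancel' ha]
  have hw0 : 0 < w := Nat.pos_of_ne_zero fun h0 ↦ by simp [h0, hpp.ne_zero] at hws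
  have hwne : ∀ i < w, ∀ j < w, i ≠ j → ∃ z ∈ Subring.center R, (τ ^ i) z ≠ (τ ^ j) z := by
    intro i hi j hj hij
    by_contra! H
    refine hij (pow_injOn_Iio_orderOf hi hj (RingEquiv.ext fun z ↦ Subtype.ext ?_))
    rw [hσ, hσ, H z z.2]
  -- `τ ^ w` is trivial on the centre, hence conjugation by some `c`; then `z = c⁻¹ g ^ w`
  -- centralises `R`
  obtain ⟨c, hc⟩ := IsSemisimpleRing.exists_unit_conj (τ ^ w) fun z hz ↦ by
    rw [← hσ w ⟨z, hz⟩, pow_orderOf_eq_one]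
    rfl
  let ιu : Rˣ →* Aˣ := Units.map (ι : R →* A)
  have hιu : ∀ x : Rˣ, ((ιu x : Aˣ) : A) = ι x := fun x ↦ rfl
  let z : Aˣ := (ιu c)⁻¹ * g ^ w
  have hgw : g ^ w = ιu c * z := by simp [z]
  have hzR : ∀ r : R, (z : A) * ι r = ι r * z := by
    intro r
    have h1 := hpow w r
    have h2 : ((g : A)) ^ w = ι c * z := by
      have := congrArg Units.val hgw
      simpa [hιu] using this
    rw [hc, h2, map_mul, map_mul] at h1
    have h3 : ι (↑c⁻¹ : R) * ι c = 1 := by rw [← map_mul, Units.inv_mul, map_one]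
    have h4 : ι c * (z * ι r) = ι c * (ι r * z) := by
      rw [← mul_assoc, h1]
      simp only [mul_assoc]
      rw [← mul_assoc (ι _) (ι _) (z : A), h3, one_mul]
    exact (c.isUnit.map ι).mul_left_cancel h4
  -- `κ` measures the failure of `g` and `z` to commute; it is a central unit of `R`
  let κ : Rˣ := (Units.map (τ : R →* R) c)⁻¹ * c
  have hgz : g * z = ιu κ * z * g := by
    have h1 : g * ιu c = ιu (Units.map (τ : R →* R) c) * g := Units.ext (hτ c)
    have h2 : g * (ιu c)⁻¹ = (ιu (Units.map (τ : R →* R) c))⁻¹ * g := by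
      rw [mul_inv_eq_iff_eq_mul, mul_assoc, h1, inv_mul_cancel_left]
    simp only [κ, z, map_mul, map_inv]
    rw [← mul_assoc, h2]
    simp only [mul_assoc, mul_inv_cancel_left, ← pow_succ, ← pow_succ']
  have hκ : ∀ r : R, r * κ = κ * r := by
    intro r
    refine hι ?_
    obtain ⟨r', rfl⟩ := τ.surjective r
    have h1 : (g : A) * z = ι κ * z * g := congrArg Units.val hgz
    have h2 : ι (τ r') * ι κ * (z * g) = ι κ * ι (τ r') * (z * g) := by
      calc ι (τ r') * ι κ * (z * g) = ι (τ r') * (ι κ * z * g) := by simp only [mul_assoc]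
        _ = ι (τ r') * (g * z) := by rw [h1]
        _ = g * (z * ι r') := by rw [← mul_assoc, ← hτ, mul_assoc, hzR]
        _ = ι κ * z * g * ι r' := by rw [← mul_assoc, h1]
        _ = ι κ * (z * ι (τ r')) * g := by rw [mul_assoc _ (g : A), hτ]; simp only [mul_assoc]
        _ = ι κ * ι (τ r') * (z * g) := by rw [hzR]; simp only [mul_assoc]
    rw [map_mul, map_mul]
    exact ((z * g).mul_left_inj).mp (by simpa using h2)
  let y : Aˣ := z ^ M
  have hyR : ∀ r : R, (y : A) * ι r = ι r * y := fun r ↦ by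
    rw [Units.val_pow_eq_pow_val]
    exact (Commute.pow_left (hzR r) M).eq
  have hyg : g * y = y * g := by
    have h1 : ∀ m : ℕ, g * z ^ m = (ιu κ * z) ^ m * g := by
      intro m
      induction m with
      | zero => simp
      | succ m ih => rw [pow_succ, ← mul_assoc, ih, mul_assoc, hgz, ← mul_assoc, ← pow_succ]
    have h2 : Commute (ιu κ) z := Units.ext (hzR κ).symm
    rw [h1, h2.mul_pow, ← map_pow, hM κ hκ, map_one, one_mul]
  -- `y` commutes with `R` and `g`, which generate `A` topologically
  have hy : ∀ b : A, (y : A) * b = b * y := by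
    have hyg' : Commute (y : A) (g : A) := by
      exact congrArg Units.val hyg.symm
    intro b
    refine sub_eq_zero.mp (hT.sep _ fun k ↦ ?_)
    induction k generalizing b with
    | zero => simp
    | succ k ih =>
      obtain ⟨r, b', hb⟩ := hspan b
      have h1 : (y : A) * ∑ i ∈ Finset.range (p ^ n), ι (r i) * (g : A) ^ i
          = (∑ i ∈ Finset.range (p ^ n), ι (r i) * (g : A) ^ i) * y := by
        rw [Finset.mul_sum, Finset.sum_mul]
        refine Finset.sum_congr rfl fun i _ ↦ ?_
        rw [← mul_assoc, hyR, mul_assoc, (hyg'.pow_right i).eq, mul_assoc]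
      have h2 : (y : A) * b - b * y = T * (y * b' - b' * y) := by
        rw [hb, mul_add, add_mul, h1, ← mul_assoc, ← hT.comm, mul_sub]
        simp only [mul_assoc]
        abel
      rw [h2, pow_succ']
      exact mul_dvd_mul_left T (ih b')
  -- the `p ^ s`-th power of `y`
  have hcz : Commute (ιu c) z := Units.ext (hzR c).symm
  have hgq' : g ^ p ^ n = ιu (c ^ p ^ s) * z ^ p ^ s := by
    rw [hws, pow_mul, hgw, hcz.mul_pow, map_pow]
  have hcs : ∀ r : R, r * ↑(c ^ p ^ s) = ↑(c ^ p ^ s) * r := by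
    intro r
    have h1 : ιu (c ^ p ^ s) = g ^ p ^ n * (z ^ p ^ s)⁻¹ := by rw [hgq', mul_inv_cancel_right]
    have h2 : Commute (ι r) ((ιu (c ^ p ^ s) : Aˣ) : A) := by
      rw [h1, Units.val_mul]
      refine Commute.mul_right ?_ ?_
      · rw [Units.val_pow_eq_pow_val]
        exact (hgq _).symm
      · refine Commute.units_inv_right ?_
        rw [Units.val_pow_eq_pow_val]
        exact (Commute.pow_right (hzR r).symm _)
    exact hι (by simpa [hιu] using h2.eq)
  have hyps : y ^ p ^ s = (g ^ p ^ n) ^ M := by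
    have h1 : Commute (ιu (c ^ p ^ s)) (z ^ p ^ s) := by
      rw [map_pow]
      exact (hcz.pow_left _).pow_right _
    rw [hgq', h1.mul_pow, ← map_pow, hM _ hcs, map_one, one_mul, ← pow_mul, ← pow_mul, mul_comm]
  let t : A := y - 1
  have htc : ∀ b, t * b = b * t := fun b ↦ by
    simp only [t, sub_mul, mul_sub, hy, one_mul, mul_one]
  have hps0 : 0 < p ^ s := pow_pos hpp.pos s
  let v : A := ∑ i ∈ Finset.range M, ((g : A) ^ p ^ n) ^ i
  have htps : t ^ p ^ s = T * v := by
    have h1 : t ^ p ^ s = (y : A) ^ p ^ s - 1 := by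
      have := sub_pow_char_pow_of_commute p (n := s) (Commute.one_right (y : A))
      rw [this, one_pow]
    rw [h1, ← Units.val_pow_eq_pow_val, hyps, mul_geom_sum]
    simp
  -- modulo `T` all powers of `g ^ (p ^ n)` are `1`, so `v` is congruent to `M`, which is prime to `p`
  obtain ⟨v', hv'⟩ : IsUnit v := by
    have hMc : Nat.Coprime M p := ((Nat.Prime.coprime_iff_not_dvd hpp).mpr hpM).symm
    obtain ⟨m', hm'⟩ : ∃ m' : ℕ, (m' : A) * (M : A) = 1 := by
      obtain ⟨m', -, hm'⟩ := Nat.exists_mul_mod_eq_one_of_coprime hMc hpp.one_lt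
      refine ⟨m', ?_⟩
      rw [← Nat.cast_mul, mul_comm m', ← Nat.div_add_mod (M * m') p, hm']
      simp
    have hm'u : IsUnit (m' : A) :=
      ⟨⟨m', M, hm', by rw [← hm']; exact (Nat.cast_commute _ _).eq⟩, rfl⟩
    have h1 : IsUnit ((m' : A) * v) := by
      refine hT.isUnit_of_dvd_sub_one ?_
      have h2 : (m' : A) * v - 1 = m' * (v - M) := by rw [mul_sub, hm']
      rw [h2]
      refine hT.dvd_mul_left_of' ?_ _
      have h3 : v - M = ∑ i ∈ Finset.range M, (((g : A) ^ p ^ n) ^ i - 1) := by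
        simp [v, Finset.sum_sub_distrib]
      rw [h3]
      refine Finset.dvd_sum fun i _ ↦ ?_
      rw [← mul_geom_sum]
      exact dvd_mul_right _ _
    obtain ⟨u, hu⟩ := hm'u
    rw [← hu] at h1
    exact (Units.isUnit_units_mul u v).mp h1
  have htA : IsAdicAlong t := hT.of_pow_eq_mul htc hps0 (v := v') (by rw [hv', htps])
  obtain ⟨Q, _, θ, hθ, hθk⟩ := exists_quotient_of_central htc
  have hθt : θ t = 0 := (hθk t).mpr dvd_rfl
  have hθT : θ T = 0 := by
    have h1 : θ T * θ v = 0 := by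
      rw [← map_mul, ← htps, map_pow, hθt, zero_pow hps0.ne']
    rw [← hv'] at h1
    exact ((v'.isUnit.map θ).mul_left_eq_zero).mp h1
  have hQ : Nontrivial Q := by
    refine ⟨1, 0, fun h1 ↦ ?_⟩
    rw [← map_one θ, hθk] at h1
    obtain ⟨b, hb⟩ := h1
    refine one_ne_zero (htA.sep (1 : A) fun k ↦ ⟨b ^ k, ?_⟩)
    rw [← (show Commute t b from htc b).mul_pow, ← hb, one_pow]
  let θu : Aˣ →* Qˣ := Units.map (θ : A →* Q)
  have hθg : θu (g ^ p ^ n) = 1 := Units.ext (by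
    have h1 : θ ((g : A) ^ p ^ n) - 1 = 0 := by rw [← map_one θ, ← map_sub]; exact hθT
    simpa [θu] using sub_eq_zero.mp h1)
  have hθy : θu y = 1 := Units.ext (by
    have h1 : θ (y : A) - 1 = 0 := by rw [← map_one θ, ← map_sub]; exact hθt
    exact sub_eq_zero.mp h1)
  -- in the quotient `z ^ M = 1` and `z ^ (p ^ s)` comes from `R`; as `M` is prime to `p`, also `z` and
  -- `g ^ w` come from `R`, so that the powers `g ^ i` with `i < w` span the quotient over `R`
  obtain ⟨e, he⟩ : ∃ e : Rˣ, θu (g ^ w) = θu (ιu e) := by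
    have hcop : Nat.gcd (p ^ s) M = 1 := ((Nat.Prime.coprime_iff_not_dvd hpp).mpr hpM).pow_left s
    have hbez := Nat.gcd_eq_gcd_ab (p ^ s) M
    rw [hcop] at hbez
    have h1 : θu z = θu (ιu ((c ^ p ^ s)⁻¹ ^ (Nat.gcdA (p ^ s) M))) := by
      have h2 : θu z ^ M = 1 := by rw [← map_pow]; exact hθy
      have h3 : θu z ^ p ^ s = θu (ιu (c ^ p ^ s)⁻¹) := by
        have h4 : z ^ p ^ s = (ιu (c ^ p ^ s))⁻¹ * g ^ p ^ n := by rw [hgq', inv_mul_cancel_left]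
        rw [← map_pow, h4, map_mul, hθg, mul_one, ← map_inv]
      calc θu z = θu z ^ ((1 : ℕ) : ℤ) := by simp
        _ = _ := by
          rw [hbez, zpow_add, zpow_mul, zpow_mul, zpow_natCast, zpow_natCast, h2, h3, one_zpow,
            mul_one, map_zpow, map_zpow]
    exact ⟨c * (c ^ p ^ s)⁻¹ ^ (Nat.gcdA (p ^ s) M), by rw [hgw, map_mul, h1, map_mul, map_mul]⟩
  have he' : θ (g : A) ^ w = θ (ι e) := by
    have := congrArg Units.val he
    simpa [θu, hιu] using this
  let ι' : R →+* Q := θ.comp ι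
  have hτ' : ∀ r, θ g * ι' r = ι' (τ r) * θ g := fun r ↦ by
    change θ g * θ (ι r) = θ (ι (τ r)) * θ g
    rw [← map_mul, hτ, map_mul]
  have hone : ∀ (r : R) (i : ℕ), ∃ r' : ℕ → R,
      ι' r * θ g ^ i = ∑ l ∈ Finset.range w, ι' (r' l) * θ g ^ l := by
    intro r i
    refine ⟨fun l ↦ if l = i % w then r * ↑(e ^ (i / w)) else 0, ?_⟩
    rw [Finset.sum_eq_single_of_mem (i % w) (Finset.mem_range.mpr (Nat.mod_lt i hw0))
      fun l _ hl ↦ by simp only [if_neg hl, map_zero, zero_mul]]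
    simp only [if_true]
    conv_lhs => rw [← Nat.div_add_mod i w, pow_add, pow_mul, he']
    simp [ι', mul_assoc]
  have hspan' : ∀ b : Q, ∃ r : ℕ → R, b = ∑ i ∈ Finset.range w, ι' (r i) * θ g ^ i := by
    intro b
    obtain ⟨b, rfl⟩ := hθ b
    obtain ⟨r, b', hb⟩ := hspan b
    choose r' hr' using hone
    refine ⟨fun l ↦ ∑ i ∈ Finset.range (p ^ n), r' (r i) i l, ?_⟩
    rw [hb, map_add, map_mul, hθT, zero_mul, add_zero, map_sum]
    simp only [map_mul, map_pow, map_sum, Finset.sum_mul]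
    rw [Finset.sum_comm]
    exact Finset.sum_congr rfl fun i _ ↦ hr' (r i) i
  refine ⟨t, Q, inferInstance, θ, htA, ?_,
    isSimpleRing_of_twist hτ' (g.isUnit.map θ) hR hwne hspan', hθ, hθk⟩
  refine Finite.of_surjective
    (fun r : Fin w → R ↦ ∑ i : Fin w, ι' (r i) * θ g ^ (i : ℕ)) fun b ↦ ?_
  obtain ⟨r, hr⟩ := hspan' b
  refine ⟨fun i ↦ r i, ?_⟩
  rw [hr, Finset.sum_range]

/-! ### The topology of the Iwasawa algebra -/

/-- The quotients of a compact group by open normal subgroups are finite. -/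
theorem OpenNormalSubgroup.finite_quotient {G : Type u} [Group G] [TopologicalSpace G]
    [IsTopologicalGroup G] [CompactSpace G] (N : OpenNormalSubgroup G) : Finite (G ⧸ N.toSubgroup) :=
  N.toOpenSubgroup.toSubgroup.quotient_finite_of_isOpen N.toOpenSubgroup.isOpen

theorem OpenNormalSubgroup.exists_le_inf {G : Type u} [Group G] [TopologicalSpace G]
    (N M : OpenNormalSubgroup G) : ∃ K : OpenNormalSubgroup G, K ≤ N ∧ K ≤ M :=
  ⟨N ⊓ M, inf_le_left, inf_le_right⟩

namespace IwasawaAlgebra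

variable {p : ℕ} [Fact p.Prime] {G : Type u} [Group G] [TopologicalSpace G]

/-- The coefficient at `g` of the image of `x` in `ℤ_p[G/N]`. -/
def coeff (x : IwasawaAlgebra p G) (N : OpenNormalSubgroup G) (g : G ⧸ N.toSubgroup) : ℤ_[p] :=
  (x.1 N).coeff g

theorem ext_coeff {x y : IwasawaAlgebra p G} (h : ∀ N g, coeff x N g = coeff y N g) : x = y :=
  Subtype.ext <| funext fun N ↦ MonoidAlgebra.ext <| Finsupp.ext <| h N

@[simp] theorem coeff_zero (N : OpenNormalSubgroup G) (g : G ⧸ N.toSubgroup) :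
    coeff (0 : IwasawaAlgebra p G) N g = 0 := rfl

@[simp] theorem coeff_add (x y : IwasawaAlgebra p G) (N g) :
    coeff (x + y) N g = coeff x N g + coeff y N g := rfl

@[simp] theorem coeff_sub (x y : IwasawaAlgebra p G) (N g) :
    coeff (x - y) N g = coeff x N g - coeff y N g := by
  change ((x - y).1 N).coeff g = _
  rw [AddSubgroupClass.coe_sub, Pi.sub_apply, MonoidAlgebra.coeff_sub]
  rfl

@[simp] theorem coeff_smul (r : ℤ_[p]) (x : IwasawaAlgebra p G) (N g) :
    coeff (r • x) N g = r * coeff x N g := rfl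

theorem coeff_sum {α : Type*} (s : Finset α) (f : α → IwasawaAlgebra p G) (N g) :
    coeff (∑ i ∈ s, f i) N g = ∑ i ∈ s, coeff (f i) N g := by
  classical
  induction s using Finset.induction_on with
  | empty => simp
  | insert a s ha ih => rw [Finset.sum_insert ha, Finset.sum_insert ha, coeff_add, ih]

theorem coeff_of_mul (g : G) (x : IwasawaAlgebra p G) (N : OpenNormalSubgroup G)
    (q : G ⧸ N.toSubgroup) :
    coeff (of p g * x) N q = coeff x N ((g : G ⧸ N.toSubgroup)⁻¹ * q) := by
  change (MonoidAlgebra.of ℤ_[p] (G ⧸ N.toSubgroup) g * x.1 N).coeff q = _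
  rw [MonoidAlgebra.of_apply, MonoidAlgebra.coeff_single_mul_apply, one_mul]
  rfl

theorem coeff_mul (x y : IwasawaAlgebra p G) (N : OpenNormalSubgroup G)
    [Fintype (G ⧸ N.toSubgroup)] (q : G ⧸ N.toSubgroup) :
    coeff (x * y) N q = ∑ h, coeff x N h * coeff y N (h⁻¹ * q) := by
  change (x.1 N * y.1 N).coeff q = _
  rw [MonoidAlgebra.coeff_mul_apply_left, Finsupp.sum_fintype _ _ (by simp)]
  rfl

theorem coeff_mapDomain {K M : Type*} [Fintype K] [DecidableEq M] (f : K → M)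
    (x : MonoidAlgebra ℤ_[p] K) (q : M) :
    (MonoidAlgebra.mapDomain f x).coeff q = ∑ r with f r = q, x.coeff r := by
  change Finsupp.mapDomain f x.coeff q = _
  rw [Finsupp.mapDomain, Finsupp.sum_apply, Finsupp.sum_fintype _ _ (by simp), Finset.sum_filter]
  exact Finset.sum_congr rfl fun r _ ↦ Finsupp.single_apply

/-- The fibre sums of the coefficients at a level `N` are the coefficients at a coarser level. -/
theorem sum_coeff_fiber (x : IwasawaAlgebra p G) {N M : OpenNormalSubgroup G} (h : N ≤ M)
    [Fintype (G ⧸ N.toSubgroup)] [DecidableEq (G ⧸ M.toSubgroup)] (q : G ⧸ M.toSubgroup) :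
    ∑ r with QuotientGroup.map N.toSubgroup M.toSubgroup (MonoidHom.id G) h r = q, coeff x N r
      = coeff x M q := by
  unfold coeff
  rw [← x.2 N M h, iwasawaTransition, MonoidAlgebra.mapDomainAlgHom_apply]
  exact (coeff_mapDomain (QuotientGroup.map N.toSubgroup M.toSubgroup (MonoidHom.id G) h) (x.1 N) q).symm

/-- The topology of `Λ(G)` as a closed subspace of the product of its coefficient spaces `ℤ_p`. -/
instance : TopologicalSpace (IwasawaAlgebra p G) :=
  .induced (fun x N q ↦ coeff x N q) inferInstance

theorem continuous_coeff (N : OpenNormalSubgroup G) (q : G ⧸ N.toSubgroup) :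
    Continuous fun x : IwasawaAlgebra p G ↦ coeff x N q := by
  have h : Continuous fun (x : IwasawaAlgebra p G) N q ↦ coeff x N q := continuous_induced_dom
  exact continuous_pi_iff.mp (continuous_pi_iff.mp h N) q

theorem continuous_of_coeff {X : Type*} [TopologicalSpace X] {f : X → IwasawaAlgebra p G}
    (h : ∀ N q, Continuous fun x ↦ coeff (f x) N q) : Continuous f :=
  continuous_induced_rng.mpr (continuous_pi fun N ↦ continuous_pi fun q ↦ h N q)

instance : T2Space (IwasawaAlgebra p G) :=
  T2Space.of_injective_continuous (fun _ _ h ↦ ext_coeff fun N q ↦ congrFun (congrFun h N) q)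
    continuous_induced_dom

instance : ContinuousAdd (IwasawaAlgebra p G) :=
  ⟨continuous_of_coeff fun N q ↦ by
    simp only [coeff_add]
    exact ((continuous_coeff N q).comp continuous_fst).add ((continuous_coeff N q).comp continuous_snd)⟩

instance : ContinuousSMul ℤ_[p] (IwasawaAlgebra p G) :=
  ⟨continuous_of_coeff fun N q ↦ by
    simp only [coeff_smul]
    exact continuous_fst.mul ((continuous_coeff N q).comp continuous_snd)⟩

section Compact

variable [IsTopologicalGroup G] [CompactSpace G]

instance : ContinuousMul (IwasawaAlgebra p G) :=
  ⟨continuous_of_coeff fun N q ↦ by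
    have := N.finite_quotient
    have := Fintype.ofFinite (G ⧸ N.toSubgroup)
    simp only [coeff_mul]
    exact continuous_finsetSum _ fun h _ ↦
      ((continuous_coeff N _).comp continuous_fst).mul ((continuous_coeff N _).comp continuous_snd)⟩

instance : CompactSpace (IwasawaAlgebra p G) := by
  classical
  have := fun N : OpenNormalSubgroup G ↦ N.finite_quotient
  let _ := fun N : OpenNormalSubgroup G ↦ Fintype.ofFinite (G ⧸ N.toSubgroup)
  let F : IwasawaAlgebra p G → ∀ N : OpenNormalSubgroup G, G ⧸ N.toSubgroup → ℤ_[p] :=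
    fun x N q ↦ coeff x N q
  -- compatible families of coefficient functions are those with the right fibre sums
  have hr : Set.range F = ⋂ (N : OpenNormalSubgroup G) (M : OpenNormalSubgroup G) (h : N ≤ M)
      (q : G ⧸ M.toSubgroup), {f | ∑ r with QuotientGroup.map N.toSubgroup M.toSubgroup
        (MonoidHom.id G) h r = q, f N r = f M q} := by
    ext f
    simp only [Set.mem_iInter, Set.mem_range, Set.mem_ofPred_eq]
    constructor
    · rintro ⟨x, rfl⟩ N M h q
      exact sum_coeff_fiber x h q
    · intro hf
      refine ⟨⟨fun N ↦ .ofCoeff (Finsupp.equivFunOnFinite.symm (f N)), fun N M h ↦ ?_⟩, rfl⟩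
      refine MonoidAlgebra.ext (Finsupp.ext fun q ↦ ?_)
      have h1 := coeff_mapDomain (QuotientGroup.map N.toSubgroup M.toSubgroup (MonoidHom.id G) h)
        (.ofCoeff (Finsupp.equivFunOnFinite.symm (f N))) q
      exact h1.trans ((Finset.sum_congr rfl fun r _ ↦ rfl).trans (hf N M h q))
  have hc : IsClosed (Set.range F) := by
    rw [hr]
    refine isClosed_iInter fun N ↦ isClosed_iInter fun M ↦ isClosed_iInter fun h ↦
      isClosed_iInter fun q ↦ isClosed_eq ?_ ?_
    · exact continuous_finsetSum _ fun r _ ↦ (continuous_apply r).comp (continuous_apply N)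
    · exact (continuous_apply q).comp (continuous_apply M)
  have he : Topology.IsClosedEmbedding F :=
    ⟨⟨⟨rfl⟩, fun _ _ h ↦ ext_coeff fun N q ↦ congrFun (congrFun h N) q⟩, hc⟩
  exact he.compactSpace

/-- A closed subset of `Λ(G)` which meets every congruence class modulo every level is everything. -/
theorem eq_univ_of_isClosed {D : Set (IwasawaAlgebra p G)} (hD : IsClosed D)
    (h : ∀ x : IwasawaAlgebra p G, ∀ N, ∃ d ∈ D, d.1 N = x.1 N) : D = Set.univ := by
  refine Set.eq_univ_of_forall fun x ↦ ?_
  let C : OpenNormalSubgroup G → Set (IwasawaAlgebra p G) := fun N ↦ D ∩ {d | d.1 N = x.1 N}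
  have hC : ∀ N, IsClosed (C N) := fun N ↦ by
    refine hD.inter ?_
    have h1 : {d : IwasawaAlgebra p G | d.1 N = x.1 N} = ⋂ q, {d | coeff d N q = coeff x N q} := by
      ext d
      simp only [Set.mem_iInter, Set.mem_ofPred_eq]
      exact ⟨fun h q ↦ by unfold coeff; rw [h], fun h ↦ MonoidAlgebra.ext (Finsupp.ext h)⟩
    rw [h1]
    exact isClosed_iInter fun q ↦ isClosed_eq (continuous_coeff N q) continuous_const
  have hle : ∀ {N M : OpenNormalSubgroup G}, N ≤ M → C N ⊆ C M := fun {N M} hNM d hd ↦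
    ⟨hd.1, show d.1 M = x.1 M by rw [← d.2 N M hNM, ← x.2 N M hNM, show d.1 N = x.1 N from hd.2]⟩
  let N₀ : OpenNormalSubgroup G := { (⊤ : OpenSubgroup G) with isNormal' := Subgroup.normal_top }
  have : Nonempty (OpenNormalSubgroup G) := ⟨N₀⟩
  obtain ⟨d, hd⟩ := IsCompact.nonempty_iInter_of_directed_nonempty_isCompact_isClosed C
    (fun N M ↦ by
      obtain ⟨K, h1, h2⟩ := N.exists_le_inf M
      exact ⟨K, hle h1, hle h2⟩)
    (fun N ↦ by
      obtain ⟨d, hd, hdx⟩ := h x N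
      exact ⟨d, hd, hdx⟩) (fun N ↦ (hC N).isCompact) hC
  rw [Set.mem_iInter] at hd
  have h1 : d = x := Subtype.ext (funext fun N ↦ (hd N).2)
  exact h1 ▸ (hd N₀).1

/-- A closed submodule of `Λ(G)` containing a dense set of group elements is everything. -/
theorem eq_top_of_isClosed {D : Submodule ℤ_[p] (IwasawaAlgebra p G)}
    (hD : IsClosed (D : Set (IwasawaAlgebra p G)))
    (h : ∀ (N : OpenNormalSubgroup G) (g : G), ∃ s : G, (s : G ⧸ N.toSubgroup) = g ∧ of p s ∈ D) :
    D = ⊤ := by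
  refine SetLike.coe_injective (eq_univ_of_isClosed hD fun x N ↦ ?_)
  have key : ∀ y : MonoidAlgebra ℤ_[p] (G ⧸ N.toSubgroup), ∃ d ∈ D, d.1 N = y := by
    intro y
    induction y using MonoidAlgebra.induction_linear with
    | zero => exact ⟨0, D.zero_mem, rfl⟩
    | add a b ha hb =>
      obtain ⟨d, hd, rfl⟩ := ha
      obtain ⟨e, he, rfl⟩ := hb
      exact ⟨d + e, D.add_mem hd he, rfl⟩
    | single q r =>
      obtain ⟨g, rfl⟩ := QuotientGroup.mk_surjective q
      obtain ⟨s, hs, hsD⟩ := h N g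
      refine ⟨r • of p s, D.smul_mem r hsD, ?_⟩
      change r • MonoidAlgebra.of ℤ_[p] (G ⧸ N.toSubgroup) (s : G ⧸ N.toSubgroup) = _
      rw [hs, MonoidAlgebra.of_apply, MonoidAlgebra.smul_single, smul_eq_mul, mul_one]
  exact key _

/-- Divisibility by `p ^ k` can be tested on coefficients. -/
theorem natCast_pow_dvd_iff (k : ℕ) (x : IwasawaAlgebra p G) :
    (p : IwasawaAlgebra p G) ^ k ∣ x ↔ ∀ N q, (p : ℤ_[p]) ^ k ∣ coeff x N q := by
  have hmul : ∀ y : IwasawaAlgebra p G, (p : IwasawaAlgebra p G) ^ k * y = (p : ℤ_[p]) ^ k • y := by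
    intro y
    rw [Algebra.smul_def, map_pow, map_natCast]
  constructor
  · rintro ⟨y, rfl⟩ N q
    rw [hmul, coeff_smul]
    exact dvd_mul_right _ _
  · intro h
    classical
    have := fun N : OpenNormalSubgroup G ↦ N.finite_quotient
    let _ := fun N : OpenNormalSubgroup G ↦ Fintype.ofFinite (G ⧸ N.toSubgroup)
    have hp : (p : ℤ_[p]) ^ k ≠ 0 := pow_ne_zero _ (Nat.cast_ne_zero.mpr (Fact.out : p.Prime).ne_zero)
    choose c hc using h
    refine ⟨⟨fun N ↦ .ofCoeff (Finsupp.equivFunOnFinite.symm (c N)), fun N M h ↦ ?_⟩, ?_⟩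
    · refine MonoidAlgebra.ext (Finsupp.ext fun q ↦ ?_)
      have h1 := coeff_mapDomain (QuotientGroup.map N.toSubgroup M.toSubgroup (MonoidHom.id G) h)
        (.ofCoeff (Finsupp.equivFunOnFinite.symm (c N))) q
      refine h1.trans (mul_left_cancel₀ hp ?_)
      rw [Finset.mul_sum]
      exact ((Finset.sum_congr rfl fun r _ ↦ (hc N r).symm).trans (sum_coeff_fiber x h q)).trans
        (hc M q)
    · refine ext_coeff fun N q ↦ ?_
      rw [hmul, coeff_smul, hc]
      rfl

/-- Power series in a fixed element converge in `Λ(G)`, by compactness. -/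
theorem exists_sum_pow_mul (t : IwasawaAlgebra p G) (a : ℕ → IwasawaAlgebra p G) :
    ∃ s, ∀ k, t ^ k ∣ s - ∑ i ∈ Finset.range k, t ^ i * a i := by
  let S : ℕ → IwasawaAlgebra p G := fun k ↦ ∑ i ∈ Finset.range k, t ^ i * a i
  let C : ℕ → Set (IwasawaAlgebra p G) := fun k ↦ (fun y ↦ S k + t ^ k * y) '' Set.univ
  have hC : ∀ k, IsCompact (C k) := fun k ↦
    isCompact_univ.image (continuous_const.add (continuous_const.mul continuous_id))
  obtain ⟨s, hs⟩ := IsCompact.nonempty_iInter_of_sequence_nonempty_isCompact_isClosed C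
    (fun k ↦ by
      rintro _ ⟨y, -, rfl⟩
      refine ⟨a k + t * y, trivial, ?_⟩
      simp only [S, Finset.sum_range_succ, pow_succ]
      noncomm_ring) (fun k ↦ ⟨_, 0, trivial, rfl⟩) (hC 0) fun k ↦ (hC k).isClosed
  refine ⟨s, fun k ↦ ?_⟩
  obtain ⟨y, -, hy⟩ := Set.mem_iInter.mp hs k
  exact ⟨y, by rw [← hy]; exact add_sub_cancel_left _ _⟩

/-- `Λ(G)` is separated and complete for the `p`-adic topology. -/
theorem isAdicAlong_natCast : IsAdicAlong (p : IwasawaAlgebra p G) := by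
  have hp0 : (p : ℤ_[p]) ≠ 0 := Nat.cast_ne_zero.mpr (Fact.out : p.Prime).ne_zero
  refine ⟨fun a ↦ (Nat.cast_commute p a).eq, fun a ha ↦ ext_coeff fun N q ↦ ?_,
    fun a ha ↦ ext_coeff fun N q ↦ ?_, fun a ↦ exists_sum_pow_mul _ a⟩
  · have h1 : coeff ((p : ℤ_[p]) • a) N q = 0 := by
      rw [Algebra.smul_def, map_natCast, ha]; rfl
    rw [coeff_smul] at h1
    exact (mul_eq_zero.mp h1).resolve_left hp0
  · by_contra h0
    obtain ⟨k, hk⟩ := (FiniteMultiplicity.of_prime_left PadicInt.prime_p h0)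
    exact hk ((natCast_pow_dvd_iff _ _).mp (ha _) N q)

/-- An element commuting with a dense set of group elements is central. -/
theorem mul_comm_of_forall_of {a : IwasawaAlgebra p G}
    (h : ∀ (N : OpenNormalSubgroup G) (g : G), ∃ s : G, (s : G ⧸ N.toSubgroup) = g ∧
      of p s * a = a * of p s) (x : IwasawaAlgebra p G) : x * a = a * x := by
  let D : Submodule ℤ_[p] (IwasawaAlgebra p G) :=
    { carrier := {x | x * a = a * x}
      add_mem' := fun {x y} hx hy ↦ by
        change (x + y) * a = a * (x + y)
        rw [add_mul, mul_add, show x * a = a * x from hx, show y * a = a * y from hy]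
      zero_mem' := by simp
      smul_mem' := fun r x hx ↦ by
        change (r • x) * a = a * (r • x)
        rw [smul_mul_assoc, mul_smul_comm, show x * a = a * x from hx] }
  have hD : D = ⊤ := eq_top_of_isClosed (isClosed_eq (continuous_id.mul continuous_const)
    (continuous_const.mul continuous_id)) h
  have : x ∈ D := hD ▸ Submodule.mem_top
  exact this

end Compact

end IwasawaAlgebra

/-! ### Sums invariant under a permutation of prime power order -/

/-- If `σ` has `p`-power order and `σ ^ (p ^ b)` has no fixed points, all orbits of `σ` have length
divisible by `p ^ (b + 1)`. -/
theorem Equiv.Perm.pow_dvd_card {p : ℕ} [Fact p.Prime] {Ω : Type*} [Finite Ω] (σ : Equiv.Perm Ω)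
    {N b : ℕ} (hσ : σ ^ p ^ N = 1) (hb : ∀ ω, (σ ^ p ^ b) ω ≠ ω) : p ^ (b + 1) ∣ Nat.card Ω := by
  classical
  have hpp : p.Prime := Fact.out
  have := Fintype.ofFinite Ω
  let K := Subgroup.zpowers σ
  have hK : Nat.card K ∣ p ^ N := by
    rw [Nat.card_zpowers]
    exact orderOf_dvd_of_pow_eq_one hσ
  rw [Nat.card_congr (MulAction.selfEquivSigmaOrbits K Ω), Nat.card_sigma]
  refine Finset.dvd_sum fun q _ ↦ ?_
  have h1 : ∀ ω : Ω, p ^ (b + 1) ∣ Nat.card (MulAction.orbit K ω) := by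
    intro ω
    rw [Nat.card_congr (MulAction.orbitEquivQuotientStabilizer K ω)]
    change _ ∣ (MulAction.stabilizer K ω).index
    obtain ⟨j, -, hj⟩ := (Nat.dvd_prime_pow hpp).mp
      ((MulAction.stabilizer K ω).index_dvd_card.trans hK)
    rw [hj]
    refine pow_dvd_pow p ?_
    by_contra! hlt
    have h2 := (MulAction.stabilizer K ω).pow_index_mem ⟨σ, Subgroup.mem_zpowers σ⟩
    rw [hj] at h2
    obtain ⟨c, hc⟩ := Nat.exists_eq_add_of_le (Nat.lt_succ_iff.mp hlt)
    have h3 := (MulAction.stabilizer K ω).pow_mem h2 (p ^ c)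
    rw [← pow_mul, ← pow_add, ← hc] at h3
    exact hb ω h3
  exact h1 _

/-- A sum over a set with an action of a cyclic `p`-group all of whose orbits have length divisible by
`p ^ (b + 1)`, of an invariant function, is divisible by `p ^ (b + 1)`. -/
theorem Equiv.Perm.pow_dvd_sum {p : ℕ} [Fact p.Prime] {Ω : Type*} [Fintype Ω] (σ : Equiv.Perm Ω)
    {N b : ℕ} (hσ : σ ^ p ^ N = 1) (hb : ∀ ω, (σ ^ p ^ b) ω ≠ ω) {k : Type*} [CommRing k]
    (f : Ω → k) (hf : ∀ ω, f (σ ω) = f ω) : (p : k) ^ (b + 1) ∣ ∑ ω, f ω := by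
  classical
  rw [← Finset.sum_fiberwise_of_maps_to (g := f) (t := Finset.univ.image f)
    fun ω _ ↦ Finset.mem_image_of_mem f (Finset.mem_univ ω)]
  refine Finset.dvd_sum fun c _ ↦ ?_
  rw [Finset.sum_congr rfl (g := fun _ ↦ c) fun ω hω ↦ (Finset.mem_filter.mp hω).2,
    Finset.sum_const, nsmul_eq_mul]
  refine dvd_mul_of_dvd_left ?_ c
  rw [← Nat.cast_pow]
  refine Nat.cast_dvd_cast ?_
  let τ : Equiv.Perm {ω // f ω = c} := σ.subtypePerm fun ω ↦ by rw [hf]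
  have hτ : ∀ (m : ℕ) (ω : {ω // f ω = c}), ((τ ^ m) ω : Ω) = (σ ^ m) ω := by
    intro m ω
    rw [Equiv.Perm.subtypePerm_pow]
    rfl
  have h1 := τ.pow_dvd_card (p := p) (N := N) (b := b)
    (Equiv.ext fun ω ↦ Subtype.ext (by rw [hτ, hσ]; rfl))
    fun ω hω ↦ hb ω (by rw [← hτ, hω])
  rwa [Nat.card_eq_fintype_card, Fintype.card_subtype] at h1

/-! ### Groups topologically generated by a finite subgroup and a procyclic one -/

/-- `γ` generates, together with `H`, a dense submonoid of the profinite group `G`, and generates a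
closed subgroup isomorphic to `ℤ_p`. -/
structure IsGenOver (p : ℕ) {G : Type u} [Group G] [TopologicalSpace G] (H : Subgroup G) (γ : G) :
    Prop where
  dense : ∀ (N : OpenNormalSubgroup G) (g : G), ∃ h ∈ H, ∃ j : ℕ,
    ((h * γ ^ j : G) : G ⧸ N.toSubgroup) = g
  tendsto : ∀ N : OpenNormalSubgroup G, ∃ r : ℕ, γ ^ p ^ r ∈ N.toSubgroup
  pow_ne_one : ∀ r : ℕ, γ ^ p ^ r ≠ 1

/-- If `G = H ⋊ Γ` with `G / H` isomorphic to `ℤ_p`, a topological generator of `Γ` generates `G` over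
`H`. -/
theorem isGenOver_of_isComplement {p : ℕ} [Fact p.Prime]
    {G : Type u} [Group G] [TopologicalSpace G] [IsTopologicalGroup G] [CompactSpace G] [T2Space G]
    {H : Subgroup G} [H.Normal] (hGH : Nonempty ((G ⧸ H) ≃ₜ* Multiplicative ℤ_[p]))
    {Γ : Subgroup G} (hΓ : H.IsComplement' Γ) {γ : G}
    (hγ : (Subgroup.zpowers γ).topologicalClosure = Γ) : IsGenOver p H γ := by
  obtain ⟨e⟩ := hGH
  let F : G → ℤ_[p] := fun g ↦ Multiplicative.toAdd (e (g : G ⧸ H))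
  have hF1 : ∀ g, F g = 0 → g ∈ H := fun g hg ↦
    (QuotientGroup.eq_one_iff g).mp (e.injective ((Multiplicative.toAdd.injective hg).trans
      (map_one e).symm))
  have hFmul : ∀ g h, F (g * h) = F g + F h := fun g h ↦ by
    simp only [F, QuotientGroup.mk_mul, map_mul, toAdd_mul]
  have hFpow : ∀ g (m : ℕ), F (g ^ m) = m * F g := fun g m ↦ by
    simp only [F, QuotientGroup.mk_pow, map_pow, toAdd_pow, nsmul_eq_mul]
  have hFc : Continuous F := continuous_toAdd.comp (e.continuous.comp continuous_quot_mk)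
  have hγΓ : γ ∈ Γ := hγ ▸ Subgroup.le_topologicalClosure _ (Subgroup.mem_zpowers γ)
  have hdisj : ∀ g, g ∈ H → g ∈ Γ → g = 1 := fun g h1 h2 ↦
    Subgroup.mem_bot.mp (hΓ.disjoint.le_bot ⟨h1, h2⟩)
  -- `Γ` embeds topologically into `ℤ_p`, where `p ^ r * F γ` tends to zero
  have htend : ∀ N : OpenNormalSubgroup G, ∃ r : ℕ, γ ^ p ^ r ∈ N.toSubgroup := by
    intro N
    have hΓc : IsClosed (Γ : Set G) := hγ ▸ Subgroup.isClosed_topologicalClosure _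
    have : CompactSpace Γ := isCompact_iff_compactSpace.mp hΓc.isCompact
    let F' : Γ → ℤ_[p] := fun g ↦ F g
    have hinj : Function.Injective F' := by
      intro a b hab
      have h1 : F ((a : G) * (b : G)⁻¹) = 0 := by
        have h2 := hFmul ((a : G) * (b : G)⁻¹) b
        rw [inv_mul_cancel_right] at h2
        have h3 : F a = F b := hab
        rw [h3] at h2
        simpa using h2.symm
      exact Subtype.ext (mul_inv_eq_one.mp (hdisj _ (hF1 _ h1) (Γ.mul_mem a.2 (Γ.inv_mem b.2))))
    have hemb : Topology.IsClosedEmbedding F' :=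
      (hFc.comp continuous_subtype_val).isClosedEmbedding hinj
    let g : Γ := ⟨γ, hγΓ⟩
    have h1 : Filter.Tendsto (fun r : ℕ ↦ g ^ p ^ r) Filter.atTop (nhds 1) := by
      rw [hemb.isInducing.tendsto_nhds_iff]
      have h2 : F' 1 = 0 := by
        have := hFmul 1 1
        rw [mul_one] at this
        exact left_eq_add.mp this
      have h3 : F' ∘ (fun r : ℕ ↦ g ^ p ^ r) = fun r ↦ (p : ℤ_[p]) ^ r * F γ := by
        funext r
        change F ((γ : G) ^ p ^ r) = _
        rw [hFpow, Nat.cast_pow]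
      rw [h2, h3]
      have h4 : Filter.Tendsto (fun r : ℕ ↦ (p : ℤ_[p]) ^ r) Filter.atTop (nhds 0) :=
        tendsto_pow_atTop_nhds_zero_of_norm_lt_one
          (PadicInt.norm_p (p := p) ▸ inv_lt_one_of_one_lt₀
            (by exact_mod_cast (Fact.out : p.Prime).one_lt))
      simpa using h4.mul_const (F γ)
    have hU : {x : Γ | (x : G) ∈ N.toSubgroup} ∈ nhds (1 : Γ) :=
      (N.toOpenSubgroup.isOpen.preimage continuous_subtype_val).mem_nhds N.toSubgroup.one_mem
    obtain ⟨r, hr⟩ := (h1.eventually hU).exists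
    exact ⟨r, hr⟩
  refine ⟨fun N g ↦ ?_, htend, fun r hr ↦ ?_⟩
  · obtain ⟨⟨⟨h, hh⟩, ⟨δ, hδ⟩⟩, rfl⟩ := hΓ.2 g
    have hδ' : δ ∈ closure (Subgroup.zpowers γ : Set G) := by
      rw [← Subgroup.topologicalClosure_coe, hγ]
      exact hδ
    have hU : IsOpen {x : G | δ⁻¹ * x ∈ N.toSubgroup} :=
      N.toOpenSubgroup.isOpen.preimage (continuous_const.mul continuous_id)
    obtain ⟨x, hx, ⟨i, rfl⟩⟩ := mem_closure_iff.mp hδ' _ hU (by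
      change δ⁻¹ * δ ∈ N.toSubgroup
      rw [inv_mul_cancel]
      exact N.toSubgroup.one_mem)
    obtain ⟨r, hr⟩ := htend N
    have hpr : (0 : ℤ) < (p ^ r : ℕ) := by
      exact_mod_cast pow_pos (Fact.out : p.Prime).pos r
    refine ⟨h, hh, (i % (p ^ r : ℕ)).toNat, ?_⟩
    have h1 : ((γ ^ (i % (p ^ r : ℕ)).toNat : G) : G ⧸ N.toSubgroup) = (γ ^ i : G) := by
      rw [← zpow_natCast, Int.toNat_of_nonneg (Int.emod_nonneg i hpr.ne')]
      conv_rhs => rw [← Int.emod_add_mul_ediv i (p ^ r : ℕ)]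
      rw [zpow_add, QuotientGroup.mk_mul, zpow_mul, zpow_natCast, QuotientGroup.mk_zpow _ (_ ^ _),
        (QuotientGroup.eq_one_iff _).mpr hr, one_zpow, mul_one]
    rw [QuotientGroup.mk_mul, h1]
    change _ = ((h * δ : G) : G ⧸ N.toSubgroup)
    rw [QuotientGroup.mk_mul]
    congr 1
    exact (QuotientGroup.eq.mpr hx).symm
  · have h1 : F γ = 0 := by
      have h2 := hFpow γ (p ^ r)
      have h3 : F 1 = 0 := by
        have := hFmul 1 1
        rw [mul_one] at this
        exact left_eq_add.mp this
      rw [hr, h3, Nat.cast_pow] at h2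
      exact (mul_eq_zero.mp h2.symm).resolve_left
        (pow_ne_zero _ (Nat.cast_ne_zero.mpr (Fact.out : p.Prime).ne_zero))
    have h2 : γ = 1 := hdisj γ (hF1 _ h1) hγΓ
    have h3 : Γ = ⊥ := by
      rw [← hγ, h2, Subgroup.zpowers_one_eq_bot]
      refine SetLike.coe_injective ?_
      rw [Subgroup.topologicalClosure_coe, Subgroup.coe_bot, closure_singleton]
    obtain ⟨g, hg⟩ := QuotientGroup.mk_surjective (e.symm (Multiplicative.ofAdd 1))
    have h4 : F g = 1 := by simp [F, hg]
    obtain ⟨⟨⟨h, hh⟩, ⟨δ, hδ⟩⟩, rfl⟩ := hΓ.2 g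
    have hδ1 : δ = 1 := by rw [h3] at hδ; exact Subgroup.mem_bot.mp hδ
    subst hδ1
    have h5 : F (h * 1) = 0 := by
      rw [mul_one]
      simp only [F]
      rw [(QuotientGroup.eq_one_iff h).mpr hh, map_one, toAdd_one]
    exact zero_ne_one (h5.symm.trans h4)

/-! ### The Iwasawa algebra as an extension of a power series ring -/

namespace IwasawaAlgebra

variable {p : ℕ} [Fact p.Prime] {G : Type u} [Group G] [TopologicalSpace G]
  [IsTopologicalGroup G] [CompactSpace G]

theorem mul_comm_of_mem_center {c : G} (hc : c ∈ Subgroup.center G) (x : IwasawaAlgebra p G) :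
    x * of p c = of p c * x :=
  mul_comm_of_forall_of (fun N g ↦ ⟨g, rfl, by
    rw [← map_mul, ← map_mul, Subgroup.mem_center_iff.mp hc]⟩) x

omit [IsTopologicalGroup G] [CompactSpace G] in
/-- Modulo `p`, the `p ^ m`-th power of `g - 1` is `g ^ (p ^ m) - 1`. -/
theorem exists_pow_of_sub_one (g : G) (m : ℕ) :
    ∃ r, (of p g - 1) ^ p ^ m = of p (g ^ p ^ m) - 1 - p * r := by
  obtain ⟨r, hr⟩ := Commute.exists_add_pow_prime_pow_eq (Fact.out : p.Prime)
    (Commute.one_right (of p g - 1)) m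
  refine ⟨(of p g - 1) * r, ?_⟩
  rw [sub_add_cancel, one_pow, mul_one] at hr
  rw [map_pow, hr]
  noncomm_ring

section Augmentation

variable {H : Subgroup G} {γ : G} (hG : IsGenOver p H γ) {n : ℕ}
  (hn : γ ^ p ^ n ∈ Subgroup.center G)
include hG

/-- `Λ(G)/p` is separated for the topology of the powers of `γ ^ (p ^ n) - 1`: on a finite level a
sufficiently high power of this element vanishes modulo `p`. -/
theorem natCast_dvd_of_forall_pow_dvd {x : IwasawaAlgebra p G}
    (hx : ∀ k, ∃ y, (p : IwasawaAlgebra p G) ∣ x - (of p (γ ^ p ^ n) - 1) ^ k * y) :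
    (p : IwasawaAlgebra p G) ∣ x := by
  rw [← pow_one (p : IwasawaAlgebra p G), natCast_pow_dvd_iff]
  intro N q
  rw [pow_one]
  obtain ⟨r, hr⟩ := hG.tendsto N
  obtain ⟨y, hy⟩ := hx (p ^ r)
  obtain ⟨s, hs⟩ := exists_pow_of_sub_one (p := p) (γ ^ p ^ n) r
  have h1 : (p : IwasawaAlgebra p G) ∣ x - (of p ((γ ^ p ^ n) ^ p ^ r) - 1) * y := by
    have h2 : x - (of p ((γ ^ p ^ n) ^ p ^ r) - 1) * y
        = (x - (of p (γ ^ p ^ n) - 1) ^ p ^ r * y) - p * (s * y) := by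
      rw [hs, sub_mul _ (p * s : IwasawaAlgebra p G), mul_assoc]; abel
    rw [h2]
    exact dvd_sub hy (dvd_mul_right _ _)
  rw [← pow_one (p : IwasawaAlgebra p G), natCast_pow_dvd_iff] at h1
  have h2 := h1 N q
  have h3 : (((γ ^ p ^ n) ^ p ^ r : G) : G ⧸ N.toSubgroup) = 1 := by
    rw [QuotientGroup.eq_one_iff, ← pow_mul, mul_comm, pow_mul]
    exact N.toSubgroup.pow_mem hr _
  rwa [pow_one, coeff_sub, sub_mul, one_mul, coeff_sub, coeff_of_mul, h3, inv_one, one_mul, sub_self,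
    sub_zero] at h2

/-- `γ ^ (p ^ n) - 1` is regular modulo `p`: an element that it kills has coefficients that are constant
along the orbits of `γ ^ (p ^ n)` modulo `p`. The coefficients on a given level are the sums over such
orbits on a finer level, of length divisible by `p`, hence vanish modulo `p`. -/
theorem natCast_dvd_of_dvd_mul [T2Space G] [TotallyDisconnectedSpace G] {x : IwasawaAlgebra p G}
    (hx : (p : IwasawaAlgebra p G) ∣ (of p (γ ^ p ^ n) - 1) * x) :
    (p : IwasawaAlgebra p G) ∣ x := by
  classical
  rw [← pow_one (p : IwasawaAlgebra p G), natCast_pow_dvd_iff] at hx ⊢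
  have hx' : ∀ (N : OpenNormalSubgroup G) (q : G ⧸ N.toSubgroup), (p : ℤ_[p]) ∣
      coeff x N (((γ ^ p ^ n : G) : G ⧸ N.toSubgroup)⁻¹ * q)
        - coeff x N q := by
    intro N q
    have := hx N q
    rwa [pow_one, sub_mul, one_mul, coeff_sub, coeff_of_mul] at this
  intro N q
  rw [pow_one]
  -- `u` is a power of `γ` lying in `N` but not in the smaller subgroup `N'`
  obtain ⟨r, hr⟩ := hG.tendsto N
  set u : G := γ ^ p ^ (n + r) with hu
  have huN : u ∈ N.toSubgroup := by
    rw [hu, add_comm, pow_add, pow_mul]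
    exact N.toSubgroup.pow_mem hr _
  obtain ⟨N₁, hN₁⟩ := ProfiniteGrp.exist_openNormalSubgroup_sub_open_nhds_of_one
    (isOpen_compl_singleton (x := u)) (fun h ↦ hG.pow_ne_one _ (Set.mem_singleton_iff.mp h).symm)
  obtain ⟨N', hN', hN'₁⟩ := N.exists_le_inf N₁
  have huN' : u ∉ N'.toSubgroup := fun h ↦ hN₁ (hN'₁ h) rfl
  have := N'.finite_quotient
  let _ := Fintype.ofFinite (G ⧸ N'.toSubgroup)
  rw [← sum_coeff_fiber x hN' q]
  have hmap : ∀ ω : G ⧸ N'.toSubgroup,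
      QuotientGroup.map N'.toSubgroup N.toSubgroup (MonoidHom.id G) hN'
        (((u : G) : G ⧸ N'.toSubgroup) * ω)
      = QuotientGroup.map N'.toSubgroup N.toSubgroup (MonoidHom.id G) hN' ω := by
    intro ω
    rw [map_mul]
    have h1 : QuotientGroup.map N'.toSubgroup N.toSubgroup (MonoidHom.id G) hN' (u : G ⧸ N'.toSubgroup)
        = 1 := (QuotientGroup.eq_one_iff u).mpr huN
    rw [h1, one_mul]
  let Ω := {ω : G ⧸ N'.toSubgroup //
    QuotientGroup.map N'.toSubgroup N.toSubgroup (MonoidHom.id G) hN' ω = q}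
  let σ : Equiv.Perm Ω := (Equiv.mulLeft (u : G ⧸ N'.toSubgroup)).subtypePerm fun ω ↦ by
    rw [Equiv.coe_mulLeft, hmap]
  have hσ : ∀ (m : ℕ) (ω : Ω), ((σ ^ m) ω : G ⧸ N'.toSubgroup) = (u : G ⧸ N'.toSubgroup) ^ m * ω := by
    intro m ω
    induction m with
    | zero => rw [pow_zero, pow_zero, one_mul]; rfl
    | succ m ih =>
      have h1 : ∀ ω : Ω, (σ ω : G ⧸ N'.toSubgroup) = (u : G ⧸ N'.toSubgroup) * ω := fun _ ↦ rfl
      rw [pow_succ', Equiv.Perm.mul_apply, h1, ih, pow_succ', mul_assoc]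
  obtain ⟨r', hr'⟩ := hG.tendsto N'
  have h1 : ∀ (m : ℕ) (ω : G ⧸ N'.toSubgroup), (p : ℤ_[p]) ∣
      coeff x N' (((γ ^ p ^ n : G) : G ⧸ N'.toSubgroup) ^ m * ω) - coeff x N' ω := by
    intro m ω
    induction m with
    | zero => simp
    | succ m ih =>
      have h2 := hx' N' (((γ ^ p ^ n : G) : G ⧸ N'.toSubgroup) ^ (m + 1) * ω)
      rw [pow_succ', mul_assoc, inv_mul_cancel_left, ← mul_assoc, ← pow_succ'] at h2
      have h3 := dvd_sub ih h2
      rwa [sub_sub_sub_cancel_left] at h3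
  have hsum := σ.pow_dvd_sum (p := p) (N := r') (b := 0) ?_ ?_ (k := ℤ_[p] ⧸ Ideal.span {(p : ℤ_[p])})
    (fun ω ↦ Ideal.Quotient.mk _ (coeff x N' ω)) ?_
  · have hp0 : (p : ℤ_[p] ⧸ Ideal.span {(p : ℤ_[p])}) = 0 := by
      rw [← map_natCast (Ideal.Quotient.mk (Ideal.span {(p : ℤ_[p])})),
        Ideal.Quotient.eq_zero_iff_mem]
      exact Ideal.mem_span_singleton_self _
    rw [hp0, zero_add, pow_one, zero_dvd_iff, ← map_sum, Ideal.Quotient.eq_zero_iff_mem,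
      Ideal.mem_span_singleton] at hsum
    rw [Finset.sum_subtype (p := fun ω ↦ QuotientGroup.map N'.toSubgroup N.toSubgroup
      (MonoidHom.id G) hN' ω = q) _ (by simp)]
    exact hsum
  · refine Equiv.ext fun ω ↦ Subtype.ext ?_
    rw [hσ]
    have h2 : ((u : G) : G ⧸ N'.toSubgroup) ^ p ^ r' = 1 := by
      rw [← QuotientGroup.mk_pow, QuotientGroup.eq_one_iff, hu, ← pow_mul, mul_comm, pow_mul]
      exact N'.toSubgroup.pow_mem hr' _
    rw [h2, one_mul]
    rfl
  · intro ω hω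
    have h2 := congrArg Subtype.val hω
    rw [hσ, pow_zero, pow_one, mul_eq_right, QuotientGroup.eq_one_iff] at h2
    exact huN' h2
  · intro ω
    rw [← sub_eq_zero, ← map_sub, Ideal.Quotient.eq_zero_iff_mem, Ideal.mem_span_singleton]
    have h2 := hσ 1 ω
    rw [pow_one, pow_one] at h2
    rw [h2]
    have h3 : ((u : G) : G ⧸ N'.toSubgroup) = ((γ ^ p ^ n : G) : G ⧸ N'.toSubgroup) ^ p ^ r := by
      rw [← QuotientGroup.mk_pow, ← pow_mul, ← pow_add]
    rw [h3]
    exact h1 _ _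

include hn in
/-- `Λ(G)/p` is separated and complete along `γ ^ (p ^ n) - 1`. -/
theorem isAdicAlong_of_sub_one [T2Space G] [TotallyDisconnectedSpace G] {A : Type u} [Ring A]
    {φ : IwasawaAlgebra p G →+* A} (hφ : Function.Surjective φ)
    (hk : ∀ a, φ a = 0 ↔ (p : IwasawaAlgebra p G) ∣ a) :
    IsAdicAlong (φ (of p (γ ^ p ^ n) - 1)) := by
  refine ⟨fun a ↦ ?_, fun a ha ↦ ?_, fun a ha ↦ ?_, fun a ↦ ?_⟩
  · obtain ⟨x, rfl⟩ := hφ a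
    rw [← map_mul, ← map_mul, sub_mul, mul_sub, mul_comm_of_mem_center hn, one_mul, mul_one]
  · obtain ⟨x, rfl⟩ := hφ a
    rw [← map_mul, hk] at ha
    exact (hk x).mpr (natCast_dvd_of_dvd_mul hG ha)
  · obtain ⟨x, rfl⟩ := hφ a
    refine (hk x).mpr (natCast_dvd_of_forall_pow_dvd hG (n := n) fun k ↦ ?_)
    obtain ⟨b, hb⟩ := ha k
    obtain ⟨y, rfl⟩ := hφ b
    exact ⟨y, (hk _).mp (by rw [map_sub φ x, hb, map_mul φ (_ ^ k), map_pow φ (_ - 1), sub_self])⟩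
  · choose b hb using fun i ↦ hφ (a i)
    obtain ⟨s, hs⟩ := exists_sum_pow_mul (of p (γ ^ p ^ n) - 1) b
    refine ⟨φ s, fun k ↦ ?_⟩
    have h1 := map_dvd φ (hs k)
    simpa only [map_sub φ s, map_sum, map_mul φ (_ ^ _), map_pow, hb] using h1

include hn in
/-- Modulo `γ ^ (p ^ n) - 1`, the Iwasawa algebra is spanned over `ℤ_p` by the finitely many elements
`h * γ ^ i` with `i < p ^ n`. -/
theorem exists_eq_sum_add_mul [Fintype H] (x : IwasawaAlgebra p G) :
    ∃ (c : ℕ → H → ℤ_[p]) (y : IwasawaAlgebra p G),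
      x = ∑ i ∈ Finset.range (p ^ n), (∑ h : H, c i h • of p (h : G)) * of p γ ^ i
        + (of p (γ ^ p ^ n) - 1) * y := by
  classical
  have hpn : 0 < p ^ n := pow_pos (Fact.out : p.Prime).pos n
  let F : (Fin (p ^ n) → H → ℤ_[p]) × IwasawaAlgebra p G →ₗ[ℤ_[p]] IwasawaAlgebra p G :=
    { toFun := fun c ↦ ∑ i, (∑ h : H, c.1 i h • of p (h : G)) * of p γ ^ (i : ℕ)
        + (of p (γ ^ p ^ n) - 1) * c.2
      map_add' := fun a b ↦ by
        simp only [Prod.fst_add, Prod.snd_add, Pi.add_apply, add_smul, Finset.sum_add_distrib, add_mul,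
          mul_add]
        abel
      map_smul' := fun r a ↦ by
        simp only [Prod.smul_fst, Prod.smul_snd, Pi.smul_apply, smul_eq_mul, RingHom.id_apply, smul_add,
          mul_smul, ← Finset.smul_sum, smul_mul_assoc, mul_smul_comm] }
  have hF : Continuous F := by
    have h1 : ∀ i h, Continuous fun c : (Fin (p ^ n) → H → ℤ_[p]) × IwasawaAlgebra p G ↦ c.1 i h :=
      fun i h ↦ (continuous_apply h).comp ((continuous_apply i).comp continuous_fst)
    exact Continuous.add (continuous_finsetSum _ fun i _ ↦ Continuous.mul (continuous_finsetSum _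
      fun h _ ↦ (h1 i h).smul continuous_const) continuous_const)
      (continuous_const.mul continuous_snd)
  have hgen : ∀ h ∈ H, ∀ j : ℕ, of p (h * γ ^ j) ∈ LinearMap.range F := by
    intro h hh j
    obtain ⟨y, hy⟩ : ∃ y, of p ((γ ^ p ^ n) ^ (j / p ^ n)) - 1 = (of p (γ ^ p ^ n) - 1) * y :=
      ⟨_, by rw [map_pow, mul_geom_sum]⟩
    refine ⟨(fun i h' ↦ if (i : ℕ) = j % p ^ n ∧ (h' : G) = h then 1 else 0,
      y * of p (h * γ ^ (j % p ^ n))), ?_⟩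
    change ∑ i : Fin (p ^ n), (∑ h' : H, (if (i : ℕ) = j % p ^ n ∧ (h' : G) = h then (1 : ℤ_[p]) else 0)
      • of p (h' : G)) * of p γ ^ (i : ℕ) + (of p (γ ^ p ^ n) - 1) * (y * of p (h * γ ^ (j % p ^ n))) = _
    rw [Finset.sum_eq_single (⟨j % p ^ n, Nat.mod_lt j hpn⟩ : Fin (p ^ n)),
      Finset.sum_eq_single (⟨h, hh⟩ : H)]
    · rw [if_pos ⟨rfl, rfl⟩, one_smul, ← mul_assoc, ← hy, sub_mul, one_mul, ← map_pow, ← map_mul,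
        add_sub_cancel, ← map_mul, (Subgroup.mem_center_iff.mp
        ((Subgroup.center G).pow_mem hn (j / p ^ n)) _).symm, mul_assoc, ← pow_mul, ← pow_add, Nat.mod_add_div]
    · intro h' _ hne
      rw [if_neg fun H' ↦ hne (Subtype.ext H'.2), zero_smul]
    · simp
    · intro i _ hne
      rw [Finset.sum_eq_zero, zero_mul]
      intro h' _
      rw [if_neg fun H' ↦ hne (Fin.ext H'.1), zero_smul]
    · simp
  have htop : LinearMap.range F = ⊤ := by
    refine eq_top_of_isClosed ?_ fun N g ↦ ?_
    · rw [LinearMap.coe_range]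
      exact (isCompact_range hF).isClosed
    · obtain ⟨h, hh, j, hj⟩ := hG.dense N g
      exact ⟨_, hj, hgen h hh j⟩
  obtain ⟨⟨c, y⟩, hc⟩ : x ∈ LinearMap.range F := htop ▸ Submodule.mem_top
  refine ⟨fun i h ↦ if hi : i < p ^ n then c ⟨i, hi⟩ h else 0, y, ?_⟩
  rw [← hc, Finset.sum_range]
  simp only [Fin.is_lt, dite_true, Fin.eta]
  rfl

end Augmentation

omit [IsTopologicalGroup G] [CompactSpace G] in
theorem ofSubgroup_of (K : Subgroup G) (g : K) : ofSubgroup p K (of p g) = of p (g : G) := by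
  refine Subtype.ext (funext fun N ↦ ?_)
  change MonoidAlgebra.mapDomainAlgHom ℤ_[p] ℤ_[p] _ (MonoidAlgebra.of ℤ_[p] _ _) = _
  rw [MonoidAlgebra.of_apply, MonoidAlgebra.mapDomainAlgHom_apply, MonoidAlgebra.mapDomain_single]
  rfl

omit [CompactSpace G] in
theorem continuous_ofSubgroup (K : Subgroup G) [CompactSpace K] : Continuous (ofSubgroup p K) := by
  classical
  refine continuous_of_coeff fun N q ↦ ?_
  have := (restrictOpenNormal K N).finite_quotient
  let _ := Fintype.ofFinite (K ⧸ (restrictOpenNormal K N).toSubgroup)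
  have h1 : ∀ x : IwasawaAlgebra p K, coeff (ofSubgroup p K x) N q = _ := fun x ↦
    coeff_mapDomain (QuotientGroup.map (restrictOpenNormal K N).toSubgroup N.toSubgroup K.subtype
      (fun _ hy ↦ hy)) (x.1 (restrictOpenNormal K N)) q
  simp only [h1]
  exact continuous_finsetSum _ fun r _ ↦ continuous_coeff _ _

/-- `Λ(G)` is finitely generated over the Iwasawa algebra of a subgroup containing `γ ^ (p ^ n)`. -/
theorem exists_eq_sum_ofSubgroup {H : Subgroup G} {γ : G} (hG : IsGenOver p H γ) {n : ℕ} [Fintype H]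
    (hn : γ ^ p ^ n ∈ Subgroup.center G)
    (K : Subgroup G) [CompactSpace K] (hK : γ ^ p ^ n ∈ K) (x : IwasawaAlgebra p G) :
    ∃ c : Fin (p ^ n) → H → IwasawaAlgebra p K,
      x = ∑ i, ∑ h : H, ofSubgroup p K (c i h) * of p ((h : G) * γ ^ (i : ℕ)) := by
  classical
  have hpn : 0 < p ^ n := pow_pos (Fact.out : p.Prime).pos n
  let F : (Fin (p ^ n) → H → IwasawaAlgebra p K) →ₗ[ℤ_[p]] IwasawaAlgebra p G :=
    { toFun := fun c ↦ ∑ i, ∑ h : H, ofSubgroup p K (c i h) * of p ((h : G) * γ ^ (i : ℕ))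
      map_add' := fun a b ↦ by
        simp only [Pi.add_apply, map_add, Finset.sum_add_distrib, add_mul]
      map_smul' := fun r a ↦ by
        simp only [Pi.smul_apply, map_smul, RingHom.id_apply, Finset.smul_sum, smul_mul_assoc] }
  have hF : Continuous F := by
    have h1 : ∀ i h, Continuous fun c : Fin (p ^ n) → H → IwasawaAlgebra p K ↦ c i h :=
      fun i h ↦ (continuous_apply h).comp (continuous_apply i)
    have h2 : ∀ i h, Continuous fun c : Fin (p ^ n) → H → IwasawaAlgebra p K ↦
        ofSubgroup p K (c i h) * of p ((h : G) * γ ^ (i : ℕ)) := fun i h ↦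
      ((continuous_ofSubgroup K).comp (h1 i h)).mul continuous_const
    change Continuous fun c : Fin (p ^ n) → H → IwasawaAlgebra p K ↦
      ∑ i, ∑ h : H, ofSubgroup p K (c i h) * of p ((h : G) * γ ^ (i : ℕ))
    exact continuous_finsetSum _ fun i _ ↦ continuous_finsetSum _ fun h _ ↦ h2 i h
  have hgen : ∀ h ∈ H, ∀ j : ℕ, of p (h * γ ^ j) ∈ LinearMap.range F := by
    intro h hh j
    refine ⟨fun i h' ↦ if (i : ℕ) = j % p ^ n ∧ (h' : G) = h then of p (⟨γ ^ p ^ n, hK⟩ ^ (j / p ^ n))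
      else 0, ?_⟩
    change ∑ i : Fin (p ^ n), ∑ h' : H, ofSubgroup p K (if (i : ℕ) = j % p ^ n ∧ (h' : G) = h
      then of p (⟨γ ^ p ^ n, hK⟩ ^ (j / p ^ n)) else 0) * of p ((h' : G) * γ ^ (i : ℕ)) = _
    rw [Finset.sum_eq_single (⟨j % p ^ n, Nat.mod_lt j hpn⟩ : Fin (p ^ n)),
      Finset.sum_eq_single (⟨h, hh⟩ : H)]
    · rw [if_pos ⟨rfl, rfl⟩, ofSubgroup_of, ← map_mul]
      change of p ((γ ^ p ^ n) ^ (j / p ^ n) * (h * γ ^ (j % p ^ n))) = _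
      rw [(Subgroup.mem_center_iff.mp ((Subgroup.center G).pow_mem hn (j / p ^ n)) _).symm, mul_assoc,
        ← pow_mul, ← pow_add, Nat.mod_add_div]
    · intro h' _ hne
      rw [if_neg fun H' ↦ hne (Subtype.ext H'.2), map_zero, zero_mul]
    · simp
    · intro i _ hne
      refine Finset.sum_eq_zero fun h' _ ↦ ?_
      rw [if_neg fun H' ↦ hne (Fin.ext H'.1), map_zero, zero_mul]
    · simp
  have htop : LinearMap.range F = ⊤ := by
    refine eq_top_of_isClosed ?_ fun N g ↦ ?_
    · rw [LinearMap.coe_range]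
      exact (isCompact_range hF).isClosed
    · obtain ⟨h, hh, j, hj⟩ := hG.dense N g
      exact ⟨_, hj, hgen h hh j⟩
  obtain ⟨c, hc⟩ : x ∈ LinearMap.range F := htop ▸ Submodule.mem_top
  exact ⟨c, hc.symm⟩

end IwasawaAlgebra

/-! ### Irreducible characters of finite groups -/

section FiniteCharacters

variable {K : Type*} [Field K] {H : Type*} [Group H]

/-- `x` is the character of an irreducible representation of degree `n` of the group `H` over `K`. -/
def IsIrredTrace (n : ℕ) (x : H → K) : Prop :=
  ∃ ρ : Representation K H (Fin n → K), ρ.IsIrreducible ∧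
    ∀ h, x h = LinearMap.trace K (Fin n → K) (ρ h)

/-- Schur's lemma. -/
theorem Representation.IsIrreducible.exists_eq_smul_one [IsAlgClosed K] {V : Type*} [AddCommGroup V]
    [Module K V] [FiniteDimensional K V] {ρ : Representation K H V} (hρ : ρ.IsIrreducible)
    (Z : Module.End K V) (hZ : ∀ h, ρ h * Z = Z * ρ h) : ∃ c : K, Z = c • 1 := by
  have := hρ
  obtain ⟨c, hc⟩ :=
    (Representation.IsIrreducible.algebraMap_intertwiningMap_bijective_of_isAlgClosed
      (ρ := ρ)).2 (Z.intertwiningMap_of_isIntertwiningMap ρ ρ fun g v ↦ (LinearMap.congr_fun (hZ g) v).symm)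
  refine ⟨c, ?_⟩
  have := congrArg Representation.IntertwiningMap.toLinearMap hc
  rw [Algebra.algebraMap_eq_smul_one, Representation.IntertwiningMap.toLinearMap_smul] at this
  exact this.symm

/-- Irreducibility is preserved by a semilinear change of coordinates together with a surjective
change of groups. -/
theorem Representation.IsIrreducible.of_semilinear {H' : Type*} [Group H'] {V V' : Type*}
    [AddCommGroup V] [Module K V] [AddCommGroup V'] [Module K V'] {ρ : Representation K H V}
    {ρ' : Representation K H' V'} (hρ : ρ.IsIrreducible) (σ : K ≃+* K) (s : V ≃+ V')
    (hs : ∀ (c : K) v, s (c • v) = σ c • s v) (θ : H' → H) (hθ : Function.Surjective θ)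
    (h : ∀ g v, s (ρ (θ g) v) = ρ' g (s v)) : ρ'.IsIrreducible := by
  let pull : Subrepresentation ρ' → Subrepresentation ρ := fun W ↦
    { toSubmodule :=
        { carrier := {v | s v ∈ W.toSubmodule}
          add_mem' := fun {a b} ha hb ↦ by
            simpa only [Set.mem_ofPred_eq, map_add] using W.toSubmodule.add_mem ha hb
          zero_mem' := by simp
          smul_mem' := fun c v hv ↦ by
            simpa only [Set.mem_ofPred_eq, hs] using W.toSubmodule.smul_mem _ hv }
      apply_mem_toSubmodule := fun g v hv ↦ by
        obtain ⟨g, rfl⟩ := hθ g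
        change s (ρ (θ g) v) ∈ W.toSubmodule
        rw [h]
        exact W.apply_mem_toSubmodule g hv }
  have hpull : ∀ W v, v ∈ (pull W).toSubmodule ↔ s v ∈ W.toSubmodule := fun _ _ ↦ Iff.rfl
  have hbot : (⊥ : Subrepresentation ρ').toSubmodule = ⊥ := rfl
  have htop : (⊤ : Subrepresentation ρ').toSubmodule = ⊤ := rfl
  have hbot' : (⊥ : Subrepresentation ρ).toSubmodule = ⊥ := rfl
  have htop' : (⊤ : Subrepresentation ρ).toSubmodule = ⊤ := rfl
  refine { exists_pair_ne := ⟨⊥, ⊤, fun hbt ↦ ?_⟩, eq_bot_or_eq_top := fun W ↦ ?_ }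
  · refine hρ.exists_pair_ne.elim fun _ _ ↦ (bot_ne_top (α := Subrepresentation ρ)) ?_
    refine Subrepresentation.toSubmodule_injective ?_
    ext v
    have h1 : s v ∈ (⊥ : Subrepresentation ρ').toSubmodule := by
      rw [hbt, htop]; trivial
    rw [hbot, Submodule.mem_bot] at h1
    rw [hbot', htop', (map_eq_zero_iff s s.injective).mp h1]
    simp
  · rcases hρ.eq_bot_or_eq_top (pull W) with h1 | h1
    · left
      refine Subrepresentation.toSubmodule_injective ?_
      rw [hbot, eq_bot_iff]
      intro v hv
      have h2 : s.symm v ∈ (pull W).toSubmodule := by rw [hpull]; simpa using hv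
      rw [h1, hbot', Submodule.mem_bot] at h2
      rw [Submodule.mem_bot]
      simpa using h2
    · right
      refine Subrepresentation.toSubmodule_injective ?_
      rw [htop, eq_top_iff]
      intro v _
      have h2 : s.symm v ∈ (pull W).toSubmodule := by rw [h1, htop']; trivial
      rw [hpull] at h2
      simpa using h2

namespace IsIrredTrace

variable {n : ℕ} {x : H → K}

theorem apply_one (hx : IsIrredTrace n x) : x 1 = n := by
  obtain ⟨ρ, -, h⟩ := hx
  rw [h, map_one, LinearMap.trace_one, Module.finrank_fin_fun]

theorem mul_comm (hx : IsIrredTrace n x) (g h : H) : x (g * h) = x (h * g) := by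
  obtain ⟨ρ, -, hρ⟩ := hx
  rw [hρ, hρ, map_mul ρ, map_mul ρ, LinearMap.trace_mul_comm]

theorem pos (hx : IsIrredTrace n x) : 0 < n := by
  obtain ⟨ρ, hρ, -⟩ := hx
  rcases Nat.eq_zero_or_pos n with rfl | h
  · obtain ⟨a, b, hab⟩ := hρ.exists_pair_ne
    exact (hab (Subrepresentation.toSubmodule_injective (Subsingleton.elim _ _))).elim
  · exact h

theorem comp_mulEquiv (hx : IsIrredTrace n x) (θ : H ≃* H) : IsIrredTrace n (x ∘ θ) := by
  obtain ⟨ρ, hρ, h⟩ := hx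
  exact ⟨ρ.comp θ.toMonoidHom, hρ.of_semilinear (RingEquiv.refl K) (AddEquiv.refl _)
    (fun _ _ ↦ rfl) θ θ.surjective fun _ _ ↦ rfl, fun g ↦ h (θ g)⟩

/-- A field automorphism maps irreducible characters to irreducible characters, by its action on the
entries of matrices. -/
theorem map_ringEquiv (hx : IsIrredTrace n x) (σ : K ≃+* K) : IsIrredTrace n (σ ∘ x) := by
  obtain ⟨ρ, hρ, h⟩ := hx
  let E : Matrix (Fin n) (Fin n) K ≃ₐ[K] Module.End K (Fin n → K) := Matrix.toLinAlgEquiv'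
  let ρ' : Representation K H (Fin n → K) :=
    E.toAlgHom.toMonoidHom.comp (((σ.toRingHom.mapMatrix :
      Matrix (Fin n) (Fin n) K →+* _).toMonoidHom).comp (E.symm.toAlgHom.toMonoidHom.comp ρ))
  have hρ' : ∀ g, ρ' g = E ((E.symm (ρ g)).map σ) := fun g ↦ rfl
  have key : ∀ g v, σ ∘ (ρ g v) = ρ' g (σ ∘ v) := by
    intro g v
    obtain ⟨M, hM⟩ := E.surjective (ρ g)
    rw [hρ', ← hM, E.symm_apply_apply]
    change σ ∘ (M.mulVec v) = (M.map σ).mulVec (σ ∘ v)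
    ext i
    simp only [Function.comp_apply, Matrix.mulVec, dotProduct, map_sum, map_mul, Matrix.map_apply]
  refine ⟨ρ', hρ.of_semilinear σ
    (AddEquiv.piCongrRight fun _ ↦ σ.toAddEquiv) ?_ id Function.surjective_id key, fun g ↦ ?_⟩
  · intro c v
    ext i
    exact map_mul σ c (v i)
  · have htr : ∀ M : Matrix (Fin n) (Fin n) K,
        LinearMap.trace K (Fin n → K) (E M) = M.trace := fun M ↦ Matrix.trace_toLin'_eq M
    obtain ⟨M, hM⟩ := E.surjective (ρ g)
    rw [Function.comp_apply, h, hρ', ← hM, E.symm_apply_apply, htr, htr, Matrix.trace,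
      Matrix.trace, map_sum]
    rfl

variable [IsAlgClosed K] [CharZero K] [Fintype H]

/-- The orthogonality relation for two different irreducible characters, whose degrees may differ. -/
theorem sum_mul_inv (hx : IsIrredTrace n x) {m : ℕ} {y : H → K} (hy : IsIrredTrace m y)
    (hxy : x ≠ y) : ∑ h, x h * y h⁻¹ = 0 := by
  obtain ⟨ρ, hρ, h⟩ := hx
  obtain ⟨σ, hσ, h'⟩ := hy
  have hc : (Nat.card H : K) ≠ 0 := Nat.cast_ne_zero.mpr Nat.card_pos.ne'
  let := invertibleOfNonzero hc
  have key := Representation.char_orthonormal ρ σ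
  rw [if_neg] at key
  · rw [mul_eq_zero] at key
    have := key.resolve_left (by simp)
    refine Eq.trans (Finset.sum_congr rfl fun g _ ↦ ?_) this
    rw [h, h']
    rfl
  · rintro ⟨e⟩
    refine hxy (funext fun g ↦ ?_)
    rw [h, h']
    exact (congrFun (Representation.char_iso e) g).symm

/-- The orthogonality relation for one irreducible character. -/
theorem sum_mul_inv_self (hx : IsIrredTrace n x) : ∑ h, x h * x h⁻¹ = Fintype.card H := by
  obtain ⟨ρ, hρ, h⟩ := hx
  have hc : (Nat.card H : K) ≠ 0 := Nat.cast_ne_zero.mpr Nat.card_pos.ne'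
  let := invertibleOfNonzero hc
  have key := Representation.char_orthonormal ρ ρ
  rw [if_pos ⟨Representation.Equiv.refl ρ⟩, inv_mul_eq_one₀ hc,
    Nat.card_eq_fintype_card] at key
  rw [key]
  refine Finset.sum_congr rfl fun g _ ↦ ?_
  rw [h, h]
  rfl

omit [IsAlgClosed K] [CharZero K] in
/-- A class function gives an operator commuting with the representation. -/
theorem _root_.Representation.mul_sum_smul_comm {V : Type*} [AddCommGroup V]
    [Module K V] (ρ : Representation K H V) {f : H → K} (hf : ∀ g h, f (g * h) = f (h * g)) (g : H) :
    ρ g * ∑ k, f k • ρ k⁻¹ = (∑ k, f k • ρ k⁻¹) * ρ g := by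
  rw [Finset.mul_sum, Finset.sum_mul]
  refine Fintype.sum_equiv (MulAut.conj g).toEquiv _ _ fun k ↦ ?_
  change _ = f (g * k * g⁻¹) • ρ (g * k * g⁻¹)⁻¹ * ρ g
  rw [mul_smul_comm, smul_mul_assoc, ← map_mul, ← map_mul, hf]
  have h1 : f (g⁻¹ * (g * k)) = f k := by rw [inv_mul_cancel_left]
  have h2 : (g * k * g⁻¹)⁻¹ * g = g * k⁻¹ := by group
  rw [h1, h2]

/-- Convolution of a class function with an irreducible character. -/
theorem sum_mul_inv_mul (hx : IsIrredTrace n x) {f : H → K} (hf : ∀ g h, f (g * h) = f (h * g))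
    (h : H) : ∑ k, f k * x (k⁻¹ * h) = (∑ k, f k * x k⁻¹) / n * x h := by
  obtain ⟨ρ, hρ, hxρ⟩ := id hx
  obtain ⟨c, hc⟩ := hρ.exists_eq_smul_one (∑ k, f k • ρ k⁻¹) (ρ.mul_sum_smul_comm hf)
  have h1 : ∀ h, ∑ k, f k * x (k⁻¹ * h) = c * x h := by
    intro h
    have := congrArg (fun z ↦ LinearMap.trace K (Fin n → K) (z * ρ h)) hc
    simp only [Finset.sum_mul, map_sum, smul_mul_assoc, map_smul, one_mul, smul_eq_mul,
      ← map_mul, ← hxρ] at this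
    exact this
  have h2 := h1 1
  simp only [mul_one, hx.apply_one] at h2
  rw [h1, h2, mul_div_cancel_right₀ _ (Nat.cast_ne_zero.mpr hx.pos.ne')]

end IsIrredTrace

end FiniteCharacters

/-! ### Traces of operators of finite order -/

section TracesOfFiniteOrder

variable {K : Type*} [Field K] {V : Type*} [AddCommGroup V] [Module K V] [FiniteDimensional K V]

theorem IsPrimitiveRoot.sum_pow_inv_mul {N : ℕ} {ζ : K} (hζ : IsPrimitiveRoot ζ N) {l : ℕ}
    (hl : l < N) : ∑ j ∈ Finset.range N, (ζ⁻¹ ^ l) ^ j = if l = 0 then (N : K) else 0 := by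
  split_ifs with h
  · subst h
    simp
  · have h1 : ζ⁻¹ ^ l ≠ 1 := hζ.inv.pow_ne_one_of_pos_of_lt h hl
    have h2 := geom_sum_mul (ζ⁻¹ ^ l) N
    rw [← pow_mul, mul_comm l, pow_mul, hζ.inv.pow_eq_one, one_pow, sub_self] at h2
    exact (mul_eq_zero.mp h2).resolve_right (sub_ne_zero.mpr h1)

/-- The traces of the powers of an operator of finite order are given by the multiplicities of its
eigenvalues. -/
theorem LinearMap.exists_trace_pow_eq [CharZero K] {N : ℕ} (hN : N ≠ 0) {ζ : K}
    (hζ : IsPrimitiveRoot ζ N) {B : Module.End K V} (hB : B ^ N = 1) :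
    ∃ t : ℕ → ℕ, ∀ k, LinearMap.trace K V (B ^ k) =
      ∑ j ∈ Finset.range N, (t j : K) * (ζ ^ k) ^ j := by
  have hN' : (N : K) ≠ 0 := Nat.cast_ne_zero.mpr hN
  have hζ0 : ζ ≠ 0 := hζ.ne_zero hN
  -- the projections onto the eigenspaces
  let P : ℕ → Module.End K V := fun j ↦
    (N : K)⁻¹ • ∑ l ∈ Finset.range N, ((ζ⁻¹ ^ j) ^ l) • B ^ l
  have hper : ∀ j, (ζ⁻¹ ^ j) ^ N = 1 := fun j ↦ by
    rw [← pow_mul, mul_comm, pow_mul, hζ.inv.pow_eq_one, one_pow]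
  have hBP : ∀ j, B * P j = ζ ^ j • P j := by
    intro j
    have h1 : ζ⁻¹ ^ j • (B * P j) = P j := by
      simp only [P, mul_smul_comm, Finset.mul_sum]
      rw [smul_comm, Finset.smul_sum]
      congr 1
      have h2 := Finset.sum_range_succ' (fun l ↦ ((ζ⁻¹ ^ j) ^ l) • B ^ l) N
      rw [Finset.sum_range_succ, hB, hper, pow_zero, pow_zero, add_left_inj] at h2
      rw [h2]
      refine Finset.sum_congr rfl fun l _ ↦ ?_
      rw [smul_smul, ← pow_succ', ← pow_succ']
    rw [← h1, smul_smul, ← mul_pow, mul_inv_cancel₀ hζ0, one_pow, one_smul, h1]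
  have hBkP : ∀ j k, B ^ k * P j = (ζ ^ k) ^ j • P j := by
    intro j k
    induction k with
    | zero => simp
    | succ k ih =>
      rw [pow_succ, mul_assoc, hBP, mul_smul_comm, ih, smul_smul, ← pow_mul, ← pow_mul, ← pow_add]
      congr 2
      ring
  have hPid : ∀ j, IsIdempotentElem (P j) := by
    intro j
    have h1 : P j * P j = (N : K)⁻¹ • ∑ l ∈ Finset.range N, ((ζ⁻¹ ^ j) ^ l) • (B ^ l * P j) := by
      conv_lhs => enter [1]; unfold P
      rw [smul_mul_assoc, Finset.sum_mul]
      simp only [smul_mul_assoc]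
    have h2 : ∀ l, ((ζ⁻¹ ^ j) ^ l) • (B ^ l * P j) = P j := by
      intro l
      rw [hBkP, smul_smul, ← pow_mul, ← pow_mul, mul_comm j l, ← mul_pow, inv_mul_cancel₀ hζ0,
        one_pow, one_smul]
    rw [IsIdempotentElem, h1]
    simp only [h2]
    rw [Finset.sum_const, Finset.card_range, ← Nat.cast_smul_eq_nsmul K, smul_smul,
      inv_mul_cancel₀ hN', one_smul]
  have hsum : ∑ j ∈ Finset.range N, P j = 1 := by
    simp only [P]
    rw [← Finset.smul_sum, Finset.sum_comm]
    have h1 : ∀ l ∈ Finset.range N, ∑ j ∈ Finset.range N, ((ζ⁻¹ ^ j) ^ l) • B ^ l =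
        (if l = 0 then (N : K) else 0) • B ^ l := by
      intro l hl
      rw [← hζ.sum_pow_inv_mul (Finset.mem_range.mp hl), Finset.sum_smul]
      refine Finset.sum_congr rfl fun j _ ↦ ?_
      rw [← pow_mul, ← pow_mul, mul_comm]
    rw [Finset.sum_congr rfl h1]
    simp only [ite_smul, zero_smul]
    rw [Finset.sum_ite_eq' (Finset.range N) 0 (fun l ↦ (N : K) • B ^ l),
      if_pos (Finset.mem_range.mpr (Nat.pos_of_ne_zero hN)), smul_smul, inv_mul_cancel₀ hN',
      one_smul, pow_zero]
  choose t ht using fun j ↦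
    (⟨_, (LinearMap.IsIdempotentElem.isProj_range _ (hPid j)).trace⟩ :
      ∃ t : ℕ, LinearMap.trace K V (P j) = t)
  refine ⟨t, fun k ↦ ?_⟩
  have h3 : B ^ k = ∑ j ∈ Finset.range N, (ζ ^ k) ^ j • P j := by
    rw [← mul_one (B ^ k), ← hsum, Finset.mul_sum]
    exact Finset.sum_congr rfl fun j _ ↦ hBkP j k
  rw [h3, map_sum]
  refine Finset.sum_congr rfl fun j _ ↦ ?_
  rw [map_smul, ht, smul_eq_mul, mul_comm]

/-- A field automorphism acts on all traces of operators of order dividing `N` through one power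
map. -/
theorem exists_coprime_map_trace_eq [IsAlgClosed K] [CharZero K] (N : ℕ) [NeZero N] (σ : K ≃+* K) :
    ∃ m : ℕ, m.Coprime N ∧ ∀ (d : ℕ) (B : Module.End K (Fin d → K)), B ^ N = 1 →
      σ (LinearMap.trace K (Fin d → K) B) = LinearMap.trace K (Fin d → K) (B ^ m) := by
  obtain ⟨ζ, hζ⟩ := HasEnoughRootsOfUnity.exists_primitiveRoot K N
  obtain ⟨m, -, hm, h⟩ := hζ.isPrimitiveRoot_iff.mp (hζ.map_of_injective (f := σ) σ.injective)
  refine ⟨m, hm, fun d B hB ↦ ?_⟩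
  obtain ⟨t, ht⟩ := LinearMap.exists_trace_pow_eq (NeZero.ne N) hζ hB
  have h1 := ht 1
  rw [pow_one] at h1
  rw [h1, ht, map_sum]
  refine Finset.sum_congr rfl fun j _ ↦ ?_
  rw [map_mul, map_natCast, map_pow, pow_one, h]

end TracesOfFiniteOrder

/-! ### Integrality of characters and central characters -/

section Norms

variable {K : Type*} [NormedField K] [IsUltrametricDist K]

omit [IsUltrametricDist K] in
theorem norm_le_one_of_pow_eq_self {r : K} {m : ℕ} (hm : m ≠ 0) (h : r ^ (m + 1) = r) : ‖r‖ ≤ 1 := by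
  by_cases hr : r = 0
  · simp [hr]
  · rw [pow_succ, mul_eq_right₀ hr] at h
    exact (le_antisymm_iff.mp ((pow_eq_one_iff_of_nonneg (norm_nonneg r) hm).mp
      (by rw [← norm_pow, h, norm_one]))).1

/-- The trace is integral because the eigenvalues are zero or roots of unity. -/
theorem norm_trace_le_one_of_pow_eq [IsAlgClosed K] {V : Type*} [AddCommGroup V] [Module K V]
    [FiniteDimensional K V] {m : ℕ} (hm : m ≠ 0) {B : Module.End K V} (h : B ^ (m + 1) = B) :
    ‖LinearMap.trace K V B‖ ≤ 1 := by
  rw [Module.End.trace_eq_sum_roots_charpoly_of_splits (IsAlgClosed.splits _)]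
  refine Multiset.sum_induction (fun r : K ↦ ‖r‖ ≤ 1) _ ?_ (by simp) ?_
  · intro a b ha hb
    exact (IsUltrametricDist.norm_add_le_max a b).trans (max_le ha hb)
  · intro r hr
    have hr' := (Module.End.hasEigenvalue_iff_isRoot_charpoly B r).mpr
      (Polynomial.isRoot_of_mem_roots hr)
    obtain ⟨v, hv⟩ := hr'.exists_hasEigenvector
    refine norm_le_one_of_pow_eq_self hm ?_
    have h1 := hv.pow_apply (m + 1)
    rw [h, hv.apply_eq_smul] at h1
    exact (smul_left_injective K hv.2 h1).symm

omit [IsUltrametricDist K] in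
/-- An element whose powers have a common denominator is integral. -/
theorem norm_le_one_of_forall_mul_pow_le {c r : K} (hc : c ≠ 0) (h : ∀ k : ℕ, ‖c * r ^ k‖ ≤ 1) :
    ‖r‖ ≤ 1 := by
  by_contra! hr
  have h1 := tendsto_pow_atTop_atTop_of_one_lt hr
  obtain ⟨k, hk⟩ := (h1.eventually_gt_atTop (‖c‖⁻¹)).exists
  have h2 := h k
  rw [norm_mul, norm_pow] at h2
  have h3 : 0 < ‖c‖ := norm_pos_iff.mpr hc
  have := mul_lt_mul_of_pos_left hk h3
  rw [mul_inv_cancel₀ h3.ne'] at this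
  linarith

variable [IsAlgClosed K] {H : Type*} [Group H] [Fintype H] {n : ℕ} {x : H → K}

theorem IsIrredTrace.norm_le_one (hx : IsIrredTrace n x) (h : H) : ‖x h‖ ≤ 1 := by
  obtain ⟨ρ, -, hρ⟩ := hx
  rw [hρ]
  refine norm_trace_le_one_of_pow_eq (m := Fintype.card H) Fintype.card_ne_zero ?_
  rw [← map_pow, pow_succ, pow_card_eq_one, one_mul]

/-- The central character of a class function with integral values is integral. -/
theorem IsIrredTrace.norm_sum_div_le_one [CharZero K] (hx : IsIrredTrace n x) {f : H → K}
    (hf : ∀ g h, f (g * h) = f (h * g)) (hf1 : ∀ h, ‖f h‖ ≤ 1) :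
    ‖(∑ k, f k * x k⁻¹) / n‖ ≤ 1 := by
  set ω := (∑ k, f k * x k⁻¹) / n with hω
  refine norm_le_one_of_forall_mul_pow_le (c := (n : K)) (Nat.cast_ne_zero.mpr hx.pos.ne') ?_
  -- convolution with `f` preserves integrality and multiplies `x` by `ω`
  have h1 : ∀ (j : ℕ) h, ‖x h * ω ^ j‖ ≤ 1 := by
    intro j
    induction j with
    | zero => simpa using hx.norm_le_one
    | succ j ih =>
      intro h
      have h2 : x h * ω ^ (j + 1) = ∑ k, f k * (x (k⁻¹ * h) * ω ^ j) := by
        simp only [← mul_assoc]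
        rw [← Finset.sum_mul, hx.sum_mul_inv_mul hf, ← hω]
        ring
      rw [h2]
      refine IsUltrametricDist.norm_sum_le_of_forall_le_of_nonneg zero_le_one fun k _ ↦ ?_
      rw [norm_mul]
      exact mul_le_one₀ (hf1 k) (norm_nonneg _) (ih _)
  intro j
  rw [← hx.apply_one]
  exact h1 j 1

/-- The degree of an irreducible character divides the order of the group, locally. -/
theorem IsIrredTrace.norm_card_le [CharZero K] (hx : IsIrredTrace n x) :
    ‖(Fintype.card H : K)‖ ≤ ‖(n : K)‖ := by
  have h1 := hx.norm_sum_div_le_one hx.mul_comm hx.norm_le_one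
  rwa [hx.sum_mul_inv_self, norm_div, div_le_one₀
    (norm_pos_iff.mpr (Nat.cast_ne_zero.mpr hx.pos.ne'))] at h1

end Norms

/-! ### Clifford's theorem -/

section Clifford

variable {K : Type*} [Field K] [IsAlgClosed K] [CharZero K] {G : Type*} [Group G] {H : Subgroup G}
  [H.Normal] [Fintype H]

/-- The operator `∑ f(k) ρ(k⁻¹)` attached to a function `f` on the subgroup `H`. -/
def Representation.sumOp {V : Type*} [AddCommGroup V] [Module K V] (ρ : Representation K G V)
    (f : H → K) : Module.End K V := ∑ k : H, f k • ρ (k : G)⁻¹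

variable {d : ℕ} {ρ : Representation K G (Fin d → K)}

omit [IsAlgClosed K] [CharZero K] [H.Normal] in
theorem Representation.trace_mul_sumOp (f : H → K) (h : G) :
    LinearMap.trace K _ (ρ h * ρ.sumOp f) =
      ∑ k : H, f k * LinearMap.trace K _ (ρ (h * (k : G)⁻¹)) := by
  simp only [Representation.sumOp, Finset.mul_sum, mul_smul_comm, ← map_mul ρ, map_sum, map_smul,
    smul_eq_mul]

omit [IsAlgClosed K] [CharZero K] in
theorem Representation.mul_sumOp (f : H → K) (g : G) :
    ρ g * ρ.sumOp f = ρ.sumOp (f ∘ MulAut.conjNormal g⁻¹) * ρ g := by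
  simp only [Representation.sumOp, Finset.mul_sum, Finset.sum_mul]
  refine Fintype.sum_equiv (MulAut.conjNormal g).toEquiv _ _ fun k ↦ ?_
  rw [mul_smul_comm, smul_mul_assoc, ← map_mul, ← map_mul]
  congr 2
  · simp
  · simp [mul_assoc]

omit [H.Normal] in
/-- On the operator of an irreducible character, the operator of a class function acts through the
central character. -/
theorem IsIrredTrace.sumOp_mul {n : ℕ} {x : H → K} (hx : IsIrredTrace n x) {f : H → K}
    (hf : ∀ g h, f (g * h) = f (h * g)) :
    ρ.sumOp f * ρ.sumOp x = ((∑ k, f k * x k⁻¹) / n) • ρ.sumOp x := by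
  have h1 : ρ.sumOp f * ρ.sumOp x = ∑ m : H, (∑ k, f k * x (k⁻¹ * m)) • ρ (m : G)⁻¹ := by
    simp only [Representation.sumOp, Finset.sum_smul]
    rw [Finset.sum_comm, Finset.sum_mul_sum]
    refine Finset.sum_congr rfl fun k _ ↦ ?_
    refine Fintype.sum_equiv (Equiv.mulRight k) _ _ fun l ↦ ?_
    rw [Equiv.coe_mulRight, hx.mul_comm, mul_assoc, mul_inv_cancel, mul_one, smul_mul_smul_comm,
      ← map_mul]
    simp
  rw [h1, Representation.sumOp, Finset.smul_sum]
  refine Finset.sum_congr rfl fun m _ ↦ ?_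
  rw [hx.sum_mul_inv_mul hf, mul_smul]

/-- Clifford's theorem: the restriction of an irreducible character to a finite normal subgroup is a
rational multiple of the sum over the orbit of any of its constituents. -/
theorem Representation.IsIrreducible.clifford (hρ : ρ.IsIrreducible) {n : ℕ} {η : H → K}
    (hη : IsIrredTrace n η)
    (hc : ∑ h : H, LinearMap.trace K _ (ρ (h : G)) * η h⁻¹ ≠ 0) (C : Finset (H → K))
    (hC : ∀ y, y ∈ C ↔ ∃ g : G, y = η ∘ MulAut.conjNormal g) :
    (∀ (m : ℕ) (y : H → K), IsIrredTrace m y →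
      (∑ h : H, LinearMap.trace K _ (ρ (h : G)) * y h⁻¹ ≠ 0 ↔ y ∈ C)) ∧
    (d / (n * C.card) : ℚ) ≠ 0 ∧
    (∀ h : H, LinearMap.trace K _ (ρ (h : G)) = ((d / (n * C.card) : ℚ) : K) * ∑ y ∈ C, y h) ∧
    ((n : K) / Fintype.card H) • ∑ y ∈ C, ρ.sumOp y = 1 ∧
    ∀ (m : ℕ) (y : H → K), IsIrredTrace m y → y ∉ C → ρ.sumOp y = 0 := by
  classical
  have hηC : η ∈ C := (hC η).mpr ⟨1, by ext; simp⟩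
  have hCirr : ∀ y ∈ C, IsIrredTrace n y := fun y hy ↦ by
    obtain ⟨g, rfl⟩ := (hC y).mp hy
    exact hη.comp_mulEquiv _
  have hn : (n : K) ≠ 0 := Nat.cast_ne_zero.mpr hη.pos.ne'
  have hH : (Fintype.card H : K) ≠ 0 := Nat.cast_ne_zero.mpr Fintype.card_ne_zero
  let χ : H → K := fun h ↦ LinearMap.trace K _ (ρ (h : G))
  have hχ : ∀ g h, χ (g * h) = χ (h * g) := fun g h ↦ by
    simp only [χ, Subgroup.coe_mul, map_mul ρ]
    exact LinearMap.trace_mul_comm _ _ _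
  have hχconj : ∀ (g : G) h, χ (MulAut.conjNormal g h) = χ h := fun g h ↦ by
    simp only [χ, MulAut.conjNormal_apply]
    rw [map_mul ρ, LinearMap.trace_mul_comm, ← map_mul ρ, inv_mul_cancel_left]
  have hflip : ∀ y : H → K, ∑ k : H, y k * χ k⁻¹ = ∑ h : H, χ h * y h⁻¹ := fun y ↦
    Fintype.sum_equiv (Equiv.inv H) _ _ fun k ↦ by simp [mul_comm]
  -- the operator of the orbit sum is an idempotent commuting with the representation
  let S : Module.End K (Fin d → K) := ((n : K) / Fintype.card H) • ∑ y ∈ C, ρ.sumOp y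
  have hyS : ∀ y ∈ C, ρ.sumOp y * S = ρ.sumOp y := by
    intro y hy
    simp only [S, mul_smul_comm, Finset.mul_sum]
    rw [Finset.sum_eq_single_of_mem y hy]
    · rw [(hCirr y hy).sumOp_mul (hCirr y hy).mul_comm, (hCirr y hy).sum_mul_inv_self, smul_smul,
        div_mul_div_cancel₀ hH, div_self hn, one_smul]
    · intro z hz hzy
      rw [(hCirr z hz).sumOp_mul (hCirr y hy).mul_comm,
        (hCirr y hy).sum_mul_inv (hCirr z hz) hzy.symm, zero_div, zero_smul]
  have hScomm : ∀ g, ρ g * S = S * ρ g := by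
    intro g
    simp only [S, mul_smul_comm, smul_mul_assoc, Finset.mul_sum, Finset.sum_mul,
      Representation.mul_sumOp]
    congr 1
    refine Finset.sum_bij (fun y _ ↦ y ∘ MulAut.conjNormal g⁻¹) ?_ ?_ ?_ fun _ _ ↦ rfl
    · intro y hy
      obtain ⟨g', rfl⟩ := (hC y).mp hy
      refine (hC _).mpr ⟨g' * g⁻¹, ?_⟩
      ext h
      simp
    · intro y _ z _ hyz
      ext h
      have := congrFun hyz (MulAut.conjNormal g h)
      simpa using this
    · intro y hy
      obtain ⟨g', rfl⟩ := (hC y).mp hy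
      refine ⟨η ∘ MulAut.conjNormal (g' * g), (hC _).mpr ⟨_, rfl⟩, ?_⟩
      ext h
      simp
  obtain ⟨c, hcS⟩ := hρ.exists_eq_smul_one S hScomm
  have htr : ∀ y : H → K, LinearMap.trace K _ (ρ.sumOp y) = ∑ h : H, χ h * y h⁻¹ := by
    intro y
    have := ρ.trace_mul_sumOp y 1
    rw [map_one, one_mul] at this
    rw [this, ← hflip]
    simp [χ]
  have hc1 : c = 1 := by
    have h1 := hyS η hηC
    rw [hcS, mul_smul_comm, mul_one] at h1
    have h2 := congrArg (LinearMap.trace K _) h1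
    rw [map_smul, htr, smul_eq_mul] at h2
    exact (mul_eq_right₀ hc).mp h2
  rw [hc1, one_smul] at hcS
  have hval : ∀ y ∈ C, ∑ h : H, χ h * y h⁻¹ = ∑ h : H, χ h * η h⁻¹ := by
    intro y hy
    obtain ⟨g, rfl⟩ := (hC y).mp hy
    refine Fintype.sum_equiv (MulAut.conjNormal g).toEquiv _ _ fun h ↦ ?_
    change _ = χ (MulAut.conjNormal g h) * η (MulAut.conjNormal g h)⁻¹
    rw [hχconj, Function.comp_apply, map_inv]
  have hres : ∀ h : H, χ h = ((∑ h : H, χ h * η h⁻¹) / Fintype.card H) * ∑ y ∈ C, y h := by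
    intro h
    have h1 : χ h = LinearMap.trace K _ (ρ (h : G) * S) := by rw [hcS, mul_one]
    rw [h1]
    simp only [S, mul_smul_comm, Finset.mul_sum, map_smul, map_sum, smul_eq_mul]
    refine Finset.sum_congr rfl fun y hy ↦ ?_
    have h2 : LinearMap.trace K _ (ρ (h : G) * ρ.sumOp y) = ∑ k, χ k * y (k⁻¹ * h) := by
      rw [ρ.trace_mul_sumOp]
      refine Fintype.sum_equiv ((Equiv.inv H).trans (Equiv.mulLeft h)) _ _ fun k ↦ ?_
      simp [χ, mul_comm]
    rw [h2, (hCirr y hy).sum_mul_inv_mul hχ, hval y hy]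
    field_simp
  have hdK : (d : K) = ((∑ h : H, χ h * η h⁻¹) / Fintype.card H) * (C.card * n) := by
    have h1 := hres 1
    have h2 : χ 1 = d := by simp [χ]
    rw [h2, Finset.sum_congr rfl fun y hy ↦ (hCirr y hy).apply_one, Finset.sum_const,
      nsmul_eq_mul] at h1
    exact h1
  have hC0 : (C.card : K) ≠ 0 := Nat.cast_ne_zero.mpr (Finset.card_ne_zero_of_mem hηC)
  have hm : ((d / (n * C.card) : ℚ) : K) = (∑ h : H, χ h * η h⁻¹) / Fintype.card H := by
    push_cast
    rw [hdK]
    field_simp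
  have hzero : ∀ (m : ℕ) (y : H → K), IsIrredTrace m y → y ∉ C → ρ.sumOp y = 0 := by
    intro m y hy hyC
    rw [← mul_one (ρ.sumOp y), ← hcS]
    simp only [S, mul_smul_comm, Finset.mul_sum]
    rw [Finset.sum_eq_zero, smul_zero]
    intro z hz
    rw [(hCirr z hz).sumOp_mul hy.mul_comm, hy.sum_mul_inv (hCirr z hz), zero_div, zero_smul]
    rintro rfl
    exact hyC hz
  refine ⟨fun m y hy ↦ ⟨fun h ↦ ?_, fun h ↦ ?_⟩, ?_, ?_, hcS, hzero⟩
  · by_contra hyC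
    refine h ?_
    have h2 := htr y
    rw [hzero m y hy hyC, map_zero] at h2
    exact h2.symm
  · exact (hval y h).trans_ne hc
  · intro h0
    rw [h0, Rat.cast_zero, eq_comm, div_eq_zero_iff] at hm
    exact hc (hm.resolve_right hH)
  · intro h
    rw [hm]
    exact hres h

end Clifford

/-! ### Idempotent class functions vanish on `p`-singular elements -/

section Words

variable {H : Type*} [Group H]

theorem List.prod_map_range_add_left (u : ℕ → H) (a b : ℕ) : ((List.range (a + b)).map u).prod =
    ((List.range a).map u).prod * ((List.range b).map fun i ↦ u (a + i)).prod := by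
  rw [List.range_add, List.map_append, List.prod_append, List.map_map]
  rfl

theorem List.prod_map_range_shift (u : ℕ → H) (M : ℕ) :
    ((List.range M).map fun i ↦ u (i + 1)).prod = (u 0)⁻¹ * ((List.range M).map u).prod * u M := by
  have h1 := List.prod_map_range_add_left u 1 M
  have h2 := List.prod_map_range_add_left u M 1
  rw [add_comm] at h2
  simp only [List.range_one, List.map_singleton, List.prod_singleton, add_zero, add_comm 1] at h1 h2
  rw [mul_assoc, ← h2, h1, inv_mul_cancel_left]

theorem List.prod_map_range_mul (u : ℕ → H) {b : ℕ} (hu : ∀ i, u (i + b) = u i) (j : ℕ) :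
    ((List.range (b * j)).map u).prod = ((List.range b).map u).prod ^ j := by
  have h0 : ∀ j i, u (b * j + i) = u i := by
    intro j i
    induction j with
    | zero => simp
    | succ j ih => rw [mul_add, mul_one, add_right_comm, hu, ih]
  induction j with
  | zero => simp
  | succ j ih =>
    rw [mul_add, mul_one, List.prod_map_range_add_left, ih, pow_succ]
    simp only [h0]

/-- The product of the letters of a cyclic word. -/
def wordProd {M : ℕ} [NeZero M] (w : Fin M → H) : H :=
  ((List.range M).map fun i : ℕ ↦ w (Fin.ofNat M i)).prod

theorem wordProd_eq_prod_ofFn {M : ℕ} [NeZero M] (w : Fin M → H) :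
    wordProd w = (List.ofFn w).prod := by
  unfold wordProd
  congr 1
  refine List.ext_getElem (by simp) fun i h1 h2 ↦ ?_
  simp only [List.getElem_map, List.getElem_range, List.getElem_ofFn]
  congr 1
  refine Fin.ext ?_
  rw [Fin.val_ofNat, Nat.mod_eq_of_lt (by simpa using h1)]

/-- The cyclic rotation of words. -/
def wordRotate (H : Type*) (M : ℕ) [NeZero M] : Equiv.Perm (Fin M → H) where
  toFun w i := w (i + 1)
  invFun w i := w (i - 1)
  left_inv w := by ext i; simp
  right_inv w := by ext i; simp

omit [Group H] in
theorem wordRotate_pow_apply (M : ℕ) [NeZero M] (j : ℕ) (w : Fin M → H) (i : Fin M) :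
    ((wordRotate H M) ^ j) w i = w (i + Fin.ofNat M j) := by
  induction j generalizing i with
  | zero =>
    rw [pow_zero]
    have : Fin.ofNat M 0 = 0 := rfl
    rw [this, add_zero]
    rfl
  | succ j ih =>
    rw [pow_succ', Equiv.Perm.mul_apply]
    change ((wordRotate H M) ^ j) w (i + 1) = _
    rw [ih]
    congr 1
    rw [add_assoc]
    congr 1
    refine Fin.ext ?_
    simp [Fin.val_add, add_comm]

theorem wordProd_rotate {M : ℕ} [NeZero M] (w : Fin M → H) :
    wordProd (wordRotate H M w) = (w 0)⁻¹ * wordProd w * w 0 := by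
  have h1 := List.prod_map_range_shift (fun i : ℕ ↦ w (Fin.ofNat M i)) M
  have h2 : Fin.ofNat M M = 0 := Fin.ext (by simp)
  have h3 : Fin.ofNat M 0 = 0 := rfl
  rw [h2, h3] at h1
  unfold wordProd
  rw [← h1]
  congr 1
  refine List.map_congr_left fun i _ ↦ ?_
  change w (Fin.ofNat M i + 1) = _
  congr 1
  refine Fin.ext ?_
  simp [Fin.val_add]

/-- The product of a word that consists of `c` copies of a shorter word is a `c`-th power. -/
theorem wordProd_of_rotate_eq {b c : ℕ} [NeZero (b * c)] {w : Fin (b * c) → H}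
    (hw : ((wordRotate H (b * c)) ^ b) w = w) : ∃ v, wordProd w = v ^ c := by
  refine ⟨_, List.prod_map_range_mul (fun i : ℕ ↦ w (Fin.ofNat (b * c) i)) (fun i ↦ ?_) c⟩
  conv_rhs => rw [← hw, wordRotate_pow_apply]
  congr 1
  refine Fin.ext ?_
  simp [Fin.val_add]

variable [Fintype H]

/-- An idempotent of the group ring is equal to its powers; expanded, these are sums over words. -/
theorem sum_prod_mul_wordProd {R : Type*} [CommSemiring R] {e : H → R}
    (he : ∀ h, ∑ k, e k * e (k⁻¹ * h) = e h) (φ : H → R) (m : ℕ) :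
    ∑ w : Fin (m + 1) → H, (∏ i, e (w i)) * φ (List.ofFn w).prod = ∑ h, e h * φ h := by
  induction m generalizing φ with
  | zero =>
    refine Fintype.sum_equiv (Equiv.funUnique (Fin 1) H) _ _ fun w ↦ ?_
    simp
  | succ m ih =>
    rw [← (Fin.consEquiv fun _ : Fin (m + 2) ↦ H).sum_comp, Fintype.sum_prod_type]
    have h1 : ∀ a : H, ∑ w : Fin (m + 1) → H,
        (∏ i, e ((Fin.consEquiv fun _ : Fin (m + 2) ↦ H) (a, w) i)) *
          φ (List.ofFn ((Fin.consEquiv fun _ : Fin (m + 2) ↦ H) (a, w))).prod =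
        e a * ∑ h, e h * φ (a * h) := by
      intro a
      rw [← ih fun h ↦ φ (a * h), Finset.mul_sum]
      refine Finset.sum_congr rfl fun w _ ↦ ?_
      rw [Fin.prod_univ_succ, List.ofFn_succ, List.prod_cons]
      simp [Fin.consEquiv, mul_assoc]
    rw [Finset.sum_congr rfl fun a _ ↦ h1 a]
    have h2 : ∀ a, e a * ∑ h, e h * φ (a * h) = ∑ h, e a * e (a⁻¹ * h) * φ h := by
      intro a
      rw [Finset.mul_sum]
      refine Fintype.sum_equiv (Equiv.mulLeft a) _ _ fun h ↦ ?_
      simp [mul_assoc]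
    rw [Finset.sum_congr rfl fun a _ ↦ h2 a, Finset.sum_comm]
    refine Finset.sum_congr rfl fun h _ ↦ ?_
    rw [← Finset.sum_mul, he]

/-- The sum over a conjugacy class of `p`-singular elements of an idempotent of the group algebra is
divisible by all powers of `p`: it is a sum over cyclic words, on which rotation acts with large
orbits. -/
theorem pow_dvd_sum_isConj {p : ℕ} [Fact p.Prime] {R : Type*} [CommRing R] {e : H → R}
    (he : ∀ h, ∑ k, e k * e (k⁻¹ * h) = e h) {s : H} (hs : p ∣ orderOf s) (b : ℕ) :
    (p : R) ^ b ∣ ∑ h, e h * (open Classical in if IsConj s h then 1 else 0) := by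
  classical
  have hpp : p.Prime := Fact.out
  obtain ⟨a, m, hm, ham⟩ := Nat.exists_eq_pow_mul_and_not_dvd (Fintype.card_ne_zero (α := H)) p
    hpp.ne_one
  have : NeZero (p ^ b * p ^ a) :=
    ⟨(mul_pos (pow_pos hpp.pos b) (pow_pos hpp.pos a)).ne'⟩
  have hsplit : p ^ b * p ^ a = p ^ b * p ^ a - 1 + 1 :=
    (Nat.succ_pred_eq_of_ne_zero this.out).symm
  have h1 : ∑ w : Fin (p ^ b * p ^ a) → H, (∏ i, e (w i)) *
      (if IsConj s (wordProd w) then 1 else 0) = ∑ h, e h * (if IsConj s h then 1 else 0) := by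
    simp only [wordProd_eq_prod_ofFn]
    rw [← sum_prod_mul_wordProd he (fun h ↦ if IsConj s h then 1 else 0) (p ^ b * p ^ a - 1),
      ← hsplit]
  rw [← h1]
  have hconj : ∀ w : Fin (p ^ b * p ^ a) → H,
      IsConj s (wordProd (wordRotate H _ w)) ↔ IsConj s (wordProd w) := by
    intro w
    have h2 : IsConj (wordProd w) (wordProd (wordRotate H _ w)) := by
      rw [wordProd_rotate]
      exact isConj_iff.mpr ⟨(w 0)⁻¹, by rw [inv_inv]⟩
    exact ⟨fun h ↦ h.trans h2.symm, fun h ↦ h.trans h2⟩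
  simp only [mul_ite, mul_one, mul_zero]
  rw [← Finset.sum_filter, Finset.sum_subtype (p := fun w ↦ IsConj s (wordProd w)) _ (by simp)]
  let σ : Equiv.Perm {w : Fin (p ^ b * p ^ a) → H // IsConj s (wordProd w)} :=
    (wordRotate H (p ^ b * p ^ a)).subtypePerm hconj
  have hσ : ∀ (m : ℕ) (w : {w : Fin (p ^ b * p ^ a) → H // IsConj s (wordProd w)}),
      ((σ ^ m) w : Fin (p ^ b * p ^ a) → H) = ((wordRotate H _) ^ m) w := by
    intro m w
    rw [Equiv.Perm.subtypePerm_pow]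
    rfl
  refine (pow_dvd_pow _ b.le_succ).trans (σ.pow_dvd_sum (N := b + a) (b := b) ?_ ?_ _ ?_)
  · refine Equiv.ext fun w ↦ Subtype.ext ?_
    rw [hσ]
    ext i
    rw [wordRotate_pow_apply]
    change _ = w.1 i
    have : Fin.ofNat (p ^ b * p ^ a) (p ^ (b + a)) = 0 := Fin.ext (by simp [pow_add])
    rw [this, add_zero]
  · intro w hw
    have h2 := congrArg Subtype.val hw
    rw [hσ] at h2
    obtain ⟨v, hv⟩ := wordProd_of_rotate_eq h2
    -- the product of a word with a period `p ^ b` is a `p ^ a`-th power, hence has order prime to `p`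
    have h3 : orderOf (wordProd w.1) ∣ m := by
      refine orderOf_dvd_of_pow_eq_one ?_
      rw [hv, ← pow_mul, ← ham, pow_card_eq_one]
    obtain ⟨g, hg⟩ := isConj_iff.mp w.2
    have h4 : orderOf (g * s * g⁻¹) = orderOf s := (MulAut.conj g).orderOf_eq s
    rw [← hg, h4] at h3
    exact hm (hs.trans h3)
  · intro w
    change ∏ i, e (wordRotate H _ w.1 i) = ∏ i, e (w.1 i)
    exact Equiv.prod_comp (Equiv.addRight (1 : Fin (p ^ b * p ^ a))) fun i ↦ e (w.1 i)

end Words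

/-! ### Integral idempotents over ultrametric fields -/

section UnitBall

variable (K : Type*) [NormedField K] [IsUltrametricDist K]

/-- The ring of integers of an ultrametric field. -/
def unitBall : Subring K where
  carrier := {x | ‖x‖ ≤ 1}
  mul_mem' {a b} ha hb := by
    rw [Set.mem_ofPred_eq, norm_mul]
    exact mul_le_one₀ ha (norm_nonneg b) hb
  one_mem' := norm_one.le
  add_mem' {a b} ha hb := (IsUltrametricDist.norm_add_le_max a b).trans (max_le ha hb)
  zero_mem' := by simp
  neg_mem' {a} ha := by simpa using ha

variable {K} {H : Type*} [Group H] [Fintype H]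

omit [IsUltrametricDist K] in
theorem sum_mul_isConj {f : H → K} (hf : ∀ g h, f (g * h) = f (h * g)) (s : H) :
    ∑ h, f h * (open Classical in if IsConj s h then 1 else 0) =
      Nat.card {h // IsConj s h} * f s := by
  classical
  simp only [mul_ite, mul_one, mul_zero]
  rw [← Finset.sum_filter, Finset.sum_congr rfl (g := fun _ ↦ f s), Finset.sum_const, nsmul_eq_mul,
    Nat.card_eq_fintype_card, Fintype.card_subtype]
  intro h hh
  obtain ⟨g, rfl⟩ := isConj_iff.mp (Finset.mem_filter.mp hh).2
  rw [hf, inv_mul_cancel_left]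

/-- A central idempotent of the group algebra with integral coefficients vanishes on the elements of
order divisible by `p`. -/
theorem eq_zero_of_dvd_orderOf [CharZero K] {p : ℕ} [Fact p.Prime] (hpK : ‖(p : K)‖ < 1) {e : H → K}
    (he : ∀ h, ∑ k, e k * e (k⁻¹ * h) = e h) (he1 : ∀ h, ‖e h‖ ≤ 1)
    (hconj : ∀ g h, e (g * h) = e (h * g)) {s : H} (hs : p ∣ orderOf s) : e s = 0 := by
  classical
  let e' : H → unitBall K := fun h ↦ ⟨e h, he1 h⟩
  have he' : ∀ h, ∑ k, e' k * e' (k⁻¹ * h) = e' h := fun h ↦ Subtype.ext (by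
    simpa [e'] using he h)
  have h1 : ∀ b : ℕ, ‖(Nat.card {h // IsConj s h} : K) * e s‖ ≤ ‖(p : K)‖ ^ b := by
    intro b
    obtain ⟨c, hc⟩ := pow_dvd_sum_isConj (p := p) he' hs b
    have h2 := congrArg Subtype.val hc
    have h3 : (∑ h, e h * (if IsConj s h then 1 else 0) : K) = p ^ b * c := by
      rw [← sub_eq_zero] at h2 ⊢
      simpa [e', apply_ite] using h2
    rw [← sum_mul_isConj hconj, h3, norm_mul, norm_pow]
    exact mul_le_of_le_one_right (by positivity) c.2
  have h2 := ge_of_tendsto' (tendsto_pow_atTop_nhds_zero_of_lt_one (norm_nonneg _) hpK) h1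
  have h3 := norm_le_zero_iff.mp h2
  refine (mul_eq_zero.mp h3).resolve_left (Nat.cast_ne_zero.mpr ?_)
  have : Nonempty {h // IsConj s h} := ⟨⟨s, IsConj.refl s⟩⟩
  exact Nat.card_pos.ne'

end UnitBall

/-! ### Orbits of irreducible characters under commuting permutations of the group -/

section CharOrbit

variable {K : Type*} [Field K] {H : Type*} [Group H] [Fintype H] {Δ : Type*} [CommGroup Δ]

/-- `X` is an orbit, consisting of irreducible characters of degree `n`, for the action of the
commutative group `Δ` on functions on `H` through permutations of `H` that commute with inversion. -/
structure IsCharOrbit (a : Δ →* Equiv.Perm H) (n : ℕ) (X : Finset (H → K)) : Prop where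
  irred : ∀ x ∈ X, IsIrredTrace n x
  nonempty : X.Nonempty
  comp_mem : ∀ θ, ∀ x ∈ X, x ∘ a θ ∈ X
  trans : ∀ x ∈ X, ∀ y ∈ X, ∃ θ, y = x ∘ a θ
  map_inv : ∀ θ h, a θ h⁻¹ = (a θ h)⁻¹

/-- The function `(n/|H|) ∑ x(h)`, the sum running over the irreducible characters `x ∈ X` of degree
`n`. Its values at inverses are the coefficients of the sum of the idempotents of these characters. -/
def idemFn (n : ℕ) (X : Finset (H → K)) (h : H) : K := n / Fintype.card H * ∑ x ∈ X, x h

namespace IsCharOrbit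

variable {a : Δ →* Equiv.Perm H} {n : ℕ} {X : Finset (H → K)}

omit [Fintype H] in
theorem pos (hX : IsCharOrbit a n X) : 0 < n := (hX.irred _ hX.nonempty.choose_spec).pos

theorem idemFn_mul_comm (hX : IsCharOrbit a n X) (g h : H) :
    idemFn n X (g * h) = idemFn n X (h * g) := by
  unfold idemFn
  rw [Finset.sum_congr rfl fun x hx ↦ (hX.irred x hx).mul_comm g h]

theorem idemFn_one (hX : IsCharOrbit a n X) :
    idemFn n X 1 = n / Fintype.card H * (X.card * n) := by
  rw [idemFn, Finset.sum_congr rfl fun x hx ↦ (hX.irred x hx).apply_one, Finset.sum_const,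
    nsmul_eq_mul]

omit [Fintype H] in
theorem mul_comm_of_mem_span (hX : IsCharOrbit a n X) {f : H → K}
    (hf : f ∈ Submodule.span K (X : Set (H → K))) (g h : H) : f (g * h) = f (h * g) := by
  induction hf using Submodule.span_induction with
  | mem x hx => exact (hX.irred x hx).mul_comm g h
  | zero => rfl
  | add x y _ _ hx hy => simp [hx, hy]
  | smul c x _ hx => simp [hx]

omit [Fintype H] in
theorem comp_mem_span (hX : IsCharOrbit a n X) {f : H → K}
    (hf : f ∈ Submodule.span K (X : Set (H → K))) (θ : Δ) :
    f ∘ a θ ∈ Submodule.span K (X : Set (H → K)) := by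
  induction hf using Submodule.span_induction with
  | mem x hx => exact Submodule.subset_span (hX.comp_mem θ x hx)
  | zero => exact Submodule.zero_mem _
  | add x y _ _ hx hy => exact Submodule.add_mem _ hx hy
  | smul c x _ hx => exact Submodule.smul_mem _ c hx

omit [Fintype H] in
theorem apply_apply_one (hX : IsCharOrbit a n X) {f : H → K}
    (hf : f ∈ Submodule.span K (X : Set (H → K))) (θ : Δ) : f (a θ 1) = f 1 := by
  induction hf using Submodule.span_induction with
  | mem x hx =>
    rw [(hX.irred x hx).apply_one]
    exact (hX.irred _ (hX.comp_mem θ x hx)).apply_one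
  | zero => rfl
  | add x y _ _ hx hy => simp [hx, hy]
  | smul c x _ hx => simp [hx]

variable [IsAlgClosed K] [CharZero K]

theorem sum_mul_idemFn (hX : IsCharOrbit a n X) {f : H → K} (hf : ∀ g h, f (g * h) = f (h * g))
    (h : H) : ∑ k, f k * idemFn n X (k⁻¹ * h) =
      (Fintype.card H : K)⁻¹ * ∑ x ∈ X, (∑ k, f k * x k⁻¹) * x h := by
  have hn : (n : K) ≠ 0 := Nat.cast_ne_zero.mpr hX.pos.ne'
  have h1 : ∑ k, f k * idemFn n X (k⁻¹ * h) =
      n / Fintype.card H * ∑ x ∈ X, ∑ k, f k * x (k⁻¹ * h) := by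
    simp only [idemFn]
    rw [Finset.sum_comm, Finset.mul_sum]
    refine Finset.sum_congr rfl fun k _ ↦ ?_
    rw [← Finset.mul_sum]
    ring
  rw [h1, Finset.mul_sum, Finset.mul_sum]
  refine Finset.sum_congr rfl fun x hx ↦ ?_
  rw [(hX.irred x hx).sum_mul_inv_mul hf]
  field_simp

/-- Convolution with `idemFn n X` is the identity on the span of `X`. -/
theorem sum_mul_idemFn_of_mem_span (hX : IsCharOrbit a n X) {f : H → K}
    (hf : f ∈ Submodule.span K (X : Set (H → K))) (h : H) :
    ∑ k, f k * idemFn n X (k⁻¹ * h) = f h := by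
  have hH : (Fintype.card H : K) ≠ 0 := Nat.cast_ne_zero.mpr Fintype.card_ne_zero
  induction hf using Submodule.span_induction with
  | mem x hx =>
    rw [hX.sum_mul_idemFn (hX.irred x hx).mul_comm, Finset.sum_eq_single_of_mem x hx,
      (hX.irred x hx).sum_mul_inv_self, inv_mul_cancel_left₀ hH]
    intro y hy hyx
    rw [(hX.irred x hx).sum_mul_inv (hX.irred y hy) hyx.symm, zero_mul]
  | zero => simp
  | add x y _ _ hx hy => simp [add_mul, Finset.sum_add_distrib, hx, hy]
  | smul c x _ hx => simp [mul_assoc, ← Finset.mul_sum, hx]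

omit [Group H] [IsAlgClosed K] [CharZero K] in
theorem idemFn_mem_span (n : ℕ) (X : Finset (H → K)) :
    idemFn n X ∈ Submodule.span K (X : Set (H → K)) := by
  have : idemFn n X = ((n : K) / Fintype.card H) • ∑ x ∈ X, x := by
    ext h
    simp [idemFn]
  rw [this]
  exact Submodule.smul_mem _ _ (Submodule.sum_mem _ fun x hx ↦ Submodule.subset_span hx)

theorem idemFn_convolution (hX : IsCharOrbit a n X) (h : H) :
    ∑ k, idemFn n X k * idemFn n X (k⁻¹ * h) = idemFn n X h :=
  hX.sum_mul_idemFn_of_mem_span (idemFn_mem_span n X) h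

/-- The projection of an invariant class function to the span of `X` is a multiple of
`idemFn n X`. -/
theorem exists_sum_mul_idemFn (hX : IsCharOrbit a n X) {f : H → K}
    (hf : ∀ g h, f (g * h) = f (h * g)) (hinv : ∀ θ h, f (a θ h) = f h) :
    ∃ c : K, ∀ h, ∑ k, f k * idemFn n X (k⁻¹ * h) = c * idemFn n X h := by
  have hn : (n : K) ≠ 0 := Nat.cast_ne_zero.mpr hX.pos.ne'
  obtain ⟨x, hx⟩ := hX.nonempty
  refine ⟨(∑ k, f k * x k⁻¹) / n, fun h ↦ ?_⟩
  rw [hX.sum_mul_idemFn hf, idemFn, Finset.sum_congr rfl (g := fun y ↦ (∑ k, f k * x k⁻¹) * y h),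
    ← Finset.mul_sum]
  · field_simp
  · intro y hy
    obtain ⟨θ, rfl⟩ := hX.trans x hx y hy
    congr 1
    refine Fintype.sum_equiv (a θ) _ _ fun k ↦ ?_
    rw [hinv, Function.comp_apply, hX.map_inv]

end IsCharOrbit

end CharOrbit

/-! ### Degrees of the characters in an integral idempotent -/

section DefectZero

variable {K : Type*} [NormedField K] [IsUltrametricDist K] [IsAlgClosed K] [CharZero K]
  {H : Type*} [Group H] [Fintype H] {Δ : Type*} [CommGroup Δ] {p : ℕ} [Fact p.Prime]

omit [IsAlgClosed K] [CharZero K] in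
theorem norm_natCast_eq_one_of_not_dvd (hpK : ‖(p : K)‖ < 1) {m : ℕ} (hm : ¬ p ∣ m) :
    ‖(m : K)‖ = 1 := by
  have hpp : p.Prime := Fact.out
  have hle : ∀ j : ℤ, ‖(j : K)‖ ≤ 1 := IsUltrametricDist.norm_intCast_le_one K
  have h1 : (m : ℤ) * m.gcdA p + p * m.gcdB p = 1 := by
    rw [← Nat.gcd_eq_gcd_ab, Nat.gcd_comm, (hpp.coprime_iff_not_dvd.mpr hm).gcd_eq_one, Nat.cast_one]
  have h2 : (m : K) * (m.gcdA p : ℤ) + p * (m.gcdB p : ℤ) = 1 := by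
    simpa using congrArg (Int.cast : ℤ → K) h1
  refine le_antisymm (by exact_mod_cast hle m) ?_
  by_contra! hlt
  have h3 : ‖(m : K) * (m.gcdA p : ℤ) + p * (m.gcdB p : ℤ)‖ < 1 := by
    refine (IsUltrametricDist.norm_add_le_max _ _).trans_lt (max_lt ?_ ?_)
    · rw [norm_mul]
      exact mul_lt_one_of_nonneg_of_lt_one_left (norm_nonneg _) hlt (hle _)
    · rw [norm_mul]
      exact mul_lt_one_of_nonneg_of_lt_one_left (norm_nonneg _) hpK (hle _)
  rw [h2, norm_one] at h3
  exact lt_irrefl _ h3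

omit [IsAlgClosed K] [CharZero K] in
/-- The sum of a class function is estimated by its values multiplied with the class sizes. -/
theorem norm_sum_le_of_isConj {f : H → K} (hf : ∀ g h, f (g * h) = f (h * g)) {c : ℝ} (hc : 0 ≤ c)
    (hfc : ∀ s, ‖(Nat.card {h // IsConj s h} : K) * f s‖ ≤ c) : ‖∑ h, f h‖ ≤ c := by
  classical
  rw [← Finset.sum_fiberwise_of_maps_to (g := ConjClasses.mk) (t := Finset.univ.image ConjClasses.mk)
    fun h _ ↦ Finset.mem_image_of_mem _ (Finset.mem_univ h)]
  refine IsUltrametricDist.norm_sum_le_of_forall_le_of_nonneg hc fun C hC ↦ ?_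
  obtain ⟨s, -, rfl⟩ := Finset.mem_image.mp hC
  have h1 := sum_mul_isConj hf s
  simp only [mul_ite, mul_one, mul_zero] at h1
  rw [← Finset.sum_filter] at h1
  have h2 : (Finset.univ.filter fun h ↦ ConjClasses.mk h = ConjClasses.mk s) =
      Finset.univ.filter fun h ↦ IsConj s h := by
    ext h
    rw [Finset.mem_filter, Finset.mem_filter, ConjClasses.mk_eq_mk_iff_isConj, isConj_comm]
  rw [h2, h1]
  exact hfc s

omit [CharZero K] in
/-- The average of a character over a coset `s P`, where the subgroup `P` centralises `s`, is the
trace of an operator whose eigenvalues are zero or roots of unity. -/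
theorem IsIrredTrace.norm_average_le_one {n : ℕ} {x : H → K} (hx : IsIrredTrace n x) {s : H}
    {P : Subgroup H} [Fintype P] (hP : ∀ u ∈ P, s * u = u * s) (hP0 : (Nat.card P : K) ≠ 0) :
    ‖(Nat.card P : K)⁻¹ * ∑ u : P, x (s * u)‖ ≤ 1 := by
  obtain ⟨ρ, -, hρ⟩ := hx
  let E : Module.End K (Fin n → K) := (Nat.card P : K)⁻¹ • ∑ u : P, ρ u
  have h1 : (Nat.card P : K)⁻¹ * ∑ u : P, x (s * u) = LinearMap.trace K _ (ρ s * E) := by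
    simp only [E, mul_smul_comm, map_smul, Finset.mul_sum, map_sum, ← map_mul ρ, smul_eq_mul, hρ]
  have hcomm : Commute (ρ s) E := by
    refine Commute.smul_right (Commute.sum_right _ _ _ fun u _ ↦ ?_) _
    rw [Commute, SemiconjBy, ← map_mul, ← map_mul, hP u u.2]
  have huE : ∀ v : P, ρ v * E = E := by
    intro v
    simp only [E, mul_smul_comm, Finset.mul_sum, ← map_mul ρ]
    congr 1
    exact Fintype.sum_equiv (Equiv.mulLeft v) _ _ fun u ↦ rfl
  have hE : E * E = E := by
    conv_lhs => enter [1]; unfold E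
    rw [smul_mul_assoc, Finset.sum_mul, Finset.sum_congr rfl fun u _ ↦ huE u, Finset.sum_const,
      Finset.card_univ, ← Nat.card_eq_fintype_card, ← Nat.cast_smul_eq_nsmul K, smul_smul,
      inv_mul_cancel₀ hP0, one_smul]
  rw [h1]
  refine norm_trace_le_one_of_pow_eq (m := Fintype.card H) Fintype.card_ne_zero ?_
  have hEpow : ∀ k : ℕ, E ^ (k + 1) = E := fun k ↦ by
    induction k with
    | zero => rw [zero_add, pow_one]
    | succ k ih => rw [pow_succ, ih, hE]
  rw [hcomm.mul_pow, hEpow, ← map_pow, pow_succ, pow_card_eq_one, one_mul]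

namespace IsCharOrbit

variable {a : Δ →* Equiv.Perm H} {n : ℕ} {X : Finset (H → K)}

/-- If the idempotent of `X` has integral coefficients, these coefficients, multiplied with the class
sizes, are divisible by the degree. -/
theorem norm_card_mul_idemFn_le (hX : IsCharOrbit a n X) (hpK : ‖(p : K)‖ < 1)
    (h1 : ∀ h, ‖idemFn n X h‖ ≤ 1) (s : H) :
    ‖(Nat.card {h // IsConj s h} : K) * idemFn n X s‖ ≤ ‖(n : K)‖ := by
  have hpp : p.Prime := Fact.out
  have hsing : ∀ s : H, p ∣ orderOf s → idemFn n X s = 0 := fun s hs ↦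
    eq_zero_of_dvd_orderOf hpK hX.idemFn_convolution h1 hX.idemFn_mul_comm hs
  by_cases hs : p ∣ orderOf s
  · rw [hsing s hs, mul_zero, norm_zero]
    exact norm_nonneg _
  let C := Subgroup.centralizer {s}
  let P : Sylow p C := default
  let P' : Subgroup H := P.1.map C.subtype
  have := Fintype.ofFinite P'
  have hP' : Nat.card P' = p ^ (Nat.card C).factorization p := by
    rw [← P.card_eq_multiplicity]
    exact Nat.card_congr (P.1.equivMapOfInjective _ C.subtype_injective).symm.toEquiv
  have hPs : ∀ u ∈ P', s * u = u * s := by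
    rintro _ ⟨u, -, rfl⟩
    exact Subgroup.mem_centralizer_singleton_iff.mp u.2 |>.symm
  have hP0 : (Nat.card P' : K) ≠ 0 := Nat.cast_ne_zero.mpr Nat.card_pos.ne'
  have hH : (Fintype.card H : K) ≠ 0 := Nat.cast_ne_zero.mpr Fintype.card_ne_zero
  -- only the trivial element of `P` contributes to the sum over the coset `s P`
  have hsum : ∑ u : P', idemFn n X (s * u) = idemFn n X s := by
    rw [Fintype.sum_eq_single 1, OneMemClass.coe_one, mul_one]
    intro u hu
    refine hsing _ ?_
    have hu1 : (u : H) ≠ 1 := fun h ↦ hu (Subtype.ext h)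
    obtain ⟨k, hk⟩ : ∃ k, orderOf (u : H) = p ^ k := by
      have h2 : orderOf u ∣ Nat.card P' := orderOf_dvd_natCard u
      rw [hP'] at h2
      obtain ⟨k, -, hk⟩ := (Nat.dvd_prime_pow hpp).mp h2
      exact ⟨k, by rw [Subgroup.orderOf_coe, hk]⟩
    have hk0 : k ≠ 0 := by
      rintro rfl
      rw [pow_zero, orderOf_eq_one_iff] at hk
      exact hu1 hk
    have hcop : (orderOf s).Coprime (orderOf (u : H)) := by
      rw [hk]
      exact Nat.Coprime.pow_right k ((hpp.coprime_iff_not_dvd.mpr hs).symm)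
    have hcomm : Commute s (u : H) := hPs u u.2
    rw [hcomm.orderOf_mul_eq_mul_orderOf_of_coprime hcop, hk]
    exact (dvd_pow_self p hk0).mul_left _
  have h2 : (Fintype.card H : K) * idemFn n X s =
      n * Nat.card P' * ∑ x ∈ X, ((Nat.card P' : K)⁻¹ * ∑ u : P', x (s * u)) := by
    rw [← hsum]
    simp only [idemFn]
    rw [← Finset.mul_sum, Finset.sum_comm, ← Finset.mul_sum]
    field_simp
  -- the averages of characters over the coset are integral
  have h3 : ‖∑ x ∈ X, ((Nat.card P' : K)⁻¹ * ∑ u : P', x (s * u))‖ ≤ 1 :=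
    IsUltrametricDist.norm_sum_le_of_forall_le_of_nonneg zero_le_one
      fun x hx ↦ (hX.irred x hx).norm_average_le_one hPs hP0
  have hC : Nat.card {h // IsConj s h} * Nat.card C = Fintype.card H := by
    rw [Subgroup.nat_card_centralizer_nat_card_stabilizer, ← Nat.card_eq_fintype_card,
      Nat.card_congr (ConjAct.toConjAct (G := H)).toEquiv,
      (MulAction.stabilizer (ConjAct H) s).card_eq_card_quotient_mul_card_subgroup,
      ← Nat.card_congr (MulAction.orbitEquivQuotientStabilizer (ConjAct H) s)]
    congr 1
    refine Nat.card_congr (Equiv.subtypeEquivRight fun h ↦ ?_)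
    rw [ConjAct.mem_orbit_conjAct, isConj_comm]
  have hC' : ‖(Nat.card C : K)‖ = ‖(Nat.card P' : K)‖ := by
    rw [hP']
    have h5 := Nat.ordProj_mul_ordCompl_eq_self (Nat.card C) p
    conv_lhs => rw [← h5]
    rw [Nat.cast_mul, norm_mul, norm_natCast_eq_one_of_not_dvd hpK
      (Nat.not_dvd_ordCompl hpp Nat.card_pos.ne'), mul_one]
  have h6 := congrArg norm h2
  rw [← hC, Nat.cast_mul, norm_mul, norm_mul, norm_mul, norm_mul, hC'] at h6
  have hP0' : 0 < ‖(Nat.card P' : K)‖ := norm_pos_iff.mpr hP0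
  refine le_of_mul_le_mul_right ?_ hP0'
  rw [norm_mul, mul_right_comm, h6]
  exact mul_le_of_le_one_right (by positivity) h3

/-- If the idempotent of `X` has integral coefficients, an integral function in the span of `X` has a
value at `1` that is divisible by the degree: this value is the sum of the products of the function
with the coefficients of the idempotent. -/
theorem norm_apply_one_le (hX : IsCharOrbit a n X) (hpK : ‖(p : K)‖ < 1)
    (h1 : ∀ h, ‖idemFn n X h‖ ≤ 1) {f : H → K} (hf : f ∈ Submodule.span K (X : Set (H → K)))
    (hf1 : ∀ h, ‖f h‖ ≤ 1) : ‖f 1‖ ≤ ‖(n : K)‖ := by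
  have hfc := hX.mul_comm_of_mem_span hf
  rw [← hX.sum_mul_idemFn_of_mem_span hf 1]
  have h2 : ∑ k, f k * idemFn n X (k⁻¹ * 1) = ∑ k, f k⁻¹ * idemFn n X k :=
    Fintype.sum_equiv (Equiv.inv H) _ _ fun k ↦ by simp
  rw [h2]
  refine norm_sum_le_of_isConj (fun g h ↦ ?_) (norm_nonneg _) fun s ↦ ?_
  · rw [hX.idemFn_mul_comm, mul_inv_rev, mul_inv_rev, hfc]
  · rw [mul_left_comm, norm_mul]
    exact (mul_le_of_le_one_left (norm_nonneg _) (hf1 _)).trans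
      (hX.norm_card_mul_idemFn_le hpK h1 s)

omit [IsUltrametricDist K] in
omit [IsAlgClosed K] in
theorem idemFn_one_ne_zero (hX : IsCharOrbit a n X) : idemFn n X 1 ≠ 0 := by
  rw [hX.idemFn_one]
  have h1 : (n : K) ≠ 0 := Nat.cast_ne_zero.mpr hX.pos.ne'
  have h2 : (X.card : K) ≠ 0 := Nat.cast_ne_zero.mpr hX.nonempty.card_pos.ne'
  have h3 : (Fintype.card H : K) ≠ 0 := Nat.cast_ne_zero.mpr Fintype.card_ne_zero
  exact mul_ne_zero (div_ne_zero h1 h3) (mul_ne_zero h2 h1)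

/-- An integral idempotent has a coefficient that is a unit. -/
theorem exists_norm_idemFn_eq_one (hX : IsCharOrbit a n X) (h1 : ∀ h, ‖idemFn n X h‖ ≤ 1) :
    ∃ h, ‖idemFn n X h‖ = 1 := by
  obtain ⟨h, hh⟩ := Finite.exists_max fun h ↦ ‖idemFn n X h‖
  refine ⟨h, le_antisymm (h1 h) ?_⟩
  have hpos : 0 < ‖idemFn n X h‖ :=
    (norm_pos_iff.mpr hX.idemFn_one_ne_zero).trans_le (hh 1)
  have h2 : ‖idemFn n X h‖ ≤ ‖idemFn n X h‖ * ‖idemFn n X h‖ := by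
    conv_lhs => rw [← hX.idemFn_convolution h]
    refine IsUltrametricDist.norm_sum_le_of_forall_le_of_nonneg (by positivity) fun k _ ↦ ?_
    rw [norm_mul]
    exact mul_le_mul (hh _) (hh _) (norm_nonneg _) (norm_nonneg _)
  exact (le_mul_iff_one_le_left hpos).mp h2

end IsCharOrbit

end DefectZero

/-! ### An orbit with integral idempotent has defect zero -/

section DefectZeroOrbit

variable {K : Type*} [NormedField K] [IsUltrametricDist K]

/-- Choice of representatives modulo elements of norm less than one. -/
theorem exists_section_residue (K : Type*) [NormedField K] [IsUltrametricDist K] :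
    ∃ s : K → K, (∀ a, ‖s a - a‖ < 1) ∧ ∀ a b, ‖a - b‖ < 1 → s a = s b := by
  let r : Setoid K :=
    { r := fun a b ↦ ‖a - b‖ < 1
      iseqv :=
        { refl := fun a ↦ by simp
          symm := fun {a b} h ↦ by rwa [norm_sub_rev]
          trans := fun {a b c} h h' ↦ by
            rw [← sub_add_sub_cancel a b c]
            exact (IsUltrametricDist.norm_add_le_max _ _).trans_lt (max_lt h h') } }
  exact ⟨fun a ↦ (Quotient.mk r a).out, fun a ↦ Quotient.exact (Quotient.out_eq (Quotient.mk r a)),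
    fun a b h ↦ congrArg Quotient.out (Quotient.sound h)⟩

variable {H : Type*}

/-- Modulo `p`, the `p ^ k`-th power of a difference operator `f ↦ f ∘ π - f` is the difference
operator of `π ^ (p ^ k)`. -/
theorem norm_diff_pow_lt_one {p : ℕ} [Fact p.Prime] (hpK : ‖(p : K)‖ < 1) (π : Equiv.Perm H) {k : ℕ}
    {f : H → K} (hf : ∀ h, ‖f h‖ ≤ 1) (hπ : ∀ h, f ((π ^ p ^ k) h) = f h) (h : H) :
    ‖((LinearMap.funLeft K K π - 1 : Module.End K (H → K)) ^ p ^ k) f h‖ < 1 := by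
  have hpp : p.Prime := Fact.out
  set A : Module.End K (H → K) := LinearMap.funLeft K K π with hA
  have hAapply : ∀ f h, A f h = f (π h) := fun _ _ ↦ rfl
  have hApow : ∀ (j : ℕ) f h, (A ^ j) f h = f ((π ^ j) h) := by
    intro j
    induction j with
    | zero => intro f h; rfl
    | succ j ih =>
      intro f h
      rw [pow_succ, Module.End.mul_apply, ih, hAapply, pow_succ', Equiv.Perm.mul_apply]
  have hpres : ∀ (q : Polynomial ℤ) (f : H → K), (∀ h, ‖f h‖ ≤ 1) →
      ∀ h, ‖(Polynomial.aeval A q) f h‖ ≤ 1 := by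
    intro q
    induction q using Polynomial.induction_on' with
    | add q r hq hr =>
      intro f hf h
      rw [map_add, LinearMap.add_apply, Pi.add_apply]
      exact (IsUltrametricDist.norm_add_le_max _ _).trans (max_le (hq f hf h) (hr f hf h))
    | monomial j c =>
      intro f hf h
      rw [Polynomial.aeval_monomial, Module.End.mul_apply, eq_intCast, ← Int.smul_one_eq_cast,
        LinearMap.smul_apply, Module.End.one_apply, Pi.smul_apply, hApow, zsmul_eq_mul, norm_mul]
      exact mul_le_one₀ (IsUltrametricDist.norm_intCast_le_one K c) (norm_nonneg _) (hf _)
  obtain ⟨r, hr⟩ := exists_add_pow_prime_pow_eq (R := Polynomial ℤ) hpp (Polynomial.X - 1) 1 k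
  have h1 := congrArg (fun q ↦ Polynomial.aeval A q f h) hr
  simp only [sub_add_cancel, one_pow, mul_one, map_add, map_pow, Polynomial.aeval_X, map_one,
    LinearMap.add_apply, Pi.add_apply, hApow, hπ, Module.End.one_apply, mul_assoc] at h1
  rw [map_mul, map_natCast, map_sub, Polynomial.aeval_X, map_one] at h1
  have h2 : ((A - 1) ^ p ^ k) f h =
      -((p : Module.End K (H → K)) (Polynomial.aeval A ((Polynomial.X - 1) * r) f) h) := by
    rw [eq_neg_iff_add_eq_zero, ← add_right_inj (f h), add_zero]
    conv_rhs => rw [h1]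
    rw [Module.End.mul_apply]
    ring
  rw [h2, norm_neg, Module.End.natCast_apply, Pi.smul_apply, nsmul_eq_mul, norm_mul]
  exact mul_lt_one_of_nonneg_of_lt_one_left (norm_nonneg _) hpK (hpres _ f hf h)

variable [IsAlgClosed K] [CharZero K] [Group H] [Fintype H] {Δ : Type*} [CommGroup Δ] [Finite Δ]
  {p : ℕ} [Fact p.Prime]

namespace IsCharOrbit

variable {a : Δ →* Equiv.Perm H} {n : ℕ} {X : Finset (H → K)}

/-- If `Δ/U` is a `p`-group, a `U`-invariant integral function in the span of `X` is determined,
modulo the maximal ideal, by its values on the `Δ`-orbit of a point where the idempotent of `X` is a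
unit: a function in the kernel could be replaced by one that is `Δ`-invariant modulo the maximal
ideal, hence a multiple of the idempotent. -/
theorem norm_lt_one_of_orbit (hX : IsCharOrbit a n X) (hpK : ‖(p : K)‖ < 1)
    (h1 : ∀ h, ‖idemFn n X h‖ ≤ 1) {c₀ : H} (hc₀ : ‖idemFn n X c₀‖ = 1) {U : Subgroup Δ}
    (hU : ∀ φ : Δ, ∃ k : ℕ, φ ^ p ^ k ∈ U) {f : H → K}
    (hf : f ∈ Submodule.span K (X : Set (H → K))) (hfU : ∀ u ∈ U, ∀ h, f (a u h) = f h)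
    (hf1 : ∀ h, ‖f h‖ ≤ 1) (hfc : ∀ θ, ‖f (a θ c₀)‖ < 1) (h : H) : ‖f h‖ < 1 := by
  classical
  have := Fintype.ofFinite Δ
  have hsub : ∀ {x y : K} {c : ℝ}, ‖x‖ ≤ c → ‖y‖ ≤ c → ‖x - y‖ ≤ c := fun {x y c} hx hy ↦ by
    rw [sub_eq_add_neg]
    exact (IsUltrametricDist.norm_add_le_max _ _).trans (max_le hx (by rwa [norm_neg]))
  have hsub' : ∀ {x y : K} {c : ℝ}, ‖x‖ < c → ‖y‖ < c → ‖x - y‖ < c := fun {x y c} hx hy ↦ by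
    rw [sub_eq_add_neg]
    exact (IsUltrametricDist.norm_add_le_max _ _).trans_lt (max_lt hx (by rwa [norm_neg]))
  let Good : (H → K) → Prop := fun f ↦ f ∈ Submodule.span K (X : Set (H → K)) ∧
    (∀ u ∈ U, ∀ h, f (a u h) = f h) ∧ (∀ h, ‖f h‖ ≤ 1) ∧ ∀ θ, ‖f (a θ c₀)‖ < 1
  let E : Δ → Module.End K (H → K) := fun φ ↦ LinearMap.funLeft K K (a φ) - 1
  have hE : ∀ φ f h, E φ f h = f (a φ h) - f h := fun _ _ _ ↦ rfl
  have hcomm : ∀ (φ ψ : Δ) h, a φ (a ψ h) = a ψ (a φ h) := fun φ ψ h ↦ by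
    rw [← Equiv.Perm.mul_apply, ← map_mul, mul_comm, map_mul, Equiv.Perm.mul_apply]
  have hGoodE : ∀ φ f, Good f → Good (E φ f) := by
    rintro φ f ⟨h1, h2, h3, h4⟩
    refine ⟨Submodule.sub_mem _ (hX.comp_mem_span h1 φ) h1, fun u hu h ↦ ?_, fun h ↦ ?_,
      fun θ ↦ ?_⟩
    · rw [hE, hE, hcomm, h2 u hu, h2 u hu]
    · rw [hE]
      exact hsub (h3 _) (h3 _)
    · rw [hE, ← Equiv.Perm.mul_apply, ← map_mul]
      exact hsub' (h4 _) (h4 _)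
  have hGoodpow : ∀ φ (j : ℕ) f, Good f → Good ((E φ ^ j) f) := by
    intro φ j
    induction j with
    | zero => exact fun f hf ↦ hf
    | succ j ih =>
      intro f hf
      rw [pow_succ', Module.End.mul_apply]
      exact hGoodE _ _ (ih f hf)
  have hsmall : ∀ φ (j : ℕ) (f : H → K), (∀ h, ‖f h‖ < 1) → ∀ h, ‖(E φ ^ j) f h‖ < 1 := by
    intro φ j
    induction j with
    | zero => exact fun f hf ↦ hf
    | succ j ih =>
      intro f hf h
      rw [pow_succ', Module.End.mul_apply, hE]
      exact hsub' (ih f hf _) (ih f hf _)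
  have hEE : ∀ φ ψ, Commute (E φ) (E ψ) := by
    intro φ ψ
    refine LinearMap.ext fun f ↦ funext fun h ↦ ?_
    rw [Module.End.mul_apply, Module.End.mul_apply, hE, hE, hE, hE, hE, hE, hcomm]
    ring
  -- make the function invariant modulo the maximal ideal, one element of `Δ` after the other
  have key : ∀ F : Finset Δ, (∃ f, Good f ∧ ∃ h, ‖f h‖ = 1) →
      ∃ f, Good f ∧ (∃ h, ‖f h‖ = 1) ∧ ∀ φ ∈ F, ∀ h, ‖E φ f h‖ < 1 := by
    intro F h0
    induction F using Finset.induction_on with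
    | empty =>
      obtain ⟨f, hf, hh⟩ := h0
      exact ⟨f, hf, hh, by simp⟩
    | insert φ F _ ih =>
      obtain ⟨f, hf, ⟨h, hh⟩, hF⟩ := ih
      obtain ⟨k, hk⟩ := hU φ
      have hex : ∃ j : ℕ, ∀ h, ‖(E φ ^ j) f h‖ < 1 := by
        refine ⟨p ^ k, norm_diff_pow_lt_one hpK (a φ) hf.2.2.1 fun h ↦ ?_⟩
        rw [← map_pow]
        exact hf.2.1 _ hk h
      -- apply the difference operator of `φ` as often as possible without making the function small
      obtain ⟨j, hj⟩ : ∃ j, Nat.find hex = j + 1 := by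
        refine Nat.exists_eq_succ_of_ne_zero fun h0 ↦ ?_
        have := Nat.find_spec hex h
        rw [h0, pow_zero, Module.End.one_apply, hh] at this
        exact lt_irrefl _ this
      have hj1 := Nat.find_spec hex
      have hj2 := Nat.find_min hex (m := j) (by omega)
      rw [hj] at hj1
      push Not at hj2
      obtain ⟨h', hh'⟩ := hj2
      have hgood := hGoodpow φ j f hf
      refine ⟨(E φ ^ j) f, hgood, ⟨h', le_antisymm (hgood.2.2.1 h') hh'⟩, fun ψ hψ ↦ ?_⟩
      rcases Finset.mem_insert.mp hψ with rfl | hψ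
      · rwa [pow_succ', Module.End.mul_apply] at hj1
      · rw [← Module.End.mul_apply, ((hEE ψ φ).pow_right j).eq, Module.End.mul_apply]
        exact hsmall φ j _ (hF ψ hψ)
  by_contra! hh
  obtain ⟨f', ⟨hf', -, hf1', hfc'⟩, ⟨h', hh'⟩, hinv⟩ :=
    key Finset.univ ⟨f, ⟨hf, hfU, hf1, hfc⟩, h, le_antisymm (hf1 h) hh⟩
  -- an invariant lift, projected to the span of `X`
  obtain ⟨s, hs1, hs2⟩ := exists_section_residue K
  obtain ⟨c, hc⟩ := hX.exists_sum_mul_idemFn (f := s ∘ f')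
    (fun g h ↦ by rw [Function.comp_apply, hX.mul_comm_of_mem_span hf', Function.comp_apply])
    (fun θ h ↦ hs2 _ _ (hinv θ (Finset.mem_univ θ) h))
  have hclose : ∀ h, ‖c * idemFn n X h - f' h‖ < 1 := by
    intro h
    rw [← hc, ← hX.sum_mul_idemFn_of_mem_span hf' h, ← Finset.sum_sub_distrib]
    have h2 : ∀ k, ‖(s ∘ f') k * idemFn n X (k⁻¹ * h) - f' k * idemFn n X (k⁻¹ * h)‖ < 1 := by
      intro k
      rw [← sub_mul, norm_mul]
      exact mul_lt_one_of_nonneg_of_lt_one_left (norm_nonneg _) (hs1 _) (h1 _)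
    obtain ⟨k, hk⟩ := Finite.exists_max fun k ↦
      ‖(s ∘ f') k * idemFn n X (k⁻¹ * h) - f' k * idemFn n X (k⁻¹ * h)‖
    exact (IsUltrametricDist.norm_sum_le_of_forall_le_of_nonneg (norm_nonneg _)
      fun i _ ↦ hk i).trans_lt (h2 k)
  have hadd : ∀ {x y : K}, ‖x - y‖ < 1 → ‖y‖ < 1 → ‖x‖ < 1 := fun {x y} hx hy ↦ by
    rw [← sub_add_cancel x y]
    exact (IsUltrametricDist.norm_add_le_max _ _).trans_lt (max_lt hx hy)
  have hc1 : ‖c‖ < 1 := by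
    have h2 : ‖f' c₀‖ < 1 := by simpa using hfc' 1
    have h3 := hadd (hclose c₀) h2
    rwa [norm_mul, hc₀, mul_one] at h3
  have h3 : ‖f' h'‖ < 1 := by
    refine hadd (y := c * idemFn n X h') (by rw [norm_sub_rev]; exact hclose h') ?_
    rw [norm_mul]
    exact mul_lt_one_of_nonneg_of_lt_one_left (norm_nonneg _) hc1 (h1 _)
  rw [hh'] at h3
  exact lt_irrefl _ h3

/-- The preceding bound, rescaled: a `U`-invariant function in the span of `X` attains its maximal norm
on the orbit of `c₀`. -/
theorem norm_le_one_of_orbit (hX : IsCharOrbit a n X) (hpK : ‖(p : K)‖ < 1)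
    (h1 : ∀ h, ‖idemFn n X h‖ ≤ 1) {c₀ : H} (hc₀ : ‖idemFn n X c₀‖ = 1) {U : Subgroup Δ}
    (hU : ∀ φ : Δ, ∃ k : ℕ, φ ^ p ^ k ∈ U) {f : H → K}
    (hf : f ∈ Submodule.span K (X : Set (H → K))) (hfU : ∀ u ∈ U, ∀ h, f (a u h) = f h) {M : ℝ}
    (hM : 0 ≤ M) (hfc : ∀ θ, ‖f (a θ c₀)‖ ≤ M) (h : H) : ‖f h‖ ≤ M := by
  obtain ⟨h', hh'⟩ := Finite.exists_max fun h ↦ ‖f h‖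
  refine (hh' h).trans ?_
  by_contra! hlt
  have hpos : 0 < ‖f h'‖ := hM.trans_lt hlt
  have h2 := hX.norm_lt_one_of_orbit hpK h1 hc₀ hU (f := (f h')⁻¹ • f) (Submodule.smul_mem _ _ hf)
    (fun u hu h ↦ by rw [Pi.smul_apply, hfU u hu, Pi.smul_apply])
    (fun h ↦ by
      rw [Pi.smul_apply, smul_eq_mul, norm_mul, norm_inv, inv_mul_le_one₀ hpos]
      exact hh' h)
    (fun θ ↦ by
      rw [Pi.smul_apply, smul_eq_mul, norm_mul, norm_inv, inv_mul_lt_one₀ hpos]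
      exact (hfc θ).trans_lt hlt) h'
  rw [Pi.smul_apply, smul_eq_mul, inv_mul_cancel₀ (norm_pos_iff.mp hpos), norm_one] at h2
  exact lt_irrefl _ h2

/-- If the idempotent of `X` has integral coefficients, the degree of the characters in `X` has the
same valuation as the order of the group. -/
theorem norm_degree_eq (hX : IsCharOrbit a n X) (hpK : ‖(p : K)‖ < 1)
    (h1 : ∀ h, ‖idemFn n X h‖ ≤ 1) : ‖(n : K)‖ = ‖(Fintype.card H : K)‖ := by
  classical
  have := Fintype.ofFinite Δ
  have hpp : p.Prime := Fact.out
  have hnK : (n : K) ≠ 0 := Nat.cast_ne_zero.mpr hX.pos.ne'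
  have hHK : (Fintype.card H : K) ≠ 0 := Nat.cast_ne_zero.mpr Fintype.card_ne_zero
  obtain ⟨η, hη⟩ := hX.nonempty
  obtain ⟨c₀, hc₀⟩ := hX.exists_norm_idemFn_eq_one h1
  have hcomp : ∀ (f : H → K) φ ψ, f ∘ a (φ * ψ) = (f ∘ a φ) ∘ a ψ := fun f φ ψ ↦ by
    rw [map_mul]; rfl
  have hinj : ∀ (f f' : H → K) φ, f ∘ a φ = f' ∘ a φ → f = f' := fun f f' φ h ↦ by
    ext k
    have := congrFun h ((a φ).symm k)
    simpa using this
  have ha1 : ∀ f : H → K, f ∘ a 1 = f := fun f ↦ by rw [map_one]; rfl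
  -- the stabiliser `S` of `η`, and the subgroup `U/S` of elements of order prime to `p` of `Δ/S`
  let S : Subgroup Δ :=
    { carrier := {θ | η ∘ a θ = η}
      one_mem' := ha1 η
      mul_mem' := fun {φ ψ} hφ hψ ↦ by
        rw [Set.mem_ofPred_eq] at hφ hψ ⊢
        rw [hcomp, hφ, hψ]
      inv_mem' := fun {φ} hφ ↦ by
        rw [Set.mem_ofPred_eq] at hφ ⊢
        refine hinj _ _ φ ?_
        rw [← hcomp, inv_mul_cancel, ha1, hφ] }
  have hSmem : ∀ θ, θ ∈ S ↔ η ∘ a θ = η := fun _ ↦ Iff.rfl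
  let U : Subgroup Δ :=
    { carrier := {θ | ∃ m : ℕ, ¬ p ∣ m ∧ θ ^ m ∈ S}
      one_mem' := ⟨1, fun h ↦ hpp.one_lt.ne' (Nat.dvd_one.mp h), by simp⟩
      mul_mem' := by
        rintro φ ψ ⟨m, hm, hφ⟩ ⟨m', hm', hψ⟩
        refine ⟨m * m', fun h ↦ (hpp.dvd_mul.mp h).elim hm hm', ?_⟩
        rw [mul_pow]
        refine S.mul_mem ?_ ?_
        · rw [pow_mul]; exact S.pow_mem hφ _
        · rw [mul_comm m, pow_mul]; exact S.pow_mem hψ _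
      inv_mem' := by
        rintro φ ⟨m, hm, hφ⟩
        exact ⟨m, hm, by rw [inv_pow]; exact S.inv_mem hφ⟩ }
  have hSU : S ≤ U := fun θ hθ ↦ ⟨1, fun h ↦ hpp.one_lt.ne' (Nat.dvd_one.mp h), by rwa [pow_one]⟩
  have hU : ∀ φ : Δ, ∃ k : ℕ, φ ^ p ^ k ∈ U := by
    intro φ
    obtain ⟨k, m, hm, hkm⟩ := Nat.exists_eq_pow_mul_and_not_dvd (orderOf_pos φ).ne' p hpp.ne_one
    refine ⟨k, m, hm, ?_⟩
    rw [← pow_mul, ← hkm, pow_orderOf_eq_one]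
    exact S.one_mem
  have hXcard : X.card = S.index := by
    have e : Δ ⧸ S ≃ X := by
      refine Equiv.ofBijective (Quotient.lift (fun θ ↦ (⟨η ∘ a θ, hX.comp_mem θ η hη⟩ : X)) ?_)
        ⟨?_, ?_⟩
      · intro φ ψ h
        refine Subtype.ext ?_
        have h2 : φ⁻¹ * ψ ∈ S := QuotientGroup.leftRel_apply.mp h
        change η ∘ a φ = η ∘ a ψ
        rw [← mul_inv_cancel_left φ ψ, mul_comm, hcomp, (hSmem _).mp h2]
      · intro x y
        refine Quotient.inductionOn₂ x y fun φ ψ h ↦ ?_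
        refine Quotient.sound (QuotientGroup.leftRel_apply.mpr ((hSmem _).mpr ?_))
        have h2 : η ∘ a φ = η ∘ a ψ := congrArg Subtype.val h
        refine hinj _ _ φ ?_
        rw [← hcomp, mul_comm, mul_inv_cancel_left, h2]
      · rintro ⟨y, hy⟩
        obtain ⟨θ, rfl⟩ := hX.trans η hη y hy
        exact ⟨(θ : Δ ⧸ S), rfl⟩
    rw [Subgroup.index, Nat.card_congr e, Nat.card_eq_fintype_card, Fintype.card_coe]
  have hrel : ¬ p ∣ S.relIndex U := by
    intro hdvd
    obtain ⟨x, hx⟩ := exists_prime_orderOf_dvd_card' (G := U ⧸ S.subgroupOf U) p hdvd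
    obtain ⟨⟨u, hu⟩, rfl⟩ := QuotientGroup.mk_surjective x
    obtain ⟨m, hm, hum⟩ := hu
    refine hm ?_
    rw [← hx]
    refine orderOf_dvd_of_pow_eq_one ?_
    rw [← QuotientGroup.mk_pow, QuotientGroup.eq_one_iff, Subgroup.mem_subgroupOf]
    exact hum
  -- the translates of the `U`-orbit sum of `η`, indexed by `Δ/U`
  let b : Δ → H → K := fun φ ↦ ∑ u : U, η ∘ a (u * φ)
  have hb_mul : ∀ φ ψ h, b φ (a ψ h) = b (φ * ψ) h := by
    intro φ ψ h
    simp only [b, Finset.sum_apply, ← mul_assoc]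
    refine Finset.sum_congr rfl fun u _ ↦ ?_
    rw [hcomp _ _ ψ]
    rfl
  have hbU : ∀ u ∈ U, ∀ φ, b (u * φ) = b φ := by
    intro u hu φ
    refine Fintype.sum_equiv (Equiv.mulRight (⟨u, hu⟩ : U)) _ _ fun v ↦ ?_
    simp [mul_assoc]
  have hbspan : ∀ φ, b φ ∈ Submodule.span K (X : Set (H → K)) := fun φ ↦
    Submodule.sum_mem _ fun u _ ↦ Submodule.subset_span (hX.comp_mem _ η hη)
  let F : (Δ ⧸ U → K) → H → K := fun c ↦ ∑ q, c q • b q.out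
  have hFspan : ∀ c, F c ∈ Submodule.span K (X : Set (H → K)) := fun c ↦
    Submodule.sum_mem _ fun q _ ↦ Submodule.smul_mem _ _ (hbspan _)
  have hFU : ∀ c, ∀ u ∈ U, ∀ h, F c (a u h) = F c h := by
    intro c u hu h
    simp only [F, Finset.sum_apply, Pi.smul_apply]
    refine Finset.sum_congr rfl fun q _ ↦ ?_
    rw [hb_mul, mul_comm, hbU u hu]
  have hFU' : ∀ c (φ : Δ) h, F c (a (φ : Δ ⧸ U).out h) = F c (a φ h) := by
    intro c φ h
    have h2 : φ⁻¹ * (φ : Δ ⧸ U).out ∈ U :=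
      QuotientGroup.eq.mp (QuotientGroup.out_eq' (φ : Δ ⧸ U)).symm
    conv_lhs => rw [← mul_inv_cancel_left φ (φ : Δ ⧸ U).out, mul_comm, map_mul,
      Equiv.Perm.mul_apply]
    exact hFU c _ h2 _
  let L : (Δ ⧸ U → K) →ₗ[K] (Δ ⧸ U → K) :=
    { toFun := fun c q ↦ F c (a q.out c₀)
      map_add' := fun c c' ↦ by
        ext q
        simp [F, add_mul, Finset.sum_add_distrib]
      map_smul' := fun r c ↦ by
        ext q
        simp [F, mul_assoc, Finset.mul_sum] }
  have hL : ∀ c (φ : Δ), F c (a φ c₀) = L c φ := fun c φ ↦ (hFU' c φ c₀).symm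
  have hLinj : Function.Injective L := by
    rw [← LinearMap.ker_eq_bot, LinearMap.ker_eq_bot']
    intro c hc
    have hF0 : ∀ h, F c h = 0 := by
      intro h
      refine norm_le_zero_iff.mp (hX.norm_le_one_of_orbit hpK h1 hc₀ hU (hFspan c) (hFU c) le_rfl
        (fun θ ↦ ?_) h)
      rw [hL, hc]
      simp
    ext q
    -- pair with the character `η ∘ a q.out`
    let y : H → K := η ∘ a q.out
    have hy : y ∈ X := hX.comp_mem _ η hη
    have hpair : ∀ q' : Δ ⧸ U, ∑ h, b q'.out h * y h⁻¹ =
        if q' = q then ((Finset.univ.filter fun u : U ↦ (u : Δ) ∈ S).card * Fintype.card H : K)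
          else 0 := by
      intro q'
      have h2 : ∀ u : U, ∑ h, (η ∘ a (u * q'.out)) h * y h⁻¹ =
          if η ∘ a (u * q'.out) = y then (Fintype.card H : K) else 0 := by
        intro u
        split_ifs with h3
        · rw [h3, (hX.irred y hy).sum_mul_inv_self]
        · exact (hX.irred _ (hX.comp_mem _ η hη)).sum_mul_inv (hX.irred y hy) h3
      simp only [b, Finset.sum_apply, Finset.sum_mul]
      rw [Finset.sum_comm, Finset.sum_congr rfl fun u _ ↦ h2 u]
      split_ifs with hq
      · subst hq
        rw [← Finset.sum_filter, Finset.sum_const, nsmul_eq_mul]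
        congr 3
        ext u
        simp only [Finset.mem_filter, Finset.mem_univ, true_and, y]
        rw [hcomp, hSmem]
        exact ⟨hinj _ _ _, fun h ↦ by rw [h]⟩
      · refine Finset.sum_eq_zero fun u _ ↦ if_neg fun h3 ↦ hq ?_
        have h4 : q.out⁻¹ * (u * q'.out) ∈ S := by
          rw [hSmem]
          refine hinj _ _ q.out ?_
          rw [← hcomp, mul_comm, mul_inv_cancel_left, h3]
        rw [← QuotientGroup.out_eq' q, ← QuotientGroup.out_eq' q']
        refine (QuotientGroup.eq.mpr ?_).symm
        have h5 := U.mul_mem (U.inv_mem u.2) (hSU h4)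
        rwa [mul_left_comm, inv_mul_cancel_left] at h5
    have h3 : ∑ h, F c h * y h⁻¹ =
        c q * ((Finset.univ.filter fun u : U ↦ (u : Δ) ∈ S).card * Fintype.card H : K) := by
      simp only [F, Finset.sum_apply, Pi.smul_apply, smul_eq_mul, Finset.sum_mul, mul_assoc]
      rw [Finset.sum_comm]
      simp only [← Finset.mul_sum]
      rw [Finset.sum_eq_single q, hpair, if_pos rfl]
      · intro q' _ hq'
        rw [hpair, if_neg hq', mul_zero]
      · simp
    simp only [hF0, zero_mul, Finset.sum_const_zero] at h3
    refine (mul_eq_zero.mp h3.symm).resolve_right (mul_ne_zero (Nat.cast_ne_zero.mpr ?_) hHK)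
    exact Finset.card_ne_zero_of_mem (a := 1) (Finset.mem_filter.mpr ⟨Finset.mem_univ _, S.one_mem⟩)
  -- a `U`-invariant function in the span of `X` whose values on the orbit of `c₀`, which are indexed by
  -- `Δ/U`, are `1` at `c₀` and `0` elsewhere; by the maximum principle it is integral
  obtain ⟨c, hc⟩ := LinearMap.injective_iff_surjective.mp hLinj (Pi.single 1 1)
  have hval : ∀ θ, ‖F c (a θ c₀)‖ ≤ 1 := by
    intro θ
    rw [hL, hc, Pi.single_apply]
    split_ifs <;> simp
  have hF1 := hX.norm_le_one_of_orbit hpK h1 hc₀ hU (hFspan c) (hFU c) zero_le_one hval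
  have hle := hX.norm_apply_one_le hpK h1 (hFspan c) hF1
  -- the sum of the translates of `F c` is a unit multiple of the idempotent
  let T : H → K := fun h ↦ ∑ q : Δ ⧸ U, F c (a q.out h)
  have hTspan : T ∈ Submodule.span K (X : Set (H → K)) := by
    have : T = ∑ q : Δ ⧸ U, F c ∘ a q.out := by
      ext h
      simp [T]
    rw [this]
    exact Submodule.sum_mem _ fun q _ ↦ hX.comp_mem_span (hFspan c) _
  have hTinv : ∀ θ h, T (a θ h) = T h := by
    intro θ h
    refine Fintype.sum_equiv (Equiv.mulRight (θ : Δ ⧸ U)) _ _ fun q ↦ ?_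
    have hq : q * (θ : Δ ⧸ U) = ((q.out * θ : Δ) : Δ ⧸ U) := by
      rw [QuotientGroup.mk_mul, QuotientGroup.out_eq']
    change _ = F c (a (q * (θ : Δ ⧸ U)).out h)
    rw [hq, hFU', map_mul]
    rfl
  obtain ⟨r, hr⟩ := hX.exists_sum_mul_idemFn (hX.mul_comm_of_mem_span hTspan) hTinv
  simp only [hX.sum_mul_idemFn_of_mem_span hTspan] at hr
  have hT0 : T c₀ = 1 := by
    have : ∀ q : Δ ⧸ U, F c (a q.out c₀) = Pi.single (M := fun _ ↦ K) 1 1 q := fun q ↦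
      congrFun hc q
    simp only [T, this]
    simp
  have hr1 : ‖r‖ = 1 := by
    have := congrArg norm (hr c₀)
    rw [hT0, norm_one, norm_mul, hc₀, mul_one] at this
    exact this.symm
  have hT1 : T 1 = U.index * F c 1 := by
    simp only [T, hX.apply_apply_one (hFspan c)]
    rw [Finset.sum_const, Finset.card_univ, nsmul_eq_mul, Subgroup.index, Nat.card_eq_fintype_card]
  have hidx : (U.index : K) ≠ 0 := Nat.cast_ne_zero.mpr U.index_ne_zero_of_finite
  have h4 := hr 1
  rw [hT1, hX.idemFn_one, hXcard, ← Subgroup.relIndex_mul_index hSU, Nat.cast_mul] at h4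
  -- as `r` and the index of `S` in `U` are units, `n ^ 2 / |H|` is divisible by `n`
  have h5 : F c 1 = r * (S.relIndex U * (n * n / Fintype.card H)) := by
    refine mul_left_cancel₀ hidx (h4.trans ?_)
    ring
  rw [h5, norm_mul, norm_mul, hr1, norm_natCast_eq_one_of_not_dvd hpK hrel, one_mul, one_mul,
    norm_div, norm_mul, div_le_iff₀ (norm_pos_iff.mpr hHK)] at hle
  exact le_antisymm (le_of_mul_le_mul_left hle (norm_pos_iff.mpr hnK))
    (hX.irred η hη).norm_card_le

end IsCharOrbit

end DefectZeroOrbit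

/-! ### Orbits under the Galois group and an automorphism -/

section GaloisOrbit

variable {F K : Type*} [Field F] [Field K] [Algebra F K] [IsAlgClosed K] [CharZero K] {H : Type u}
  [Group H] [Finite H]

/-- The Galois group acts on the characters of a finite group through power maps. -/
theorem exists_galois_perm (σ : K ≃ₐ[F] K) : ∃ (π : Equiv.Perm H) (m : ℕ), (∀ h, π h = h ^ m) ∧
    ∀ (d : ℕ) (ρ : Representation K H (Fin d → K)) h,
      σ (LinearMap.trace K _ (ρ h)) = LinearMap.trace K _ (ρ (h ^ m)) := by
  have : NeZero (Nat.card H) := ⟨Nat.card_pos.ne'⟩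
  obtain ⟨m, hm, h⟩ := exists_coprime_map_trace_eq (Nat.card H) σ.toRingEquiv
  refine ⟨powCoprime hm.symm, m, fun h ↦ rfl, fun d ρ k ↦ ?_⟩
  have h1 := h d (ρ k) (by rw [← map_pow, pow_card_eq_one', map_one])
  rwa [← map_pow] at h1

/-- The characters obtained from an irreducible character by applying field automorphisms and powers
of a group automorphism form an orbit for a finite commutative group of permutations: the field
automorphisms act through power maps, which commute with group automorphisms. -/
theorem exists_isCharOrbit (c : MulAut H) {n : ℕ} {η : H → K} (hη : IsIrredTrace n η) :
    ∃ (Δ : Type u) (_ : CommGroup Δ) (_ : Finite Δ) (a : Δ →* Equiv.Perm H) (X : Finset (H → K)),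
      IsCharOrbit a n X ∧
      ∀ x, x ∈ X ↔ ∃ (σ : K ≃ₐ[F] K) (j : ℤ), x = fun h ↦ σ (η ((c ^ j) h)) := by
  classical
  have := Fintype.ofFinite H
  let gen : Set (Equiv.Perm H) := {MulAut.toPerm H c} ∪
    {π | ∃ (m : ℕ) (σ : K ≃ₐ[F] K), (∀ h, π h = h ^ m) ∧
      ∀ (d : ℕ) (ρ : Representation K H (Fin d → K)) h,
        σ (LinearMap.trace K _ (ρ h)) = LinearMap.trace K _ (ρ (h ^ m))}
  have hcomm : ∀ x ∈ gen, ∀ y ∈ gen, x * y = y * x := by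
    rintro x (rfl | ⟨m, σ, hm, -⟩) y (rfl | ⟨m', σ', hm', -⟩)
    · rfl
    · ext h
      rw [Equiv.Perm.mul_apply, Equiv.Perm.mul_apply, hm', hm']
      exact map_pow c h m'
    · ext h
      rw [Equiv.Perm.mul_apply, Equiv.Perm.mul_apply, hm, hm]
      exact (map_pow c h m).symm
    · ext h
      simp [hm, hm', ← pow_mul, mul_comm]
  let Δ := Subgroup.closure gen
  have := Subgroup.isMulCommutative_closure hcomm
  let cg : CommGroup Δ := { (inferInstance : Group Δ) with mul_comm := mul_comm' }
  let a : Δ →* Equiv.Perm H := Δ.subtype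
  -- on irreducible characters, each permutation in `Δ` acts as a field automorphism followed by a power
  -- of `c`
  have key : ∀ θ ∈ Δ, ∃ (σ : K ≃ₐ[F] K) (j : ℤ), ∀ (n : ℕ) (x : H → K), IsIrredTrace n x →
      ∀ h, x (θ h) = σ (x ((c ^ j) h)) := by
    intro θ hθ
    induction hθ using Subgroup.closure_induction with
    | mem θ hθ =>
      rcases hθ with rfl | ⟨m, σ, hm, hσ⟩
      · exact ⟨1, 1, fun n x _ h ↦ rfl⟩
      · refine ⟨σ, 0, fun n x hx h ↦ ?_⟩
        obtain ⟨ρ, -, hρ⟩ := hx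
        rw [hm, hρ, ← hσ, zpow_zero, MulAut.one_apply, hρ]
    | one => exact ⟨1, 0, fun n x _ h ↦ rfl⟩
    | mul θ φ _ _ h1 h2 =>
      obtain ⟨σ, j, h1⟩ := h1
      obtain ⟨τ, k, h2⟩ := h2
      refine ⟨σ * τ, j + k, fun n x hx h ↦ ?_⟩
      rw [Equiv.Perm.mul_apply, h1 n x hx, zpow_add, MulAut.mul_apply, AlgEquiv.mul_apply]
      exact congrArg σ (h2 n _ (hx.comp_mulEquiv (c ^ j)) h)
    | inv θ _ h1 =>
      obtain ⟨σ, j, h1⟩ := h1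
      refine ⟨σ⁻¹, -j, fun n x hx h ↦ ?_⟩
      have h2 := h1 n _ ((hx.comp_mulEquiv (c ^ (-j))).map_ringEquiv (σ⁻¹).toRingEquiv) (θ⁻¹ h)
      have h3 : θ (θ⁻¹ h) = h := θ.apply_symm_apply h
      rw [h3] at h2
      have h4 : (c ^ (-j)) ((c ^ j) (θ⁻¹ h)) = θ⁻¹ h := by
        rw [← MulAut.mul_apply, ← zpow_add, neg_add_cancel, zpow_zero, MulAut.one_apply]
      simp only [Function.comp_apply, h4] at h2
      exact (h2.trans (σ.apply_symm_apply _)).symm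
  have hinv : ∀ θ ∈ Δ, ∀ h, θ h⁻¹ = (θ h)⁻¹ := by
    intro θ hθ
    induction hθ using Subgroup.closure_induction with
    | mem θ hθ =>
      rcases hθ with rfl | ⟨m, σ, hm, hσ⟩
      · exact fun h ↦ map_inv c h
      · intro h
        rw [hm, hm, inv_pow]
    | one => exact fun h ↦ rfl
    | mul θ φ _ _ h1 h2 =>
      intro h
      rw [Equiv.Perm.mul_apply, h2, h1, Equiv.Perm.mul_apply]
    | inv θ _ h1 =>
      intro h
      refine θ.injective ?_
      have h3 : ∀ h, θ (θ⁻¹ h) = h := θ.apply_symm_apply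
      rw [h1, h3, h3]
  have := Fintype.ofFinite Δ
  let X : Finset (H → K) := Finset.univ.image fun θ : Δ ↦ η ∘ a θ
  have hX : ∀ x, x ∈ X ↔ ∃ θ : Δ, η ∘ a θ = x := fun x ↦ by simp [X]
  refine ⟨Δ, cg, inferInstance, a, X, ?_, fun x ↦ ⟨fun hx ↦ ?_, ?_⟩⟩
  · refine ⟨fun x hx ↦ ?_, ⟨η, (hX η).mpr ⟨1, rfl⟩⟩, fun θ x hx ↦ ?_, fun x hx y hy ↦ ?_,
      fun θ h ↦ hinv θ.1 θ.2 h⟩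
    · obtain ⟨θ, rfl⟩ := (hX x).mp hx
      obtain ⟨σ, j, h⟩ := key θ.1 θ.2
      have : η ∘ a θ = σ.toRingEquiv ∘ (η ∘ (c ^ j)) := funext fun k ↦ h n η hη k
      rw [this]
      exact (hη.comp_mulEquiv _).map_ringEquiv _
    · obtain ⟨φ, rfl⟩ := (hX x).mp hx
      exact (hX _).mpr ⟨φ * θ, rfl⟩
    · obtain ⟨φ, rfl⟩ := (hX x).mp hx
      obtain ⟨ψ, rfl⟩ := (hX y).mp hy
      refine ⟨φ⁻¹ * ψ, ?_⟩
      have : a ψ = a φ * a (φ⁻¹ * ψ) := by rw [← map_mul, mul_inv_cancel_left]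
      rw [this]
      rfl
  · obtain ⟨θ, rfl⟩ := (hX x).mp hx
    obtain ⟨σ, j, h⟩ := key θ.1 θ.2
    exact ⟨σ, j, funext fun k ↦ h n η hη k⟩
  · rintro ⟨σ, j, rfl⟩
    obtain ⟨π, m, hπ, hσ⟩ := exists_galois_perm (H := H) σ
    have hc : MulAut.toPerm H c ∈ Δ := Subgroup.subset_closure (Or.inl rfl)
    have hπ' : π ∈ Δ := Subgroup.subset_closure (Or.inr ⟨m, σ, hπ, hσ⟩)
    refine (hX _).mpr ⟨⟨MulAut.toPerm H c ^ j * π, Δ.mul_mem (Δ.zpow_mem hc j) hπ'⟩, ?_⟩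
    ext h
    obtain ⟨ρ, -, hρ⟩ := hη.comp_mulEquiv (c ^ j)
    have h1 : η ((c ^ j) h) = _ := hρ h
    rw [h1, hσ, ← hρ, ← hπ, Function.comp_apply, Function.comp_apply]
    congr 1
    change (MulAut.toPerm H c ^ j * π) h = _
    rw [← map_zpow]
    rfl

end GaloisOrbit

/-! ### The idempotent `ε_χ` as an orbit sum -/

section EpsilonChi

variable {p : ℕ} [Fact p.Prime] {G : Type u} [Group G] [TopologicalSpace G]

theorem IrrChar.isIrredTrace (χ : IrrChar p G) : IsIrredTrace χ.degree χ.1 := by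
  obtain ⟨ρ, h⟩ := χ.2.choose_spec
  exact ⟨ρ, h.irreducible, h.char_eq⟩

theorem IsIrredTrace.exists_irrChar [DiscreteTopology G] {n : ℕ} {x : G → PadicAlgCl p}
    (hx : IsIrredTrace n x) : ∃ η : IrrChar p G, η.1 = x := by
  obtain ⟨ρ, h, h'⟩ := hx
  exact ⟨⟨x, n, ρ, h, isOpen_discrete _, h'⟩, rfl⟩

variable [IsTopologicalGroup G] [T2Space G] {H : Subgroup G} [H.Normal] [Fintype H]

/-- The centraliser of a finite normal subgroup is open. -/
theorem exists_openNormalSubgroup_commute (H : Subgroup G) [H.Normal] [Fintype H] :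
    ∃ N : OpenNormalSubgroup G, ∀ g ∈ N.toSubgroup, ∀ h : H, MulAut.conjNormal g h = h := by
  let Z : Subgroup G := (MulAut.conjNormal : G →* MulAut H).ker
  have hZ : ∀ g, g ∈ Z ↔ ∀ h : H, g * h * g⁻¹ = h := by
    intro g
    rw [MonoidHom.mem_ker]
    refine ⟨fun hg h ↦ ?_, fun hg ↦ ?_⟩
    · rw [← MulAut.conjNormal_apply, hg, MulAut.one_apply]
    · ext h
      rw [MulAut.conjNormal_apply, hg, MulAut.one_apply]
  have hclosed : IsClosed (Z : Set G) := by
    have h1 : (Z : Set G) = ⋂ h : H, {g : G | g * h * g⁻¹ = h} := by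
      ext g
      simpa using hZ g
    rw [h1]
    exact isClosed_iInter fun h ↦ isClosed_eq (by fun_prop) continuous_const
  have hfin : Finite (MulAut H) := Finite.of_injective (fun e : MulAut H ↦ (e : H → H))
    DFunLike.coe_injective
  have : Z.FiniteIndex := Subgroup.finiteIndex_ker _
  refine ⟨⟨⟨Z, Z.isOpen_of_isClosed_of_finiteIndex hclosed⟩, inferInstanceAs Z.Normal⟩, fun g hg h ↦ Subtype.ext ?_⟩
  rw [MulAut.conjNormal_apply]
  exact (hZ g).mp hg h

omit [Fact (Nat.Prime p)] in
/-- Up to inner automorphisms of `H`, conjugation by an element of `G` is conjugation by a power of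
`γ`. -/
theorem IsGenOver.exists_conjNormal {γ : G} (hG : IsGenOver p H γ) (g : G) :
    ∃ (j : ℕ) (h : H), ∀ k : H,
      MulAut.conjNormal g k = h * (MulAut.conjNormal γ ^ (j : ℤ) : MulAut H) k * h⁻¹ := by
  obtain ⟨N, hN⟩ := exists_openNormalSubgroup_commute H
  obtain ⟨h, hh, j, hj⟩ := hG.dense N g
  refine ⟨j, ⟨h, hh⟩, fun k ↦ ?_⟩
  have h1 := hN _ (QuotientGroup.eq.mp hj) k
  have h2 : g = (h * γ ^ j) * ((h * γ ^ j)⁻¹ * g) := by rw [mul_inv_cancel_left]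
  rw [h2, map_mul, MulAut.mul_apply, h1, zpow_natCast, ← map_pow]
  refine Subtype.ext ?_
  simp [mul_assoc]

omit [IsTopologicalGroup G] [T2Space G] in
theorem galoisAct_tmul (σ : PadicAlgCl p ≃ₐ[ℚ_[p]] PadicAlgCl p) (c : PadicAlgCl p)
    (y : FractionIwasawa p G) : galoisAct p σ (c ⊗ₜ y) = σ c ⊗ₜ y := by
  simp [galoisAct]

variable (H) in
/-- The element `∑ f(h⁻¹) h` of `𝒬ᶜ(G)`. -/
def sumTmul (f : H → PadicAlgCl p) : FractionIwasawaAlgCl p G :=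
  ∑ h : H, f h⁻¹ ⊗ₜ[ℚ_[p]] toFraction p (IwasawaAlgebra.of p (h : G))

omit [IsTopologicalGroup G] [T2Space G] [H.Normal] in
theorem sumTmul_finset_sum {ι : Type*} (s : Finset ι) (f : ι → H → PadicAlgCl p) :
    sumTmul H (∑ i ∈ s, f i) = ∑ i ∈ s, sumTmul H (f i) := by
  simp only [sumTmul, Finset.sum_apply, TensorProduct.sum_tmul]
  exact Finset.sum_comm

omit [IsTopologicalGroup G] [T2Space G] in
omit [H.Normal] in
theorem galoisAct_sumTmul (σ : PadicAlgCl p ≃ₐ[ℚ_[p]] PadicAlgCl p) (f : H → PadicAlgCl p) :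
    galoisAct p σ (sumTmul H f) = sumTmul H (σ ∘ f) := by
  simp only [sumTmul, map_sum, galoisAct_tmul, Function.comp_apply]

omit [IsTopologicalGroup G] [T2Space G] [H.Normal] in
theorem idemOfChar_eq (η : IrrChar p H) : idemOfChar H η =
    sumTmul H (((η.degree : PadicAlgCl p) / Fintype.card H) • η.1) := by
  simp only [idemOfChar, sumTmul, ← IrrChar.degree_eq, Pi.smul_apply, smul_eq_mul]

/-- The idempotent `ε_χ` is the sum of the idempotents of the characters in the orbit of a
constituent of the restriction of `χ`, under Galois and the powers of `γ`. -/
theorem exists_isCharOrbit_epsilonChi {γ : G} (hG : IsGenOver p H γ) (χ : IrrChar p G)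
    (η : IrrChar p H) (hη : IsConstituent H χ η) :
    ∃ (Δ : Type u) (_ : CommGroup Δ) (_ : Finite Δ) (a : Δ →* Equiv.Perm H)
      (X : Finset (H → PadicAlgCl p)), IsCharOrbit a η.degree X ∧
      (∀ x, x ∈ X ↔ ∃ (σ : PadicAlgCl p ≃ₐ[ℚ_[p]] PadicAlgCl p) (j : ℤ),
        x = fun h ↦ σ (η ((MulAut.conjNormal γ ^ j : MulAut H) h))) ∧
      epsilonChi H χ = sumTmul H (idemFn η.degree X) ∧
      ∃ ρ : Representation (PadicAlgCl p) G (Fin χ.degree → PadicAlgCl p),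
        IsIrrCharOf p χ.1 ρ ∧ ∑ h : H, idemFn η.degree X h • ρ (h : G)⁻¹ = 1 := by
  classical
  obtain ⟨ρ, hρ⟩ := χ.2.choose_spec
  change Representation (PadicAlgCl p) G (Fin χ.degree → PadicAlgCl p) at ρ
  change IsIrrCharOf p χ.1 ρ at hρ
  obtain ⟨Δ, _, _, a, X, hX, hXmem⟩ := exists_isCharOrbit (F := ℚ_[p])
    (MulAut.conjNormal γ : MulAut H) η.isIrredTrace
  set n := η.degree
  have hconjX : ∀ (σ : PadicAlgCl p ≃ₐ[ℚ_[p]] PadicAlgCl p) (g : G),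
      (fun h ↦ σ (η (MulAut.conjNormal g h))) ∈ X := by
    intro σ g
    obtain ⟨j, h, hjh⟩ := hG.exists_conjNormal g
    refine (hXmem _).mpr ⟨σ, j, funext fun k ↦ ?_⟩
    rw [hjh, η.isIrredTrace.mul_comm, inv_mul_cancel_left]
  -- the constituents of the restriction
  let C : Finset (H → PadicAlgCl p) := X.filter fun y ↦ ∃ g : G, y = η.1 ∘ MulAut.conjNormal g
  have hC : ∀ y, y ∈ C ↔ ∃ g : G, y = η.1 ∘ MulAut.conjNormal g := by
    intro y
    refine ⟨fun h ↦ (Finset.mem_filter.mp h).2, fun h ↦ Finset.mem_filter.mpr ⟨?_, h⟩⟩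
    obtain ⟨g, rfl⟩ := h
    exact hconjX 1 g
  have hH : (Fintype.card H : PadicAlgCl p) ≠ 0 := Nat.cast_ne_zero.mpr Fintype.card_ne_zero
  have hcons : ∀ y : H → PadicAlgCl p,
      (Fintype.card H : PadicAlgCl p)⁻¹ * ∑ h : H, χ (h : G) * y h⁻¹ ≠ 0 ↔
        ∑ h : H, LinearMap.trace (PadicAlgCl p) _ (ρ (h : G)) * y h⁻¹ ≠ 0 := by
    intro y
    rw [mul_ne_zero_iff, and_iff_right (inv_ne_zero hH)]
    simp only [← hρ.char_eq]
  obtain ⟨hCl, hm0, hχ, hS, hS0⟩ := hρ.irreducible.clifford η.isIrredTrace ((hcons η).mp hη) C hC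
  simp only [← hρ.char_eq] at hχ hCl
  set m : ℚ := (χ.degree / (n * C.card) : ℚ) with hm
  have hCX : C ⊆ X := Finset.filter_subset _ _
  have hidem : idemFn n X = ∑ x ∈ X, ((n : PadicAlgCl p) / Fintype.card H) • x := by
    ext h
    simp [idemFn, Finset.mul_sum]
  refine ⟨Δ, inferInstance, inferInstance, a, X, hX, hXmem, ?_, ρ, hρ, ?_⟩
  · have heChi : eChi H χ = ∑ y ∈ C, sumTmul H (((n : PadicAlgCl p) / Fintype.card H) • y) := by
      rw [← finsum_mem_coe_finset]
      refine finsum_mem_eq_of_bijOn (s := {η' | IsConstituent H χ η'}) Subtype.val ?_ ?_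
      · refine ⟨fun η' h ↦ ?_, Subtype.val_injective.injOn, fun y hy ↦ ?_⟩
        · exact (hCl _ _ η'.isIrredTrace).mp ((mul_ne_zero_iff.mp h).2)
        · obtain ⟨η', rfl⟩ := (hX.irred y (hCX hy)).exists_irrChar
          exact ⟨η', mul_ne_zero (inv_ne_zero hH) ((hCl _ _ η'.isIrredTrace).mpr hy), rfl⟩
      · intro η' h
        have h1 : η'.1 ∈ C := (hCl _ _ η'.isIrredTrace).mp ((mul_ne_zero_iff.mp h).2)
        have h2 : (η'.degree : PadicAlgCl p) = n := by
          rw [IrrChar.degree_eq, (hX.irred _ (hCX h1)).apply_one]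
        rw [idemOfChar_eq, h2]
    -- Galois conjugates of values of `χ` are values of `χ` at powers
    have : Normal ℚ_[p] (charField H χ) := by
      rw [IntermediateField.normal_iff_forall_map_le']
      intro σ
      rw [charField, IntermediateField.adjoin_map, IntermediateField.adjoin_le_iff]
      rintro _ ⟨_, ⟨h, rfl⟩, rfl⟩
      obtain ⟨π, k, -, hk⟩ := exists_galois_perm (H := H) σ
      have h1 := hk _ (ρ.comp H.subtype) h
      have h2 : χ ((h ^ k : H) : G) = _ := hρ.char_eq _
      have h3 : χ (h : G) = _ := hρ.char_eq _
      refine IntermediateField.subset_adjoin _ _ ⟨h ^ k, ?_⟩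
      change χ ((h ^ k : H) : G) = σ (χ (h : G))
      rw [h2, h3]
      exact h1.symm
    have hfix : ∀ φ ψ : PadicAlgCl p ≃ₐ[ℚ_[p]] PadicAlgCl p,
        (∀ h : H, φ (χ (h : G)) = ψ (χ (h : G))) ↔ ∀ z : charField H χ, φ z = ψ z := by
      refine fun φ ψ ↦ ⟨fun h z ↦ ?_, fun h k ↦
        h ⟨_, IntermediateField.subset_adjoin _ _ ⟨k, rfl⟩⟩⟩
      have h1 : charField H χ ≤ (AlgHom.equalizer φ.toAlgHom ψ.toAlgHom :
          Subalgebra ℚ_[p] (PadicAlgCl p)).toIntermediateField (fun z hz ↦ by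
            have hz' : φ z = ψ z := hz
            change φ z⁻¹ = ψ z⁻¹
            rw [map_inv₀, map_inv₀, hz']) := by
        rw [charField, IntermediateField.adjoin_le_iff]
        rintro _ ⟨k, rfl⟩
        exact h k
      exact h1 z.2
    -- an automorphism fixing the values of `χ` permutes the constituents
    have hCfix : ∀ φ : PadicAlgCl p ≃ₐ[ℚ_[p]] PadicAlgCl p, (∀ h : H, φ (χ (h : G)) = χ (h : G)) →
        ∀ g : G, (fun h ↦ φ (η (MulAut.conjNormal g h))) ∈ C := by
      intro φ hφ g
      have h1 : IsIrredTrace n (φ.toRingEquiv ∘ η.1) := η.isIrredTrace.map_ringEquiv _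
      have h2 : (φ.toRingEquiv ∘ η.1) ∈ C := by
        refine (hCl _ _ h1).mp ?_
        have h3 := (mul_ne_zero_iff.mp hη).2
        rw [← map_ne_zero φ, map_sum] at h3
        refine fun h0 ↦ h3 (Eq.trans ?_ h0)
        refine Finset.sum_congr rfl fun h _ ↦ ?_
        rw [map_mul, hφ]
        rfl
      obtain ⟨g', hg'⟩ := (hC _).mp h2
      refine (hC _).mpr ⟨g' * g, funext fun h ↦ ?_⟩
      have h4 := congrFun hg' (MulAut.conjNormal g h)
      rw [map_mul]
      exact h4
    have hlift : ∀ (σ : charField H χ ≃ₐ[ℚ_[p]] charField H χ) (z : charField H χ),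
        σ.liftNormal (PadicAlgCl p) z = σ z := fun σ z ↦ σ.liftNormal_commutes (PadicAlgCl p) z
    rw [epsilonChi, heChi]
    simp only [map_sum]
    rw [hidem, sumTmul_finset_sum, ← Finset.sum_product']
    -- the pairs of an automorphism of the field of values and a constituent of the restriction
    -- correspond to the elements of the orbit
    refine Finset.sum_bij
      (fun q _ ↦ (q.1.liftNormal (PadicAlgCl p) : PadicAlgCl p ≃ₐ[ℚ_[p]] PadicAlgCl p) ∘ q.2)
      ?_ ?_ ?_ ?_
    · rintro ⟨σ, y⟩ hq
      obtain ⟨g, rfl⟩ := (hC y).mp (Finset.mem_product.mp hq).2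
      exact hconjX _ g
    · rintro ⟨σ, y⟩ hq ⟨τ, y'⟩ hq' h
      obtain ⟨g, rfl⟩ := (hC y).mp (Finset.mem_product.mp hq).2
      obtain ⟨g', rfl⟩ := (hC y').mp (Finset.mem_product.mp hq').2
      -- both automorphisms map the sum over `C` to the sum over the orbit of the common image
      have h1 : ∀ k : H, σ.liftNormal (PadicAlgCl p) (χ (k : G)) =
          τ.liftNormal (PadicAlgCl p) (χ (k : G)) := by
        intro k
        rw [hχ, map_mul, map_mul, map_ratCast, map_ratCast, map_sum, map_sum]
        congr 1
        refine Finset.sum_bij (fun y _ ↦ ((τ.liftNormal (PadicAlgCl p)).symm :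
          PadicAlgCl p ≃ₐ[ℚ_[p]] PadicAlgCl p) ∘ (σ.liftNormal (PadicAlgCl p) :
          PadicAlgCl p ≃ₐ[ℚ_[p]] PadicAlgCl p) ∘ y) ?_ ?_ ?_ ?_
        · intro y hy
          obtain ⟨g₁, rfl⟩ := (hC y).mp hy
          refine (hC _).mpr ⟨g' * g⁻¹ * g₁, funext fun l ↦ ?_⟩
          have h2 := congrFun h ((MulAut.conjNormal (g⁻¹ * g₁) : MulAut H) l)
          simp only [Function.comp_apply, ← MulAut.mul_apply, ← map_mul,
            mul_inv_cancel_left] at h2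
          simp only [Function.comp_apply]
          rw [h2, AlgEquiv.symm_apply_apply, mul_assoc]
        · intro y _ y' _ hy
          ext l
          have h2 := congrFun hy l
          simpa using h2
        · intro y hy
          obtain ⟨g₁, rfl⟩ := (hC y).mp hy
          refine ⟨η.1 ∘ MulAut.conjNormal (g * g'⁻¹ * g₁), (hC _).mpr ⟨_, rfl⟩, funext fun l ↦ ?_⟩
          have h2 := congrFun h ((MulAut.conjNormal (g'⁻¹ * g₁) : MulAut H) l)
          simp only [Function.comp_apply, ← MulAut.mul_apply, ← map_mul,
            mul_inv_cancel_left] at h2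
          simp only [Function.comp_apply]
          rw [mul_assoc, h2, AlgEquiv.symm_apply_apply]
        · intro y _
          simp
      have h2 : σ = τ := by
        ext z
        have := (hfix _ _).mp h1 z
        rwa [hlift, hlift] at this
      subst h2
      congr 1
      ext l
      have := congrFun h l
      simpa using this
    · intro x hx
      obtain ⟨σ, j, rfl⟩ := (hXmem x).mp hx
      let τ : charField H χ ≃ₐ[ℚ_[p]] charField H χ := σ.restrictNormal (charField H χ)
      let τ' : PadicAlgCl p ≃ₐ[ℚ_[p]] PadicAlgCl p := τ.liftNormal (PadicAlgCl p)
      have h1 : ∀ z : charField H χ, σ z = τ' z := by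
        intro z
        rw [hlift]
        exact (σ.restrictNormal_commutes (charField H χ) z).symm
      have h2 : ∀ h : H, (τ'⁻¹ * σ) (χ (h : G)) = χ (h : G) := by
        intro h
        have := (hfix σ τ').mpr h1 h
        rw [AlgEquiv.mul_apply, this]
        exact τ'.symm_apply_apply _
      refine ⟨(τ, fun h ↦ (τ'⁻¹ * σ) (η ((MulAut.conjNormal (γ ^ j) : MulAut H) h))),
        Finset.mem_product.mpr ⟨Finset.mem_univ _, hCfix _ h2 _⟩, funext fun h ↦ ?_⟩
      change τ' (τ'.symm (σ _)) = _
      rw [τ'.apply_symm_apply, map_zpow]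
    · rintro ⟨σ, y⟩ hq
      rw [galoisAct_sumTmul]
      refine congrArg (sumTmul H) (funext fun h ↦ ?_)
      simp
  · have h1 : ∑ h : H, idemFn n X h • ρ (h : G)⁻¹ = ρ.sumOp (idemFn n X) := rfl
    have h2 : ρ.sumOp (idemFn n X) = ((n : PadicAlgCl p) / Fintype.card H) • ∑ x ∈ X, ρ.sumOp x := by
      simp only [Representation.sumOp, idemFn, Finset.smul_sum, smul_smul, Finset.sum_smul,
        Finset.mul_sum]
      exact Finset.sum_comm
    rw [h1, h2, ← hS]
    congr 1
    refine (Finset.sum_subset hCX fun x hx hxC ↦ hS0 n x (hX.irred x hx) hxC).symm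

end EpsilonChi

/-! ### Integrality of the idempotent `ε_χ` -/

section Integrality

variable {p : ℕ} [Fact p.Prime]

theorem PadicAlgCl.norm_galois (σ : PadicAlgCl p ≃ₐ[ℚ_[p]] PadicAlgCl p) (x : PadicAlgCl p) :
    ‖σ x‖ = ‖x‖ := by
  rw [← PadicAlgCl.spectralNorm_eq, ← PadicAlgCl.spectralNorm_eq, ← spectralNorm_eq_of_equiv]

theorem PadicAlgCl.norm_algebraMap (x : ℚ_[p]) : ‖algebraMap ℚ_[p] (PadicAlgCl p) x‖ = ‖x‖ :=
  PadicAlgCl.norm_extends p x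

theorem PadicAlgCl.norm_natCast (m : ℕ) : ‖(m : PadicAlgCl p)‖ = ‖(m : ℚ_[p])‖ := by
  rw [← PadicAlgCl.norm_algebraMap, map_natCast]

variable (p) in
theorem PadicAlgCl.norm_prime_lt_one : ‖(p : PadicAlgCl p)‖ < 1 := by
  rw [PadicAlgCl.norm_natCast]
  exact Padic.norm_p_lt_one

theorem PadicAlgCl.norm_natCast_eq_iff {m n : ℕ} (hm : m ≠ 0) (hn : n ≠ 0) :
    ‖(m : PadicAlgCl p)‖ = ‖(n : PadicAlgCl p)‖ ↔ padicValNat p m = padicValNat p n := by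
  have hp : (1 : ℝ) < p := by exact_mod_cast (Fact.out : p.Prime).one_lt
  have key : ∀ k : ℕ, k ≠ 0 → ‖(k : PadicAlgCl p)‖ = (p : ℝ) ^ (-(padicValNat p k : ℤ)) := by
    intro k hk
    rw [PadicAlgCl.norm_natCast, Padic.norm_eq_zpow_neg_valuation (Nat.cast_ne_zero.mpr hk),
      Padic.valuation_natCast]
  rw [key m hm, key n hn, zpow_right_inj₀ (by linarith) hp.ne', neg_inj, Nat.cast_inj]

section Injectivity

variable {G : Type u} [Group G] [TopologicalSpace G]

theorem toFraction_injective : Function.Injective (toFraction p (G := G)) :=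
  OreLocalization.numeratorHom_inj fun _ hx ↦ hx.2.1

theorem toFractionAlgCl_injective : Function.Injective (toFractionAlgCl p (G := G)) :=
  (Algebra.TensorProduct.includeRight_injective
    (algebraMap ℚ_[p] (PadicAlgCl p)).injective).comp toFraction_injective

theorem algebraMap_fractionIwasawa (r : ℤ_[p]) :
    algebraMap ℚ_[p] (FractionIwasawa p G) r = toFraction p (algebraMap ℤ_[p] _ r) :=
  congrArg Subtype.val (IsLocalization.lift_eq (isUnit_padicIntToCenter p (G := G)) r)

theorem toFraction_smul (r : ℤ_[p]) (x : IwasawaAlgebra p G) :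
    toFraction p (r • x) = (r : ℚ_[p]) • toFraction p x := by
  rw [Algebra.smul_def, map_mul, ← algebraMap_fractionIwasawa, ← Algebra.smul_def]

theorem toFractionAlgCl_sum_smul {H : Subgroup G} [Fintype H] (e : H → ℤ_[p]) :
    toFractionAlgCl p (∑ h : H, e h • IwasawaAlgebra.of p (h : G)) =
      sumTmul H fun h ↦ algebraMap ℚ_[p] (PadicAlgCl p) (e h⁻¹) := by
  have h1 : ∀ y, toFractionAlgCl p (G := G) y = (1 : PadicAlgCl p) ⊗ₜ[ℚ_[p]] toFraction p y :=
    fun _ ↦ rfl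
  rw [map_sum, sumTmul]
  refine Finset.sum_congr rfl fun h _ ↦ ?_
  rw [h1, toFraction_smul, TensorProduct.tmul_smul, TensorProduct.smul_tmul', inv_inv,
    Algebra.algebraMap_eq_smul_one]

end Injectivity

variable {G : Type u} [Group G] [TopologicalSpace G] [IsTopologicalGroup G] [CompactSpace G]
  [T2Space G] [TotallyDisconnectedSpace G]

omit [T2Space G] in
/-- A finite subgroup of a profinite group meets some open normal subgroup trivially. -/
theorem exists_openNormalSubgroup_inf_eq_bot (H : Subgroup G) [Fintype H] :
    ∃ N : OpenNormalSubgroup G, ∀ h ∈ H, h ∈ N.toSubgroup → h = 1 := by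
  have hfin : ((H : Set G) \ {1}).Finite := (Set.toFinite (H : Set G)).subset Set.sdiff_subset
  obtain ⟨N, hN⟩ := ProfiniteGrp.exist_openNormalSubgroup_sub_open_nhds_of_one
    (U := ((H : Set G) \ {1})ᶜ) hfin.isClosed.isOpen_compl (by simp)
  refine ⟨N, fun h hh hhN ↦ ?_⟩
  by_contra h1
  exact hN hhN ⟨hh, h1⟩

omit [IsTopologicalGroup G] [CompactSpace G] [T2Space G] [TotallyDisconnectedSpace G] in
theorem IwasawaAlgebra.coeff_of (g : G) (N : OpenNormalSubgroup G) (q : G ⧸ N.toSubgroup)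
    [Decidable ((g : G ⧸ N.toSubgroup) = q)] :
    IwasawaAlgebra.coeff (IwasawaAlgebra.of p g) N q =
      if (g : G ⧸ N.toSubgroup) = q then 1 else 0 := by
  classical
  change (MonoidAlgebra.of ℤ_[p] (G ⧸ N.toSubgroup) g).coeff q = _
  rw [MonoidAlgebra.of_apply, MonoidAlgebra.coeff_single, Finsupp.single_apply]

omit [T2Space G] in
/-- The coefficients of an element of `ℤ_p[H]` can be read off in `ℤ_p[G/N]` for some `N`. -/
theorem exists_coeff_sum_smul_of (p : ℕ) [Fact p.Prime] (H : Subgroup G) [Fintype H] :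
    ∃ N : OpenNormalSubgroup G, ∀ (e : H → ℤ_[p]) (k : H),
      IwasawaAlgebra.coeff (∑ h : H, e h • IwasawaAlgebra.of p (h : G)) N (k : G) = e k := by
  classical
  obtain ⟨N, hN⟩ := exists_openNormalSubgroup_inf_eq_bot H
  refine ⟨N, fun e k ↦ ?_⟩
  rw [IwasawaAlgebra.coeff_sum, Fintype.sum_eq_single k]
  · rw [IwasawaAlgebra.coeff_smul, IwasawaAlgebra.coeff_of, if_pos rfl, mul_one]
  · intro h hhk
    rw [IwasawaAlgebra.coeff_smul, IwasawaAlgebra.coeff_of, if_neg, mul_zero]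
    intro heq
    have h1 := hN _ (H.mul_mem (H.inv_mem h.2) k.2) (QuotientGroup.eq.mp heq)
    exact hhk (Subtype.ext (inv_mul_eq_one.mp h1))

omit [T2Space G] in
/-- An element of `ℚ_p[H]` lying in `Λ(G)` has integral coefficients. -/
theorem norm_le_one_of_toFractionAlgCl_eq {H : Subgroup G} [Fintype H] {f : H → ℚ_[p]}
    {ε : IwasawaAlgebra p G}
    (hε : toFractionAlgCl p ε = sumTmul H fun h ↦ algebraMap ℚ_[p] (PadicAlgCl p) (f h)) (h : H) :
    ‖f h‖ ≤ 1 := by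
  -- clear denominators, and compare the coefficients on a level on which `H` is embedded
  obtain ⟨c, hc⟩ := IsLocalization.exist_integer_multiples_of_finite (nonZeroDivisors ℤ_[p]) f
  choose d hd using hc
  have hc0 : ((c : ℤ_[p]) : ℚ_[p]) ≠ 0 := by
    rw [Ne, PadicInt.coe_eq_zero]
    exact nonZeroDivisors.ne_zero c.2
  have hd' : ∀ h, (d h : ℚ_[p]) = ((c : ℤ_[p]) : ℚ_[p]) * f h := fun h ↦ by
    rw [← smul_eq_mul]
    exact hd h
  obtain ⟨N, hN⟩ := exists_coeff_sum_smul_of p H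
  have h1 : (c : ℤ_[p]) • ε = ∑ h : H, d h⁻¹ • IwasawaAlgebra.of p (h : G) := by
    refine toFractionAlgCl_injective ?_
    rw [toFractionAlgCl_sum_smul]
    have h2 : toFractionAlgCl p ((c : ℤ_[p]) • ε) =
        ((c : ℤ_[p]) : ℚ_[p]) • toFractionAlgCl p ε := by
      have h3 : ∀ y, toFractionAlgCl p (G := G) y = (1 : PadicAlgCl p) ⊗ₜ[ℚ_[p]] toFraction p y :=
        fun _ ↦ rfl
      rw [h3, h3, toFraction_smul, TensorProduct.tmul_smul]
    rw [h2, hε, sumTmul, sumTmul, Finset.smul_sum]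
    refine Finset.sum_congr rfl fun h _ ↦ ?_
    rw [TensorProduct.smul_tmul', inv_inv, hd', map_mul, Algebra.smul_def]
  have h2 := hN (fun h ↦ d h⁻¹) h⁻¹
  rw [← h1, IwasawaAlgebra.coeff_smul, inv_inv] at h2
  have h3 := congrArg (fun z : ℤ_[p] ↦ (z : ℚ_[p])) h2
  simp only [PadicInt.coe_mul, hd'] at h3
  rw [← mul_left_cancel₀ hc0 h3]
  exact PadicInt.norm_le_one _

section Orbit

variable {H : Type*} [Group H] [Fintype H]

omit [Group H] in
/-- The idempotent of a set of characters stable under Galois has coefficients in `ℚ_p`. -/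
theorem exists_idemFn_eq_algebraMap {n : ℕ} {X : Finset (H → PadicAlgCl p)}
    (hX : ∀ (σ : PadicAlgCl p ≃ₐ[ℚ_[p]] PadicAlgCl p), ∀ x ∈ X, (fun h ↦ σ (x h)) ∈ X) :
    ∃ f : H → ℚ_[p], idemFn n X = fun h ↦ algebraMap ℚ_[p] (PadicAlgCl p) (f h) := by
  have key : ∀ h, idemFn n X h ∈ Set.range (algebraMap ℚ_[p] (PadicAlgCl p)) := by
    intro h
    rw [InfiniteGalois.mem_range_algebraMap_iff_fixed]
    intro σ
    simp only [idemFn, map_mul, map_div₀, map_natCast, map_sum]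
    congr 1
    refine Finset.sum_bij (fun x _ ↦ fun h ↦ σ (x h)) (hX σ) ?_ ?_ fun _ _ ↦ rfl
    · intro x _ y _ hxy
      exact funext fun k ↦ σ.injective (congrFun hxy k)
    · intro x hx
      exact ⟨_, hX σ⁻¹ x hx, funext fun k ↦ σ.apply_symm_apply _⟩
  choose f hf using key
  exact ⟨f, funext fun h ↦ (hf h).symm⟩

end Orbit

end Integrality

/-! ### Reduction of the block of a character whose degree has full valuation -/

section IntegralGroupRing

variable {K : Type*} [Field K] {O : Type*} [CommRing O] (i : O →+* K) {H : Type*} [Group H]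

/-- The action of the group ring `O[H]` through a representation of `H` over an `O`-algebra `K`. -/
def Representation.integralHom {V : Type*} [AddCommGroup V] [Module K V]
    (ρ : Representation K H V) : MonoidAlgebra O H →+* Module.End K V :=
  ρ.asAlgebraHom.toRingHom.comp (MonoidAlgebra.mapRingHom H i)

theorem Representation.integralHom_single {V : Type*} [AddCommGroup V] [Module K V]
    (ρ : Representation K H V) (h : H) (r : O) :
    ρ.integralHom i (MonoidAlgebra.single h r) = i r • ρ h := by
  simp [Representation.integralHom, MonoidAlgebra.mapRingHom_single,
    Representation.asAlgebraHom_single]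

variable [Fintype H]

omit [Group H] in
theorem MonoidAlgebra.eq_sum_single (a : MonoidAlgebra O H) :
    a = ∑ h, MonoidAlgebra.single h (a.coeff h) := by
  classical
  ext h
  simp

/-- The value at `a` of the `O`-linear extension of the function `x` on `H`. -/
def evalFn (x : H → K) (a : MonoidAlgebra O H) : K := ∑ h, i (a.coeff h) * x h

theorem Representation.integralHom_apply {V : Type*} [AddCommGroup V] [Module K V]
    (ρ : Representation K H V) (a : MonoidAlgebra O H) :
    ρ.integralHom i a = ∑ h, i (a.coeff h) • ρ h := by
  conv_lhs => rw [a.eq_sum_single, map_sum]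
  simp only [Representation.integralHom_single]

theorem evalFn_eq_trace {n : ℕ} {x : H → K} {ρ : Representation K H (Fin n → K)}
    (hρ : ∀ h, x h = LinearMap.trace K _ (ρ h)) (a : MonoidAlgebra O H) :
    evalFn i x a = LinearMap.trace K _ (ρ.integralHom i a) := by
  rw [Representation.integralHom_apply, map_sum, evalFn]
  simp only [map_smul, smul_eq_mul, hρ]

theorem evalFn_mapDomain (x : H → K) (c : MulAut H) (a : MonoidAlgebra O H) :
    evalFn i x (MonoidAlgebra.mapDomainRingHom O (c : H →* H) a) = evalFn i (x ∘ c) a := by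
  induction a using MonoidAlgebra.induction_linear with
  | zero => simp [evalFn]
  | add a b ha hb =>
    have h1 : ∀ (x : H → K) (a b : MonoidAlgebra O H),
        evalFn i x (a + b) = evalFn i x a + evalFn i x b := fun x a b ↦ by
      simp [evalFn, add_mul, Finset.sum_add_distrib]
    rw [map_add, h1, h1, ha, hb]
  | single h r =>
    classical
    simp [evalFn, Finsupp.single_apply, apply_ite i, ite_mul]

variable {i} {n : ℕ} {x : H → K}

theorem IsIrredTrace.evalFn_mul_comm (hx : IsIrredTrace n x) (a b : MonoidAlgebra O H) :
    evalFn i x (a * b) = evalFn i x (b * a) := by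
  obtain ⟨ρ, -, hρ⟩ := hx
  rw [evalFn_eq_trace i hρ, evalFn_eq_trace i hρ, map_mul (ρ.integralHom i),
    map_mul (ρ.integralHom i), LinearMap.trace_mul_comm]

theorem evalFn_add (a b : MonoidAlgebra O H) :
    evalFn i x (a + b) = evalFn i x a + evalFn i x b := by
  simp [evalFn, add_mul, Finset.sum_add_distrib]

theorem evalFn_sum {ι : Type*} (s : Finset ι) (f : ι → MonoidAlgebra O H) :
    evalFn i x (∑ k ∈ s, f k) = ∑ k ∈ s, evalFn i x (f k) :=
  map_sum (⟨⟨evalFn i x, by simp [evalFn]⟩, evalFn_add⟩ : MonoidAlgebra O H →+ K) f s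

variable [IsAlgClosed K] [CharZero K]

/-- The central character of an irreducible character is a ring homomorphism on the center of the
group ring, through which the center acts. -/
theorem IsIrredTrace.exists_centralHom (hx : IsIrredTrace n x) :
    ∃ ω : Subring.center (MonoidAlgebra O H) →+* K,
      ∀ (z : Subring.center (MonoidAlgebra O H)) (a : MonoidAlgebra O H),
      evalFn i x (a * z) = ω z * evalFn i x a ∧ ω z = evalFn i x (z : MonoidAlgebra O H) / n := by
  obtain ⟨ρ, hirr, hρ⟩ := id hx
  have hn : (n : K) ≠ 0 := Nat.cast_ne_zero.mpr hx.pos.ne'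
  have h1 : ∀ z : Subring.center (MonoidAlgebra O H),
      ρ.integralHom i z = (evalFn i x (z : MonoidAlgebra O H) / n) • 1 := by
    intro z
    obtain ⟨c, hc⟩ := hirr.exists_eq_smul_one (ρ.integralHom i z) fun h ↦ by
      have h2 : ρ h = ρ.integralHom i (MonoidAlgebra.single h 1) := by
        rw [Representation.integralHom_single, map_one, one_smul]
      rw [h2, ← map_mul, ← map_mul, Subring.mem_center_iff.mp z.2]
    rw [evalFn_eq_trace i hρ, hc, map_smul, LinearMap.trace_one, Module.finrank_fin_fun, smul_eq_mul,
      mul_div_cancel_right₀ _ hn]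
  have h2 : ∀ (z : Subring.center (MonoidAlgebra O H)) (a : MonoidAlgebra O H),
      evalFn i x (a * z) = evalFn i x (z : MonoidAlgebra O H) / n * evalFn i x a := by
    intro z a
    rw [evalFn_eq_trace i hρ (a * z), map_mul (ρ.integralHom i), h1, mul_smul_comm, mul_one, map_smul,
      ← evalFn_eq_trace i hρ, smul_eq_mul]
  have h3 : evalFn i x (1 : MonoidAlgebra O H) / n = 1 := by
    rw [evalFn_eq_trace i hρ, map_one, LinearMap.trace_one, Module.finrank_fin_fun, div_self hn]
  refine ⟨{ toFun := fun z ↦ evalFn i x (z : MonoidAlgebra O H) / n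
            map_one' := h3
            map_mul' := fun z w ↦ ?_
            map_zero' := by simp [evalFn]
            map_add' := fun z w ↦ ?_ }, fun z a ↦ ⟨h2 z a, rfl⟩⟩
  · rw [Subring.coe_mul, h2]
    ring
  · rw [Subring.coe_add, evalFn_add, add_div]

end IntegralGroupRing

section Norms

variable {K : Type*} [NormedField K] [IsUltrametricDist K] [IsAlgClosed K] [CharZero K]
  {O : Type*} [CommRing O] {i : O →+* K} {H : Type*} [Group H] [Fintype H] {n : ℕ} {x : H → K}

/-- The central character of a class function with values in the maximal ideal lies in the maximal
ideal. The value group need not be discrete, so the function is divided by its value of maximal norm. -/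
theorem IsIrredTrace.norm_sum_div_lt_one (hx : IsIrredTrace n x) {f : H → K}
    (hf : ∀ g h, f (g * h) = f (h * g)) (hf1 : ∀ h, ‖f h‖ < 1) :
    ‖(∑ k, f k * x k⁻¹) / n‖ < 1 := by
  obtain ⟨m, -, hm⟩ := Finset.exists_max_image Finset.univ (fun h ↦ ‖f h‖) ⟨1, Finset.mem_univ _⟩
  by_cases h0 : f m = 0
  · have h1 : ∀ h, f h = 0 := fun h ↦ by
      have := hm h (Finset.mem_univ _)
      rw [h0, norm_zero] at this
      exact norm_le_zero_iff.mp this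
    simp [h1]
  · have h1 := hx.norm_sum_div_le_one (f := fun h ↦ f h / f m) (fun g h ↦ by rw [hf]) fun h ↦ by
      rw [norm_div]
      exact div_le_one_of_le₀ (hm h (Finset.mem_univ _)) (norm_nonneg _)
    have h2 : (∑ k, f k * x k⁻¹) / n = f m * ((∑ k, f k / f m * x k⁻¹) / n) := by
      rw [← mul_div_assoc, Finset.mul_sum]
      congr 1
      refine Finset.sum_congr rfl fun k _ ↦ ?_
      field_simp
    rw [h2, norm_mul]
    exact (mul_le_of_le_one_right (norm_nonneg _) h1).trans_lt (hf1 m)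

omit [Fintype H] in
/-- The coefficients of a central element form a class function. -/
theorem MonoidAlgebra.coeff_mul_comm_of_mem_center {z : MonoidAlgebra O H}
    (hz : z ∈ Subring.center (MonoidAlgebra O H)) (g h : H) :
    z.coeff (g * h) = z.coeff (h * g) := by
  have h1 := congrArg (fun a ↦ a.coeff (g * h * g))
    (Subring.mem_center_iff.mp hz (MonoidAlgebra.single g 1))
  simpa [MonoidAlgebra.coeff_single_mul_apply, MonoidAlgebra.coeff_mul_single_apply, mul_assoc]
    using h1.symm

theorem IsIrredTrace.norm_evalFn_div_le_one (hx : IsIrredTrace n x) (hi : ∀ r, ‖i r‖ ≤ 1)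
    {z : MonoidAlgebra O H} (hz : z ∈ Subring.center (MonoidAlgebra O H)) :
    ‖evalFn i x z / n‖ ≤ 1 := by
  have h1 := hx.norm_sum_div_le_one (f := fun k ↦ i (z.coeff k⁻¹))
    (fun g h ↦ by
      rw [mul_inv_rev, mul_inv_rev, MonoidAlgebra.coeff_mul_comm_of_mem_center hz]) fun h ↦ hi _
  rwa [show evalFn i x z = ∑ k, i (z.coeff k⁻¹) * x k⁻¹ from
    Fintype.sum_equiv (Equiv.inv H) _ _ fun k ↦ by simp]

/-- Suppose that a finite quotient `R` of the group ring is the reduction of the block cut out by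
irreducible characters whose degree has the same norm as the group order. If these characters are
conjugate under isometric field automorphisms and powers of an automorphism `c` of the group, then
`R` has no proper nonzero ideal that is stable under the automorphism induced by `c`. -/
theorem eq_bot_or_eq_top_of_forall_map_mem (hi : ∀ r, ‖i r‖ ≤ 1) {X : Finset (H → K)}
    (hX : ∀ x ∈ X, IsIrredTrace n x) (hn : ‖(n : K)‖ = ‖(Fintype.card H : K)‖) {c : MulAut H}
    (htrans : ∀ x ∈ X, ∀ y ∈ X, ∃ (σ : K →+* K) (j : ℤ), (∀ r, σ (i r) = i r) ∧
      (∀ r, ‖σ r‖ = ‖r‖) ∧ y = fun h ↦ σ (x ((c ^ j : MulAut H) h)))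
    {R : Type*} [Ring R] [Finite R] (Φ : MonoidAlgebra O H →+* R) (hΦs : Function.Surjective Φ)
    (τ : RingAut R) (hτ : ∀ a, Φ (MonoidAlgebra.mapDomainRingHom O (c : H →* H) a) = τ (Φ a))
    (hΦ : ∀ a, Φ a = 0 ↔ ∀ h, ‖∑ x ∈ X, evalFn i x (MonoidAlgebra.single h 1 * a)‖ < 1)
    (I : TwoSidedIdeal R) (hI : ∀ r ∈ I, τ r ∈ I) : I = ⊥ ∨ I = ⊤ := by
  classical
  by_cases hbot : I = ⊥
  · exact Or.inl hbot
  right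
  have hnorm : ∀ (s : Finset (H → K)) (f : (H → K) → K), (∀ x ∈ s, ‖f x‖ < 1) →
      ‖∑ x ∈ s, f x‖ < 1 := fun s f hf ↦ by
    induction s using Finset.induction_on with
    | empty => simp
    | insert x s hx ih =>
      rw [Finset.sum_insert hx]
      exact (IsUltrametricDist.norm_add_le_max _ _).trans_lt (max_lt
        (hf x (Finset.mem_insert_self x s)) (ih fun y hy ↦ hf y (Finset.mem_insert_of_mem hy)))
  have hx0 : ∀ x ∈ X, (n : K) ≠ 0 := fun x hx ↦ Nat.cast_ne_zero.mpr (hX x hx).pos.ne'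
  -- an element of the ideal on which some character does not vanish modulo the maximal ideal
  obtain ⟨x, hx, a, haI, hxa⟩ : ∃ x ∈ X, ∃ a, Φ a ∈ I ∧ 1 ≤ ‖evalFn i x a‖ := by
    obtain ⟨r, hrI, hr0⟩ : ∃ r ∈ I, r ≠ 0 := by
      by_contra! h
      refine hbot (le_antisymm (fun r hr ↦ ?_) bot_le)
      rw [h r hr]
      exact TwoSidedIdeal.zero_mem _
    obtain ⟨a, rfl⟩ := hΦs r
    rw [Ne, hΦ] at hr0
    push Not at hr0
    obtain ⟨h, hh⟩ := hr0
    by_contra! hcon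
    refine absurd (hnorm X _ fun x hx ↦ hcon x hx (MonoidAlgebra.single h 1 * a) ?_) (not_lt.mpr hh)
    rw [map_mul]
    exact I.mul_mem_left _ _ hrI
  -- averaging over the group makes it central
  obtain ⟨z, hz, hzI, hxz⟩ : ∃ z ∈ Subring.center (MonoidAlgebra O H), Φ z ∈ I ∧
      1 ≤ ‖evalFn i x z / n‖ := by
    refine ⟨∑ g : H, MonoidAlgebra.single g 1 * a * MonoidAlgebra.single g⁻¹ 1,
      Subring.mem_center_iff.mpr fun b ↦ ?_, ?_, ?_⟩
    · induction b using MonoidAlgebra.induction_linear with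
      | zero => simp
      | add b b' hb hb' => rw [add_mul, mul_add, hb, hb']
      | single h r =>
        have h1 : MonoidAlgebra.single h r = algebraMap O _ r * MonoidAlgebra.single h (1 : O) := by
          simp
        have h2 : ∀ w : MonoidAlgebra O H, MonoidAlgebra.single h 1 * w = w * MonoidAlgebra.single h 1 →
            MonoidAlgebra.single h r * w = w * MonoidAlgebra.single h r := by
          intro w hw
          rw [h1, mul_assoc, hw, ← mul_assoc, ← mul_assoc, Algebra.commutes r w]
        refine h2 _ ?_
        rw [Finset.mul_sum, Finset.sum_mul]
        refine Fintype.sum_equiv (Equiv.mulLeft h) _ _ fun g ↦ ?_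
        simp [← mul_assoc, MonoidAlgebra.single_mul_single]
        rw [mul_assoc _ (MonoidAlgebra.single _ _) (MonoidAlgebra.single _ _),
          MonoidAlgebra.single_mul_single]
        simp
    · rw [map_sum]
      refine sum_mem fun g _ ↦ ?_
      rw [map_mul, map_mul]
      exact I.mul_mem_right _ _ (I.mul_mem_left _ _ haI)
    · have h1 : ∀ g : H, evalFn i x (MonoidAlgebra.single g 1 * a * MonoidAlgebra.single g⁻¹ 1) =
          evalFn i x a := fun g ↦ by
        rw [(hX x hx).evalFn_mul_comm, ← mul_assoc, MonoidAlgebra.single_mul_single]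
        simp [← MonoidAlgebra.one_def]
      rw [evalFn_sum, Finset.sum_congr rfl fun g _ ↦ h1 g, Finset.sum_const, Finset.card_univ,
        nsmul_eq_mul, mul_comm, mul_div_assoc, norm_mul, norm_div, hn, div_self, mul_one]
      · exact hxa
      · rw [← hn]
        exact norm_ne_zero_iff.mpr (hx0 x hx)
  have hXω : ∀ y : X, ∃ ω : Subring.center (MonoidAlgebra O H) →+* K,
      ∀ (z : Subring.center (MonoidAlgebra O H)) (a : MonoidAlgebra O H),
      evalFn i (y : H → K) (a * z) = ω z * evalFn i y a ∧
        ω z = evalFn i (y : H → K) (z : MonoidAlgebra O H) / n :=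
    fun y ↦ (hX y y.2).exists_centralHom
  choose ω hω using hXω
  have hωle : ∀ y z, ‖ω y z‖ ≤ 1 := fun y z ↦ by
    rw [(hω y z 1).2]
    exact (hX y y.2).norm_evalFn_div_le_one hi z.2
  have hev : ∀ (y : X) (z : Subring.center (MonoidAlgebra O H)) h,
      evalFn i (y : H → K) (MonoidAlgebra.single h 1 * (z : MonoidAlgebra O H)) =
        ω y z * (y : H → K) h := fun y z h ↦ by
    rw [(hω y z _).1]
    congr 1
    simp [evalFn, Finsupp.single_apply, apply_ite i, ite_mul]
  -- central elements that reduce to zero have central characters in the maximal ideal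
  have hker : ∀ b : Subring.center (MonoidAlgebra O H), Φ b = 0 → ∀ y, ‖ω y b‖ < 1 := by
    intro b hb y
    rw [hΦ] at hb
    have hB : ∀ h, ∑ x ∈ X, evalFn i x (MonoidAlgebra.single h 1 * (b : MonoidAlgebra O H)) =
        ∑ x : X, ω x b * (x : H → K) h := fun h ↦ by
      rw [← Finset.sum_coe_sort]
      exact Finset.sum_congr rfl fun x _ ↦ hev x b h
    have h1 := (hX y y.2).norm_sum_div_lt_one (f := fun h ↦ ∑ x : X, ω x b * (x : H → K) h)
      (fun g h ↦ Finset.sum_congr rfl fun x _ ↦ by rw [(hX x x.2).mul_comm])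
      fun h ↦ (hB h) ▸ hb h
    have h2 : ∑ k, (∑ x : X, ω x b * (x : H → K) k) * (y : H → K) k⁻¹ =
        ω y b * Fintype.card H := by
      simp only [Finset.sum_mul, mul_assoc]
      rw [Finset.sum_comm]
      simp only [← Finset.mul_sum]
      rw [Finset.sum_eq_single_of_mem y (Finset.mem_univ _), (hX y y.2).sum_mul_inv_self]
      intro x _ hxy
      rw [(hX x x.2).sum_mul_inv (hX y y.2) (fun h ↦ hxy (Subtype.ext h)), mul_zero]
    rw [h2, mul_div_assoc, norm_mul, norm_div, hn, div_self, mul_one] at h1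
    · exact h1
    · rw [← hn]
      exact norm_ne_zero_iff.mpr (hx0 y y.2)
  have hcen : ∀ (d : MulAut H) (z : MonoidAlgebra O H), z ∈ Subring.center (MonoidAlgebra O H) →
      MonoidAlgebra.mapDomainRingHom O (d : H →* H) z ∈ Subring.center (MonoidAlgebra O H) := by
    intro d z hz
    refine Subring.mem_center_iff.mpr fun b ↦ ?_
    have h1 : b = MonoidAlgebra.mapDomainRingHom O (d : H →* H)
        (MonoidAlgebra.mapDomainRingHom O ((d⁻¹ : MulAut H) : H →* H) b) := by
      induction b using MonoidAlgebra.induction_linear with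
      | zero => simp
      | add b b' hb hb' => rw [map_add, map_add, ← hb, ← hb']
      | single h r => simp
    rw [h1, ← map_mul, ← map_mul, Subring.mem_center_iff.mp hz]
  have hτk : ∀ (k : ℕ) (a : MonoidAlgebra O H), Φ a ∈ I →
      Φ (MonoidAlgebra.mapDomainRingHom O ((c ^ k : MulAut H) : H →* H) a) ∈ I := by
    intro k
    induction k with
    | zero =>
      intro a ha
      have h1 : MonoidAlgebra.mapDomainRingHom O ((c ^ 0 : MulAut H) : H →* H) a = a := by
        rw [a.eq_sum_single, map_sum]
        simp
      rwa [h1]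
    | succ k ih =>
      intro a ha
      have h1 : MonoidAlgebra.mapDomainRingHom O ((c ^ (k + 1) : MulAut H) : H →* H) a =
          MonoidAlgebra.mapDomainRingHom O (c : H →* H)
            (MonoidAlgebra.mapDomainRingHom O ((c ^ k : MulAut H) : H →* H) a) := by
        rw [a.eq_sum_single, map_sum, map_sum, map_sum]
        simp [pow_succ']
      rw [h1, hτ]
      exact hI _ (ih a ha)
  -- each character admits a central element of the ideal with central character close to one
  have hv : ∀ y : X, ∃ v : Subring.center (MonoidAlgebra O H), Φ v ∈ I ∧ ‖1 - ω y v‖ < 1 := by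
    intro y
    obtain ⟨σ, j, hσi, hσn, hy⟩ := htrans x hx y y.2
    obtain ⟨k, hk⟩ : ∃ k : ℕ, c ^ k = (c ^ j)⁻¹ := by
      have h1 : (c ^ j)⁻¹ ∈ Subgroup.zpowers c := ⟨-j, zpow_neg c j⟩
      exact mem_powers_iff_mem_zpowers.mpr h1
    let w : Subring.center (MonoidAlgebra O H) := ⟨_, hcen (c ^ k) z hz⟩
    have hw : 1 ≤ ‖ω y w‖ := by
      have h1 : evalFn i (y : H → K) (w : MonoidAlgebra O H) = σ (evalFn i x z) := by
        rw [evalFn_mapDomain, evalFn, evalFn, map_sum]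
        refine Finset.sum_congr rfl fun h _ ↦ ?_
        rw [map_mul, hσi, hk, hy]
        simp
      have h2 : σ (evalFn i x z) / n = σ (evalFn i x z / n) := by rw [map_div₀, map_natCast]
      rw [(hω y w 1).2, h1, h2, hσn]
      exact hxz
    obtain ⟨k₁, k₂, hlt, heq⟩ : ∃ k₁ k₂ : ℕ, k₁ < k₂ ∧
        Φ (w : MonoidAlgebra O H) ^ k₁ = Φ (w : MonoidAlgebra O H) ^ k₂ := by
      obtain ⟨k₁, k₂, hne, h⟩ := Finite.exists_ne_map_eq_of_infinite
        fun k : ℕ ↦ Φ (w : MonoidAlgebra O H) ^ k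
      rcases lt_or_gt_of_ne hne with hlt | hlt
      · exact ⟨k₁, k₂, hlt, h⟩
      · exact ⟨k₂, k₁, hlt, h.symm⟩
    -- the image of `w` in `R` has finite period, and the central character of `w` is a unit
    refine ⟨w ^ (k₂ - k₁), ?_, ?_⟩
    · obtain ⟨m, hm⟩ : ∃ m, k₂ - k₁ = m + 1 := ⟨k₂ - k₁ - 1, by omega⟩
      rw [hm, pow_succ, Subring.coe_mul, map_mul]
      exact I.mul_mem_left _ _ (hτk k z hzI)
    · have h1 := hker (w ^ k₁ - w ^ k₂) (by
        rw [AddSubgroupClass.coe_sub, Subring.coe_pow, Subring.coe_pow, map_sub, map_pow, map_pow, heq,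
          sub_self]) y
      have h2 : ω y (w ^ k₁ - w ^ k₂) = ω y w ^ k₁ * (1 - ω y (w ^ (k₂ - k₁))) := by
        rw [map_sub, map_pow, map_pow, map_pow, mul_sub, mul_one, ← pow_add,
          Nat.add_sub_cancel' hlt.le]
      rw [h2, norm_mul, norm_pow] at h1
      exact (le_mul_of_one_le_left (norm_nonneg _) (one_le_pow₀ hw)).trans_lt h1
  -- the product of their complements reduces to zero
  obtain ⟨u, huI, hu⟩ : ∃ u : Subring.center (MonoidAlgebra O H), 1 - Φ u ∈ I ∧
      ∀ y, ‖ω y u‖ < 1 := by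
    suffices h : ∀ s : Finset X, ∃ u : Subring.center (MonoidAlgebra O H), 1 - Φ u ∈ I ∧
        ∀ y ∈ s, ‖ω y u‖ < 1 by
      obtain ⟨u, h1, h2⟩ := h Finset.univ
      exact ⟨u, h1, fun y ↦ h2 y (Finset.mem_univ y)⟩
    intro s
    induction s using Finset.induction_on with
    | empty => exact ⟨1, by simp, by simp⟩
    | insert y s hy ih =>
      obtain ⟨u, hu1, hu2⟩ := ih
      obtain ⟨v, hv1, hv2⟩ := hv y
      refine ⟨u * (1 - v), ?_, fun y' hy' ↦ ?_⟩
      · have h1 : 1 - Φ (u * (1 - v) : Subring.center (MonoidAlgebra O H)) =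
            (1 - Φ u) + Φ u * Φ v := by
          rw [Subring.coe_mul, AddSubgroupClass.coe_sub, Subring.coe_one, map_mul, map_sub, map_one]
          noncomm_ring
        rw [h1]
        exact I.add_mem hu1 (I.mul_mem_left _ _ hv1)
      · rw [map_mul, norm_mul]
        rcases Finset.mem_insert.mp hy' with rfl | hy'
        · refine (mul_le_of_le_one_left (norm_nonneg _) (hωle _ _)).trans_lt ?_
          rwa [map_sub, map_one]
        · exact (mul_le_of_le_one_right (norm_nonneg _) (hωle _ _)).trans_lt (hu2 y' hy')
  have hu0 : Φ u = 0 := by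
    refine (hΦ _).mpr fun h ↦ ?_
    refine hnorm X _ fun y hy ↦ ?_
    rw [hev ⟨y, hy⟩, norm_mul]
    exact (mul_le_of_le_one_right (norm_nonneg _) ((hX y hy).norm_le_one h)).trans_lt (hu ⟨y, hy⟩)
  rw [hu0, sub_zero] at huI
  exact I.eq_top huI

end Norms

/-! ### The component of the Iwasawa algebra at an integral block idempotent -/

namespace IsIdempotentElem

variable {A : Type*} [Ring A] {e : A} (he : IsIdempotentElem e) (hc : ∀ a, a * e = e * a)

/-- The projection of `A` onto the corner ring of a central idempotent `e`. -/
def cornerHom : A →+* he.Corner where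
  toFun := he.toCorner
  map_one' := he.cornerVal_injective (by
    rw [cornerVal_toCorner, mul_one, he.eq, cornerVal_one])
  map_mul' a b := he.cornerVal_injective (by
    rw [map_mul, cornerVal_toCorner, cornerVal_toCorner, cornerVal_toCorner]
    simp only [← mul_assoc, ← hc, mul_assoc _ e e, he.eq]
    simp only [mul_assoc, ← hc, he.eq])
  map_zero' := he.cornerVal_injective (by simp)
  map_add' a b := he.cornerVal_injective (by
    rw [map_add, cornerVal_toCorner, cornerVal_toCorner, cornerVal_toCorner, mul_add, add_mul])

include hc in
theorem cornerVal_cornerHom (a : A) : he.cornerVal (he.cornerHom hc a) = e * a := by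
  change e * a * e = e * a
  rw [mul_assoc, hc, ← mul_assoc, he.eq]

theorem cornerHom_cornerVal (b : he.Corner) : he.cornerHom hc (he.cornerVal b) = b :=
  he.toCorner_cornerVal b

theorem cornerHom_surjective : Function.Surjective (he.cornerHom hc) :=
  fun b ↦ ⟨_, he.cornerHom_cornerVal hc b⟩

end IsIdempotentElem

section GroupRing

variable (p : ℕ) [Fact p.Prime] {G : Type u} [Group G] [TopologicalSpace G] (H : Subgroup G)

/-- The canonical map `ℤ_p[H] → Λ(G)` for a subgroup `H` of `G`. -/
def groupRingHom : MonoidAlgebra ℤ_[p] H →ₐ[ℤ_[p]] IwasawaAlgebra p G :=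
  MonoidAlgebra.lift ℤ_[p] (IwasawaAlgebra p G) H ((IwasawaAlgebra.of p).comp H.subtype)

variable {p H}

theorem groupRingHom_single (h : H) (r : ℤ_[p]) :
    groupRingHom p H (MonoidAlgebra.single h r) = r • IwasawaAlgebra.of p (h : G) := by
  simp [groupRingHom, MonoidAlgebra.lift_apply]

variable [Fintype H]

theorem groupRingHom_apply (a : MonoidAlgebra ℤ_[p] H) :
    groupRingHom p H a = ∑ h : H, a.coeff h • IwasawaAlgebra.of p (h : G) := by
  conv_lhs => rw [a.eq_sum_single, map_sum]
  simp only [groupRingHom_single]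

theorem of_mul_groupRingHom [H.Normal] (g : G) (a : MonoidAlgebra ℤ_[p] H) :
    IwasawaAlgebra.of p g * groupRingHom p H a =
      groupRingHom p H (MonoidAlgebra.mapDomainRingHom ℤ_[p]
        ((MulAut.conjNormal g : MulAut H) : H →* H) a) * IwasawaAlgebra.of p g := by
  conv_lhs => rw [a.eq_sum_single, map_sum, Finset.mul_sum]
  conv_rhs => rw [a.eq_sum_single, map_sum, map_sum, Finset.sum_mul]
  refine Finset.sum_congr rfl fun h _ ↦ ?_
  rw [MonoidAlgebra.mapDomainRingHom_apply, MonoidAlgebra.mapDomain_single, groupRingHom_single,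
    groupRingHom_single, mul_smul_comm, smul_mul_assoc, ← map_mul, ← map_mul]
  congr 2
  simp

variable [IsTopologicalGroup G] [CompactSpace G] [T2Space G] [TotallyDisconnectedSpace G]

omit [T2Space G] in
/-- The map `ℤ_p[H] → Λ(G)` is injective modulo `p`. -/
theorem natCast_dvd_groupRingHom_iff (a : MonoidAlgebra ℤ_[p] H) :
    (p : IwasawaAlgebra p G) ∣ groupRingHom p H a ↔ ∀ h, (p : ℤ_[p]) ∣ a.coeff h := by
  constructor
  · intro h k
    obtain ⟨N, hN⟩ := exists_coeff_sum_smul_of p H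
    rw [← pow_one (p : IwasawaAlgebra p G), IwasawaAlgebra.natCast_pow_dvd_iff] at h
    have h1 := h N (k : G)
    rwa [pow_one, groupRingHom_apply, hN] at h1
  · intro h
    rw [groupRingHom_apply]
    refine Finset.dvd_sum fun k _ ↦ ?_
    obtain ⟨c, hc⟩ := h k
    refine ⟨c • IwasawaAlgebra.of p (k : G), ?_⟩
    rw [hc, mul_smul, Algebra.smul_def, map_natCast]

end GroupRing

section BlockIdempotent

variable {p : ℕ} [Fact p.Prime] {H : Type*} [Group H] [Fintype H] {n : ℕ}
  {X : Finset (H → PadicAlgCl p)}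

variable (p) in
/-- The structure map from `ℤ_p` to the algebraic closure of `ℚ_p`. -/
def padicIntToAlgCl : ℤ_[p] →+* PadicAlgCl p :=
  (algebraMap ℚ_[p] (PadicAlgCl p)).comp PadicInt.Coe.ringHom

theorem norm_padicIntToAlgCl (r : ℤ_[p]) : ‖padicIntToAlgCl p r‖ = ‖r‖ :=
  PadicAlgCl.norm_algebraMap _

theorem padicIntToAlgCl_injective : Function.Injective (padicIntToAlgCl p) :=
  (algebraMap ℚ_[p] (PadicAlgCl p)).injective.comp Subtype.val_injective

theorem natCast_dvd_iff_norm_padicIntToAlgCl_lt_one (r : ℤ_[p]) :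
    (p : ℤ_[p]) ∣ r ↔ ‖padicIntToAlgCl p r‖ < 1 := by
  rw [norm_padicIntToAlgCl, PadicInt.norm_lt_one_iff_dvd]

/-- `e` is the element of `ℤ_p[H]` whose coefficients are those of the sum of the idempotents of the
characters in `X`. -/
def IsBlockElem (n : ℕ) (X : Finset (H → PadicAlgCl p)) (e : MonoidAlgebra ℤ_[p] H) : Prop :=
  ∀ h, padicIntToAlgCl p (e.coeff h) = idemFn n X h⁻¹

/-- If the degree has the same valuation as the group order, the coefficients
`(n / |H|) * ∑ x(h⁻¹)` are integral. -/
theorem exists_isBlockElem (hX : ∀ x ∈ X, IsIrredTrace n x)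
    (hn : ‖(n : PadicAlgCl p)‖ = ‖(Fintype.card H : PadicAlgCl p)‖)
    (hσ : ∀ (σ : PadicAlgCl p ≃ₐ[ℚ_[p]] PadicAlgCl p), ∀ x ∈ X, (fun h ↦ σ (x h)) ∈ X) :
    ∃ e : MonoidAlgebra ℤ_[p] H, IsBlockElem n X e := by
  obtain ⟨f, hf⟩ := exists_idemFn_eq_algebraMap (n := n) hσ
  have h1 : ∀ h, ‖f h‖ ≤ 1 := fun h ↦ by
    rw [← PadicAlgCl.norm_algebraMap, ← congrFun hf h, idemFn, norm_mul, norm_div, hn]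
    refine mul_le_one₀ (div_self_le_one _) (norm_nonneg _) ?_
    exact IsUltrametricDist.norm_sum_le_of_forall_le_of_nonneg zero_le_one
      fun x hx ↦ (hX x hx).norm_le_one h
  refine ⟨.ofCoeff (Finsupp.equivFunOnFinite.symm fun h ↦ ⟨f h⁻¹, h1 h⁻¹⟩), fun h ↦ ?_⟩
  rw [hf]
  rfl

namespace IsBlockElem

variable {e : MonoidAlgebra ℤ_[p] H}

/-- The coefficients of `e * a` are, up to a constant, the sums over `X` of the values of the
characters at translates of `a`. -/
theorem coeff_mul (he : IsBlockElem n X e) (hX : ∀ x ∈ X, IsIrredTrace n x)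
    (a : MonoidAlgebra ℤ_[p] H) (h : H) :
    padicIntToAlgCl p ((e * a).coeff h) = n / Fintype.card H *
      ∑ x ∈ X, evalFn (padicIntToAlgCl p) x (MonoidAlgebra.single h⁻¹ 1 * a) := by
  rw [MonoidAlgebra.coeff_mul_apply_left, Finsupp.sum_fintype _ _ (by simp), map_sum]
  simp only [map_mul, he _, idemFn, evalFn, MonoidAlgebra.coeff_single_mul_apply, one_mul, inv_inv]
  simp only [mul_assoc, ← Finset.mul_sum]
  congr 1
  simp only [Finset.sum_mul]
  rw [Finset.sum_comm]
  refine Finset.sum_congr rfl fun x hx ↦ ?_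
  refine Fintype.sum_equiv ((Equiv.inv H).trans (MulAut.conj h⁻¹).toEquiv) _ _ fun k ↦ ?_
  simp only [Equiv.trans_apply, Equiv.inv_apply, MulEquiv.toEquiv_eq_coe, MulEquiv.coe_toEquiv,
    MulAut.conj_apply, inv_inv]
  rw [mul_comm]
  congr 1
  · simp [mul_assoc]
  · rw [(hX x hx).mul_comm, ← mul_assoc, mul_inv_cancel, one_mul]

theorem isIdempotentElem {Δ : Type*} [CommGroup Δ] {a : Δ →* Equiv.Perm H} (he : IsBlockElem n X e)
    (hX : IsCharOrbit a n X) : IsIdempotentElem e := by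
  refine MonoidAlgebra.ext (Finsupp.ext fun h ↦ padicIntToAlgCl_injective ?_)
  rw [MonoidAlgebra.coeff_mul_apply_left, Finsupp.sum_fintype _ _ (by simp), map_sum]
  simp only [map_mul, he _]
  rw [← hX.idemFn_convolution]
  refine Fintype.sum_equiv (Equiv.inv H) _ _ fun k ↦ ?_
  rw [Equiv.inv_apply, inv_inv, mul_inv_rev, inv_inv, hX.idemFn_mul_comm h⁻¹]

/-- The idempotent is fixed by the automorphisms of `H` that permute `X`. -/
theorem mapDomain_eq (he : IsBlockElem n X e) {c : MulAut H} (hc : ∀ x ∈ X, x ∘ c ∈ X) :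
    MonoidAlgebra.mapDomainRingHom ℤ_[p] (c : H →* H) e = e := by
  have h1 : ∀ h, idemFn n X (c h) = idemFn n X h := by
    intro h
    simp only [idemFn]
    congr 1
    have hinj : Set.InjOn (fun x : H → PadicAlgCl p ↦ x ∘ c) X := fun x _ y _ hxy ↦ by
      ext k
      have := congrFun hxy (c.symm k)
      simpa using this
    exact Finset.sum_bij (fun x _ ↦ x ∘ c) hc (fun x hx y hy ↦ hinj hx hy)
      (fun y hy ↦ by
        have := Finset.surj_on_of_inj_on_of_card_le (s := X) (t := X) (fun x _ ↦ x ∘ c) hc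
          (fun x y hx hy ↦ hinj hx hy) le_rfl y hy
        obtain ⟨x, hx, hxy⟩ := this
        exact ⟨x, hx, hxy.symm⟩) fun _ _ ↦ rfl
  refine MonoidAlgebra.ext (Finsupp.ext fun h ↦ padicIntToAlgCl_injective ?_)
  obtain ⟨h, rfl⟩ := c.surjective h
  rw [he, ← map_inv, h1, ← he]
  congr 1
  change Finsupp.mapDomain c e.coeff (c h) = _
  rw [Finsupp.mapDomain_apply c.injective]

end IsBlockElem

end BlockIdempotent

/-- The reduction modulo `p` of the corner ring of a central idempotent. -/
theorem IsAdicAlong.exists_corner_reduction {p : ℕ} {A : Type*} [Ring A] (hA : IsAdicAlong (p : A))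
    {ε : A} (hε : IsIdempotentElem ε) (hc : ∀ a, a * ε = ε * a) {A₀ : Type*} [Ring A₀] {φ₀ : A →+* A₀}
    (hφ₀k : ∀ a, φ₀ a = 0 ↔ (p : A) ∣ a) (hε' : IsIdempotentElem (φ₀ ε))
    (hc' : ∀ a, a * φ₀ ε = φ₀ ε * a) :
    IsAdicAlong ((p : ℕ) : hε.Corner) ∧ ∃ φ : hε.Corner →+* hε'.Corner,
      (∀ a, φ (hε.cornerHom hc a) = hε'.cornerHom hc' (φ₀ a)) ∧
      ∀ b, φ b = 0 ↔ ((p : ℕ) : hε.Corner) ∣ b := by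
  have hpC : hε.toCorner (p : A) = ((p : ℕ) : hε.Corner) := map_natCast (hε.cornerHom hc) p
  refine ⟨hpC ▸ hA.corner hε, { toFun := fun b ↦ hε'.cornerHom hc' (φ₀ (hε.cornerVal b))
                                map_one' := hε'.cornerVal_injective ?_
                                map_mul' := fun a b ↦ by rw [map_mul hε.cornerVal, map_mul φ₀, map_mul]
                                map_zero' := by rw [map_zero, map_zero, map_zero]
                                map_add' := fun a b ↦ by
                                  rw [map_add hε.cornerVal, map_add φ₀, map_add] }, ?_, ?_⟩
  · rw [hε.cornerVal_one, hε'.cornerVal_cornerHom, hε'.eq, hε'.cornerVal_one]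
  · intro a
    refine hε'.cornerVal_injective ?_
    change hε'.cornerVal (hε'.cornerHom hc' (φ₀ (hε.cornerVal _))) = _
    rw [hε'.cornerVal_cornerHom, hε'.cornerVal_cornerHom, hε.cornerVal_cornerHom, map_mul, ← mul_assoc,
      hε'.eq]
  · intro b
    change hε'.cornerHom hc' (φ₀ (hε.cornerVal b)) = 0 ↔ _
    rw [← map_eq_zero_iff _ hε'.cornerVal_injective, hε'.cornerVal_cornerHom, ← map_mul,
      hε.mul_cornerVal, hφ₀k]
    constructor
    · rintro ⟨y, hy⟩
      refine ⟨hε.cornerHom hc y, ?_⟩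
      rw [← hε.cornerHom_cornerVal hc b, hy, map_mul, map_natCast]
    · rintro ⟨y, rfl⟩
      rw [map_mul, ← hpC, hε.cornerVal_toCorner, hc, ← mul_assoc, hε.eq]
      exact dvd_mul_of_dvd_left (hA.dvd_mul_left_of' dvd_rfl _) _

/-- The situation of `exists_isAdicAlong_isSimpleRing` when the finite subring is the image of a ring
`M` and the unit `g` induces an automorphism `c` of `M`. -/
theorem exists_isAdicAlong_isSimpleRing_of_range {p : ℕ} [Fact p.Prime] {A : Type u} [Ring A]
    [CharP A p] {M : Type*} [Ring M] (ψ : M →+* A) [Finite ψ.range] (g : Aˣ) (c c' : M →+* M)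
    (hcc' : ∀ a, c (c' a) = a) (hg : ∀ a, g * ψ a = ψ (c a) * g)
    (hR : ∀ τ : RingAut ψ.range, (∀ a, ψ.rangeRestrict (c a) = τ (ψ.rangeRestrict a)) →
      ∀ I : TwoSidedIdeal ψ.range, (∀ r ∈ I, τ r ∈ I) → I = ⊥ ∨ I = ⊤) {n : ℕ}
    (hT : IsAdicAlong ((g : A) ^ p ^ n - 1))
    (hspan : ∀ b : A, ∃ (r : ℕ → M) (b' : A),
      b = ∑ i ∈ Finset.range (p ^ n), ψ (r i) * (g : A) ^ i + ((g : A) ^ p ^ n - 1) * b') :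
    ∃ (t : A) (Q : Type u) (_ : Ring Q) (θ : A →+* Q), IsAdicAlong t ∧ Finite Q ∧ IsSimpleRing Q ∧
      Function.Surjective θ ∧ ∀ a, θ a = 0 ↔ t ∣ a := by
  let τ : RingAut ψ.range :=
    { toFun := fun r ↦ ⟨g * r * ↑g⁻¹, by
        obtain ⟨_, a, rfl⟩ := r
        exact ⟨c a, by rw [hg, mul_assoc, Units.mul_inv, mul_one]⟩⟩
      invFun := fun r ↦ ⟨↑g⁻¹ * r * g, by
        obtain ⟨_, a, rfl⟩ := r
        refine ⟨c' a, ?_⟩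
        have h1 := hg (c' a)
        rw [hcc'] at h1
        rw [mul_assoc, ← h1, Units.inv_mul_cancel_left]⟩
      left_inv := fun r ↦ Subtype.ext (by
        change ↑g⁻¹ * (g * (r : A) * ↑g⁻¹) * g = _
        simp only [mul_assoc, Units.inv_mul, mul_one, Units.inv_mul_cancel_left])
      right_inv := fun r ↦ Subtype.ext (by
        change (g : A) * (↑g⁻¹ * r * g) * ↑g⁻¹ = _
        simp only [mul_assoc, Units.mul_inv, mul_one, Units.mul_inv_cancel_left])
      map_mul' := fun r s ↦ Subtype.ext (by
        change (g : A) * (r * s) * ↑g⁻¹ = (g * r * ↑g⁻¹) * (g * s * ↑g⁻¹)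
        simp only [mul_assoc, Units.inv_mul_cancel_left])
      map_add' := fun r s ↦ Subtype.ext (by
        change (g : A) * (r + s) * ↑g⁻¹ = g * r * ↑g⁻¹ + g * s * ↑g⁻¹
        rw [mul_add, add_mul]) }
  refine exists_isAdicAlong_isSimpleRing ψ.range.subtype g τ (fun r ↦ ?_) (hR τ fun a ↦ ?_) hT
    fun b ↦ ?_
  · change (g : A) * (r : A) = g * r * ↑g⁻¹ * g
    rw [mul_assoc _ _ (g : A), Units.inv_mul, mul_one]
  · refine Subtype.ext ?_
    change ψ (c a) = g * ψ a * ↑g⁻¹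
    rw [hg, mul_assoc, Units.mul_inv, mul_one]
  · obtain ⟨r, b', h⟩ := hspan b
    exact ⟨fun i ↦ ψ.rangeRestrict (r i), b', h⟩

/-- The image of `ℤ_p[H]` in a ring of characteristic `p` is finite. -/
theorem finite_range_of_natCast_eq_zero {p : ℕ} [Fact p.Prime] {H : Type*} [Group H] [Fintype H]
    {A : Type*} [Ring A] (hp0 : (p : A) = 0) (ψ : MonoidAlgebra ℤ_[p] H →+* A) :
    Finite ψ.range := by
  refine Finite.of_surjective (fun c : H → Fin p ↦
    (⟨ψ (∑ h, MonoidAlgebra.single h ((c h : ℕ) : ℤ_[p])), _, rfl⟩ : ψ.range)) ?_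
  rintro ⟨_, a, rfl⟩
  choose c hc₁ hc₂ using fun h ↦ PadicInt.exists_mem_range (a.coeff h)
  refine ⟨fun h ↦ ⟨c h, hc₁ h⟩, Subtype.ext ?_⟩
  change ψ _ = ψ a
  rw [eq_comm, ← sub_eq_zero, ← map_sub]
  conv_lhs => rw [a.eq_sum_single, ← Finset.sum_sub_distrib, map_sum]
  refine Finset.sum_eq_zero fun h _ ↦ ?_
  rw [← MonoidAlgebra.single_sub]
  have h1 := hc₂ h
  rw [PadicInt.maximalIdeal_eq_span_p, Ideal.mem_span_singleton] at h1
  obtain ⟨r, hr⟩ := h1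
  have h2 : MonoidAlgebra.single h ((p : ℤ_[p]) * r) = (p : MonoidAlgebra ℤ_[p] H) *
      MonoidAlgebra.single h r := by
    rw [← nsmul_eq_mul, ← nsmul_eq_mul, MonoidAlgebra.smul_single]
  rw [hr, h2, map_mul, map_natCast, hp0, zero_mul]

section Component

variable {p : ℕ} [Fact p.Prime] {G : Type u} [Group G] [TopologicalSpace G] [IsTopologicalGroup G]
  [CompactSpace G] [T2Space G] [TotallyDisconnectedSpace G] {H : Subgroup G} [H.Normal] [Fintype H]
  {γ : G} {d : ℕ} {X : Finset (H → PadicAlgCl p)} {e : MonoidAlgebra ℤ_[p] H}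

omit [T2Space G] [TotallyDisconnectedSpace G] in
/-- The idempotent is central in `Λ(G)` if conjugation by `γ` permutes the characters. -/
theorem IsBlockElem.mul_groupRingHom_comm (he : IsBlockElem d X e) (hG : IsGenOver p H γ)
    (hX : ∀ x ∈ X, IsIrredTrace d x) (hXγ : ∀ x ∈ X, x ∘ (MulAut.conjNormal γ : MulAut H) ∈ X)
    (x : IwasawaAlgebra p G) : x * groupRingHom p H e = groupRingHom p H e * x := by
  have hγ : ∀ g : G, (∀ x ∈ X, x ∘ (MulAut.conjNormal g : MulAut H) ∈ X) →
      IwasawaAlgebra.of p g * groupRingHom p H e = groupRingHom p H e * IwasawaAlgebra.of p g :=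
    fun g hg ↦ by rw [of_mul_groupRingHom, he.mapDomain_eq hg]
  refine IwasawaAlgebra.mul_comm_of_forall_of (fun N g ↦ ?_) x
  obtain ⟨h, hh, j, hj⟩ := hG.dense N g
  refine ⟨_, hj, ?_⟩
  have h1 : ∀ x ∈ X, x ∘ (MulAut.conjNormal h : MulAut H) ∈ X := fun x hx ↦ by
    convert hx
    ext k
    have h2 : (MulAut.conjNormal h : MulAut H) k = ⟨h, hh⟩ * k * ⟨h, hh⟩⁻¹ := Subtype.ext (by simp)
    rw [Function.comp_apply, h2, (hX x hx).mul_comm, inv_mul_cancel_left]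
  rw [map_mul, mul_assoc, map_pow]
  have h3 : IwasawaAlgebra.of p γ ^ j * groupRingHom p H e =
      groupRingHom p H e * IwasawaAlgebra.of p γ ^ j := Commute.pow_left (hγ γ hXγ) j
  rw [h3, ← mul_assoc, hγ h h1, mul_assoc]

/-- If the degree of the characters in `X` has full valuation, then the corresponding component of the
Iwasawa algebra is a matrix ring over a local domain that is integrally closed. -/
theorem IsBlockElem.exists_ringEquiv_matrix (he : IsBlockElem d X e) (hG : IsGenOver p H γ) {n : ℕ}
    (hγ : γ ^ p ^ n ∈ Subgroup.center G) (hX : ∀ x ∈ X, IsIrredTrace d x)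
    (hd : ‖(d : PadicAlgCl p)‖ = ‖(Fintype.card H : PadicAlgCl p)‖)
    (hXγ : ∀ x ∈ X, x ∘ (MulAut.conjNormal γ : MulAut H) ∈ X)
    (htrans : ∀ x ∈ X, ∀ y ∈ X, ∃ (σ : PadicAlgCl p ≃ₐ[ℚ_[p]] PadicAlgCl p) (j : ℤ),
      y = fun h ↦ σ (x ((MulAut.conjNormal γ ^ j : MulAut H) h)))
    {ε : IwasawaAlgebra p G} (hεe : groupRingHom p H e = ε) (hε : IsIdempotentElem ε) (hε0 : ε ≠ 0) :
    ∃ (N : ℕ) (S : Type u) (_ : CommRing S), 0 < N ∧ IsDomain S ∧ IsLocalRing S ∧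
      IsComplIntClosed S ∧ Nonempty (hε.Corner ≃+* Matrix (Fin N) (Fin N) S) := by
  have hpp : p.Prime := Fact.out
  have hc : ∀ x, x * ε = ε * x := hεe ▸ he.mul_groupRingHom_comm hG hX hXγ
  have hΛ : IsAdicAlong (p : IwasawaAlgebra p G) := IwasawaAlgebra.isAdicAlong_natCast
  -- the reduction modulo `p` of the component is a corner of the reduction of the Iwasawa algebra
  obtain ⟨A₀, _, φ₀, hφ₀, hφ₀k⟩ := exists_quotient_of_central hΛ.comm
  have hε' : IsIdempotentElem (φ₀ ε) := hε.map φ₀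
  have hc' : ∀ a, a * φ₀ ε = φ₀ ε * a := fun a ↦ by
    obtain ⟨x, rfl⟩ := hφ₀ a
    rw [← map_mul, ← map_mul, hc]
  obtain ⟨hB, φ, hφq, hφk⟩ := hΛ.exists_corner_reduction hε hc hφ₀k hε' hc'
  obtain ⟨q, hqdef⟩ : ∃ q : IwasawaAlgebra p G →+* hε'.Corner, q = (hε'.cornerHom hc').comp φ₀ :=
    ⟨_, rfl⟩
  have hqv : ∀ x, hε'.cornerVal (q x) = φ₀ (ε * x) := fun x ↦ by
    rw [hqdef, RingHom.comp_apply, hε'.cornerVal_cornerHom hc', map_mul]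
  have hqT : ∀ x, q x = hε'.toCorner (φ₀ x) := fun x ↦ by rw [hqdef]; rfl
  have hq : Function.Surjective q := hqdef ▸ (hε'.cornerHom_surjective hc').comp hφ₀
  have hqk : ∀ x, q x = 0 ↔ (p : IwasawaAlgebra p G) ∣ ε * x := fun x ↦ by
    rw [← hφ₀k, ← hqv, map_eq_zero_iff _ hε'.cornerVal_injective]
  have hφ : Function.Surjective φ := fun a ↦ by
    obtain ⟨x, rfl⟩ := hq a
    exact ⟨_, (hφq x).trans (hqdef ▸ rfl)⟩
  have hp0 : ((p : ℕ) : hε'.Corner) = 0 := by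
    rw [← map_natCast q, hqk]
    exact hΛ.dvd_mul_left_of' dvd_rfl _
  have hchar : CharP hε'.Corner p := by
    have hnt : Nontrivial hε'.Corner := by
      rw [← not_subsingleton_iff_nontrivial]
      intro hs
      have h1 : (p : IwasawaAlgebra p G) ∣ ε := by
        have := (hqk 1).mp (Subsingleton.elim _ _)
        rwa [mul_one] at this
      refine hε0 (hΛ.sep _ fun k ↦ ?_)
      induction k with
      | zero => simp
      | succ k ih =>
        rw [← hε.eq]
        exact hΛ.dvd_mul_of_dvd ih (by rwa [pow_one])
    rcases (Nat.dvd_prime hpp).mp (ringChar.dvd hp0) with h2 | h2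
    · exact absurd h2 CharP.ringChar_ne_one
    · exact ringChar.of_eq h2
  -- the image of the group ring of `H`
  obtain ⟨ψ, hψ⟩ : ∃ ψ : MonoidAlgebra ℤ_[p] H →+* hε'.Corner, ∀ a, ψ a = q (groupRingHom p H a) :=
    ⟨q.comp (groupRingHom p H).toRingHom, fun _ ↦ rfl⟩
  have hψk : ∀ a, ψ a = 0 ↔ ∀ h, (p : ℤ_[p]) ∣ (e * a).coeff h := fun a ↦ by
    rw [← natCast_dvd_groupRingHom_iff, map_mul, hεe, hψ, hqk]
  have hfin : Finite ψ.range := finite_range_of_natCast_eq_zero hp0 ψ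
  obtain ⟨g, hg⟩ : ∃ g : (hε'.Corner)ˣ, (g : hε'.Corner) = q (IwasawaAlgebra.of p γ) :=
    ⟨Units.map ((q : IwasawaAlgebra p G →* hε'.Corner).comp (IwasawaAlgebra.of p)) (toUnits γ), rfl⟩
  have hgpow : (g : hε'.Corner) ^ p ^ n - 1 = q (IwasawaAlgebra.of p (γ ^ p ^ n) - 1) := by
    rw [map_sub, map_one, map_pow, map_pow, hg]
  have hT : IsAdicAlong ((g : hε'.Corner) ^ p ^ n - 1) := by
    rw [hgpow, hqT]
    exact (IwasawaAlgebra.isAdicAlong_of_sub_one hG hγ hφ₀ hφ₀k).corner hε'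
  obtain ⟨t, Q, _, θ, ht, _, _, hθ, hθk⟩ := exists_isAdicAlong_isSimpleRing_of_range ψ g
    (MonoidAlgebra.mapDomainRingHom ℤ_[p] ((MulAut.conjNormal γ : MulAut H) : H →* H))
    (MonoidAlgebra.mapDomainRingHom ℤ_[p] (((MulAut.conjNormal γ : MulAut H)⁻¹ : MulAut H) : H →* H))
    (fun a ↦ by
      rw [a.eq_sum_single, map_sum, map_sum]
      simp)
    (fun a ↦ by rw [hψ, hψ, hg, ← map_mul q, ← map_mul q, of_mul_groupRingHom])
    (fun τ hτ ↦ eq_bot_or_eq_top_of_forall_map_mem (i := padicIntToAlgCl p)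
      (fun r ↦ (norm_padicIntToAlgCl r).trans_le (PadicInt.norm_le_one r)) hX hd
      (c := MulAut.conjNormal γ)
      (fun x hx y hy ↦ by
        obtain ⟨σ, j, h⟩ := htrans x hx y hy
        exact ⟨σ, j, fun r ↦ σ.commutes _, PadicAlgCl.norm_galois σ, h⟩)
      ψ.rangeRestrict ψ.rangeRestrict_surjective τ hτ fun a ↦ by
        have h1 : ψ.rangeRestrict a = 0 ↔ ψ a = 0 := Subtype.ext_iff
        have hd0 : ‖(d : PadicAlgCl p) / Fintype.card H‖ = 1 := by
          rw [norm_div, hd, div_self]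
          exact norm_ne_zero_iff.mpr (Nat.cast_ne_zero.mpr Fintype.card_ne_zero)
        rw [h1, hψk]
        simp only [natCast_dvd_iff_norm_padicIntToAlgCl_lt_one, he.coeff_mul hX, norm_mul, hd0, one_mul]
        exact ⟨fun h k ↦ by simpa using h k⁻¹, fun h k ↦ h k⁻¹⟩) hT
    (fun b ↦ by
      obtain ⟨x, rfl⟩ := hq b
      obtain ⟨c, y, hxy⟩ := IwasawaAlgebra.exists_eq_sum_add_mul hG hγ x
      refine ⟨fun i ↦ ∑ h, MonoidAlgebra.single h (c i h), q y, ?_⟩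
      rw [hgpow]
      conv_lhs => rw [hxy, map_add q, map_sum, map_mul q]
      congr 1
      refine Finset.sum_congr rfl fun i _ ↦ ?_
      rw [map_mul q, map_pow q, hg, hψ, map_sum (groupRingHom p H)]
      simp only [groupRingHom_single])
  exact exists_ringEquiv_matrix_of_isSimpleRing hB hφ hφk ht hθ hθk

end Component

/-! ### Matrix rings over completely integrally closed domains as maximal orders -/

section MaximalOrder

variable {Q : Type*} [Ring Q] {S : Type*} [CommRing S] {N : ℕ}

theorem Matrix.exists_eq_scalar_of_commute_single {M : Matrix (Fin N) (Fin N) S}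
    (hM : ∀ i j, Matrix.single i j 1 * M = M * Matrix.single i j 1) :
    ∃ a, M = Matrix.scalar (Fin N) a := by
  obtain ⟨a, ha⟩ := Matrix.mem_range_scalar_iff_commute_single'.mpr fun i j ↦ hM i j
  exact ⟨a, ha.symm⟩

/-- A ring between a matrix ring over a completely integrally closed domain and its multiple by a
central unit of an overring is equal to the matrix ring. -/
theorem IsComplIntClosed.mem_range_of_smul_mem [IsDomain S] (hS : IsComplIntClosed S) [NeZero N]
    {f : Matrix (Fin N) (Fin N) S →ₙ+* Q} (hf : Function.Injective f) {O : NonUnitalSubring Q}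
    (hO : ∀ M, f M ∈ O) (hO1 : ∀ b ∈ O, f 1 * b = b ∧ b * f 1 = b) {s : Q} (hs : IsUnit s)
    (hsc : ∀ b, s * b = b * s) (hsO : ∀ b ∈ O, ∃ M, f M = s * b) {b : Q} (hb : b ∈ O) :
    ∃ M, f M = b := by
  let u : Fin N → Fin N → Q := fun i j ↦ f (Matrix.single i j 1)
  have huu : ∀ i j k l, u i j * u k l = if j = k then u i l else 0 := fun i j k l ↦ by
    simp only [u, ← map_mul]
    split_ifs with h
    · subst h
      rw [Matrix.single_mul_single_same, mul_one]
    · rw [Matrix.single_mul_single_of_ne _ _ _ _ h, map_zero]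
  have hu1 : ∑ i, u i i = f 1 := by
    simp only [u, ← map_sum]
    rw [Matrix.sum_single_one]
  have h11 := hO1 _ (hO 1)
  have hscalar : ∀ b, (∀ i j, u i j * b = b * u i j) → b ∈ O → ∃ a, f (Matrix.scalar (Fin N) a) = s * b := by
    intro b hb hbO
    obtain ⟨M, hM⟩ := hsO b hbO
    obtain ⟨a, rfl⟩ := Matrix.exists_eq_scalar_of_commute_single (M := M) fun i j ↦ hf (by
      rw [map_mul, map_mul, hM]
      change u i j * (s * b) = s * b * u i j
      rw [← mul_assoc, ← hsc, mul_assoc, hb, mul_assoc])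
    exact ⟨a, hM⟩
  have hf1 : ∀ M, f 1 * f M = f M ∧ f M * f 1 = f M := fun M ↦ hO1 _ (hO M)
  -- `s` corresponds to a scalar matrix `σ`
  obtain ⟨σ, hσ⟩ := hscalar (f 1) (fun i j ↦ by rw [(hf1 _).1, (hf1 _).2]) (hO 1)
  have hσmul : ∀ a, f (Matrix.scalar (Fin N) (σ * a)) = s * f (Matrix.scalar (Fin N) a) := fun a ↦ by
    rw [map_mul, map_mul, hσ, mul_assoc, (hf1 _).1]
  have hσ0 : σ ≠ 0 := by
    rintro rfl
    rw [map_zero, map_zero, eq_comm, hs.mul_right_eq_zero] at hσ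
    exact one_ne_zero ((map_eq_zero_iff f hf).mp hσ)
  have hinj : Function.Injective fun a : S ↦ f (Matrix.scalar (Fin N) a) := fun a b h ↦
    Matrix.scalar_inj.mp (hf h)
  -- elements commuting with the matrix units
  have key : ∀ b ∈ O, (∀ i j, u i j * b = b * u i j) → ∃ M, f M = b := by
    intro b hbO hb
    obtain ⟨a, ha⟩ := hscalar b hb hbO
    have hpow : ∀ k : ℕ, b ^ k * f 1 ∈ O ∧ ∀ i j, u i j * (b ^ k * f 1) = b ^ k * f 1 * u i j := by
      intro k
      induction k with
      | zero =>
        rw [pow_zero, one_mul]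
        exact ⟨hO 1, fun i j ↦ by rw [(hf1 _).1, (hf1 _).2]⟩
      | succ k ih =>
        have h1 : b ^ (k + 1) * f 1 = b * (b ^ k * f 1) := by rw [pow_succ', mul_assoc]
        rw [h1]
        exact ⟨O.mul_mem hbO ih.1, fun i j ↦ by
          rw [← mul_assoc, hb, mul_assoc, ih.2, mul_assoc b]⟩
    -- all powers of `b = a / σ` have the common denominator `σ`
    obtain ⟨a', ha'⟩ := hS a σ σ hσ0 hσ0 fun k ↦ by
      obtain ⟨d, hd⟩ := hscalar _ (hpow k).2 (hpow k).1
      refine ⟨d, hinj ?_⟩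
      change f (Matrix.scalar (Fin N) (σ * a ^ k)) = f (Matrix.scalar (Fin N) (σ ^ k * d))
      have h1 : ∀ k : ℕ, f (Matrix.scalar (Fin N) (σ * a ^ k)) = s ^ (k + 1) * (b ^ k * f 1) := by
        intro k
        induction k with
        | zero => rw [pow_zero, pow_zero, mul_one, one_mul, hσ, zero_add, pow_one]
        | succ k ih =>
          rw [pow_succ', mul_left_comm, map_mul, map_mul, ih, ha, pow_succ' s (k + 1), pow_succ' b]
          have h2 : b * s ^ (k + 1) = s ^ (k + 1) * b := (Commute.pow_left (hsc b) (k + 1)).eq.symm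
          rw [mul_assoc s b, ← mul_assoc b (s ^ (k + 1)), h2]
          simp only [mul_assoc]
      have h3 : ∀ k : ℕ, f (Matrix.scalar (Fin N) (σ ^ k * d)) = s ^ k * f (Matrix.scalar (Fin N) d) := by
        intro k
        induction k with
        | zero => rw [pow_zero, pow_zero, one_mul, one_mul]
        | succ k ih => rw [pow_succ', mul_assoc, hσmul, ih, pow_succ', mul_assoc]
      rw [h1, h3, hd, pow_succ, mul_assoc]
    refine ⟨Matrix.scalar (Fin N) a', hs.mul_left_cancel ?_⟩
    rw [← hσmul, ← ha', ha]
  -- the entries of an element of `O`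
  have hentry : ∀ i j, ∃ M, f M = ∑ k, u k i * b * u j k := fun i j ↦ by
    refine key _ (O.sum_mem fun k _ ↦ O.mul_mem (O.mul_mem (hO _) hb) (hO _)) fun l m ↦ ?_
    rw [Finset.mul_sum, Finset.sum_mul, Finset.sum_eq_single m, Finset.sum_eq_single l]
    · rw [← mul_assoc, ← mul_assoc, huu, if_pos rfl, mul_assoc _ _ (u l m), huu, if_pos rfl]
    · intro k _ hk
      rw [mul_assoc, huu, if_neg hk, mul_zero]
    · simp
    · intro k _ hk
      rw [← mul_assoc, ← mul_assoc, huu, if_neg hk.symm, zero_mul, zero_mul]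
    · simp
  choose M hM using hentry
  refine ⟨∑ i, ∑ j, M i j * Matrix.single i j 1, ?_⟩
  have h1 : ∀ i j, f (M i j * Matrix.single i j 1) = u i i * b * u j j := fun i j ↦ by
    rw [map_mul, hM, Finset.sum_mul, Finset.sum_eq_single i]
    · change _ * u i j = _
      rw [mul_assoc, huu, if_pos rfl]
    · intro k _ hk
      change _ * u i j = _
      rw [mul_assoc, huu, if_neg hk, mul_zero]
    · simp
  simp only [map_sum, h1, ← Finset.mul_sum, ← Finset.sum_mul, hu1]
  rw [(hO1 b hb).1, (hO1 b hb).2]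

end MaximalOrder

/-! ### The size of the matrix ring -/

section Degree

variable {K : Type*} [Field K] [IsAlgClosed K] {G : Type*} [Group G] {d : ℕ}
  {ρ : Representation K G (Fin d → K)}

/-- If an irreducible representation factors through a matrix ring over a commutative ring, then its
degree is the size of the matrices. -/
theorem Representation.IsIrreducible.eq_of_matrix (hρ : ρ.IsIrreducible) {S : Type*} [CommRing S]
    {N : ℕ} [NeZero N] (θ : Matrix (Fin N) (Fin N) S →+* Module.End K (Fin d → K))
    (hθ : ∀ g, ∃ M, θ M = ρ g) : N = d := by
  -- the scalar matrices act through scalars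
  have hsc : ∀ a : S, ∃ c : K, θ (Matrix.scalar (Fin N) a) = c • 1 := fun a ↦
    hρ.exists_eq_smul_one _ fun g ↦ by
      obtain ⟨M, hM⟩ := hθ g
      rw [← hM, ← map_mul, ← map_mul, Matrix.scalar_comm a (fun _ ↦ mul_comm _ _) M]
  choose l hl using hsc
  let u : Fin N → Fin N → Module.End K (Fin d → K) := fun i j ↦ θ (Matrix.single i j 1)
  have huu : ∀ i j k l, u i j * u k l = if j = k then u i l else 0 := fun i j k l ↦ by
    simp only [u, ← map_mul]
    split_ifs with h
    · subst h
      rw [Matrix.single_mul_single_same, mul_one]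
    · rw [Matrix.single_mul_single_of_ne _ _ _ _ h, map_zero]
  have hu1 : ∑ i, u i i = 1 := by
    simp only [u, ← map_sum]
    rw [Matrix.sum_single_one, map_one]
  have hθu : ∀ M, θ M = ∑ i, ∑ j, l (M i j) • u i j := fun M ↦ by
    conv_lhs => rw [Matrix.matrix_eq_sum_single M, map_sum]
    refine Finset.sum_congr rfl fun i _ ↦ ?_
    rw [map_sum]
    refine Finset.sum_congr rfl fun j _ ↦ ?_
    have h1 : Matrix.single i j (M i j) = Matrix.scalar (Fin N) (M i j) * Matrix.single i j 1 := by
      rw [Matrix.scalar_apply, ← Matrix.smul_eq_diagonal_mul, Matrix.smul_single, smul_eq_mul, mul_one]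
    rw [h1, map_mul, hl, smul_mul_assoc, one_mul]
  have hnt : Nontrivial (Fin d → K) := by
    by_contra h
    rw [not_nontrivial_iff_subsingleton] at h
    obtain ⟨a, b, hab⟩ := hρ.exists_pair_ne
    exact hab (Subrepresentation.toSubmodule_injective (Subsingleton.elim _ _))
  obtain ⟨w, hw, hw0⟩ : ∃ w, u 0 0 w = w ∧ w ≠ 0 := by
    have h1 : u 0 0 ≠ 0 := by
      intro h0
      have h2 : ∀ i, u i i = 0 := fun i ↦ by
        have h3 : u i 0 * u 0 0 * u 0 i = u i i := by rw [huu, if_pos rfl, huu, if_pos rfl]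
        rw [← h3, h0, mul_zero, zero_mul]
      have h4 := hu1
      rw [Finset.sum_eq_zero fun i _ ↦ h2 i] at h4
      exact zero_ne_one h4
    obtain ⟨v, hv⟩ : ∃ v, u 0 0 v ≠ 0 := by
      by_contra! h
      exact h1 (LinearMap.ext h)
    refine ⟨u 0 0 v, ?_, hv⟩
    rw [← Module.End.mul_apply, huu, if_pos rfl]
  -- the span of these `N` vectors is stable under the matrix ring, hence everything
  let b : Fin N → (Fin d → K) := fun i ↦ u i 0 w
  have hub : ∀ i j k, u i j (b k) = if j = k then b i else 0 := fun i j k ↦ by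
    simp only [b]
    rw [← Module.End.mul_apply, huu]
    split_ifs <;> rfl
  have hli : LinearIndependent K b := by
    rw [Fintype.linearIndependent_iff]
    intro c hc i
    have h1 := congrArg (u 0 i) hc
    simp only [map_sum, map_smul, hub, map_zero, smul_ite, smul_zero] at h1
    rw [Finset.sum_ite_eq Finset.univ i (fun j ↦ c j • b 0), if_pos (Finset.mem_univ _)] at h1
    have h2 : b 0 = w := hw
    rw [h2] at h1
    exact (smul_eq_zero.mp h1).resolve_right hw0
  let W : Subrepresentation ρ :=
    { toSubmodule := Submodule.span K (Set.range b)
      apply_mem_toSubmodule := fun g v hv ↦ by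
        obtain ⟨M, hM⟩ := hθ g
        induction hv using Submodule.span_induction with
        | mem x hx =>
          obtain ⟨k, rfl⟩ := hx
          rw [← hM, hθu]
          simp only [LinearMap.sum_apply, LinearMap.smul_apply, hub]
          refine Submodule.sum_mem _ fun i _ ↦ Submodule.sum_mem _ fun j _ ↦ Submodule.smul_mem _ _ ?_
          split_ifs
          · exact Submodule.subset_span ⟨i, rfl⟩
          · exact Submodule.zero_mem _
        | zero => rw [map_zero]; exact Submodule.zero_mem _
        | add x y _ _ hx hy => rw [map_add]; exact Submodule.add_mem _ hx hy
        | smul c x _ hx => rw [map_smul]; exact Submodule.smul_mem _ _ hx }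
  have htop : Submodule.span K (Set.range b) = ⊤ := by
    rcases hρ.eq_bot_or_eq_top W with h | h
    · have h1 : b 0 ∈ W.toSubmodule := Submodule.subset_span ⟨0, rfl⟩
      rw [h] at h1
      exact absurd (hw.symm.trans ((Submodule.mem_bot K).mp h1)) hw0
    · exact congrArg Subrepresentation.toSubmodule h
  have h1 := Module.finrank_eq_card_basis (Module.Basis.mk hli htop.ge)
  rw [Module.finrank_fin_fun, Fintype.card_fin] at h1
  exact h1.symm

end Degree

/-! ### The component as an order -/

/-- A regular element of an algebra that is finite over a commutative subring divides a nonzero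
element of the subring: the constant term of an equation of minimal degree. -/
theorem exists_mul_eq_algebraMap_of_regular {C A : Type*} [CommRing C] [Nontrivial C] [Ring A]
    [Algebra C A] [Module.Finite C A] {s : A} (hs : ∀ a, s * a = 0 → a = 0) :
    ∃ (c : C) (z : A), c ≠ 0 ∧ s * z = algebraMap C A c := by
  have key : ∀ (k : ℕ) (P : Polynomial C), P.natDegree = k → P ≠ 0 → Polynomial.aeval s P = 0 →
      ∃ R : Polynomial C, Polynomial.aeval s R = 0 ∧ R.coeff 0 ≠ 0 := by
    intro k
    induction k with
    | zero =>
      intro P hk hP0 hP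
      refine ⟨P, hP, fun h0 ↦ hP0 ?_⟩
      rw [Polynomial.eq_C_of_natDegree_eq_zero hk, h0, Polynomial.C_0]
    | succ k ih =>
      intro P hk hP0 hP
      by_cases h0 : P.coeff 0 = 0
      · have h1 : Polynomial.X * P.divX = P := by
          conv_rhs => rw [← Polynomial.X_mul_divX_add P, h0, Polynomial.C_0, add_zero]
        refine ih P.divX ?_ ?_ (hs _ ?_)
        · rw [Polynomial.natDegree_divX_eq_natDegree_tsub_one, hk, Nat.add_sub_cancel]
        · intro h2
          rw [h2, mul_zero] at h1
          exact hP0 h1.symm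
        · rw [← h1, map_mul, Polynomial.aeval_X] at hP
          exact hP
      · exact ⟨P, hP, h0⟩
  obtain ⟨P, hPm, hP⟩ := Algebra.IsIntegral.isIntegral (R := C) s
  obtain ⟨R, hR, hR0⟩ := key _ P rfl hPm.ne_zero (by rwa [Polynomial.aeval_def])
  refine ⟨-R.coeff 0, Polynomial.aeval s R.divX, neg_ne_zero.mpr hR0, ?_⟩
  have h1 := congrArg (Polynomial.aeval s) (Polynomial.X_mul_divX_add R)
  rw [map_add, map_mul, Polynomial.aeval_X, Polynomial.aeval_C, hR] at h1
  rw [map_neg]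
  exact eq_neg_of_add_eq_zero_left h1

section Order

variable {p : ℕ} [Fact p.Prime] {G : Type u} [Group G] [TopologicalSpace G] [IsTopologicalGroup G]
  [CompactSpace G]

/-- The Iwasawa algebra of a central subgroup is central. -/
theorem mul_ofSubgroup_comm {K : Subgroup G} [CompactSpace K] (hK : K ≤ Subgroup.center G)
    (c : IwasawaAlgebra p K) (x : IwasawaAlgebra p G) :
    x * IwasawaAlgebra.ofSubgroup p K c = IwasawaAlgebra.ofSubgroup p K c * x := by
  let D : Submodule ℤ_[p] (IwasawaAlgebra p K) :=
    { carrier := {c | x * IwasawaAlgebra.ofSubgroup p K c = IwasawaAlgebra.ofSubgroup p K c * x}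
      add_mem' := fun {a b} ha hb ↦ by
        simp only [Set.mem_ofPred_eq, map_add, mul_add, add_mul] at ha hb ⊢
        rw [ha, hb]
      zero_mem' := by simp
      smul_mem' := fun r a ha ↦ by
        simp only [Set.mem_ofPred_eq, map_smul, mul_smul_comm, smul_mul_assoc] at ha ⊢
        rw [ha] }
  have hD : D = ⊤ := IwasawaAlgebra.eq_top_of_isClosed
    (isClosed_eq (continuous_const.mul (IwasawaAlgebra.continuous_ofSubgroup K))
      ((IwasawaAlgebra.continuous_ofSubgroup K).mul continuous_const)) fun N g ↦ ⟨g, rfl, by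
        change x * IwasawaAlgebra.ofSubgroup p K (IwasawaAlgebra.of p g) =
          IwasawaAlgebra.ofSubgroup p K (IwasawaAlgebra.of p g) * x
        rw [IwasawaAlgebra.ofSubgroup_of]
        exact IwasawaAlgebra.mul_comm_of_mem_center (hK g.2) x⟩
  have : c ∈ D := hD ▸ Submodule.mem_top
  exact this

variable {H : Subgroup G} [Fintype H] {γ : G} {n : ℕ} {K : Subgroup G} [CompactSpace K]

/-- A regular element of `Λ(G)` divides a nonzero element of the Iwasawa algebra of a central subgroup
containing `γ ^ (p ^ n)`, over which `Λ(G)` is finite. -/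
theorem exists_mul_eq_ofSubgroup (hG : IsGenOver p H γ) (hn : γ ^ p ^ n ∈ Subgroup.center G)
    (hK : K ≤ Subgroup.center G) (hγK : γ ^ p ^ n ∈ K) {s : IwasawaAlgebra p G}
    (hs : ∀ a, s * a = 0 → a = 0) (h10 : (1 : IwasawaAlgebra p G) ≠ 0) :
    ∃ c z, IwasawaAlgebra.ofSubgroup p K c ≠ 0 ∧ s * z = IwasawaAlgebra.ofSubgroup p K c := by
  let T := (IwasawaAlgebra.ofSubgroup p K).toRingHom.range
  let : CommRing T := { (inferInstance : Ring T) with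
    mul_comm := fun a b ↦ by
      obtain ⟨_, b, rfl⟩ := b
      exact Subtype.ext (mul_ofSubgroup_comm hK b a.1) }
  let : Algebra T (IwasawaAlgebra p G) := RingHom.toAlgebra' T.subtype fun c x ↦ by
    obtain ⟨_, c, rfl⟩ := c
    exact (mul_ofSubgroup_comm hK c x).symm
  have hnt : Nontrivial T := ⟨0, 1, fun h ↦ h10 (congrArg Subtype.val h).symm⟩
  have hfin : Module.Finite T (IwasawaAlgebra p G) := by
    let F : (Fin (p ^ n) → H → T) →ₗ[T] IwasawaAlgebra p G :=
      { toFun := fun c ↦ ∑ i, ∑ h : H, c i h • IwasawaAlgebra.of p ((h : G) * γ ^ (i : ℕ))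
        map_add' := fun a b ↦ by simp only [Pi.add_apply, add_smul, Finset.sum_add_distrib]
        map_smul' := fun r a ↦ by
          change ∑ i : Fin (p ^ n), ∑ h : H, (r * a i h) • IwasawaAlgebra.of p ((h : G) * γ ^ (i : ℕ)) = _
          simp only [mul_smul, RingHom.id_apply, Finset.smul_sum] }
    refine Module.Finite.of_surjective F fun x ↦ ?_
    obtain ⟨c, hc⟩ := IwasawaAlgebra.exists_eq_sum_ofSubgroup hG hn K hγK x
    exact ⟨fun i h ↦ ⟨_, c i h, rfl⟩, hc.symm⟩
  obtain ⟨⟨_, c, rfl⟩, z, hc0, hz⟩ := exists_mul_eq_algebraMap_of_regular (C := T) hs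
  exact ⟨c, z, fun h ↦ hc0 (Subtype.ext h), hz⟩

variable {ε : IwasawaAlgebra p G}

omit [IsTopologicalGroup G] [CompactSpace G] in
theorem mem_component_iff (hε : IsIdempotentElem ε) (hc : ∀ x, x * ε = ε * x)
    {x : IwasawaAlgebra p G} : x ∈ component p ε ↔ ε * x = x := by
  change x ∈ Subsemigroup.corner ε ↔ _
  rw [Subsemigroup.mem_corner_iff hε, hc, and_self_iff]

/-- The component of the Iwasawa algebra at a central idempotent is an order over the Iwasawa algebra
of an open central subgroup. -/
theorem isOrderIn_component (hG : IsGenOver p H γ) (hn : γ ^ p ^ n ∈ Subgroup.center G)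
    (hK : K ≤ Subgroup.center G) (hγK : γ ^ p ^ n ∈ K) (hε : IsIdempotentElem ε)
    (hc : ∀ x, x * ε = ε * x) (hε0 : ε ≠ 0) :
    IsOrderIn (iwasawaSubring p K) (toFraction p ε) ((component p ε).map (toFraction p)) := by
  classical
  have hmem : ∀ y, y ∈ (component p ε).map (toFraction p) ↔
      ∃ x, ε * x = x ∧ toFraction p x = y := fun y ↦ by
    rw [NonUnitalSubring.mem_map]
    exact exists_congr fun x ↦ by rw [mem_component_iff hε hc]
  have hε' : IsIdempotentElem (toFraction p ε) := hε.map (toFraction p)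
  refine ⟨(hmem _).mpr ⟨ε, hε, rfl⟩, fun y hy ↦ ?_, ?_, fun a ha ↦ ?_⟩
  · obtain ⟨x, hx, rfl⟩ := (hmem y).mp hy
    change _ ∈ Subsemigroup.corner (toFraction p ε)
    rw [Subsemigroup.mem_corner_iff hε', ← map_mul, ← map_mul, hc, hx, and_self]
  · refine ⟨Finset.univ.image fun k : Fin (p ^ n) × H ↦
      toFraction p (ε * IwasawaAlgebra.of p ((k.2 : G) * γ ^ (k.1 : ℕ))), Set.ext fun y ↦ ?_⟩
    constructor
    · intro hy
      change y ∈ Submodule.span _ _ at hy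
      rw [SetLike.mem_coe]
      induction hy using Submodule.span_induction with
      | mem y hy =>
        rw [Finset.coe_image] at hy
        obtain ⟨k, -, rfl⟩ := hy
        exact (hmem _).mpr ⟨_, by rw [← mul_assoc, hε.eq], rfl⟩
      | zero => exact NonUnitalSubring.zero_mem _
      | add y z _ _ hy hz => exact NonUnitalSubring.add_mem _ hy hz
      | smul r y _ hy =>
        obtain ⟨_, c, rfl⟩ := r
        obtain ⟨x, hx, rfl⟩ := (hmem y).mp hy
        refine (hmem _).mpr ⟨IwasawaAlgebra.ofSubgroup p K c * x, ?_, map_mul _ _ _⟩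
        rw [← mul_assoc, mul_ofSubgroup_comm hK, mul_assoc, hx]
    · intro hy
      obtain ⟨x, hx, rfl⟩ := (hmem y).mp hy
      obtain ⟨c, hcx⟩ := IwasawaAlgebra.exists_eq_sum_ofSubgroup hG hn K hγK x
      have h1 : x = ∑ i : Fin (p ^ n), ∑ h : H, IwasawaAlgebra.ofSubgroup p K (c i h) *
          (ε * IwasawaAlgebra.of p ((h : G) * γ ^ (i : ℕ))) := by
        rw [← hx, hcx]
        simp only [Finset.mul_sum, ← mul_assoc, mul_ofSubgroup_comm hK _ ε]
      rw [h1]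
      simp only [map_sum, map_mul (toFraction p) (IwasawaAlgebra.ofSubgroup p K _)]
      refine Submodule.sum_mem _ fun i _ ↦ Submodule.sum_mem _ fun h _ ↦ ?_
      refine Submodule.smul_mem _ (⟨_, c i h, rfl⟩ : iwasawaSubring p K) (Submodule.subset_span ?_)
      rw [Finset.coe_image]
      exact ⟨(i, h), Finset.mem_coe.mpr (Finset.mem_univ _), rfl⟩
  -- denominators of `𝒬(G)` may be taken from the Iwasawa algebra of `K`
  · obtain ⟨s, hs, y, hy⟩ := exists_toFraction_mul p a
    obtain ⟨c, z, hc0, hz⟩ := exists_mul_eq_ofSubgroup (K := K) hG hn hK hγK hs.2.1 fun h ↦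
      hε0 (by rw [← one_mul ε, h, zero_mul])
    refine ⟨toFraction p (IwasawaAlgebra.ofSubgroup p K c), ⟨c, rfl⟩, fun h ↦ hc0 ?_, ?_⟩
    · exact toFraction_injective (h.trans (map_zero _).symm)
    · have h1 : toFraction p (IwasawaAlgebra.ofSubgroup p K c) * a = toFraction p (z * y) := by
        rw [← hz, ← Submonoid.mem_center_iff.mp hs.1 z, map_mul, mul_assoc, hy, map_mul]
      have h2 : toFraction p ε * a = a :=
        ((Subsemigroup.mem_corner_iff hε').mp ha).1
      refine (hmem _).mpr ⟨ε * (z * y), by rw [← mul_assoc, hε.eq], ?_⟩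
      rw [map_mul, ← h1, ← mul_assoc, ← map_mul, mul_ofSubgroup_comm hK, map_mul, mul_assoc, h2]

/-- A component that is a matrix ring over a completely integrally closed domain is a maximal
order. -/
theorem isMaximalOrderIn_component (hG : IsGenOver p H γ) (hn : γ ^ p ^ n ∈ Subgroup.center G)
    (hK : K ≤ Subgroup.center G) (hγK : γ ^ p ^ n ∈ K) (hε : IsIdempotentElem ε)
    (hc : ∀ x, x * ε = ε * x) (hε0 : ε ≠ 0) {S : Type*} [CommRing S] [IsDomain S]
    (hS : IsComplIntClosed S) {N : ℕ} [NeZero N] (f : hε.Corner ≃+* Matrix (Fin N) (Fin N) S) :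
    IsMaximalOrderIn (iwasawaSubring p K) (toFraction p ε) ((component p ε).map (toFraction p)) := by
  classical
  have hO := isOrderIn_component hG hn hK hγK hε hc hε0
  have hε' : IsIdempotentElem (toFraction p ε) := hε.map (toFraction p)
  refine ⟨hO, fun O' hO' hle ↦ ?_⟩
  let j : Matrix (Fin N) (Fin N) S →ₙ+* FractionIwasawa p G :=
    (toFraction p (G := G)).toNonUnitalRingHom.comp
      (hε.cornerVal.comp f.symm.toNonUnitalRingHom)
  have hj : ∀ M, j M = toFraction p (hε.cornerVal (f.symm M)) := fun _ ↦ rfl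
  have hjr : ∀ y, y ∈ (component p ε).map (toFraction p) ↔ ∃ M, j M = y := fun y ↦ by
    rw [NonUnitalSubring.mem_map]
    constructor
    · rintro ⟨x, hx, rfl⟩
      refine ⟨f (hε.cornerHom hc x), ?_⟩
      rw [hj, f.symm_apply_apply, hε.cornerVal_cornerHom hc, (mem_component_iff hε hc).mp hx]
    · rintro ⟨M, rfl⟩
      exact ⟨_, (mem_component_iff hε hc).mpr (hε.mul_cornerVal _), rfl⟩
  have hj1 : j 1 = toFraction p ε := by rw [hj, map_one f.symm, hε.cornerVal_one]
  -- a common denominator of the larger order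
  obtain ⟨F, hF⟩ := hO'.fg
  obtain ⟨s, hs, hsF⟩ : ∃ s ∈ centralRegular (IwasawaAlgebra p G), ∀ b ∈ F,
      ∃ y, toFraction p s * b = toFraction p y := by
    clear hF
    induction F using Finset.induction_on with
    | empty => exact ⟨1, Submonoid.one_mem _, by simp⟩
    | insert b F _ ih =>
      obtain ⟨s, hs, h⟩ := ih
      obtain ⟨t, ht, y, hy⟩ := exists_toFraction_mul p b
      refine ⟨s * t, Submonoid.mul_mem _ hs ht, fun b' hb' ↦ ?_⟩
      rcases Finset.mem_insert.mp hb' with rfl | hb'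
      · exact ⟨s * y, by rw [map_mul, mul_assoc, hy, map_mul]⟩
      · obtain ⟨y', hy'⟩ := h b' hb'
        exact ⟨t * y', by
          rw [← Submonoid.mem_center_iff.mp hs.1 t, map_mul, mul_assoc, hy', map_mul]⟩
  have hsc : ∀ b, toFraction p s * b = b * toFraction p s := fun b ↦
    (Subring.mem_center_iff.mp (toFraction_mem_center p (Submonoid.mem_center_iff.mp hs.1)) b).symm
  have hsO : ∀ b ∈ O', ∃ M, j M = toFraction p s * b := by
    intro b hb
    have hbe := ((Subsemigroup.mem_corner_iff hε').mp (hO'.le_corner hb)).1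
    obtain ⟨y, hy⟩ : ∃ y, toFraction p s * b = toFraction p y := by
      have hb' : b ∈ (Submodule.span (iwasawaSubring p K) (F : Set (FractionIwasawa p G)) :
          Set (FractionIwasawa p G)) := hF ▸ hb
      rw [SetLike.mem_coe] at hb'
      clear hb hbe
      induction hb' using Submodule.span_induction with
      | mem b hb => exact hsF b hb
      | zero => exact ⟨0, by rw [mul_zero, map_zero]⟩
      | add b b' _ _ h h' =>
        obtain ⟨y, hy⟩ := h
        obtain ⟨y', hy'⟩ := h'
        exact ⟨y + y', by rw [mul_add, hy, hy', map_add]⟩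
      | smul r b _ h =>
        obtain ⟨_, c, rfl⟩ := r
        obtain ⟨y, hy⟩ := h
        refine ⟨IwasawaAlgebra.ofSubgroup p K c * y, ?_⟩
        rw [map_mul, ← hy, ← mul_assoc, ← hsc, mul_assoc]
        rfl
    refine (hjr _).mp (NonUnitalSubring.mem_map.mpr ⟨ε * y, (mem_component_iff hε hc).mpr ?_, ?_⟩)
    · rw [← mul_assoc, hε.eq]
    · rw [map_mul, ← hy, ← mul_assoc, ← hsc, mul_assoc, hbe]
  intro b hb
  refine (hjr b).mpr (hS.mem_range_of_smul_mem (f := j) ?_ (O := O') (fun M ↦ hle ((hjr _).mpr ⟨M, rfl⟩))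
    (fun b hb ↦ ?_) (isUnit_toFraction p hs) hsc hsO hb)
  · exact toFraction_injective.comp (hε.cornerVal_injective.comp f.symm.injective)
  · rw [hj1]
    exact (Subsemigroup.mem_corner_iff hε').mp (hO'.le_corner hb)

end Order

/-! ### The component of an irreducible character -/

section

variable {p : ℕ} [Fact p.Prime] {G : Type u} [Group G] [TopologicalSpace G] [IsTopologicalGroup G]

/-- If the `m`-th power of a topological generator is central, so are all `m`-th powers. -/
theorem mem_center_of_mem_topologicalClosure [T2Space G] {γ : G} {m : ℕ}
    (hm : γ ^ m ∈ Subgroup.center G) {g : G} (hg : g ∈ (Subgroup.zpowers γ).topologicalClosure) :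
    g ^ m ∈ Subgroup.center G := by
  refine Subgroup.mem_center_iff.mpr fun x ↦ ?_
  have hcl : IsClosed {g : G | x * g ^ m = g ^ m * x} :=
    isClosed_eq (continuous_const.mul (continuous_pow m)) ((continuous_pow m).mul continuous_const)
  refine closure_minimal ?_ hcl hg
  rintro _ ⟨j, rfl⟩
  have h1 : (γ ^ j) ^ m = (γ ^ m) ^ j := by
    rw [← zpow_natCast, ← zpow_natCast γ, zpow_comm]
  change x * (γ ^ j) ^ m = (γ ^ j) ^ m * x
  rw [h1]
  exact Subgroup.mem_center_iff.mp ((Subgroup.center G).zpow_mem hm j) x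

variable {H : Subgroup G} [Fintype H] {d : ℕ} {χ : G → PadicAlgCl p}
  {ρ : Representation (PadicAlgCl p) G (Fin d → PadicAlgCl p)}

omit [IsTopologicalGroup G] in
/-- A representation with open kernel extends to the Iwasawa algebra. -/
theorem IsIrrCharOf.exists_ringHom (hρ : IsIrrCharOf p χ ρ) :
    ∃ Θ : IwasawaAlgebra p G →+* Module.End (PadicAlgCl p) (Fin d → PadicAlgCl p),
      ∀ (r : ℤ_[p]) g, Θ (r • IwasawaAlgebra.of p g) = padicIntToAlgCl p r • ρ g := by
  let N : OpenNormalSubgroup G :=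
    { toOpenSubgroup := ⟨MonoidHom.ker ρ, hρ.open_kernel⟩
      isNormal' := MonoidHom.normal_ker ρ }
  let ρN : Representation (PadicAlgCl p) (G ⧸ N.toSubgroup) (Fin d → PadicAlgCl p) :=
    QuotientGroup.lift N.toSubgroup ρ fun g hg ↦ hg
  refine ⟨(ρN.integralHom (padicIntToAlgCl p)).comp
    ((Pi.evalRingHom (fun N : OpenNormalSubgroup G ↦ MonoidAlgebra ℤ_[p] (G ⧸ N.toSubgroup)) N).comp
      (IwasawaAlgebra p G).val.toRingHom), fun r g ↦ ?_⟩
  change ρN.integralHom (padicIntToAlgCl p)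
    (r • MonoidAlgebra.of ℤ_[p] (G ⧸ N.toSubgroup) (g : G ⧸ N.toSubgroup)) = _
  rw [MonoidAlgebra.of_apply, MonoidAlgebra.smul_single, smul_eq_mul, mul_one,
    Representation.integralHom_single]
  rfl

omit [IsTopologicalGroup G] in
/-- If the idempotent `ε` acts as the identity on an irreducible representation, then the size of a
matrix ring isomorphic to the component at `ε` is the degree of the representation. -/
theorem IsIrrCharOf.eq_of_ringEquiv_matrix (hρ : IsIrrCharOf p χ ρ) {e : H → ℤ_[p]}
    {ε : IwasawaAlgebra p G} (hεe : ε = ∑ h : H, e h • IwasawaAlgebra.of p (h : G))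
    (hε1 : ∑ h : H, padicIntToAlgCl p (e h) • ρ (h : G) = 1) (hε : IsIdempotentElem ε)
    {S : Type*} [CommRing S] {N : ℕ} [NeZero N] (f : hε.Corner ≃+* Matrix (Fin N) (Fin N) S) :
    N = d := by
  obtain ⟨Θ, hΘ⟩ := hρ.exists_ringHom
  have hΘε : Θ ε = 1 := by
    rw [hεe, map_sum]
    simpa only [hΘ] using hε1
  let θ : hε.Corner →+* Module.End (PadicAlgCl p) (Fin d → PadicAlgCl p) :=
    { toFun := fun b ↦ Θ (hε.cornerVal b)
      map_one' := hΘε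
      map_mul' := fun _ _ ↦ Θ.map_mul _ _
      map_zero' := Θ.map_zero
      map_add' := fun _ _ ↦ Θ.map_add _ _ }
  refine hρ.irreducible.eq_of_matrix (θ.comp f.symm.toRingHom) fun g ↦
    ⟨f (hε.toCorner (IwasawaAlgebra.of p g)), ?_⟩
  change Θ (hε.cornerVal (f.symm (f _))) = _
  have h1 := hΘ 1 g
  rw [one_smul, map_one, one_smul] at h1
  rw [f.symm_apply_apply, hε.cornerVal_toCorner, map_mul, map_mul, hΘε, one_mul, mul_one, h1]

end

end

theorem proposition3p7 (p : ℕ) [Fact p.Prime] (hp : p ≠ 2)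
    -- a profinite group `G` with a finite normal subgroup `H` such that `G/H ≃ ℤ_p`
    (G : Type u) [Group G] [TopologicalSpace G] [IsTopologicalGroup G] [CompactSpace G]
    [T2Space G] [TotallyDisconnectedSpace G]
    (H : Subgroup G) [H.Normal] [Fintype H]
    (hGH : Nonempty ((G ⧸ H) ≃ₜ* Multiplicative ℤ_[p]))
    -- a closed subgroup `Γ` with `G = H ⋊ Γ`, a topological generator `γ` of `Γ`, and `n` such that
    -- the `p ^ n`-th power of `γ` is central in `G`
    (Γ : Subgroup G) (hΓ : H.IsComplement' Γ)
    (γ : G) (hγ : (Subgroup.zpowers γ).topologicalClosure = Γ)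
    (n : ℕ) (hn : γ ^ p ^ n ∈ Subgroup.center G)
    -- the subgroup `Γ₀` of all `p ^ n`-th powers in `Γ`
    (Γ₀ : Subgroup G) (hΓ₀ : (Γ₀ : Set G) = (fun g ↦ g ^ p ^ n) '' (Γ : Set G))
    (χ : IrrChar p G) (η : IrrChar p H) (hη : IsConstituent H χ η) :
    List.TFAE [
      padicValNat p η.degree = padicValNat p (Fintype.card H),
      ∃ ε : IwasawaAlgebra p G, toFractionAlgCl p (G := G) ε = epsilonChi H χ,
      ∃ ε : IwasawaAlgebra p G, toFractionAlgCl p (G := G) ε = epsilonChi H χ ∧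
        IsMaximalOrderIn (iwasawaSubring p Γ₀) (toFraction p ε)
          ((component p ε).map (toFraction p))] ∧
    ∀ ε : IwasawaAlgebra p G, toFractionAlgCl p (G := G) ε = epsilonChi H χ →
      ∃ (S : Type u) (_ : CommRing S), IsDomain S ∧ IsLocalRing S ∧ IsIntegrallyClosed S ∧
        Nonempty (component p ε ≃+* Matrix (Fin χ.degree) (Fin χ.degree) S) := by
  have hG : IsGenOver p H γ := isGenOver_of_isComplement hGH hΓ hγ
  have hcen : Γ₀ ≤ Subgroup.center G := fun k hk ↦ by
    have hk' : k ∈ (Γ₀ : Set G) := hk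
    rw [hΓ₀] at hk'
    obtain ⟨g, hg, rfl⟩ := hk'
    exact mem_center_of_mem_topologicalClosure hn (hγ ▸ hg)
  have hγΓ₀ : γ ^ p ^ n ∈ Γ₀ := by
    have h1 : γ ^ p ^ n ∈ (Γ₀ : Set G) :=
      hΓ₀ ▸ ⟨γ, hγ ▸ Subgroup.le_topologicalClosure _ (Subgroup.mem_zpowers γ), rfl⟩
    exact h1
  have hcomp : CompactSpace Γ₀ := by
    have h1 : IsCompact (Γ : Set G) := hγ ▸ (Subgroup.isClosed_topologicalClosure _).isCompact
    have h2 : IsCompact (Γ₀ : Set G) := hΓ₀ ▸ h1.image (continuous_pow (p ^ n))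
    exact isCompact_iff_compactSpace.mp h2
  obtain ⟨Δ, _, _, a, X, hX, hXmem, hεX, ρ, hρ, hρ1⟩ := exists_isCharOrbit_epsilonChi hG χ η hη
  have hXσ : ∀ (σ : PadicAlgCl p ≃ₐ[ℚ_[p]] PadicAlgCl p), ∀ x ∈ X, (fun h ↦ σ (x h)) ∈ X := by
    intro σ x hx
    obtain ⟨σ', j, rfl⟩ := (hXmem x).mp hx
    exact (hXmem _).mpr ⟨σ'.trans σ, j, rfl⟩
  have hXγ : ∀ x ∈ X, x ∘ (MulAut.conjNormal γ : MulAut H) ∈ X := by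
    intro x hx
    obtain ⟨σ, j, rfl⟩ := (hXmem x).mp hx
    refine (hXmem _).mpr ⟨σ, j + 1, funext fun h ↦ ?_⟩
    rw [zpow_add_one]
    rfl
  have htrans : ∀ x ∈ X, ∀ y ∈ X, ∃ (σ : PadicAlgCl p ≃ₐ[ℚ_[p]] PadicAlgCl p) (j : ℤ),
      y = fun h ↦ σ (x ((MulAut.conjNormal γ ^ j : MulAut H) h)) := by
    intro x hx y hy
    obtain ⟨σ, i, rfl⟩ := (hXmem x).mp hx
    obtain ⟨σ', j, rfl⟩ := (hXmem y).mp hy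
    refine ⟨σ.symm.trans σ', j - i, funext fun h ↦ ?_⟩
    rw [AlgEquiv.trans_apply, AlgEquiv.symm_apply_apply, ← MulAut.mul_apply, ← zpow_add,
      add_sub_cancel]
  have hdeg : padicValNat p η.degree = padicValNat p (Fintype.card H) ↔
      ‖(η.degree : PadicAlgCl p)‖ = ‖(Fintype.card H : PadicAlgCl p)‖ :=
    (PadicAlgCl.norm_natCast_eq_iff hX.pos.ne' Fintype.card_ne_zero).symm
  -- an integral idempotent forces the degree to have the valuation of the group order
  have h21 : (∃ ε : IwasawaAlgebra p G, toFractionAlgCl p (G := G) ε = epsilonChi H χ) →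
      padicValNat p η.degree = padicValNat p (Fintype.card H) := by
    rintro ⟨ε, hε⟩
    rw [hdeg]
    obtain ⟨f, hf⟩ := exists_idemFn_eq_algebraMap (n := η.degree) hXσ
    refine hX.norm_degree_eq (PadicAlgCl.norm_prime_lt_one p) fun h ↦ ?_
    rw [hεX, hf] at hε
    rw [hf, PadicAlgCl.norm_algebraMap]
    exact norm_le_one_of_toFractionAlgCl_eq hε h
  -- in the case of full valuation `ε_χ` is integral and its component is a matrix ring of size `χ(1)`
  have h1 : padicValNat p η.degree = padicValNat p (Fintype.card H) →
      ∃ (ε : IwasawaAlgebra p G) (hε : IsIdempotentElem ε), toFractionAlgCl p ε = epsilonChi H χ ∧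
        (∀ x, x * ε = ε * x) ∧ ε ≠ 0 ∧ ∃ (S : Type u) (_ : CommRing S), IsDomain S ∧ IsLocalRing S ∧
          IsComplIntClosed S ∧ NeZero χ.degree ∧
            Nonempty (hε.Corner ≃+* Matrix (Fin χ.degree) (Fin χ.degree) S) := by
    intro h
    rw [hdeg] at h
    obtain ⟨e, he⟩ := exists_isBlockElem (p := p) hX.irred h hXσ
    have hε : IsIdempotentElem (groupRingHom p H e) := (he.isIdempotentElem hX).map (groupRingHom p H)
    have hεe : toFractionAlgCl p (groupRingHom p H e) = epsilonChi H χ := by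
      rw [groupRingHom_apply, toFractionAlgCl_sum_smul, hεX]
      congr 1
      funext h
      exact (he h⁻¹).trans (by rw [inv_inv])
    have hε0 : groupRingHom p H e ≠ 0 := by
      intro h0
      obtain ⟨N, hN⟩ := exists_coeff_sum_smul_of p H
      have h2 := hN e.coeff 1
      rw [← groupRingHom_apply, h0, IwasawaAlgebra.coeff_zero] at h2
      have h3 := he 1
      rw [← h2, map_zero, inv_one] at h3
      exact hX.idemFn_one_ne_zero h3.symm
    obtain ⟨N, S, _, hN, hS₁, hS₂, hS₃, ⟨f⟩⟩ :=
      he.exists_ringEquiv_matrix hG hn hX.irred h hXγ htrans rfl hε hε0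
    have : NeZero N := ⟨hN.ne'⟩
    obtain rfl : N = χ.degree := hρ.eq_of_ringEquiv_matrix (groupRingHom_apply e) (by
      rw [← hρ1]
      refine Fintype.sum_equiv (Equiv.inv H) _ _ fun k ↦ ?_
      rw [he, Equiv.inv_apply, Subgroup.coe_inv, inv_inv]) hε f
    exact ⟨_, hε, hεe, he.mul_groupRingHom_comm hG hX.irred hXγ, hε0, S, _, hS₁, hS₂, hS₃, this, ⟨f⟩⟩
  refine ⟨?_, fun ε hε ↦ ?_⟩
  · tfae_have 3 → 2 := fun ⟨ε, h, _⟩ ↦ ⟨ε, h⟩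
    tfae_have 2 → 1 := h21
    tfae_have 1 → 3 := fun h ↦ by
      obtain ⟨ε, hε, hεe, hc, hε0, S, _, _, _, hS, _, ⟨f⟩⟩ := h1 h
      exact ⟨ε, hεe, isMaximalOrderIn_component hG hn hcen hγΓ₀ hε hc hε0 hS f⟩
    tfae_finish
  · obtain ⟨ε', hε', hεe, -, -, S, _, hS₁, hS₂, hS₃, -, ⟨f⟩⟩ := h1 (h21 ⟨ε, hε⟩)
    obtain rfl : ε = ε' := toFractionAlgCl_injective (hε.trans hεe.symm)
    exact ⟨S, _, hS₁, hS₂, hS₃.isIntegrallyClosed, ⟨f⟩⟩
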